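/- Let $X\subset\mathbb R^d$ ($d\ge1$) be a nonempty bounded open set of class $C^1$ with outer normal $n$ and surface measure $d\mu$ on $\partial X$. Let $V=-V\subset\mathbb R^d$, with measure $dv$, be either a nonempty bounded open set with $0\notin\overline V$ (Lebesgue measure), or a nonempty closed $C^1$ hypersurface with $0\notin V$ (surface measure) such that $\{v\in V: e\cdot v=0\}$ is a null set for every $e\neq0$ (for instance the unit sphere). Put $$\Gamma_\pm=\{(x,v)\in\partial X\times V:\pm v\cdot n(x)>0\},\quad d\xi=|n(x)\cdot v|\,d\mu(x)\,dv,$$ $$\tau_\pm(x,v)=\inf\{s>0: x\pm sv\notin X\},\quad \tau=\tau_-+\tau_+ .$$ For $\sigma\in L^\infty(X\times V)$ and a kernel $k$ put $$Ku(x,v)=\int_V k(x,v',v)u(x,v')\,dv',\qquad \sigma_s(x,v)=\int_V k(x,v,v')\,dv',$$ $$T_{\Gamma_+}^{-1}f(x,v)=-\int_0^{\tau_+(x,v)}e^{\int_0^t\sigma(x+sv,v)ds}f(x+tv,v)\,dt,$$ $$T_{\Gamma_-}^{-1}f(x,v)=\int_0^{\tau_-(x,v)}e^{-\int_0^t\sigma(x-sv,v)ds}f(x-tv,v)\,dt,$$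 $$L_{\Gamma_-}g(x,v)=e^{-\int_0^{\tau_-(x,v)}\sigma(x-sv,v)ds}\,g(x-\tau_-(x,v)v,v).$$ When $I-T_{\Gamma_-}^{-1}K$ is invertible, the albedo operator of $(\sigma,k)$ is $A=\big((I-T_{\Gamma_-}^{-1}K)^{-1}L_{\Gamma_-}\big)_{|\Gamma_+}$, the trace on $\Gamma_+$ being taken along characteristics. It is considered in two settings: $A:L^2(\Gamma_-,d\xi)\to L^2(\Gamma_+,d\xi)$ with phase space $\tau^{1/2}L^2(X\times V)$, and $A:L^2(\Gamma_-,\tau d\xi)\to L^2(\Gamma_+,\tau d\xi)$ with phase space $L^2(X\times V)$. Pairs $(\sigma_1,k_1),(\sigma_2,k_2)\in L^\infty(X\times V)\times L^1(X\times V\times V)$ are equivalent if there is $\varphi>0$ with $\varphi,\ \tau\, v\cdot\nabla_x\varphi\in L^\infty(X\times V)$ and trace $1$ on $\Gamma_+\cup\Gamma_-$ such that $\sigma_2=\sigma_1-v\cdot\nabla_x\ln\varphi$ and $k_2(x,v',v)=\frac{\varphi(x,v)}{\varphi(x,v')}k_1(x,v',v)$. Theorem. Let $M_1,M_2,M_3>0$.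 There is a constant $C\ge M_2$, depending only on $X$, $V$, $d$, $M_1,M_2,M_3$, with the following property. Let $k\in C(\overline X,L^2(V\times V))$ satisfy $k(x,v',v)=k(x,v,v')=k(x,v',-v)$ a.e., let $K$ be a nonnegative operator on $L^2(X\times V)$, and let $M_1\le\sigma_s\le M_2$ a.e. Let $\sigma\in L^\infty(X\times V)$ satisfy $\sigma(x,v)=\sigma(x,-v)$ and $C\le\sigma\le C+M_3$ a.e. Then: 1. $KT_{\Gamma_+}^{-1}$ has, in $L^2(X\times V)$, a real eigenvalue greater than or equal to $1$. 2. If in addition $k\ge0$ a.e., then there is $\lambda\in(0,1)$ such that, in both settings, for $(\sigma,\lambda k)$ and for every pair of coefficients equivalent to it, $I-T_{\Gamma_-}^{-1}K$ (formed with these coefficients) is invertible, so that the albedo operator is well defined, the albedo operator has a nonzero kernel, and it is not onto: some outgoing data on $\Gamma_+$ are not produced by any incoming data on $\Gamma_-$. -/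

import Mathlib

open MeasureTheory Set Filter Topology
open scoped ENNReal ContDiff

noncomputable section

namespace Transport

/-- Euclidean space `ℝᵈ`. -/
abbrev Vec (d : ℕ) : Type := EuclideanSpace ℝ (Fin d)

variable {d : ℕ}

/-! ### Domains, normals, velocity spaces -/

/-- `n` is the outer unit normal of `X` at the boundary point `x`: near `x` the set `X` is
`{ρ < 0}` for a `C¹` function `ρ` whose gradient at `x` is a positive multiple of `n`. -/
def IsOuterNormal (X : Set (Vec d)) (x n : Vec d) : Prop :=
  x ∈ frontier X ∧ ‖n‖ = 1 ∧
    ∃ (U : Set (Vec d)) (ρ : Vec d → ℝ), IsOpen U ∧ x ∈ U ∧ ContDiffOn ℝ 1 ρ U ∧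
      X ∩ U = {y ∈ U | ρ y < 0} ∧ ∃ c : ℝ, 0 < c ∧ gradient ρ x = c • n

/-- `X` is a (not necessarily connected) nonempty bounded open set of class `C¹`. -/
def IsC1Domain (X : Set (Vec d)) : Prop :=
  IsOpen X ∧ X.Nonempty ∧ Bornology.IsBounded X ∧ ∀ x ∈ frontier X, ∃ n, IsOuterNormal X x n

open Classical in
/-- The outer unit normal field of `X` (zero off the boundary). -/
def outerNormal (X : Set (Vec d)) (x : Vec d) : Vec d :=
  if h : ∃ n, IsOuterNormal X x n then h.choose else 0

/-- `V` is a nonempty closed (that is, compact and without boundary) embedded `C¹` hypersurface. -/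
def IsClosedC1Hypersurface (V : Set (Vec d)) : Prop :=
  V.Nonempty ∧ IsCompact V ∧ ∀ v ∈ V, ∃ (U : Set (Vec d)) (ρ : Vec d → ℝ),
    IsOpen U ∧ v ∈ U ∧ ContDiffOn ℝ 1 ρ U ∧ gradient ρ v ≠ 0 ∧ V ∩ U = {w ∈ U | ρ w = 0}

/-- `V`, with its canonical measure `ν = dv`, is an admissible set of velocities. Either it is a
bounded open set that avoids a neighbourhood of `0`, with Lebesgue measure; or it is a closed
hypersurface that avoids `0`, with surface measure, such that hyperplanes through the origin are
null sets (as for the unit sphere). -/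
def IsVelocitySpace (V : Set (Vec d)) (ν : Measure (Vec d)) : Prop :=
  (IsOpen V ∧ V.Nonempty ∧ Bornology.IsBounded V ∧ (0 : Vec d) ∉ closure V ∧
      ν = volume.restrict V) ∨
  (IsClosedC1Hypersurface V ∧ (0 : Vec d) ∉ V ∧
      ν = (Measure.euclideanHausdorffMeasure (d - 1)).restrict V ∧
      ∀ e : Vec d, e ≠ 0 → ν {v | inner ℝ e v = 0} = 0)

/-- The measure `dx dv` on `X × V`. -/
def phaseMeasure (X : Set (Vec d)) (ν : Measure (Vec d)) : Measure (Vec d × Vec d) :=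
  (volume.restrict X).prod ν

/-- The measure `dx dv' dv` on `X × V × V`. -/
def kernelMeasure (X : Set (Vec d)) (ν : Measure (Vec d)) : Measure (Vec d × Vec d × Vec d) :=
  (volume.restrict X).prod (ν.prod ν)

/-- The outgoing boundary `Γ₊`. -/
def gammaPlus (X V : Set (Vec d)) : Set (Vec d × Vec d) :=
  {p | p.1 ∈ frontier X ∧ p.2 ∈ V ∧ 0 < inner ℝ p.2 (outerNormal X p.1)}

/-- The incoming boundary `Γ₋`. -/
def gammaMinus (X V : Set (Vec d)) : Set (Vec d × Vec d) :=
  {p | p.1 ∈ frontier X ∧ p.2 ∈ V ∧ inner ℝ p.2 (outerNormal X p.1) < 0}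

/-- The measure `dξ(x,v) = |n(x)·v| dμ(x) dv`, with `dμ` the surface measure of `∂X`. -/
def xi (X : Set (Vec d)) (ν : Measure (Vec d)) : Measure (Vec d × Vec d) :=
  (((Measure.euclideanHausdorffMeasure (d - 1)).restrict (frontier X)).prod ν).withDensity
    fun p => ENNReal.ofReal |inner ℝ p.2 (outerNormal X p.1)|

/-! ### Travel times and the transport operators -/

/-- Forward travel time `τ₊(x,v) = inf {s > 0 | x + s v ∉ X}`; it vanishes on `Γ₊`. -/
def tauPlus (X : Set (Vec d)) (p : Vec d × Vec d) : ℝ :=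
  sInf {s : ℝ | 0 < s ∧ p.1 + s • p.2 ∉ X}

/-- Backward travel time `τ₋(x,v) = inf {s > 0 | x - s v ∉ X}`; it vanishes on `Γ₋`. -/
def tauMinus (X : Set (Vec d)) (p : Vec d × Vec d) : ℝ :=
  sInf {s : ℝ | 0 < s ∧ p.1 - s • p.2 ∉ X}

/-- `τ = τ₋ + τ₊`. -/
def tau (X : Set (Vec d)) (p : Vec d × Vec d) : ℝ := tauMinus X p + tauPlus X p

/-- `E₊(x,v,t) = exp (∫₀ᵗ σ(x + s v, v) ds)`. -/
def EPlus (σ : Vec d × Vec d → ℝ) (p : Vec d × Vec d) (t : ℝ) : ℝ :=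
  Real.exp (∫ s in (0 : ℝ)..t, σ (p.1 + s • p.2, p.2))

/-- `E₋(x,v,t) = exp (-∫₀ᵗ σ(x - s v, v) ds)`. -/
def EMinus (σ : Vec d × Vec d → ℝ) (p : Vec d × Vec d) (t : ℝ) : ℝ :=
  Real.exp (-∫ s in (0 : ℝ)..t, σ (p.1 - s • p.2, p.2))

/-- The operator `T_{Γ₊}⁻¹` (solution of `v·∇ₓu + σu = f` with `u = 0` on `Γ₊`). -/
def TPlusInv (X : Set (Vec d)) (σ f : Vec d × Vec d → ℝ) (p : Vec d × Vec d) : ℝ :=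
  -∫ t in (0 : ℝ)..tauPlus X p, EPlus σ p t * f (p.1 + t • p.2, p.2)

/-- The operator `T_{Γ₋}⁻¹` (solution of `v·∇ₓu + σu = f` with `u = 0` on `Γ₋`). -/
def TMinusInv (X : Set (Vec d)) (σ f : Vec d × Vec d → ℝ) (p : Vec d × Vec d) : ℝ :=
  ∫ t in (0 : ℝ)..tauMinus X p, EMinus σ p t * f (p.1 - t • p.2, p.2)

open Classical in
/-- The lifting `L_{Γ₋}` of incoming data (solution of `v·∇ₓu + σu = 0` with `u = g` on `Γ₋`). -/
def LMinus (X V : Set (Vec d)) (σ g : Vec d × Vec d → ℝ) (p : Vec d × Vec d) : ℝ :=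
  (gammaMinus X V).indicator g (p.1 - tauMinus X p • p.2, p.2) * EMinus σ p (tauMinus X p)

/-- The scattering operator `K u(x,v) = ∫ k(x,v',v) u(x,v') dv'`. -/
def KOp (ν : Measure (Vec d)) (k : Vec d × Vec d × Vec d → ℝ) (u : Vec d × Vec d → ℝ)
    (p : Vec d × Vec d) : ℝ :=
  ∫ v', k (p.1, v', p.2) * u (p.1, v') ∂ν

/-- `σ_s(x,v) = ∫ k(x,v,v') dv'`. -/
def sigmaS (ν : Measure (Vec d)) (k : Vec d × Vec d × Vec d → ℝ) (p : Vec d × Vec d) : ℝ :=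
  ∫ v', k (p.1, p.2, v') ∂ν

/-! ### Hypotheses on the coefficients -/

/-- `k ∈ C(X̄, L²(V × V))`. -/
def IsContinuousKernel (X : Set (Vec d)) (ν : Measure (Vec d))
    (k : Vec d × Vec d × Vec d → ℝ) : Prop :=
  AEStronglyMeasurable k (kernelMeasure X ν) ∧
    ∀ x ∈ closure X, MemLp (fun w => k (x, w)) 2 (ν.prod ν) ∧
      Tendsto (fun y => eLpNorm (fun w => k (y, w) - k (x, w)) 2 (ν.prod ν))
        (𝓝[closure X] x) (𝓝 0)

/-- `k(x,v',v) = k(x,v,v') = k(x,v',-v)` almost everywhere. -/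
def IsSymmetricEvenKernel (X : Set (Vec d)) (ν : Measure (Vec d))
    (k : Vec d × Vec d × Vec d → ℝ) : Prop :=
  ∀ᵐ q ∂kernelMeasure X ν,
    k (q.1, q.2.1, q.2.2) = k (q.1, q.2.2, q.2.1) ∧
    k (q.1, q.2.1, q.2.2) = k (q.1, q.2.1, -q.2.2)

/-- `K` is a nonnegative operator on `L²(X × V)`. -/
def IsNonnegOperator (X : Set (Vec d)) (ν : Measure (Vec d))
    (k : Vec d × Vec d × Vec d → ℝ) : Prop :=
  ∀ φ : Vec d × Vec d → ℝ, MemLp φ 2 (phaseMeasure X ν) →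
    0 ≤ ∫ p, KOp ν k φ p * φ p ∂phaseMeasure X ν

/-- `μ` is an eigenvalue, in the space `L²(m)`, of the operator induced by `A`. -/
def HasL2Eigenvalue {α : Type*} [MeasurableSpace α] (m : Measure α)
    (A : (α → ℝ) → α → ℝ) (μ : ℝ) : Prop :=
  ∃ ψ : α → ℝ, MemLp ψ 2 m ∧ ¬ ψ =ᵐ[m] 0 ∧ A ψ =ᵐ[m] fun p => μ * ψ p

/-! ### Traces and equivalent pairs -/

/-- The trace of `u` on `Γ₊` is `f`: the limit of `u` along almost every characteristic that
leaves `X`. (The limit ignores null sets of `t`, so it only depends on the a.e. class of `u`.) -/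
def HasTracePlus (X V : Set (Vec d)) (ν : Measure (Vec d)) (u f : Vec d × Vec d → ℝ) : Prop :=
  ∀ᵐ p ∂(xi X ν).restrict (gammaPlus X V),
    Tendsto (fun t : ℝ => u (p.1 - t • p.2, p.2)) (𝓝[>] 0 ⊓ ae volume) (𝓝 (f p))

/-- The trace of `u` on `Γ₋` is `g`. -/
def HasTraceMinus (X V : Set (Vec d)) (ν : Measure (Vec d)) (u g : Vec d × Vec d → ℝ) : Prop :=
  ∀ᵐ p ∂(xi X ν).restrict (gammaMinus X V),
    Tendsto (fun t : ℝ => u (p.1 + t • p.2, p.2)) (𝓝[>] 0 ⊓ ae volume) (𝓝 (g p))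

/-- `v·∇ₓu = h` in the sense of distributions on `X × V`. -/
def HasTransportDeriv (X : Set (Vec d)) (ν : Measure (Vec d)) (u h : Vec d × Vec d → ℝ) : Prop :=
  ∀ η : Vec d × Vec d → ℝ, ContDiff ℝ ∞ η → HasCompactSupport η → tsupport η ⊆ X ×ˢ univ →
    ∫ p, u p * fderiv ℝ η p (p.2, 0) ∂phaseMeasure X ν = -∫ p, h p * η p ∂phaseMeasure X ν

/-- The pairs `(σ₁,k₁), (σ₂,k₂) ∈ L^∞ × L¹` are equivalent: for some `φ > 0` with
`φ, τ v·∇ₓφ ∈ L^∞` and boundary trace `1`, one has `σ₂ = σ₁ - v·∇ₓ ln φ` and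
`k₂(x,v',v) = φ(x,v) / φ(x,v') k₁(x,v',v)`. -/
def EquivalentPairs (X V : Set (Vec d)) (ν : Measure (Vec d))
    (σ₁ : Vec d × Vec d → ℝ) (k₁ : Vec d × Vec d × Vec d → ℝ)
    (σ₂ : Vec d × Vec d → ℝ) (k₂ : Vec d × Vec d × Vec d → ℝ) : Prop :=
  MemLp σ₁ ∞ (phaseMeasure X ν) ∧ MemLp σ₂ ∞ (phaseMeasure X ν) ∧
  Integrable k₁ (kernelMeasure X ν) ∧ Integrable k₂ (kernelMeasure X ν) ∧
  ∃ φ h : Vec d × Vec d → ℝ,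
    MemLp φ ∞ (phaseMeasure X ν) ∧ HasTransportDeriv X ν φ h ∧
    MemLp (fun p => tau X p * h p) ∞ (phaseMeasure X ν) ∧
    (∀ᵐ p ∂phaseMeasure X ν, 0 < φ p) ∧
    HasTracePlus X V ν φ 1 ∧ HasTraceMinus X V ν φ 1 ∧
    (∀ᵐ p ∂phaseMeasure X ν, σ₂ p = σ₁ p - h p / φ p) ∧
    (∀ᵐ q ∂kernelMeasure X ν,
      k₂ (q.1, q.2.1, q.2.2) = φ (q.1, q.2.2) / φ (q.1, q.2.1) * k₁ (q.1, q.2.1, q.2.2))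

/-! ### The albedo operator

All notions below have a parameter `r`. The phase space is `τ^r L²(X × V)` and the boundary space
is `L²(Γ±, τ^(1-2r) dξ)`. The two cases of interest are `r = 1/2`, that is `τ^(1/2) L²` with
`L²(Γ±, dξ)`, and `r = 0`, that is `L²` with `L²(Γ±, τ dξ)`. -/

/-- `u ∈ τ^r L²(X × V)`. -/
def MemPhase (X : Set (Vec d)) (ν : Measure (Vec d)) (r : ℝ) (u : Vec d × Vec d → ℝ) : Prop :=
  MemLp (fun p => tau X p ^ (-r) * u p) 2 (phaseMeasure X ν)

/-- `g ∈ L²(G, τ^(1-2r) dξ)` for a part `G` of the boundary. -/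
def MemBoundary (X : Set (Vec d)) (ν : Measure (Vec d)) (r : ℝ) (G : Set (Vec d × Vec d))
    (g : Vec d × Vec d → ℝ) : Prop :=
  MemLp g 2 (((xi X ν).restrict G).withDensity fun p => ENNReal.ofReal (tau X p ^ (1 - 2 * r)))

/-- `I - T_{Γ₋}⁻¹ K` is invertible in `τ^r L²(X × V)`, so that the forward transport problem is
well-posed and the albedo operator is defined. -/
def WellPosed (X : Set (Vec d)) (ν : Measure (Vec d)) (r : ℝ)
    (σ : Vec d × Vec d → ℝ) (k : Vec d × Vec d × Vec d → ℝ) : Prop :=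
  ∀ f, MemPhase X ν r f →
    ∃ u, MemPhase X ν r u ∧
      (fun p => u p - TMinusInv X σ (KOp ν k u) p) =ᵐ[phaseMeasure X ν] f ∧
      ∀ w, MemPhase X ν r w →
        (fun p => w p - TMinusInv X σ (KOp ν k w) p) =ᵐ[phaseMeasure X ν] f →
          w =ᵐ[phaseMeasure X ν] u

/-- `A g = f` for the albedo operator `A = ((I - T_{Γ₋}⁻¹ K)⁻¹ L_{Γ₋})|_{Γ₊}`. -/
def IsAlbedo (X V : Set (Vec d)) (ν : Measure (Vec d)) (r : ℝ)
    (σ : Vec d × Vec d → ℝ) (k : Vec d × Vec d × Vec d → ℝ) (g f : Vec d × Vec d → ℝ) : Prop :=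
  ∃ u, MemPhase X ν r u ∧
    (fun p => u p - TMinusInv X σ (KOp ν k u) p) =ᵐ[phaseMeasure X ν] LMinus X V σ g ∧
    HasTracePlus X V ν u f

/-- The albedo operator of `(σ,k)` is well defined, has a nonzero kernel and is not onto: some
nonzero incoming data produce no outgoing data, and some outgoing data are not produced by any
incoming data. -/
def AlbedoObstruction (X V : Set (Vec d)) (ν : Measure (Vec d)) (r : ℝ)
    (σ : Vec d × Vec d → ℝ) (k : Vec d × Vec d × Vec d → ℝ) : Prop :=
  WellPosed X ν r σ k ∧
  (∃ g, MemBoundary X ν r (gammaMinus X V) g ∧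
    ¬ g =ᵐ[(xi X ν).restrict (gammaMinus X V)] 0 ∧ IsAlbedo X V ν r σ k g 0) ∧
  (∃ f, MemBoundary X ν r (gammaPlus X V) f ∧
    ∀ g, MemBoundary X ν r (gammaMinus X V) g → ¬ IsAlbedo X V ν r σ k g f)

end Transport

end

open MeasureTheory Set Filter Topology
open scoped ENNReal ContDiff

noncomputable section

namespace Transport

section

/-! ### Completely continuous operators on Hilbert spaces -/

section Hilbert

variable {H G : Type*} [NormedAddCommGroup H] [InnerProductSpace ℝ H]
  [NormedAddCommGroup G] [InnerProductSpace ℝ G]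

/-! Write T for `TPlusInv X σ` and U for `TMinusInv X (-σ)`, both on L²(X × V). Exchanging the two
points of a chord gives T = -U*. Reversing the velocity gives T f = -(U f) ∘ `reflect` for even f,
because σ is even. The range of K consists of even functions, so the form ⟨TKa, Kb⟩ is symmetric. As
K is symmetric and nonnegative, eigenvalues of KT are critical values of the quotient ⟨TKa, Ka⟩ /
⟨Ka, a⟩, and compactness of KT makes the supremum of this quotient an eigenvalue as soon as it
exceeds 1 (`exists_eigenvalue_gt_one`).

The quotient is large for large absorption, since T carries the growing weight exp ∫σ. For a
function w of x alone, Kw = w σ_s, and ⟨TKw, Kw⟩ is minus the integral, over pairs of points on a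
common characteristic, of the product of the two values of w σ_s with that weight. Taking w = 1 on
one small ball and -1 on another, a positive time a apart, flights between the balls contribute at
least a multiple of e^{Ca}. Contributions of the wrong sign come only from flights inside one ball,
which last at most a/2, so they are at most a multiple of e^{(C + M₃)a/2}. A large C depending only
on the geometry and the bounds therefore wins (`exists_test_function`).

Compactness of KT is, by duality, compactness of UK, which is velocity averaging. A source g(v) w(x)
may be replaced by its average over short segments along v at a small cost in L², and such an
average is the Fourier multiplier `averageSymbol` in v·ξ. Its mean over v tends to 0 as |ξ| → ∞
because hyperplanes through the origin are null. Weakly null w thus give strongly null solutions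
(`tendsto_lintegral_TMinusInv_tensor`). Rectangles in V × V, measurable sets, simple functions and
finally kernels continuous in x follow by approximation (`isCompactingKernel_of_continuous`).

All integrations along characteristics rest on the disintegration of dx dv over Γ₋ or Γ₊
(`lintegral_phase_eq_minus`). It comes from the area formula for a C¹ hypersurface swept along a
fixed direction (`IsNormalField.volume_sweep_le`).

Let KTψ = μψ with μ > 1 and replace k by k/μ. Then u₀ = Tψ solves the forward transport problem and
vanishes on Γ₊, so its incoming data are in the kernel of the albedo operator. They are nonzero by
uniqueness, the problem being subcritical because ‖K‖/μ ≤ M₂/μ < C (`wellPosed_of_lt`). The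
reflection of u₀ solves the adjoint problem. If its outgoing trace were produced by some solution u,
Green's formula (`integral_sq_gammaPlus`) would give this trace zero L² norm, a contradiction
(`albedoObstruction_of_fixed`).

For an equivalent pair, φ is a bounded weak solution of v·∇ₓφ = (σ₁ - σ₂)φ with trace 1, hence
equals the explicit exponential `gauge` (`exists_isGauge`). Multiplication by it conjugates the two
transport problems and leaves the boundary data alone (`IsGauge.albedoObstruction`). -/

/-- A bounded sequence that converges weakly to `0`. -/
def WeakNull (u : ℕ → H) : Prop :=
  (∃ M, ∀ n, ‖u n‖ ≤ M) ∧ ∀ w, Tendsto (fun n => inner ℝ (u n) w) atTop (𝓝 0)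

/-- The operator `A` maps weakly null sequences to null sequences. -/
def CompletelyContinuous (A : H →L[ℝ] G) : Prop :=
  ∀ u, WeakNull u → Tendsto (fun n => A (u n)) atTop (𝓝 0)

theorem WeakNull.map [CompleteSpace H] [CompleteSpace G] {u : ℕ → H} (hu : WeakNull u)
    (A : H →L[ℝ] G) : WeakNull fun n => A (u n) := by
  obtain ⟨⟨M, hM⟩, hw⟩ := hu
  refine ⟨⟨‖A‖ * M, fun n => (A.le_opNorm _).trans (by gcongr; exact hM n)⟩, fun w => ?_⟩
  simpa [ContinuousLinearMap.adjoint_inner_right] using hw (A.adjoint w)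

/-- ‖A* uₙ‖² = ⟨uₙ, A A* uₙ⟩, where A* uₙ is again weakly null and uₙ is bounded. -/
theorem CompletelyContinuous.adjoint [CompleteSpace H] [CompleteSpace G] {A : H →L[ℝ] G}
    (hA : CompletelyContinuous A) :
    CompletelyContinuous (ContinuousLinearMap.adjoint A) := fun u hu => by
  have h1 : Tendsto (fun n => A (A.adjoint (u n))) atTop (𝓝 0) := hA _ (hu.map A.adjoint)
  obtain ⟨M, hM⟩ := hu.1
  rw [tendsto_zero_iff_norm_tendsto_zero]
  have h2 : Tendsto (fun n => ‖A (A.adjoint (u n))‖ * M) atTop (𝓝 0) := by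
    simpa using h1.norm.mul_const M
  have h3 : Tendsto (fun n => ‖A.adjoint (u n)‖ ^ 2) atTop (𝓝 0) := by
    refine squeeze_zero (fun n => by positivity) (fun n => ?_) h2
    rw [← real_inner_self_eq_norm_sq, ContinuousLinearMap.adjoint_inner_right]
    exact (real_inner_le_norm _ _).trans (by gcongr; exact hM n)
  simpa using (Real.continuous_sqrt.tendsto 0).comp h3 |>.congr fun n => by simp

theorem CompletelyContinuous.of_approx {A : H →L[ℝ] G}
    (h : ∀ ε : ℝ, 0 < ε → ∃ B : H →L[ℝ] G, CompletelyContinuous B ∧ ‖A - B‖ ≤ ε) :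
    CompletelyContinuous A := fun u hu => by
  obtain ⟨M, hM⟩ := hu.1
  have hM0 : 0 ≤ M := (norm_nonneg _).trans (hM 0)
  rw [Metric.tendsto_atTop]
  intro ε hε
  obtain ⟨B, hB, hAB⟩ := h (ε / (2 * (M + 1))) (by positivity)
  obtain ⟨N, hN⟩ := (Metric.tendsto_atTop.1 (hB u hu)) (ε / 2) (by positivity)
  refine ⟨N, fun n hn => ?_⟩
  have h1 := hN n hn
  rw [dist_zero_right] at h1 ⊢
  have h2 : ‖(A - B) (u n)‖ ≤ ε / 2 := by
    refine ((A - B).le_opNorm _).trans ((mul_le_mul hAB (hM n) (norm_nonneg _) (by positivity)).trans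
      ?_)
    rw [div_mul_eq_mul_div, div_le_div_iff₀ (by positivity) (by positivity)]
    nlinarith
  calc ‖A (u n)‖ = ‖(A - B) (u n) + B (u n)‖ := by simp
    _ ≤ ‖(A - B) (u n)‖ + ‖B (u n)‖ := norm_add_le _ _
    _ < ε := by linarith

/-- Sequential Banach–Alaoglu, through the Riesz identification; separability makes the weak-* ball
sequentially compact. -/
theorem exists_subseq_weakNull_sub [CompleteSpace H] [TopologicalSpace.SeparableSpace H]
    (u : ℕ → H) (M : ℝ) (hM : ∀ n, ‖u n‖ ≤ M) :
    ∃ (f : H) (φ : ℕ → ℕ), StrictMono φ ∧ WeakNull fun n => u (φ n) - f := by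
  let D := InnerProductSpace.toDual ℝ H
  obtain ⟨l, -, φ, hφ, hl⟩ := WeakDual.isSeqCompact_closedBall (𝕜 := ℝ) (E := H) 0 M
    (x := fun n => StrongDual.toWeakDual (D (u n))) (fun n => by simpa [D] using hM n)
  refine ⟨D.symm (WeakDual.toStrongDual l), φ, hφ, ⟨M + ‖D.symm (WeakDual.toStrongDual l)‖,
    fun n => (norm_sub_le _ _).trans (by gcongr; exact hM _)⟩, fun w => ?_⟩
  have h1 := ((WeakDual.eval_continuous w).tendsto l).comp hl
  have h2 : Tendsto (fun n => inner ℝ (u (φ n)) w) atTop (𝓝 (l w)) := by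
    refine h1.congr fun n => ?_
    simp [D]
  have h3 : inner ℝ (D.symm (WeakDual.toStrongDual l)) w = l w := by
    rw [InnerProductSpace.toDual_symm_apply]; rfl
  simpa [inner_sub_left, h3] using h2.sub_const (l w)

/-- Cauchy–Schwarz for the semidefinite form ⟨La, b⟩ with b = La, read off from the discriminant of
t ↦ ⟨L(ta + La), ta + La⟩. -/
theorem norm_sq_apply_le_of_nonneg {L : H →L[ℝ] H} (hs : ∀ a b, inner ℝ (L a) b = inner ℝ a (L b))
    (hp : ∀ a, 0 ≤ inner ℝ (L a) a) (a : H) : ‖L a‖ ^ 2 ≤ ‖L‖ * inner ℝ (L a) a := by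
  have key : ∀ c t : ℝ, 0 ≤ inner ℝ (L a) a * (t * t) + 2 * ‖L a‖ ^ 2 * t
      + inner ℝ (L (L a)) (L a) := fun _ t => by
    have := hp (t • a + L a)
    simp only [map_add, map_smul, inner_add_left, inner_add_right, inner_smul_left,
      inner_smul_right, RCLike.conj_to_real] at this
    rw [hs (L a) a, real_inner_self_eq_norm_sq] at this
    linarith
  have hd := discrim_le_zero (key 0)
  have hb : inner ℝ (L (L a)) (L a) ≤ ‖L‖ * ‖L a‖ ^ 2 := by
    refine (real_inner_le_norm _ _).trans ?_
    rw [pow_two, ← mul_assoc]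
    gcongr
    exact L.le_opNorm _
  rcases eq_or_ne (L a) 0 with h0 | h0
  · simp [h0]
  have hpos : 0 < ‖L a‖ ^ 2 := by positivity
  unfold discrim at hd
  have h4 : ‖L a‖ ^ 2 * ‖L a‖ ^ 2 ≤ (‖L‖ * inner ℝ (L a) a) * ‖L a‖ ^ 2 := by
    nlinarith [mul_le_mul_of_nonneg_left hb (hp a)]
  exact le_of_mul_le_mul_right h4 hpos

/-- If `K` is symmetric and nonnegative, `T` is symmetric on the range of `K`, `K T` is completely
continuous, and the form of `T` exceeds that of `K⁻¹` somewhere on the range of `K`, then `K T` has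
an eigenvalue larger than `1`. -/
theorem exists_eigenvalue_gt_one [CompleteSpace H] [TopologicalSpace.SeparableSpace H]
    (K T : H →L[ℝ] H) (hs : ∀ a b, inner ℝ (K a) b = inner ℝ a (K b))
    (hp : ∀ a, 0 ≤ inner ℝ (K a) a)
    (hT : ∀ a b, inner ℝ (T (K a)) (K b) = inner ℝ (K a) (T (K b)))
    (hcc : CompletelyContinuous (K.comp T)) (a₀ : H)
    (ha₀ : inner ℝ (K a₀) a₀ < inner ℝ (T (K a₀)) (K a₀)) :
    ∃ M : ℝ, 1 < M ∧ ∃ f : H, f ≠ 0 ∧ K (T f) = M • f := by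
  have hKn := norm_sq_apply_le_of_nonneg hs hp
  set S : Set ℝ := {y | ∃ a, inner ℝ (K a) a ≤ 1 ∧ y = inner ℝ (T (K a)) (K a)} with hS
  -- Control by ⟨Ka, a⟩ both bounds the quotient and shows that its numerator is not positive where
  -- its denominator vanishes.
  have hTK : ∀ a, inner ℝ (T (K a)) (K a) ≤ ‖T‖ * ‖K‖ * inner ℝ (K a) a := fun a => by
    calc inner ℝ (T (K a)) (K a) ≤ ‖T (K a)‖ * ‖K a‖ := real_inner_le_norm _ _
      _ ≤ ‖T‖ * ‖K a‖ * ‖K a‖ := by gcongr; exact T.le_opNorm _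
      _ = ‖T‖ * ‖K a‖ ^ 2 := by ring
      _ ≤ ‖T‖ * (‖K‖ * inner ℝ (K a) a) := by gcongr; exact hKn a
      _ = _ := by ring
  have hSb : BddAbove S := ⟨‖T‖ * ‖K‖, by
    rintro y ⟨a, ha, rfl⟩
    refine (hTK a).trans ?_
    have : 0 ≤ ‖T‖ * ‖K‖ := by positivity
    nlinarith [hp a]⟩
  have hbpos : ∀ a, 0 < inner ℝ (T (K a)) (K a) → 0 < inner ℝ (K a) a := fun a ha => by
    refine lt_of_le_of_ne (hp a) fun h0 => ?_
    have := hTK a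
    rw [← h0] at this
    linarith
  set M := sSup S with hMdef
  have hscale : ∀ a, 0 < inner ℝ (K a) a →
      inner ℝ (T (K a)) (K a) / inner ℝ (K a) a ∈ S := fun a ha => by
    set b := inner ℝ (K a) a with hb
    have hbb : (√b)⁻¹ * (√b)⁻¹ = b⁻¹ := by
      rw [← mul_inv, Real.mul_self_sqrt ha.le]
    refine ⟨(√b)⁻¹ • a, ?_, ?_⟩
    · simp only [map_smul, inner_smul_left, inner_smul_right, RCLike.conj_to_real]
      rw [← mul_assoc, hbb, ← hb, inv_mul_cancel₀ ha.ne']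
    · simp only [map_smul, inner_smul_left, inner_smul_right, RCLike.conj_to_real]
      rw [← mul_assoc, hbb, div_eq_inv_mul]
  have hle : ∀ a, inner ℝ (T (K a)) (K a) ≤ M * inner ℝ (K a) a := fun a => by
    rcases (hp a).eq_or_lt with h0 | h0
    · have := hTK a
      rw [← h0] at this ⊢
      simpa using this
    · rw [← div_le_iff₀ h0]
      exact le_csSup hSb (hscale a h0)
  have hM1 : 1 < M := by
    have h0 : 0 < inner ℝ (K a₀) a₀ := hbpos a₀ ((hp a₀).trans_lt ha₀)
    exact ((one_lt_div h0).2 ha₀).trans_le (le_csSup hSb (hscale a₀ h0))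
  have hne : S.Nonempty := ⟨0, 0, by simp⟩
  obtain ⟨y, -, hyt, hyS⟩ := exists_seq_tendsto_sSup hne hSb
  choose a hab hay using hyS
  -- By the choice of M this operator is symmetric and nonnegative, and ⟨L aₙ, aₙ⟩ ≤ M - yₙ → 0
  -- along the maximizing sequence. Cauchy–Schwarz for L upgrades this to L aₙ → 0.
  set L : H →L[ℝ] H := M • K - K.comp (T.comp K) with hL
  have hLs : ∀ a b, inner ℝ (L a) b = inner ℝ a (L b) := fun a b => by
    simp only [hL, sub_apply, smul_apply,
      ContinuousLinearMap.comp_apply, inner_sub_left, inner_sub_right, inner_smul_left,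
      inner_smul_right, RCLike.conj_to_real, hs]
    rw [← hs a (T (K b)), ← hT]
  have hLq : ∀ a, inner ℝ (L a) a = M * inner ℝ (K a) a - inner ℝ (T (K a)) (K a) := fun a => by
    simp only [hL, sub_apply, smul_apply,
      ContinuousLinearMap.comp_apply, inner_sub_left, inner_smul_left, RCLike.conj_to_real, hs (T _)]
  have hLp : ∀ a, 0 ≤ inner ℝ (L a) a := fun a => by rw [hLq]; linarith [hle a]
  have hLn := norm_sq_apply_le_of_nonneg hLs hLp
  have hL0 : Tendsto (fun n => L (a n)) atTop (𝓝 0) := by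
    rw [tendsto_zero_iff_norm_tendsto_zero]
    have h1 : Tendsto (fun n => ‖L‖ * (M - y n)) atTop (𝓝 0) := by
      simpa [hMdef] using (tendsto_const_nhds (x := M).sub hyt).const_mul ‖L‖
    have h3 : Tendsto (fun n => ‖L (a n)‖ ^ 2) atTop (𝓝 0) := by
      refine squeeze_zero (fun n => by positivity) (fun n => (hLn _).trans ?_) h1
      gcongr
      rw [hLq, hay]
      nlinarith [hab n]
    simpa using (Real.continuous_sqrt.tendsto 0).comp h3 |>.congr fun n => by simp
  have hfb : ∀ n, ‖K (a n)‖ ≤ √‖K‖ := fun n => by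
    refine Real.le_sqrt_of_sq_le ((hKn _).trans ?_)
    exact mul_le_of_le_one_right (norm_nonneg _) (hab n)
  obtain ⟨f, φ, hφ, hf⟩ := exists_subseq_weakNull_sub (fun n => K (a n)) _ hfb
  have h1 : Tendsto (fun n => K (T (K (a (φ n)) - f))) atTop (𝓝 0) := hcc _ hf
  have h2 := (hL0.comp hφ.tendsto_atTop).add h1
  -- M K aₙ = L aₙ + KT(K aₙ), and complete continuity of KT turns the weak convergence of K aₙ to f
  -- into strong convergence of the right side to KTf.
  have h3 : Tendsto (fun n => K (a (φ n))) atTop (𝓝 (M⁻¹ • K (T f))) := by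
    have h4 := (h2.add_const (K (T f))).const_smul M⁻¹
    simp only [add_zero, zero_add] at h4
    refine h4.congr fun n => ?_
    have : M ≠ 0 := by linarith
    simp only [hL, Function.comp, sub_apply, smul_apply,
      ContinuousLinearMap.comp_apply, map_sub]
    rw [sub_add_sub_cancel, sub_add_cancel, smul_smul, inv_mul_cancel₀ this, one_smul]
  have hfeq : M⁻¹ • K (T f) = f := by
    refine ext_inner_right ℝ fun w => ?_
    have h5 := Filter.Tendsto.inner (𝕜 := ℝ) (h3.sub_const f) (tendsto_const_nhds (x := w))
    have h6 := tendsto_nhds_unique h5 (hf.2 w)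
    rw [inner_sub_left] at h6
    linarith
  rw [hfeq] at h3
  refine ⟨M, hM1, f, fun h0 => ?_, ?_⟩
  -- By strong convergence the form at f takes the maximal value M > 1, so f is not zero.
  · have h7 : Tendsto (fun n => inner ℝ (T (K (a (φ n)))) (K (a (φ n)))) atTop
        (𝓝 (inner ℝ (T f) f)) := Filter.Tendsto.inner (𝕜 := ℝ) ((T.continuous.tendsto f).comp h3) h3
    have h8 : Tendsto (fun n => y (φ n)) atTop (𝓝 (inner ℝ (T f) f)) := h7.congr fun n => (hay _).symm
    have h9 := tendsto_nhds_unique (hyt.comp hφ.tendsto_atTop) h8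
    rw [h0] at h9
    simp only [map_zero, inner_zero_left] at h9
    linarith
  · nth_rw 2 [← hfeq]
    rw [smul_smul, mul_inv_cancel₀ (by linarith), one_smul]

end Hilbert

end

section

variable {d : ℕ}

/-! ### Normals of `C¹` domains -/

theorem fderiv_apply_eq_inner_gradient (ρ : Vec d → ℝ) (x w : Vec d) :
    fderiv ℝ ρ x w = inner ℝ (gradient ρ x) w := by
  rw [← toDual_gradient, InnerProductSpace.toDual_apply_apply]

theorem tendsto_add_smul_nhdsGT (x v : Vec d) :
    Tendsto (fun s : ℝ => x + s • v) (𝓝[>] 0) (𝓝 x) := by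
  have : Tendsto (fun s : ℝ => x + s • v) (𝓝 0) (𝓝 (x + (0 : ℝ) • v)) :=
    Continuous.tendsto (by fun_prop) 0
  rw [zero_smul, add_zero] at this
  exact this.mono_left nhdsWithin_le_nhds

/-- A differentiable function decreases strictly in a direction of negative slope. -/
theorem eventually_lt_of_fderiv_neg {ρ : Vec d → ℝ} {x v : Vec d} (h : DifferentiableAt ℝ ρ x)
    (hv : fderiv ℝ ρ x v < 0) : ∀ᶠ s : ℝ in 𝓝[>] 0, ρ (x + s • v) < ρ x := by
  have h1 : HasDerivAt (fun s : ℝ => ρ (x + s • v)) (fderiv ℝ ρ x v) 0 := by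
    have h2 : HasDerivAt (fun s : ℝ => x + s • v) v 0 := by
      simpa using ((hasDerivAt_id (0 : ℝ)).smul_const v).const_add x
    have h3 : HasFDerivAt ρ (fderiv ℝ ρ x) (x + (0 : ℝ) • v) := by simpa using h.hasFDerivAt
    exact h3.comp_hasDerivAt 0 h2
  have h4 := (hasDerivAt_iff_tendsto_slope.1 h1).mono_left
    (nhdsWithin_mono (0 : ℝ) (fun s (hs : 0 < s) => hs.ne'))
  filter_upwards [h4.eventually (gt_mem_nhds hv), self_mem_nhdsWithin] with s hs hs0
  have hs0' : (0 : ℝ) < s := hs0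
  rw [slope_def_field, zero_smul, add_zero, sub_zero, div_neg_iff] at hs
  rcases hs with ⟨-, h⟩ | ⟨h, -⟩
  · linarith
  · linarith

section Normal

variable {X : Set (Vec d)}

/-- The data of a local defining function at a boundary point. -/
structure LocalDefining (X U : Set (Vec d)) (ρ : Vec d → ℝ) : Prop where
  isOpen : IsOpen U
  smooth : ContDiffOn ℝ 1 ρ U
  eq : X ∩ U = {y ∈ U | ρ y < 0}

theorem LocalDefining.contDiffAt {U : Set (Vec d)} {ρ : Vec d → ℝ} (h : LocalDefining X U ρ)
    {x : Vec d} (hx : x ∈ U) : ContDiffAt ℝ 1 ρ x :=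
  h.smooth.contDiffAt (h.isOpen.mem_nhds hx)

theorem LocalDefining.differentiableAt {U : Set (Vec d)} {ρ : Vec d → ℝ} (h : LocalDefining X U ρ)
    {x : Vec d} (hx : x ∈ U) : DifferentiableAt ℝ ρ x :=
  (h.contDiffAt hx).differentiableAt one_ne_zero

theorem LocalDefining.mem_iff {U : Set (Vec d)} {ρ : Vec d → ℝ} (h : LocalDefining X U ρ)
    {x : Vec d} (hx : x ∈ U) : x ∈ X ↔ ρ x < 0 := by
  have : x ∈ X ∩ U ↔ x ∈ {y ∈ U | ρ y < 0} := by rw [h.eq]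
  simpa [hx] using this

theorem LocalDefining.eq_zero {U : Set (Vec d)} {ρ : Vec d → ℝ} (h : LocalDefining X U ρ)
    (hX : IsOpen X) {x : Vec d} (hx : x ∈ U) (hf : x ∈ frontier X) : ρ x = 0 := by
  rw [hX.frontier_eq] at hf
  refine le_antisymm ?_ (not_lt.1 fun h0 => hf.2 ((h.mem_iff hx).2 h0))
  by_contra! h0
  have h1 : ∀ᶠ y in 𝓝 x, 0 < ρ y ∧ y ∈ U :=
    (((h.differentiableAt hx).continuousAt).eventually (lt_mem_nhds h0)).and (h.isOpen.mem_nhds hx)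
  obtain ⟨y, hyX, hy1, hy2⟩ := ((mem_closure_iff_frequently.1 hf.1).and_eventually h1).exists
  have := (h.mem_iff hy2).1 hyX
  linarith

theorem IsOuterNormal.eventually_mem (hX : IsOpen X) {x n v : Vec d} (h : IsOuterNormal X x n)
    (hv : inner ℝ v n < 0) : ∀ᶠ s : ℝ in 𝓝[>] 0, x + s • v ∈ X := by
  obtain ⟨hf, -, U, ρ, hU, hxU, hρ, hXU, c, hc, hg⟩ := h
  have hL : LocalDefining X U ρ := ⟨hU, hρ, hXU⟩
  have h1 : fderiv ℝ ρ x v < 0 := by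
    rw [fderiv_apply_eq_inner_gradient, hg, inner_smul_left, real_inner_comm]
    exact mul_neg_of_pos_of_neg hc hv
  filter_upwards [eventually_lt_of_fderiv_neg (hL.differentiableAt hxU) h1,
    (tendsto_add_smul_nhdsGT x v).eventually (hU.mem_nhds hxU)] with s hs hsU
  rw [hL.eq_zero hX hxU hf] at hs
  exact (hL.mem_iff hsU).2 hs

theorem IsOuterNormal.eventually_notMem (hX : IsOpen X) {x n v : Vec d} (h : IsOuterNormal X x n)
    (hv : 0 < inner ℝ v n) : ∀ᶠ s : ℝ in 𝓝[>] 0, x + s • v ∉ X := by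
  obtain ⟨hf, -, U, ρ, hU, hxU, hρ, hXU, c, hc, hg⟩ := h
  have hL : LocalDefining X U ρ := ⟨hU, hρ, hXU⟩
  have h1 : fderiv ℝ (fun y => -ρ y) x v < 0 := by
    rw [fderiv_fun_neg, neg_apply, fderiv_apply_eq_inner_gradient, hg, inner_smul_left,
      real_inner_comm]
    simpa using mul_pos hc hv
  filter_upwards [eventually_lt_of_fderiv_neg (hL.differentiableAt hxU).neg h1,
    (tendsto_add_smul_nhdsGT x v).eventually (hU.mem_nhds hxU)] with s hs hsU
  simp only [hL.eq_zero hX hxU hf, Pi.neg_apply] at hs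
  rw [hL.mem_iff hsU]
  linarith

/-- The direction n' - n would point into X according to n and out of X according to n'. -/
theorem IsOuterNormal.unique (hX : IsOpen X) {x n n' : Vec d} (h : IsOuterNormal X x n)
    (h' : IsOuterNormal X x n') : n = n' := by
  by_contra hne
  have h1 : inner ℝ n n' < 1 := (inner_lt_one_iff_real_of_norm_eq_one h.2.1 h'.2.1).2 hne
  have h2 : inner ℝ (n' - n) n < 0 := by
    rw [inner_sub_left, real_inner_self_eq_norm_sq, h.2.1, real_inner_comm]; linarith
  have h3 : 0 < inner ℝ (n' - n) n' := by
    rw [inner_sub_left, real_inner_self_eq_norm_sq, h'.2.1]; linarith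
  obtain ⟨s, hs, hs'⟩ := ((h.eventually_mem hX h2).and (h'.eventually_notMem hX h3)).exists
  exact hs' hs

theorem isOuterNormal_outerNormal (hX : IsC1Domain X) {x : Vec d} (hx : x ∈ frontier X) :
    IsOuterNormal X x (outerNormal X x) := by
  have h := hX.2.2.2 x hx
  rw [outerNormal, dif_pos h]
  exact h.choose_spec

theorem outerNormal_eq (hX : IsOpen X) {x n : Vec d} (h : IsOuterNormal X x n) :
    outerNormal X x = n := by
  have h' : ∃ n, IsOuterNormal X x n := ⟨n, h⟩
  rw [outerNormal, dif_pos h']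
  exact h'.choose_spec.unique hX h

theorem outerNormal_eq_zero {x : Vec d} (hx : x ∉ frontier X) : outerNormal X x = 0 := by
  rw [outerNormal, dif_neg]
  rintro ⟨n, hn⟩
  exact hx hn.1

theorem norm_outerNormal (hX : IsC1Domain X) {x : Vec d} (hx : x ∈ frontier X) :
    ‖outerNormal X x‖ = 1 := (isOuterNormal_outerNormal hX hx).2.1

theorem continuousOn_gradient {U : Set (Vec d)} {ρ : Vec d → ℝ} (hU : IsOpen U)
    (h : ContDiffOn ℝ 1 ρ U) : ContinuousOn (gradient ρ) U :=
  (InnerProductSpace.toDual ℝ (Vec d)).symm.continuous.comp_continuousOn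
    (h.continuousOn_fderiv_of_isOpen hU le_rfl)

/-- By uniqueness, a single defining function near x computes the normal at all nearby boundary
points as its normalized gradient, which is continuous. -/
theorem continuousOn_outerNormal (hX : IsC1Domain X) :
    ContinuousOn (outerNormal X) (frontier X) := by
  intro x hx
  obtain ⟨hf, hn1, U, ρ, hU, hxU, hρ, hXU, c, hc, hg⟩ := isOuterNormal_outerNormal hX hx
  have hgx : gradient ρ x ≠ 0 := by
    rw [hg]
    refine smul_ne_zero hc.ne' fun h0 => ?_
    rw [h0, norm_zero] at hn1
    exact zero_ne_one hn1
  have hgc : ContinuousAt (gradient ρ) x :=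
    (continuousOn_gradient hU hρ).continuousAt (hU.mem_nhds hxU)
  have h1 : ContinuousAt (fun y => ‖gradient ρ y‖⁻¹ • gradient ρ y) x :=
    (hgc.norm.inv₀ (norm_ne_zero_iff.2 hgx)).smul hgc
  have h2 : ∀ᶠ y in 𝓝[frontier X] x,
      ‖gradient ρ y‖⁻¹ • gradient ρ y = outerNormal X y := by
    filter_upwards [self_mem_nhdsWithin,
      mem_nhdsWithin_of_mem_nhds (hgc.eventually_ne hgx),
      mem_nhdsWithin_of_mem_nhds (hU.mem_nhds hxU)] with y hy hy0 hyU
    have hpos : 0 < ‖gradient ρ y‖ := norm_pos_iff.2 hy0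
    refine (outerNormal_eq hX.1 ⟨hy, ?_, U, ρ, hU, hyU, hρ, hXU, ‖gradient ρ y‖, hpos, ?_⟩).symm
    · rw [norm_smul, norm_inv, norm_norm, inv_mul_cancel₀ hpos.ne']
    · rw [smul_smul, mul_inv_cancel₀ hpos.ne', one_smul]
  exact (h1.continuousWithinAt (s := frontier X)).congr_of_eventuallyEq
    (h2.mono fun y hy => hy.symm) (by
      exact (h2.self_of_nhdsWithin hx).symm)

theorem measurable_outerNormal (hX : IsC1Domain X) : Measurable (outerNormal X) := by
  classical
  have h := (continuousOn_outerNormal hX).measurable_piecewise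
    (continuousOn_const (c := (0 : Vec d)) (s := (frontier X)ᶜ)) isClosed_frontier.measurableSet
  convert h using 1
  ext1 x
  by_cases hx : x ∈ frontier X
  · simp [hx]
  · simp [hx, outerNormal_eq_zero hx]

end Normal

/-! ### Flat pieces of hypersurfaces -/

/-- The secants of `S` have slope at most `ε` over the hyperplane orthogonal to `n`. -/
def IsFlat (S : Set (Vec d)) (n : Vec d) (ε : ℝ) : Prop :=
  ∀ y ∈ S, ∀ y' ∈ S, |inner ℝ n (y - y')| ≤ ε * ‖y - y'‖

theorem IsFlat.mono {S S' : Set (Vec d)} {n : Vec d} {ε : ℝ} (h : IsFlat S n ε) (hS : S' ⊆ S) :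
    IsFlat S' n ε := fun y hy y' hy' => h y (hS hy) y' (hS hy')

/-- Strict differentiability at y: on the zero set the increment of ρ vanishes, so dρ(z - z') is
o(|z - z'|) uniformly near y. -/
theorem exists_isFlat {U : Set (Vec d)} {ρ : Vec d → ℝ} {y n : Vec d} {c : ℝ} (hU : IsOpen U)
    (hy : y ∈ U) (hρ : ContDiffOn ℝ 1 ρ U) (hg : gradient ρ y = c • n) (hc : 0 < c) {ε : ℝ}
    (hε : 0 < ε) : ∃ O : Set (Vec d), IsOpen O ∧ y ∈ O ∧ O ⊆ U ∧ IsFlat ({z | ρ z = 0} ∩ O) n ε := by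
  have h1 : HasStrictFDerivAt ρ (fderiv ℝ ρ y) y :=
    (hρ.contDiffAt (hU.mem_nhds hy)).hasStrictFDerivAt one_ne_zero
  have h2 := h1.isLittleO.bound (mul_pos hc hε)
  rw [nhds_prod_eq] at h2
  obtain ⟨O, hO, hOO⟩ := (eventually_prod_self_iff' (r := fun p : Vec d × Vec d =>
    ‖ρ p.1 - ρ p.2 - fderiv ℝ ρ y (p.1 - p.2)‖ ≤ c * ε * ‖p.1 - p.2‖)).1 h2
  obtain ⟨O', hO'O, hO', hyO'⟩ := mem_nhds_iff.1 (inter_mem hO (hU.mem_nhds hy))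
  refine ⟨O', hO', hyO', fun z hz => (hO'O hz).2, fun z hz z' hz' => ?_⟩
  have h3 := hOO z (hO'O hz.2).1 z' (hO'O hz'.2).1
  have hz0 : ρ z = 0 := hz.1
  have hz0' : ρ z' = 0 := hz'.1
  simp only [hz0, hz0', sub_zero, zero_sub, norm_neg] at h3
  rw [fderiv_apply_eq_inner_gradient, hg, inner_smul_left, Real.norm_eq_abs, abs_mul] at h3
  simp only [RCLike.conj_to_real, abs_of_pos hc, mul_assoc] at h3
  exact le_of_mul_le_mul_left h3 hc

end

/-! ### Sweeping a flat piece of hypersurface along a fixed direction -/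

section

variable {d : ℕ}

/-- `(y,t) ↦ π y + t n`, with `π` the orthogonal projection along the unit vector `n`. -/
def flatten (n : Vec d) (p : Vec d × ℝ) : Vec d := p.1 + (p.2 - inner ℝ n p.1) • n

/-- `(y,t) ↦ y + t v`. -/
def sweep (v : Vec d) (p : Vec d × ℝ) : Vec d := p.1 + p.2 • v

theorem continuous_flatten (n : Vec d) : Continuous (flatten n) := by
  unfold flatten; fun_prop

theorem continuous_sweep (v : Vec d) : Continuous (sweep v) := by
  unfold sweep; fun_prop

theorem inner_flatten {n : Vec d} (hn : ‖n‖ = 1) (p : Vec d × ℝ) :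
    inner ℝ n (flatten n p) = p.2 := by
  simp [flatten, inner_add_right, inner_smul_right, hn]

theorem norm_flatten_sub_sq {n : Vec d} (hn : ‖n‖ = 1) (p q : Vec d × ℝ) :
    ‖flatten n p - flatten n q‖ ^ 2 =
      ‖p.1 - q.1‖ ^ 2 - inner ℝ n (p.1 - q.1) ^ 2 + (p.2 - q.2) ^ 2 := by
  have : flatten n p - flatten n q
      = (p.1 - q.1) + ((p.2 - q.2) - inner ℝ n (p.1 - q.1)) • n := by
    simp only [flatten, inner_sub_right]
    module
  rw [this, norm_add_sq_real, norm_smul, hn, inner_smul_right, real_inner_comm, mul_one,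
    Real.norm_eq_abs, sq_abs]
  ring

/-- Flattening only loses the component of y - y' along n, which flatness bounds by ε‖y - y'‖. Hence
the inverse is Lipschitz with constant (1 - ε²)^(-1/2), or any larger one. -/
theorem norm_sub_le_flatten {S : Set (Vec d)} {n : Vec d} {ε : ℝ} (hn : ‖n‖ = 1)
    (hS : IsFlat S n ε) {K : ℝ} (hK : 0 ≤ K) (hKε : 1 ≤ K ^ 2 * (1 - ε ^ 2)) {p q : Vec d × ℝ}
    (hp : p.1 ∈ S) (hq : q.1 ∈ S) : ‖p.1 - q.1‖ ≤ K * ‖flatten n p - flatten n q‖ := by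
  refine abs_le_of_sq_le_sq' ?_ (by positivity) |>.2
  rw [mul_pow, norm_flatten_sub_sq hn]
  have h2 : inner ℝ n (p.1 - q.1) ^ 2 ≤ ε ^ 2 * ‖p.1 - q.1‖ ^ 2 := by
    rw [← mul_pow, ← sq_abs (inner ℝ n _)]
    exact pow_le_pow_left₀ (abs_nonneg _) (hS _ hp _ hq) 2
  have h3 : K ^ 2 * ((1 - ε ^ 2) * ‖p.1 - q.1‖ ^ 2) ≤
      K ^ 2 * (‖p.1 - q.1‖ ^ 2 - inner ℝ n (p.1 - q.1) ^ 2 + (p.2 - q.2) ^ 2) := by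
    gcongr
    nlinarith [sq_nonneg (p.2 - q.2)]
  nlinarith [sq_nonneg ‖p.1 - q.1‖]

theorem injOn_flatten {S : Set (Vec d)} {n : Vec d} {ε : ℝ} (hn : ‖n‖ = 1)
    (hS : IsFlat S n ε) {K : ℝ} (hK : 0 ≤ K) (hKε : 1 ≤ K ^ 2 * (1 - ε ^ 2)) :
    InjOn (flatten n) (S ×ˢ univ) := fun p hp q hq h => by
  have h1 := norm_sub_le_flatten hn hS hK hKε hp.1 hq.1
  rw [h, sub_self, norm_zero, mul_zero] at h1
  have h2 : p.1 = q.1 := sub_eq_zero.1 (norm_le_zero_iff.1 h1)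
  have h3 : p.2 = q.2 := by rw [← inner_flatten hn p, h, inner_flatten hn]
  exact Prod.ext h2 h3

/-- Fubini over hyperplanes orthogonal to n. The slices carry Hausdorff measure, so that slices of a
hypersurface cylinder can be compared with it through Lipschitz maps. -/
theorem volume_eq_lintegral_slices {n : Vec d} (hn : ‖n‖ = 1) {A : Set (Vec d)}
    (hA : MeasurableSet A) : volume A = ∫⁻ t : ℝ,
      Measure.euclideanHausdorffMeasure (d - 1) (A ∩ {z | inner ℝ n z = t}) := by
  have hn0 : n ≠ 0 := fun h => by simp [h] at hn
  have h := EuclideanGeometry.euclideanHausdorffMeasure_eq_lintegral (0 : Vec d) hn0 hA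
  have hfin : Module.finrank ℝ (Vec d) = d := by simp
  have hset : ∀ t : ℝ, ((AffineSubspace.mk' (t • n +ᵥ (0 : Vec d)) (ℝ ∙ n)ᗮ :
      AffineSubspace ℝ (Vec d)) : Set (Vec d)) = {z | inner ℝ n z = t} := fun t => by
    ext z
    rw [SetLike.mem_coe, AffineSubspace.mem_mk', Submodule.mem_orthogonal_singleton_iff_inner_right]
    simp [inner_sub_right, inner_smul_right, hn, sub_eq_zero]
  rw [InnerProductSpace.euclideanHausdorffMeasure_eq_volume, hfin] at h
  have hn1 : ‖n‖ₑ = 1 := by rw [← ofReal_norm, hn, ENNReal.ofReal_one]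
  simpa only [hset, hn1, one_mul] using h

theorem euclideanHausdorffMeasure_image_le {α β : Type*} [MetricSpace α] [MeasurableSpace α]
    [BorelSpace α] [MetricSpace β] [MeasurableSpace β] [BorelSpace β] {K : NNReal} {f : α → β}
    {s : Set α} (h : LipschitzOnWith K f s) (m : ℕ) :
    Measure.euclideanHausdorffMeasure m (f '' s) ≤
      (K : ℝ≥0∞) ^ m * Measure.euclideanHausdorffMeasure m s := by
  rw [Measure.euclideanHausdorffMeasure_def, Measure.euclideanHausdorffMeasure_def,
    Measure.smul_apply, Measure.smul_apply, ENNReal.smul_def, ENNReal.smul_def, smul_eq_mul,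
    smul_eq_mul, mul_left_comm]
  gcongr
  simpa using h.hausdorffMeasure_image_le (d := (m : ℝ)) (by positivity)

theorem flatten_image_inter {n : Vec d} (hn : ‖n‖ = 1) (E : Set (Vec d × ℝ)) (t : ℝ) :
    flatten n '' E ∩ {z | inner ℝ n z = t} = (fun y => flatten n (y, t)) '' {y | (y, t) ∈ E} := by
  ext z
  constructor
  · rintro ⟨⟨p, hp, rfl⟩, ht⟩
    rw [mem_ofPred_eq, inner_flatten hn] at ht
    subst ht
    exact ⟨p.1, hp, rfl⟩
  · rintro ⟨y, hy, rfl⟩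
    exact ⟨⟨_, hy, rfl⟩, inner_flatten hn _⟩

section Compare

variable {S : Set (Vec d)} {n : Vec d} {ε : ℝ} {K : NNReal} {E : Set (Vec d × ℝ)}

theorem measurableSet_flatten_image (hn : ‖n‖ = 1) (hS : IsFlat S n ε)
    (hKε : 1 ≤ (K : ℝ) ^ 2 * (1 - ε ^ 2)) (hE : MeasurableSet E) (hES : E ⊆ S ×ˢ univ) :
    MeasurableSet (flatten n '' E) :=
  hE.image_of_continuousOn_injOn (continuous_flatten n).continuousOn
    ((injOn_flatten hn hS K.2 hKε).mono hES)

/-- On each slice the orthogonal projection along n is 1-Lipschitz. -/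
theorem volume_flatten_le (hn : ‖n‖ = 1) (hS : IsFlat S n ε)
    (hKε : 1 ≤ (K : ℝ) ^ 2 * (1 - ε ^ 2)) (hE : MeasurableSet E) (hES : E ⊆ S ×ˢ univ) :
    volume (flatten n '' E) ≤
      ∫⁻ t : ℝ, Measure.euclideanHausdorffMeasure (d - 1) {y | (y, t) ∈ E} := by
  rw [volume_eq_lintegral_slices hn (measurableSet_flatten_image hn hS hKε hE hES)]
  refine lintegral_mono fun t => ?_
  rw [flatten_image_inter hn]
  have hl : LipschitzOnWith 1 (fun y => flatten n (y, t)) {y | (y, t) ∈ E} := by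
    refine LipschitzOnWith.of_dist_le_mul fun y _ z _ => ?_
    rw [dist_eq_norm, dist_eq_norm, NNReal.coe_one, one_mul]
    refine abs_le_of_sq_le_sq' ?_ (by positivity) |>.2
    rw [norm_flatten_sub_sq hn]
    nlinarith [sq_nonneg (inner ℝ n (y - z))]
  simpa using euclideanHausdorffMeasure_image_le hl (d - 1)

/-- On each slice the inverse of the projection is K-Lipschitz by flatness, at the price of K^(d-1)
in (d-1)-dimensional measure. -/
theorem le_volume_flatten (hn : ‖n‖ = 1) (hS : IsFlat S n ε)
    (hKε : 1 ≤ (K : ℝ) ^ 2 * (1 - ε ^ 2)) (hE : MeasurableSet E) (hES : E ⊆ S ×ˢ univ) :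
    ∫⁻ t : ℝ, Measure.euclideanHausdorffMeasure (d - 1) {y | (y, t) ∈ E} ≤
      (K : ℝ≥0∞) ^ (d - 1) * volume (flatten n '' E) := by
  rw [volume_eq_lintegral_slices hn (measurableSet_flatten_image hn hS hKε hE hES),
    ← lintegral_const_mul' _ _ (by finiteness)]
  refine lintegral_mono fun t => ?_
  rw [flatten_image_inter hn]
  set f : Vec d → Vec d := fun y => flatten n (y, t)
  set s := {y | (y, t) ∈ E}
  have hinj : InjOn f s := fun y hy z hz h =>
    congrArg Prod.fst (injOn_flatten hn hS K.2 hKε (hES hy) (hES hz) h)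
  have hl : LipschitzOnWith K (Function.invFunOn f s) (f '' s) := by
    refine LipschitzOnWith.of_dist_le_mul ?_
    rintro _ ⟨y, hy, rfl⟩ _ ⟨z, hz, rfl⟩
    rw [hinj.leftInvOn_invFunOn hy, hinj.leftInvOn_invFunOn hz, dist_eq_norm, dist_eq_norm]
    exact norm_sub_le_flatten (p := (y, t)) (q := (z, t)) hn hS K.2 hKε (hES hy).1 (hES hz).1
  have h1 := euclideanHausdorffMeasure_image_le hl (d - 1)
  rwa [hinj.leftInvOn_invFunOn.image_image] at h1

/-- The linear map that fixes the hyperplane orthogonal to `n` and sends `n` to `v`. -/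
def shear (n v : Vec d) : Vec d →L[ℝ] Vec d :=
  ContinuousLinearMap.id ℝ (Vec d) + (innerSL ℝ n).smulRight (v - n)

theorem det_shear (hn : ‖n‖ = 1) (v : Vec d) : (shear n v).det = inner ℝ n v := by
  have : ((shear n v : Vec d →L[ℝ] Vec d) : Vec d →ₗ[ℝ] Vec d) =
      LinearMap.transvection ((innerSL ℝ n : Vec d →L[ℝ] ℝ) : Vec d →ₗ[ℝ] ℝ) (v - n) := by
    ext1 x
    simp [shear, LinearMap.transvection.apply]
  rw [ContinuousLinearMap.det, this, LinearMap.transvection.det]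
  simp [inner_sub_right, hn]

/-- In flattened coordinates the sweep differs from the linear map `shear n v`, of determinant
⟨n,v⟩, by the field ⟨n, y - y'⟩ n, which flatness makes small. Volume estimates for almost linear
maps then apply. -/
theorem approximatesLinearOn_sweep (hn : ‖n‖ = 1) (hS : IsFlat S n ε)
    (hKε : 1 ≤ (K : ℝ) ^ 2 * (1 - ε ^ 2)) (v : Vec d) {δ : NNReal} (hε : 0 ≤ ε)
    (hδ : ε * K ≤ δ) :
    ApproximatesLinearOn (fun z => sweep v (Function.invFunOn (flatten n) (S ×ˢ univ) z))
      (shear n v) (flatten n '' (S ×ˢ univ)) δ := by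
  have hinj := injOn_flatten hn hS K.2 hKε
  rintro _ ⟨p, hp, rfl⟩ _ ⟨q, hq, rfl⟩
  simp only [hinj.leftInvOn_invFunOn hp, hinj.leftInvOn_invFunOn hq]
  have h1 : sweep v p - sweep v q - shear n v (flatten n p - flatten n q)
      = inner ℝ n (p.1 - q.1) • n := by
    simp only [shear, add_apply, ContinuousLinearMap.id_apply, ContinuousLinearMap.smulRight_apply,
      innerSL_apply_apply, inner_sub_right, inner_flatten hn]
    simp only [flatten, sweep]
    module
  rw [h1, norm_smul, hn, mul_one, Real.norm_eq_abs]
  calc |inner ℝ n (p.1 - q.1)| ≤ ε * ‖p.1 - q.1‖ := hS _ hp.1 _ hq.1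
    _ ≤ ε * (K * ‖flatten n p - flatten n q‖) := by
      gcongr; exact norm_sub_le_flatten hn hS K.2 hKε hp.1 hq.1
    _ ≤ δ * ‖flatten n p - flatten n q‖ := by rw [← mul_assoc]; gcongr

theorem sweep_image_eq (hn : ‖n‖ = 1) (hS : IsFlat S n ε)
    (hKε : 1 ≤ (K : ℝ) ^ 2 * (1 - ε ^ 2)) (v : Vec d) (hES : E ⊆ S ×ˢ univ) :
    (fun z => sweep v (Function.invFunOn (flatten n) (S ×ˢ univ) z)) '' (flatten n '' E) =
      sweep v '' E := by
  have hinj := injOn_flatten hn hS K.2 hKε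
  rw [image_image]
  exact image_congr fun p hp => by rw [hinj.leftInvOn_invFunOn (hES hp)]

end Compare

/-- On flat enough pieces of a hypersurface, sweeping along `v` multiplies the measure by a factor
close to `|⟨n,v⟩|`. -/
theorem exists_flatness {n : Vec d} (hn : ‖n‖ = 1) (v : Vec d) {η : ℝ} (hη : 0 < η) :
    ∃ ε : ℝ, 0 < ε ∧ ∀ S : Set (Vec d), IsFlat S n ε → ∀ E : Set (Vec d × ℝ), MeasurableSet E →
      E ⊆ S ×ˢ univ →
      volume (sweep v '' E) ≤ ENNReal.ofReal (|inner ℝ n v| + η) *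
        ∫⁻ t : ℝ, Measure.euclideanHausdorffMeasure (d - 1) {y | (y, t) ∈ E} ∧
      ENNReal.ofReal (|inner ℝ n v| - η) *
        ∫⁻ t : ℝ, Measure.euclideanHausdorffMeasure (d - 1) {y | (y, t) ∈ E} ≤
          volume (sweep v '' E) := by
  have h1 := addHaar_image_le_mul_of_det_lt (volume : Measure (Vec d)) (shear n v)
    (m := (|inner ℝ n v| + η).toNNReal) (by
      rw [det_shear hn]
      exact (ENNReal.ofReal_lt_ofReal_iff (by positivity)).2 (by linarith))
  have h2 : ∀ᶠ δ in 𝓝[>] (0 : NNReal), ∀ (s : Set (Vec d)) (f : Vec d → Vec d),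
      ApproximatesLinearOn f (shear n v) s δ →
        ENNReal.ofReal (|inner ℝ n v| - η / 2) * volume s ≤ volume (f '' s) := by
    -- The lower volume bound for almost linear maps needs a factor strictly below |det|. This could
    -- fail only for a degenerate direction, where the claim is trivial.
    rcases le_or_gt (|inner ℝ n v| - η / 2) 0 with h0 | h0
    · filter_upwards with δ s f hf
      simp [ENNReal.ofReal_eq_zero.2 h0]
    · refine mul_le_addHaar_image_of_lt_det (volume : Measure (Vec d)) (shear n v)
        (m := (|inner ℝ n v| - η / 2).toNNReal) ?_
      rw [det_shear hn]
      exact (ENNReal.ofReal_lt_ofReal_iff (by linarith)).2 (by linarith)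
  obtain ⟨δ, ⟨hδ1, hδ2⟩, hδ⟩ := ((h1.and h2).and self_mem_nhdsWithin).exists
  have hδ' : (0 : ℝ) < δ := hδ
  -- the Lipschitz constant of the inverse projection
  have hK : ∃ K : NNReal, 1 < K ∧
      (|inner ℝ n v| - η) * (K : ℝ) ^ (d - 1) ≤ |inner ℝ n v| - η / 2 := by
    have hc : Tendsto (fun K : NNReal => (|inner ℝ n v| - η) * (K : ℝ) ^ (d - 1)) (𝓝[>] 1)
        (𝓝 ((|inner ℝ n v| - η) * ((1 : NNReal) : ℝ) ^ (d - 1))) :=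
      (Continuous.tendsto (by fun_prop) 1).mono_left nhdsWithin_le_nhds
    have hlt : (|inner ℝ n v| - η) * ((1 : NNReal) : ℝ) ^ (d - 1) < |inner ℝ n v| - η / 2 := by
      simp; linarith
    obtain ⟨K, hK1, hK2⟩ := ((hc.eventually (gt_mem_nhds hlt)).and self_mem_nhdsWithin).exists
    exact ⟨K, hK2, hK1.le⟩
  obtain ⟨K, hK1, hK2⟩ := hK
  have hK1' : (1 : ℝ) < K := hK1
  have hε : ∃ ε : ℝ, 0 < ε ∧ ε * K ≤ δ ∧ 1 ≤ (K : ℝ) ^ 2 * (1 - ε ^ 2) := by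
    have hc : Tendsto (fun ε : ℝ => (K : ℝ) ^ 2 * (1 - ε ^ 2)) (𝓝[>] 0)
        (𝓝 ((K : ℝ) ^ 2 * (1 - 0 ^ 2))) :=
      (Continuous.tendsto (by fun_prop) 0).mono_left nhdsWithin_le_nhds
    have hc' : Tendsto (fun ε : ℝ => ε * K) (𝓝[>] 0) (𝓝 (0 * K)) :=
      (Continuous.tendsto (by fun_prop) 0).mono_left nhdsWithin_le_nhds
    have hlt : 1 < (K : ℝ) ^ 2 * (1 - 0 ^ 2) := by nlinarith
    obtain ⟨ε, ⟨h1, h2⟩, h3⟩ := (((hc.eventually (lt_mem_nhds hlt)).and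
      (hc'.eventually (gt_mem_nhds (by rwa [zero_mul])))).and self_mem_nhdsWithin).exists
    exact ⟨ε, h3, h2.le, h1.le⟩
  obtain ⟨ε, hε0, hεK, hKε⟩ := hε
  refine ⟨ε, hε0, fun S hS E hE hES => ?_⟩
  have hA := (approximatesLinearOn_sweep hn hS hKε v hε0.le hεK).mono_set (image_mono hES)
  rw [← sweep_image_eq hn hS hKε v hES]
  constructor
  · exact (hδ1 _ _ hA).trans (mul_le_mul_right (volume_flatten_le hn hS hKε hE hES) _)
  · refine le_trans ?_ (hδ2 _ _ hA)
    refine (mul_le_mul_right (le_volume_flatten hn hS hKε hE hES) _).trans ?_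
    rw [← mul_assoc]
    gcongr
    rw [show ((K : ℝ≥0∞) ^ (d - 1)) = ENNReal.ofReal ((K : ℝ) ^ (d - 1)) by
      rw [ENNReal.ofReal_pow K.coe_nonneg, ENNReal.ofReal_coe_nnreal], ← ENNReal.ofReal_mul' (by positivity)]
    exact ENNReal.ofReal_le_ofReal hK2

end

/-! ### The area formula for sweeping a compact hypersurface; finiteness and positivity of its
measure -/

section

variable {d : ℕ}

/-- `N` is a unit normal field of the hypersurface `M`, in the sense that near each point `y` the
secants of `M` are almost orthogonal to `N y`. -/
def IsNormalField (M : Set (Vec d)) (N : Vec d → Vec d) : Prop :=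
  ∀ y ∈ M, ‖N y‖ = 1 ∧ ∀ ε : ℝ, 0 < ε → ∃ O : Set (Vec d), IsOpen O ∧ y ∈ O ∧
    IsFlat (M ∩ O) (N y) ε

theorem isNormalField_frontier {X : Set (Vec d)} (hX : IsC1Domain X) :
    IsNormalField (frontier X) (outerNormal X) := fun y hy => by
  refine ⟨norm_outerNormal hX hy, fun ε hε => ?_⟩
  obtain ⟨hf, -, U, ρ, hU, hyU, hρ, hXU, c, hc, hg⟩ := isOuterNormal_outerNormal hX hy
  obtain ⟨O, hO, hyO, hOU, hfl⟩ := exists_isFlat hU hyU hρ hg hc hε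
  have hL : LocalDefining X U ρ := ⟨hU, hρ, hXU⟩
  exact ⟨O, hO, hyO, hfl.mono fun z hz => ⟨hL.eq_zero hX.1 (hOU hz.2) hz.1, hz.2⟩⟩

theorem IsClosedC1Hypersurface.exists_isNormalField {V : Set (Vec d)}
    (hV : IsClosedC1Hypersurface V) : ∃ N, IsNormalField V N := by
  have : ∀ v ∈ V, ∃ n : Vec d, ‖n‖ = 1 ∧ ∀ ε : ℝ, 0 < ε → ∃ O : Set (Vec d), IsOpen O ∧ v ∈ O ∧
      IsFlat (V ∩ O) n ε := fun v hv => by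
    obtain ⟨U, ρ, hU, hvU, hρ, hg, hVU⟩ := hV.2.2 v hv
    have hpos : 0 < ‖gradient ρ v‖ := norm_pos_iff.2 hg
    refine ⟨‖gradient ρ v‖⁻¹ • gradient ρ v, ?_, fun ε hε => ?_⟩
    · rw [norm_smul, norm_inv, norm_norm, inv_mul_cancel₀ hpos.ne']
    · obtain ⟨O, hO, hyO, hOU, hfl⟩ := exists_isFlat hU hvU hρ
        (n := ‖gradient ρ v‖⁻¹ • gradient ρ v) (c := ‖gradient ρ v‖)
        (by rw [smul_smul, mul_inv_cancel₀ hpos.ne', one_smul]) hpos hε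
      refine ⟨O, hO, hyO, hfl.mono fun z hz => ⟨?_, hz.2⟩⟩
      have : z ∈ V ∩ U := ⟨hz.1, hOU hz.2⟩
      rw [hVU] at this
      exact this.2
  choose! N hN using this
  exact ⟨N, hN⟩

/-- The measure of a flat piece S is at most a constant times the volume of the flattening of S ×
[0,1], which is bounded; compactness sums finitely many pieces. -/
theorem IsNormalField.measure_lt_top {M : Set (Vec d)} {N : Vec d → Vec d}
    (hN : IsNormalField M N) (hM : IsCompact M) :
    Measure.euclideanHausdorffMeasure (d - 1) M < ⊤ := by
  refine hM.measure_lt_top_of_nhdsWithin fun y hy => ?_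
  obtain ⟨hn, hfl⟩ := hN y hy
  obtain ⟨O, hO, hyO, hS⟩ := hfl (1 / 2) (by norm_num)
  set S := M ∩ (O ∩ Metric.ball y 1) with hSdef
  have hSm : MeasurableSet S :=
    hM.isClosed.measurableSet.inter (hO.inter Metric.isOpen_ball).measurableSet
  have hS' : IsFlat S (N y) (1 / 2) := hS.mono fun z hz => ⟨hz.1, hz.2.1⟩
  refine ⟨S, inter_mem_nhdsWithin _ ((hO.inter Metric.isOpen_ball).mem_nhds
    ⟨hyO, Metric.mem_ball_self one_pos⟩), ?_⟩
  have h1 := le_volume_flatten (K := 2) hn hS' (by norm_num)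
    (hSm.prod (measurableSet_Icc (a := (0 : ℝ)) (b := 1)))
    (prod_mono_right (subset_univ _))
  have h2 : volume (flatten (N y) '' (S ×ˢ Icc (0 : ℝ) 1)) < ⊤ := by
    have hb : Bornology.IsBounded (closure (S ×ˢ Icc (0 : ℝ) 1)) :=
      (((Metric.isBounded_ball.subset fun z hz => hz.2.2).prod
        (Metric.isBounded_Icc 0 1))).closure
    exact ((Metric.isCompact_of_isClosed_isBounded isClosed_closure hb).image
      (continuous_flatten (N y))).measure_lt_top.trans_le' (measure_mono (image_mono subset_closure))
  have h3 : ∫⁻ t : ℝ, Measure.euclideanHausdorffMeasure (d - 1) {z | (z, t) ∈ S ×ˢ Icc (0 : ℝ) 1}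
      = Measure.euclideanHausdorffMeasure (d - 1) S := by
    have : ∀ t : ℝ, Measure.euclideanHausdorffMeasure (d - 1) {z | (z, t) ∈ S ×ˢ Icc (0 : ℝ) 1}
        = (Icc (0 : ℝ) 1).indicator
          (fun _ => Measure.euclideanHausdorffMeasure (d - 1) S) t := fun t => by
      by_cases ht : t ∈ Icc (0 : ℝ) 1
      · simp only [mem_prod, ht, and_true, indicator_of_mem]; rfl
      · simp [mem_prod, ht]
    simp_rw [this]
    rw [lintegral_indicator measurableSet_Icc]
    simp
  rw [h3] at h1
  exact h1.trans_lt (ENNReal.mul_lt_top (by finiteness) h2)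

/-- Sweeping a subset `E` of `M × ℝ` along `v` yields a set of volume at most
`∫_E |⟨N,v⟩|`, with equality if the sweep is injective. -/
theorem IsNormalField.sweep_bounds {M : Set (Vec d)} {N : Vec d → Vec d}
    (hN : IsNormalField M N) (hM : IsCompact M) (hNc : ContinuousOn N M)
    (v : Vec d) {η : ℝ} (hη : 0 < η) {E : Set (Vec d × ℝ)} (hE : MeasurableSet E)
    (hEM : E ⊆ M ×ˢ univ) (J : Vec d → ℝ≥0∞) (hJ : J = fun y => ENNReal.ofReal |inner ℝ (N y) v|)
    (m : Measure (Vec d × ℝ))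
    (hm : m = ((Measure.euclideanHausdorffMeasure (d - 1)).restrict M).prod volume) :
    volume (sweep v '' E) ≤ ∫⁻ p in E, J p.1 ∂m + ENNReal.ofReal η * m E ∧
      (InjOn (sweep v) E →
        ∫⁻ p in E, J p.1 ∂m ≤ volume (sweep v '' E) + ENNReal.ofReal η * m E) := by
  have : IsFiniteMeasure ((Measure.euclideanHausdorffMeasure (d - 1)).restrict M) :=
    ⟨by simpa using hN.measure_lt_top hM⟩
  -- the slices
  have hslice : ∀ E : Set (Vec d × ℝ), MeasurableSet E → E ⊆ M ×ˢ univ →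
      m E = ∫⁻ t : ℝ, Measure.euclideanHausdorffMeasure (d - 1) {y | (y, t) ∈ E} := by
    intro E hE hEM
    rw [hm, Measure.prod_apply_symm hE]
    refine lintegral_congr fun t => ?_
    rw [Measure.restrict_apply (measurable_prodMk_right hE)]
    congr 1
    exact inter_eq_left.2 fun y hy => (hEM hy).1
  -- local neighbourhoods
  have hloc : ∀ y ∈ M, ∃ O : Set (Vec d), IsOpen O ∧ y ∈ O ∧ ∀ E : Set (Vec d × ℝ),
      MeasurableSet E → E ⊆ M ×ˢ univ → E ⊆ O ×ˢ univ →
      volume (sweep v '' E) ≤ ∫⁻ p in E, J p.1 ∂m + ENNReal.ofReal η * m E ∧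
      ∫⁻ p in E, J p.1 ∂m ≤ volume (sweep v '' E) + ENNReal.ofReal η * m E := by
    intro y hy
    obtain ⟨hn, hfl⟩ := hN y hy
    obtain ⟨ε, hε, hflat⟩ := exists_flatness hn v (half_pos hη)
    obtain ⟨O, hO, hyO, hS⟩ := hfl ε hε
    have hc : ContinuousWithinAt (fun z => |inner ℝ (N z) v|) M y :=
      ((hNc y hy).inner continuousWithinAt_const).abs
    have hc' : ∀ᶠ z in 𝓝[M] y, dist (|inner ℝ (N z) v|) (|inner ℝ (N y) v|) < η / 2 :=
      Metric.tendsto_nhds.1 hc (η / 2) (half_pos hη)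
    obtain ⟨O', hO', hyO', hOO'⟩ := mem_nhdsWithin.1 hc'
    refine ⟨O ∩ O', hO.inter hO', ⟨hyO, hyO'⟩, fun E hE hEM hEO => ?_⟩
    obtain ⟨hup, hlow⟩ := hflat (M ∩ O) hS E hE fun p hp => ⟨⟨(hEM hp).1, (hEO hp).1.1⟩, trivial⟩
    rw [← hslice E hE hEM] at hup hlow
    have hnear : ∀ p ∈ E, dist (|inner ℝ (N p.1) v|) (|inner ℝ (N y) v|) < η / 2 := fun p hp =>
      hOO' ⟨(hEO hp).1.2, (hEM hp).1⟩
    constructor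
    · refine hup.trans ?_
      rw [← setLIntegral_const, ← setLIntegral_const, ← lintegral_add_right _ measurable_const]
      refine setLIntegral_mono' hE fun p hp => ?_
      rw [hJ, ← ENNReal.ofReal_add (abs_nonneg _) hη.le]
      apply ENNReal.ofReal_le_ofReal
      linarith [(abs_lt.1 (Real.dist_eq _ _ ▸ hnear p hp)).1]
    · refine le_trans ?_ (add_le_add_left hlow _)
      rw [← setLIntegral_const, ← setLIntegral_const, ← lintegral_add_right _ measurable_const]
      refine setLIntegral_mono' hE fun p hp => ?_
      rw [hJ]
      refine le_trans (ENNReal.ofReal_le_ofReal ?_) ENNReal.ofReal_add_le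
      linarith [(abs_lt.1 (Real.dist_eq _ _ ▸ hnear p hp)).2]
  choose! O hO hyO hOE using hloc
  obtain ⟨s, hs⟩ := hM.elim_nhds_subcover' (fun y _ => O y)
    (fun y hy => (hO y hy).mem_nhds (hyO y hy))
  -- induction over the cover
  have key : ∀ s : Finset M, ∀ E : Set (Vec d × ℝ), MeasurableSet E → E ⊆ M ×ˢ univ →
      E ⊆ (⋃ y ∈ s, O y) ×ˢ univ →
      volume (sweep v '' E) ≤ ∫⁻ p in E, J p.1 ∂m + ENNReal.ofReal η * m E ∧
      (InjOn (sweep v) E →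
        ∫⁻ p in E, J p.1 ∂m ≤ volume (sweep v '' E) + ENNReal.ofReal η * m E) := by
    classical
    intro s
    induction s using Finset.induction_on with
    | empty =>
      intro E hE hEM hEs
      have : E = ∅ := by
        refine eq_empty_of_forall_notMem fun p hp => ?_
        simpa using (hEs hp).1
      simp [this]
    | insert y s hys ih =>
      intro E hE hEM hEs
      set A : Set (Vec d × ℝ) := O y ×ˢ univ with hA
      have hAm : MeasurableSet A := (hO y y.2).measurableSet.prod MeasurableSet.univ
      obtain ⟨h1, h1'⟩ := hOE y y.2 (E ∩ A) (hE.inter hAm) (inter_subset_left.trans hEM)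
        inter_subset_right
      obtain ⟨h2, h2'⟩ := ih (E \ A) (hE.diff hAm) (sdiff_subset.trans hEM) (fun p hp => by
        have := (hEs hp.1).1
        simp only [Finset.mem_insert, iUnion_iUnion_eq_or_left, mem_union] at this
        exact ⟨this.resolve_left fun h => hp.2 ⟨h, trivial⟩, trivial⟩)
      have hsplit : sweep v '' E = sweep v '' (E ∩ A) ∪ sweep v '' (E \ A) := by
        rw [← image_union, inter_union_sdiff]
      have hint : ∫⁻ p in E, J p.1 ∂m = ∫⁻ p in E ∩ A, J p.1 ∂m + ∫⁻ p in E \ A, J p.1 ∂m :=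
        (lintegral_inter_add_sdiff _ _ hAm).symm
      have hmE : m E = m (E ∩ A) + m (E \ A) := (measure_inter_add_sdiff _ hAm).symm
      rw [hint, hmE, hsplit, mul_add, add_add_add_comm]
      constructor
      · exact (measure_union_le _ _).trans (add_le_add h1 h2)
      · intro hinj
        -- The upper bound needs only subadditivity. The lower bound needs disjoint images of the
        -- two parts, which is where injectivity of the sweep enters.
        have hd : Disjoint (sweep v '' (E ∩ A)) (sweep v '' (E \ A)) :=
          disjoint_image_image fun p hp q hq h => hq.2 (hinj hp.1 hq.1 h ▸ hp.2)
        rw [measure_union hd ((hE.diff hAm).image_of_continuousOn_injOn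
          (continuous_sweep v).continuousOn (hinj.mono sdiff_subset)), add_add_add_comm]
        exact add_le_add h1' (h2' (hinj.mono sdiff_subset))
  exact key s E hE hEM fun p hp => ⟨by simpa using hs (hEM hp).1, trivial⟩

/-- Let η → 0 in `sweep_bounds`. The error η m(E) disappears because m(E) is finite, which is why
the sweep times are confined to [-T,T]. -/
theorem IsNormalField.volume_sweep_le {M : Set (Vec d)} {N : Vec d → Vec d}
    (hN : IsNormalField M N) (hM : IsCompact M) (hNc : ContinuousOn N M)
    (v : Vec d) {T : ℝ} {E : Set (Vec d × ℝ)} (hE : MeasurableSet E)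
    (hEM : E ⊆ M ×ˢ Icc (-T) T) :
    volume (sweep v '' E) ≤ ∫⁻ p in E, ENNReal.ofReal |inner ℝ (N p.1) v|
        ∂(((Measure.euclideanHausdorffMeasure (d - 1)).restrict M).prod volume) ∧
      (InjOn (sweep v) E →
        ∫⁻ p in E, ENNReal.ofReal |inner ℝ (N p.1) v|
          ∂(((Measure.euclideanHausdorffMeasure (d - 1)).restrict M).prod volume)
          ≤ volume (sweep v '' E)) := by
  have : IsFiniteMeasure ((Measure.euclideanHausdorffMeasure (d - 1)).restrict M) :=
    ⟨by simpa using hN.measure_lt_top hM⟩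
  set m := ((Measure.euclideanHausdorffMeasure (d - 1)).restrict M).prod (volume : Measure ℝ)
    with hm
  have hfin : m E ≠ ⊤ := by
    refine ((measure_mono hEM).trans_lt ?_).ne
    rw [hm, Measure.prod_prod]
    exact ENNReal.mul_lt_top (MeasureTheory.measure_lt_top _ _) (by simp)
  have hlim : ∀ a : ℝ≥0∞, Tendsto (fun η : ℝ => a + ENNReal.ofReal η * m E) (𝓝[>] 0) (𝓝 a) := by
    intro a
    have h1 : Tendsto (fun η : ℝ => ENNReal.ofReal η * m E) (𝓝[>] 0) (𝓝 (ENNReal.ofReal 0 * m E)) :=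
      ENNReal.Tendsto.mul_const ((ENNReal.continuous_ofReal.tendsto 0).mono_left nhdsWithin_le_nhds)
        (Or.inr hfin)
    simpa using h1.const_add a
  have hb := fun (η : ℝ) (hη : 0 < η) => hN.sweep_bounds hM hNc v hη hE
    (hEM.trans (prod_mono_right (subset_univ _))) _ rfl m rfl
  refine ⟨ge_of_tendsto (hlim _) ?_, fun hinj => ge_of_tendsto (hlim _) ?_⟩
  · filter_upwards [self_mem_nhdsWithin] with η hη using (hb η hη).1
  · filter_upwards [self_mem_nhdsWithin] with η hη using (hb η hη).2 hinj

/-- Along the normal at v the defining function changes sign, and so it does along nearby parallel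
lines. The intermediate value theorem puts a point of V on each such line, so flattening (V ∩ O) × ℝ
covers a neighbourhood of v. Flattening does not increase measure, hence V is not null. -/
theorem IsClosedC1Hypersurface.measure_pos {V : Set (Vec d)} (hV : IsClosedC1Hypersurface V) :
    0 < Measure.euclideanHausdorffMeasure (d - 1) V := by
  obtain ⟨v, hv⟩ := hV.1
  obtain ⟨U, ρ, hU, hvU, hρ, hg, hVU⟩ := hV.2.2 v hv
  have hpos : 0 < ‖gradient ρ v‖ := norm_pos_iff.2 hg
  set n := ‖gradient ρ v‖⁻¹ • gradient ρ v with hndef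
  have hn : ‖n‖ = 1 := by rw [norm_smul, norm_inv, norm_norm, inv_mul_cancel₀ hpos.ne']
  have hgn : gradient ρ v = ‖gradient ρ v‖ • n := by
    rw [smul_smul, mul_inv_cancel₀ hpos.ne', one_smul]
  obtain ⟨O, hO, hvO, hOU, hfl⟩ := exists_isFlat hU hvU hρ hgn hpos (ε := 1 / 2) (by norm_num)
  have hVO : V ∩ O ⊆ {z | ρ z = 0} ∩ O := fun z hz => by
    have : z ∈ V ∩ U := ⟨hz.1, hOU hz.2⟩
    rw [hVU] at this
    exact ⟨this.2, hz.2⟩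
  have hdiff : DifferentiableAt ℝ ρ v :=
    (hρ.contDiffAt (hU.mem_nhds hvU)).differentiableAt one_ne_zero
  have hρv : ρ v = 0 := (hVO ⟨hv, hvO⟩).1
  have h1 : ∀ᶠ s : ℝ in 𝓝[>] 0, ρ (v + s • -n) < 0 := by
    suffices h : ∀ᶠ s : ℝ in 𝓝[>] 0, ρ (v + s • -n) < ρ v by rwa [hρv] at h
    refine eventually_lt_of_fderiv_neg hdiff ?_
    rw [fderiv_apply_eq_inner_gradient, hgn, inner_neg_right, inner_smul_left,
      real_inner_self_eq_norm_sq, hn]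
    simpa using hpos
  have h2 : ∀ᶠ s : ℝ in 𝓝[>] 0, 0 < ρ (v + s • n) := by
    have : ∀ᶠ s : ℝ in 𝓝[>] 0, -ρ (v + s • n) < -ρ v := by
      refine eventually_lt_of_fderiv_neg (ρ := fun y => -ρ y) hdiff.neg ?_
      rw [fderiv_fun_neg, neg_apply, fderiv_apply_eq_inner_gradient, hgn, inner_smul_left,
        real_inner_self_eq_norm_sq, hn]
      simpa using hpos
    filter_upwards [this] with s hs
    rw [hρv] at hs; linarith
  obtain ⟨r, hr, hrO⟩ := Metric.isOpen_iff.1 hO v hvO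
  have h3 : ∀ᶠ s : ℝ in 𝓝[>] 0, s < r / 2 :=
    mem_nhdsWithin_of_mem_nhds (Iio_mem_nhds (by positivity))
  obtain ⟨s, ⟨⟨hs1, hs2⟩, hs3⟩, hs0⟩ :=
    (((h1.and h2).and h3).and self_mem_nhdsWithin).exists
  have hs0' : (0 : ℝ) < s := hs0
  -- every point near `v` is the flattening of a point of `V`
  have hline : ∀ᶠ z in 𝓝 v, ρ (z + (inner ℝ n v - inner ℝ n z) • n + s • -n) < 0 ∧
      0 < ρ (z + (inner ℝ n v - inner ℝ n z) • n + s • n) ∧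
      z + (inner ℝ n v - inner ℝ n z) • n ∈ Metric.ball v (r / 2) := by
    have hc : Continuous fun z : Vec d => z + (inner ℝ n v - inner ℝ n z) • n := by fun_prop
    have hmem : ∀ e : Vec d, ‖e‖ = 1 → v + s • e ∈ U := fun e he => hOU (hrO (by
      rw [Metric.mem_ball, dist_eq_norm, add_sub_cancel_left, norm_smul, he, mul_one,
        Real.norm_of_nonneg hs0'.le]
      linarith))
    have hc1 : ∀ e : Vec d, ‖e‖ = 1 → Tendsto
        (fun z : Vec d => ρ (z + (inner ℝ n v - inner ℝ n z) • n + s • e)) (𝓝 v)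
        (𝓝 (ρ (v + s • e))) := fun e he => by
      have h5 : Tendsto (fun z : Vec d => z + (inner ℝ n v - inner ℝ n z) • n + s • e) (𝓝 v)
          (𝓝 (v + s • e)) := by
        have := (hc.add (continuous_const (y := s • e))).tendsto v
        simpa [Pi.add_def] using this
      exact Tendsto.comp (hρ.contDiffAt (hU.mem_nhds (hmem e he))).continuousAt h5
    have hc2 : Tendsto (fun z : Vec d => z + (inner ℝ n v - inner ℝ n z) • n) (𝓝 v) (𝓝 v) := by
      simpa using hc.tendsto v
    exact ((hc1 (-n) (by simpa using hn)).eventually (gt_mem_nhds hs1)).and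
      (((hc1 n hn).eventually (lt_mem_nhds hs2)).and
        (hc2.eventually (Metric.ball_mem_nhds v (by positivity))))
  have hsub : ∀ᶠ z in 𝓝 v, z ∈ flatten n '' ((V ∩ O) ×ˢ univ) := by
    filter_upwards [hline] with z hz
    set z' := z + (inner ℝ n v - inner ℝ n z) • n with hz'
    have hball : ∀ a ∈ Icc (-s) s, z' + a • n ∈ O := fun a ha => hrO (by
      have h6 := hz.2.2
      rw [Metric.mem_ball, dist_eq_norm] at h6 ⊢
      have : z' + a • n - v = (z' - v) + a • n := by abel
      rw [this]
      refine (norm_add_le _ _).trans_lt ?_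
      rw [norm_smul, hn, mul_one, Real.norm_eq_abs]
      have := abs_le.2 ha
      linarith)
    have hcont : ContinuousOn (fun a : ℝ => ρ (z' + a • n)) (Icc (-s) s) :=
      hρ.continuousOn.comp (by fun_prop) fun a ha => hOU (hball a ha)
    have hivt := intermediate_value_Icc (by linarith) hcont
    have h0 : (0 : ℝ) ∈ Icc (ρ (z' + (-s) • n)) (ρ (z' + s • n)) := by
      refine ⟨?_, hz.2.1.le⟩
      have := hz.1
      rw [smul_neg, ← neg_smul] at this
      exact this.le
    obtain ⟨a, ha, ha0⟩ := hivt h0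
    refine ⟨(z' + a • n, inner ℝ n z), ⟨⟨?_, hball a ha⟩, trivial⟩, ?_⟩
    · have : z' + a • n ∈ {w ∈ U | ρ w = 0} := ⟨hOU (hball a ha), ha0⟩
      rw [← hVU] at this
      exact this.1
    · simp only [flatten, hz', inner_add_right, inner_smul_right, real_inner_self_eq_norm_sq, hn]
      module
  have hvol : 0 < volume (flatten n '' ((V ∩ O) ×ˢ univ)) := Measure.measure_pos_of_mem_nhds _ hsub
  have hle := volume_flatten_le (K := 2) hn (hfl.mono hVO) (by norm_num)
    ((hV.2.1.isClosed.measurableSet.inter hO.measurableSet).prod MeasurableSet.univ) subset_rfl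
  have hint := hvol.trans_le hle
  rw [pos_iff_ne_zero] at hint ⊢
  intro h0
  apply hint
  rw [lintegral_eq_zero_of_ae_eq_zero]
  filter_upwards with t
  exact measure_mono_null (fun z hz => hz.1.1) h0

end

section

variable {d : ℕ} {X V : Set (Vec d)} {ν : Measure (Vec d)}

/-! ### Travel times -/

theorem tauMinus_eq_tauPlus (X : Set (Vec d)) (x v : Vec d) :
    tauMinus X (x, v) = tauPlus X (x, -v) := by
  simp [tauMinus, tauPlus, sub_eq_add_neg]

theorem tauPlus_nonneg (X : Set (Vec d)) (p : Vec d × Vec d) : 0 ≤ tauPlus X p :=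
  Real.sInf_nonneg fun _ hs => hs.1.le

theorem tauMinus_nonneg (X : Set (Vec d)) (p : Vec d × Vec d) : 0 ≤ tauMinus X p :=
  Real.sInf_nonneg fun _ hs => hs.1.le

theorem tau_nonneg (X : Set (Vec d)) (p : Vec d × Vec d) : 0 ≤ tau X p :=
  add_nonneg (tauMinus_nonneg X p) (tauPlus_nonneg X p)

theorem add_smul_mem_of_lt_tauPlus {p : Vec d × Vec d} {s : ℝ} (h0 : 0 < s)
    (hs : s < tauPlus X p) : p.1 + s • p.2 ∈ X := by
  by_contra h
  exact notMem_of_lt_csInf hs ⟨0, fun _ ht => ht.1.le⟩ ⟨h0, h⟩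

theorem tauPlus_le_of_notMem {p : Vec d × Vec d} {s : ℝ} (h0 : 0 < s)
    (hs : p.1 + s • p.2 ∉ X) : tauPlus X p ≤ s :=
  csInf_le ⟨0, fun _ ht => ht.1.le⟩ ⟨h0, hs⟩

theorem tauPlus_eq_of {p : Vec d × Vec d} {a : ℝ} (ha : 0 < a)
    (h : ∀ s, 0 < s → s < a → p.1 + s • p.2 ∈ X) (h' : p.1 + a • p.2 ∉ X) :
    tauPlus X p = a := by
  refine le_antisymm (tauPlus_le_of_notMem ha h') (le_csInf ⟨a, ha, h'⟩ fun s hs => ?_)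
  by_contra! hsa
  exact hs.2 (h s hs.1 hsa)

theorem tauMinus_eq_of {p : Vec d × Vec d} {a : ℝ} (ha : 0 < a)
    (h : ∀ s, 0 < s → s < a → p.1 - s • p.2 ∈ X) (h' : p.1 - a • p.2 ∉ X) :
    tauMinus X p = a := by
  obtain ⟨x, v⟩ := p
  rw [tauMinus_eq_tauPlus]
  refine tauPlus_eq_of ha (fun s h0 h1 => ?_) ?_
  · simpa [sub_eq_add_neg] using h s h0 h1
  · simpa [sub_eq_add_neg] using h'

theorem sub_smul_mem_of_lt_tauMinus {p : Vec d × Vec d} {s : ℝ} (h0 : 0 < s)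
    (hs : s < tauMinus X p) : p.1 - s • p.2 ∈ X := by
  obtain ⟨x, v⟩ := p
  rw [tauMinus_eq_tauPlus] at hs
  simpa [sub_eq_add_neg] using add_smul_mem_of_lt_tauPlus h0 hs

theorem exists_notMem_of_isBounded (hX : Bornology.IsBounded X) {p : Vec d × Vec d}
    (hv : p.2 ≠ 0) : ∃ s : ℝ, 0 < s ∧ p.1 + s • p.2 ∉ X := by
  obtain ⟨r, hr⟩ := hX.subset_closedBall p.1
  have hv' : 0 < ‖p.2‖ := norm_pos_iff.2 hv
  refine ⟨(|r| + 1) / ‖p.2‖, by positivity, fun h => ?_⟩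
  have := hr h
  rw [Metric.mem_closedBall, dist_eq_norm, add_sub_cancel_left, norm_smul, Real.norm_of_nonneg
    (by positivity), div_mul_cancel₀ _ hv'.ne'] at this
  linarith [le_abs_self r]

theorem tauPlus_pos (hX : IsOpen X) (hb : Bornology.IsBounded X) {p : Vec d × Vec d}
    (hv : p.2 ≠ 0) (hp : p.1 ∈ X) : 0 < tauPlus X p := by
  have h1 : ∀ᶠ s : ℝ in 𝓝 0, p.1 + s • p.2 ∈ X := by
    have : Tendsto (fun s : ℝ => p.1 + s • p.2) (𝓝 0) (𝓝 (p.1 + (0 : ℝ) • p.2)) :=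
      Continuous.tendsto (by fun_prop) 0
    rw [zero_smul, add_zero] at this
    exact this.eventually (hX.mem_nhds hp)
  obtain ⟨r, hr, hrX⟩ := Metric.eventually_nhds_iff.1 h1
  obtain ⟨s₀, hs₀⟩ := exists_notMem_of_isBounded hb hv
  refine hr.trans_le (le_csInf ⟨s₀, hs₀⟩ fun s hs => ?_)
  by_contra! h
  exact hs.2 (hrX (by rwa [Real.dist_eq, sub_zero, abs_of_pos hs.1]))

/-- If the exit point were in X, openness would let the line stay in X for a positive extra time,
against the infimum. Boundedness makes the set of exit times nonempty. -/
theorem add_tauPlus_smul_notMem (hX : IsOpen X) (hb : Bornology.IsBounded X) {p : Vec d × Vec d}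
    (hv : p.2 ≠ 0) : p.1 + tauPlus X p • p.2 ∉ X := by
  intro hmem
  set T := tauPlus X p with hT
  have h1 := tauPlus_pos hX hb (p := (p.1 + T • p.2, p.2)) hv hmem
  obtain ⟨s₀, hs₀⟩ := exists_notMem_of_isBounded hb hv (p := p)
  have h2 : T + tauPlus X (p.1 + T • p.2, p.2) ≤ T := by
    conv_rhs => rw [hT]
    refine le_csInf ⟨s₀, hs₀⟩ fun s hs => ?_
    by_contra! hlt
    rcases lt_trichotomy s T with h3 | h3 | h3
    · exact hs.2 (add_smul_mem_of_lt_tauPlus hs.1 h3)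
    · exact hs.2 (h3 ▸ hmem)
    · have := add_smul_mem_of_lt_tauPlus (X := X) (p := (p.1 + T • p.2, p.2)) (s := s - T)
        (by linarith) (by linarith)
      apply hs.2
      simpa [add_assoc, ← add_smul] using this
  linarith

theorem tauPlus_le (hb : Bornology.IsBounded X) {p : Vec d × Vec d} (hv : p.2 ≠ 0) :
    tauPlus X p ≤ Metric.diam X / ‖p.2‖ := by
  have hv' : 0 < ‖p.2‖ := norm_pos_iff.2 hv
  rw [le_div_iff₀ hv']
  by_contra! h
  have h0 : 0 ≤ Metric.diam X := Metric.diam_nonneg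
  set D := Metric.diam X
  set T := tauPlus X p
  have hT : 0 < T := by
    by_contra! hT
    nlinarith
  -- two points of `X` at distance larger than the diameter
  set ε := (T * ‖p.2‖ - D) / (4 * ‖p.2‖) with hε
  have hε0 : 0 < ε := by have : 0 < T * ‖p.2‖ - D := by linarith
                         positivity
  have hεT : 4 * ε * ‖p.2‖ = T * ‖p.2‖ - D := by rw [hε]; field_simp
  have hε4 : 4 * ε ≤ T := by
    by_contra! h5
    nlinarith
  have h1 := add_smul_mem_of_lt_tauPlus (X := X) (p := p) hε0 (by linarith)
  have h2 := add_smul_mem_of_lt_tauPlus (X := X) (p := p) (s := T - ε) (by linarith)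
    (by linarith : T - ε < T)
  have h3 := Metric.dist_le_diam_of_mem hb h2 h1
  rw [dist_eq_norm, add_sub_add_left_eq_sub, ← sub_smul, norm_smul, Real.norm_of_nonneg
    (by linarith)] at h3
  nlinarith

theorem isOpen_setOf_segment_subset (hX : IsOpen X) (a b : ℝ) :
    IsOpen {p : Vec d × Vec d | ∀ s ∈ Icc a b, p.1 + s • p.2 ∈ X} := by
  rw [isOpen_iff_eventually]
  intro p hp
  refine isCompact_Icc.eventually_forall_of_forall_eventually fun s hs => ?_
  have hc : Continuous fun z : (Vec d × Vec d) × ℝ => z.1.1 + z.2 • z.1.2 := by fun_prop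
  exact (hc.tendsto (p, s)).eventually (hX.mem_nhds (hp s hs))

/-- Superlevel sets are countable combinations of open conditions on compact time intervals. The
complemented intersection removes lines that never leave X, for which the infimum of the empty set
takes the value 0. -/
theorem measurable_tauPlus (hX : IsOpen X) : Measurable (tauPlus X) := by
  have hm : ∀ a b : ℝ, MeasurableSet {p : Vec d × Vec d | ∀ s ∈ Icc a b, p.1 + s • p.2 ∈ X} :=
    fun a b => (isOpen_setOf_segment_subset hX a b).measurableSet
  refine measurable_of_Ici fun c => ?_
  rcases le_or_gt c 0 with hc | hc
  · convert MeasurableSet.univ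
    exact eq_univ_of_forall fun p => hc.trans (tauPlus_nonneg X p)
  have : tauPlus X ⁻¹' Ici c =
      (⋂ n : ℕ, {p : Vec d × Vec d | ∀ s ∈ Icc (1 / (n + 1) : ℝ) (n + 1), p.1 + s • p.2 ∈ X})ᶜ ∩
      ⋂ n : ℕ, {p : Vec d × Vec d | ∀ s ∈ Icc (1 / (n + 1) : ℝ) (c - 1 / (n + 1)),
        p.1 + s • p.2 ∈ X} := by
    ext p
    simp only [mem_preimage, mem_Ici, mem_inter_iff, mem_compl_iff, mem_iInter, mem_ofPred_eq]
    constructor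
    · intro h
      constructor
      · intro hall
        have hemp : {s : ℝ | 0 < s ∧ p.1 + s • p.2 ∉ X} = ∅ := by
          refine eq_empty_of_forall_notMem fun s hs => ?_
          obtain ⟨n, hn⟩ := exists_nat_ge (max s (1 / s))
          refine hs.2 (hall n s ⟨?_, ?_⟩)
          · rw [one_div_le (by positivity) hs.1]
            linarith [le_max_right s (1 / s)]
          · linarith [le_max_left s (1 / s)]
        rw [tauPlus, hemp, Real.sInf_empty] at h
        linarith
      · intro n s hs
        have h1 : (0 : ℝ) < 1 / (n + 1) := by positivity
        exact add_smul_mem_of_lt_tauPlus (by linarith [hs.1]) (by linarith [hs.2])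
    · rintro ⟨h1, h2⟩
      push Not at h1
      obtain ⟨n, s, hs, hsX⟩ := h1
      have h3 : (0 : ℝ) < 1 / (n + 1) := by positivity
      refine le_csInf ⟨s, by linarith [hs.1], hsX⟩ fun t ht => ?_
      by_contra! htc
      obtain ⟨m, hm⟩ := exists_nat_ge (max (1 / t) (1 / (c - t)))
      refine ht.2 (h2 m t ⟨?_, ?_⟩)
      · rw [one_div_le (by positivity) ht.1]
        linarith [le_max_left (1 / t) (1 / (c - t))]
      · have : 1 / ((m : ℝ) + 1) ≤ c - t := by
          rw [one_div_le (by positivity) (by linarith)]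
          linarith [le_max_right (1 / t) (1 / (c - t))]
        linarith
  rw [this]
  exact (MeasurableSet.iInter fun n => hm _ _).compl.inter (MeasurableSet.iInter fun n => hm _ _)

theorem measurable_tauMinus (hX : IsOpen X) : Measurable (tauMinus X) := by
  have : tauMinus X = fun p => tauPlus X (p.1, -p.2) := by
    ext ⟨x, v⟩
    exact tauMinus_eq_tauPlus X x v
  rw [this]
  exact (measurable_tauPlus hX).comp (by fun_prop)

theorem measurable_tau (hX : IsOpen X) : Measurable (tau X) :=
  (measurable_tauMinus hX).add (measurable_tauPlus hX)

theorem tauMinus_pos (hX : IsOpen X) (hb : Bornology.IsBounded X) {p : Vec d × Vec d}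
    (hv : p.2 ≠ 0) (hp : p.1 ∈ X) : 0 < tauMinus X p := by
  obtain ⟨x, v⟩ := p
  rw [tauMinus_eq_tauPlus]
  exact tauPlus_pos hX hb (neg_ne_zero.2 hv) hp

theorem sub_tauMinus_smul_notMem (hX : IsOpen X) (hb : Bornology.IsBounded X) {p : Vec d × Vec d}
    (hv : p.2 ≠ 0) : p.1 - tauMinus X p • p.2 ∉ X := by
  obtain ⟨x, v⟩ := p
  rw [tauMinus_eq_tauPlus]
  simpa [sub_eq_add_neg] using add_tauPlus_smul_notMem hX hb (p := (x, -v)) (neg_ne_zero.2 hv)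

theorem tauMinus_le (hb : Bornology.IsBounded X) {p : Vec d × Vec d} (hv : p.2 ≠ 0) :
    tauMinus X p ≤ Metric.diam X / ‖p.2‖ := by
  obtain ⟨x, v⟩ := p
  rw [tauMinus_eq_tauPlus]
  simpa using tauPlus_le hb (p := (x, -v)) (neg_ne_zero.2 hv)

theorem sub_tauMinus_smul_mem_frontier (hX : IsOpen X) (hb : Bornology.IsBounded X)
    {p : Vec d × Vec d} (hv : p.2 ≠ 0) (hp : p.1 ∈ X) :
    p.1 - tauMinus X p • p.2 ∈ frontier X := by
  have h0 := tauMinus_pos hX hb hv hp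
  rw [hX.frontier_eq]
  refine ⟨?_, sub_tauMinus_smul_notMem hX hb hv⟩
  have hc : Tendsto (fun s : ℝ => p.1 - s • p.2) (𝓝[<] (tauMinus X p))
      (𝓝 (p.1 - tauMinus X p • p.2)) :=
    (Continuous.tendsto (by fun_prop) _).mono_left nhdsWithin_le_nhds
  refine mem_closure_of_tendsto hc ?_
  filter_upwards [self_mem_nhdsWithin, mem_nhdsWithin_of_mem_nhds (lt_mem_nhds h0)] with s hs hs0
  exact sub_smul_mem_of_lt_tauMinus hs0 hs

/-- For an interior point, the travel times after moving along the characteristic. -/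
theorem tauPlus_add_smul (hX : IsOpen X) (hb : Bornology.IsBounded X) {x v : Vec d} (hv : v ≠ 0)
    {t : ℝ} (ht : t < tauPlus X (x, v)) (ht' : -tauMinus X (x, v) ≤ t) (hx : x ∈ X) :
    tauPlus X (x + t • v, v) = tauPlus X (x, v) - t := by
  refine tauPlus_eq_of (by linarith) (fun s hs hst => ?_) ?_
  · rcases lt_trichotomy (t + s) 0 with h | h | h
    · have := sub_smul_mem_of_lt_tauMinus (X := X) (p := (x, v)) (s := -(t + s)) (by linarith)
        (by linarith)
      simpa [add_smul, add_assoc, sub_eq_add_neg] using this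
    · simpa [add_assoc, ← add_smul, h] using hx
    · have := add_smul_mem_of_lt_tauPlus (X := X) (p := (x, v)) h (by linarith)
      simpa [add_smul, add_assoc] using this
  · have := add_tauPlus_smul_notMem hX hb (p := (x, v)) hv
    simpa [add_assoc, ← add_smul] using this

theorem tauMinus_add_smul (hX : IsOpen X) (hb : Bornology.IsBounded X) {x v : Vec d} (hv : v ≠ 0)
    {t : ℝ} (ht : t ≤ tauPlus X (x, v)) (ht' : -tauMinus X (x, v) < t) (hx : x ∈ X) :
    tauMinus X (x + t • v, v) = tauMinus X (x, v) + t := by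
  have h := tauPlus_add_smul hX hb (x := x) (v := -v) (t := -t) (neg_ne_zero.2 hv)
    (by rw [← tauMinus_eq_tauPlus]; linarith)
    (by rw [tauMinus_eq_tauPlus, neg_neg]; linarith) hx
  rw [tauMinus_eq_tauPlus, tauMinus_eq_tauPlus]
  simpa using h

/-- The travel times of the points on a characteristic that enters `X` at `y`. -/
theorem tauMinus_add_smul_of_notMem {y v : Vec d} (hy : y ∉ X) {t : ℝ} (h0 : 0 < t)
    (ht : t < tauPlus X (y, v)) : tauMinus X (y + t • v, v) = t := by
  refine tauMinus_eq_of h0 (fun s hs hst => ?_) (by simpa using hy)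
  have := add_smul_mem_of_lt_tauPlus (X := X) (p := (y, v)) (s := t - s) (by linarith) (by linarith)
  simpa [sub_smul, add_sub_assoc] using this

theorem tauPlus_sub_smul_of_notMem {y v : Vec d} (hy : y ∉ X) {t : ℝ} (h0 : 0 < t)
    (ht : t < tauMinus X (y, v)) : tauPlus X (y - t • v, v) = t := by
  have h := tauMinus_add_smul_of_notMem (v := -v) hy h0 (by rwa [← tauMinus_eq_tauPlus])
  rw [tauMinus_eq_tauPlus] at h
  simpa [sub_eq_add_neg] using h

end

section

variable {d : ℕ} {X V : Set (Vec d)} {ν : Measure (Vec d)}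

/-! ### Admissible domains and velocity spaces -/

/-- The properties of the domain and of the velocity space on which the analysis rests. -/
structure Admissible (X V : Set (Vec d)) (ν : Measure (Vec d)) : Prop where
  isC1 : IsC1Domain X
  finite : IsFiniteMeasure ν
  ne_zero : ν ≠ 0
  measurableSet : MeasurableSet V
  ae_mem : ∀ᵐ v ∂ν, v ∈ V
  neg_mem : ∀ v ∈ V, -v ∈ V
  map_neg : MeasurePreserving (fun v : Vec d => -v) ν ν
  lower : ∃ c : ℝ, 0 < c ∧ ∀ v ∈ V, c ≤ ‖v‖
  upper : ∃ R : ℝ, 0 < R ∧ ∀ v ∈ V, ‖v‖ ≤ R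
  hyperplane : ∀ e : Vec d, e ≠ 0 → ν {v | inner ℝ e v = 0} = 0

theorem measurePreserving_neg_restrict {μ : Measure (Vec d)}
    (h : MeasurePreserving (fun v : Vec d => -v) μ μ) (hV : MeasurableSet V)
    (hs : ∀ v ∈ V, -v ∈ V) :
    MeasurePreserving (fun v : Vec d => -v) (μ.restrict V) (μ.restrict V) := by
  have h1 := h.restrict_preimage hV
  have h2 : (fun v : Vec d => -v) ⁻¹' V = V := by
    ext v
    exact ⟨fun hv => by simpa using hs _ hv, fun hv => hs v hv⟩
  rwa [h2] at h1

theorem exists_pos_le_norm {W : Set (Vec d)} (h0 : (0 : Vec d) ∉ closure W) :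
    ∃ c : ℝ, 0 < c ∧ ∀ v ∈ W, c ≤ ‖v‖ := by
  obtain ⟨c, hc, hcW⟩ := Metric.isOpen_iff.1 isClosed_closure.isOpen_compl 0 h0
  refine ⟨c, hc, fun v hv => ?_⟩
  by_contra! h
  exact hcW (by simpa using h : v ∈ Metric.ball 0 c) (subset_closure hv)

theorem exists_norm_le {W : Set (Vec d)} (hb : Bornology.IsBounded W) :
    ∃ R : ℝ, 0 < R ∧ ∀ v ∈ W, ‖v‖ ≤ R :=
  let ⟨R, hR, h⟩ := hb.exists_pos_norm_le
  ⟨R, hR, h⟩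

/-- The rest of the argument sees the two kinds of velocity space only through these properties. For
Lebesgue measure the nullity of hyperplanes is automatic; for hypersurfaces it is assumed. -/
theorem admissible_of_isVelocitySpace (hX : IsC1Domain X) (hV : IsVelocitySpace V ν)
    (hs : ∀ v ∈ V, -v ∈ V) : Admissible X V ν := by
  rcases hV with ⟨hVo, hVn, hVb, hV0, rfl⟩ | ⟨hVc, hV0, rfl, hnull⟩
  · have hfin : volume V < ⊤ := hVb.measure_lt_top
    refine ⟨hX, ⟨by simpa using hfin⟩, ?_, hVo.measurableSet, ae_restrict_mem hVo.measurableSet, hs,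
      measurePreserving_neg_restrict (Measure.measurePreserving_neg volume) hVo.measurableSet hs,
      exists_pos_le_norm hV0, exists_norm_le hVb, fun e he => ?_⟩
    · rw [Ne, Measure.restrict_eq_zero]
      exact (hVo.measure_pos volume hVn).ne'
    · refine Measure.restrict_apply_eq_zero'  hVo.measurableSet |>.2
        (measure_mono_null inter_subset_left ?_)
      have h1 : {v : Vec d | inner ℝ e v = 0} = ((ℝ ∙ e)ᗮ : Submodule ℝ (Vec d)) := by
        ext v
        rw [SetLike.mem_coe, Submodule.mem_orthogonal_singleton_iff_inner_right]; rfl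
      rw [h1]
      refine Measure.addHaar_submodule volume _ fun htop => he ?_
      have : e ∈ ((ℝ ∙ e)ᗮ : Submodule ℝ (Vec d)) := htop ▸ Submodule.mem_top
      rw [Submodule.mem_orthogonal_singleton_iff_inner_right] at this
      exact inner_self_eq_zero.1 this
  · obtain ⟨N, hN⟩ := hVc.exists_isNormalField
    have hm := hVc.2.1.isClosed.measurableSet
    refine ⟨hX, ⟨by simpa using hN.measure_lt_top hVc.2.1⟩, ?_, hm, ae_restrict_mem hm, hs,
      measurePreserving_neg_restrict ?_ hm hs,
      exists_pos_le_norm (by rwa [hVc.2.1.isClosed.closure_eq]),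
      exists_norm_le hVc.2.1.isBounded, hnull⟩
    · rw [Ne, Measure.restrict_eq_zero]
      exact hVc.measure_pos.ne'
    · exact (IsometryEquiv.neg (Vec d)).measurePreserving_euclideanHausdorffMeasure (d - 1)

namespace Admissible

theorem isOpen (h : Admissible X V ν) : IsOpen X := h.isC1.1

theorem isBounded (h : Admissible X V ν) : Bornology.IsBounded X := h.isC1.2.2.1

theorem velocity_ne_zero (h : Admissible X V ν) {v : Vec d} (hv : v ∈ V) : v ≠ 0 := by
  obtain ⟨c, hc, hcV⟩ := h.lower
  exact norm_pos_iff.1 (hc.trans_le (hcV v hv))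

theorem exists_tau_le (h : Admissible X V ν) : ∃ D : ℝ, 0 < D ∧ ∀ p : Vec d × Vec d, p.2 ∈ V →
    tauPlus X p ≤ D ∧ tauMinus X p ≤ D := by
  obtain ⟨c, hc, hcV⟩ := h.lower
  refine ⟨Metric.diam X / c + 1, by positivity [Metric.diam_nonneg (s := X)], fun p hp => ?_⟩
  have hv := h.velocity_ne_zero hp
  have : Metric.diam X / ‖p.2‖ ≤ Metric.diam X / c + 1 := by
    have := div_le_div_of_nonneg_left (Metric.diam_nonneg (s := X)) hc (hcV _ hp)
    linarith
  exact ⟨(tauPlus_le h.isBounded hv).trans this, (tauMinus_le h.isBounded hv).trans this⟩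

theorem isCompact_frontier (h : Admissible X V ν) : IsCompact (frontier X) :=
  Metric.isCompact_of_isClosed_isBounded isClosed_frontier
    (h.isBounded.closure.subset frontier_subset_closure)

theorem isFiniteMeasure_boundary (h : Admissible X V ν) :
    IsFiniteMeasure ((Measure.euclideanHausdorffMeasure (d - 1)).restrict (frontier X)) :=
  ⟨by simpa using (isNormalField_frontier h.isC1).measure_lt_top h.isCompact_frontier⟩

theorem notMem_of_mem_frontier (h : Admissible X V ν) {y : Vec d} (hy : y ∈ frontier X) :
    y ∉ X := by
  rw [h.isOpen.frontier_eq] at hy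
  exact hy.2

theorem measurable_inner_outerNormal (h : Admissible X V ν) :
    Measurable fun p : Vec d × Vec d => inner ℝ p.2 (outerNormal X p.1) :=
  measurable_snd.inner ((measurable_outerNormal h.isC1).comp measurable_fst)

theorem measurableSet_gammaMinus (h : Admissible X V ν) : MeasurableSet (gammaMinus X V) := by
  have h1 : MeasurableSet {p : Vec d × Vec d | inner ℝ p.2 (outerNormal X p.1) < 0} :=
    measurableSet_lt h.measurable_inner_outerNormal measurable_const
  exact (isClosed_frontier.measurableSet.preimage measurable_fst).inter
    ((h.measurableSet.preimage measurable_snd).inter h1)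

theorem measurableSet_gammaPlus (h : Admissible X V ν) : MeasurableSet (gammaPlus X V) := by
  have h1 : MeasurableSet {p : Vec d × Vec d | 0 < inner ℝ p.2 (outerNormal X p.1)} :=
    measurableSet_lt measurable_const h.measurable_inner_outerNormal
  exact (isClosed_frontier.measurableSet.preimage measurable_fst).inter
    ((h.measurableSet.preimage measurable_snd).inter h1)

theorem measurable_xi_density (h : Admissible X V ν) :
    Measurable fun p : Vec d × Vec d => ENNReal.ofReal |inner ℝ p.2 (outerNormal X p.1)| :=
  (continuous_abs.measurable.comp h.measurable_inner_outerNormal).ennreal_ofReal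

/-- Near an outgoing boundary point the characteristic lies in `X`. -/
theorem tauMinus_pos_of_mem_gammaPlus (h : Admissible X V ν) {p : Vec d × Vec d}
    (hp : p ∈ gammaPlus X V) : 0 < tauMinus X p := by
  have h1 := (isOuterNormal_outerNormal h.isC1 hp.1).eventually_mem h.isOpen (v := -p.2)
    (by rw [inner_neg_left]; linarith [hp.2.2])
  obtain ⟨r, hr, hrX⟩ := mem_nhdsGT_iff_exists_Ioo_subset.1 h1
  obtain ⟨x, v⟩ := p
  rw [tauMinus_eq_tauPlus]
  obtain ⟨s₀, hs₀⟩ := exists_notMem_of_isBounded h.isBounded (p := (x, -v))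
    (neg_ne_zero.2 (h.velocity_ne_zero hp.2.1))
  refine (show (0 : ℝ) < r from hr).trans_le (le_csInf ⟨s₀, hs₀⟩ fun s hs => ?_)
  by_contra! hlt
  exact hs.2 (hrX ⟨hs.1, hlt⟩)

theorem tauPlus_pos_of_mem_gammaMinus (h : Admissible X V ν) {p : Vec d × Vec d}
    (hp : p ∈ gammaMinus X V) : 0 < tauPlus X p := by
  have := h.tauMinus_pos_of_mem_gammaPlus (p := (p.1, -p.2))
    ⟨hp.1, h.neg_mem _ hp.2.1, by rw [inner_neg_left]; linarith [hp.2.2]⟩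
  rwa [tauMinus_eq_tauPlus, neg_neg] at this

/-! ### Disintegration of the Lebesgue measure along characteristics -/

/-- The set of points of `∂X × ℝ` that parametrizes `X` along the direction `v`. -/
def chordSet (X : Set (Vec d)) (v : Vec d) : Set (Vec d × ℝ) :=
  {p | p.1 ∈ frontier X ∧ inner ℝ v (outerNormal X p.1) < 0 ∧ 0 < p.2 ∧ p.2 < tauPlus X (p.1, v)}

theorem measurableSet_chordSet (h : Admissible X V ν) (v : Vec d) :
    MeasurableSet (chordSet X v) := by
  have h1 : MeasurableSet {p : Vec d × ℝ | inner ℝ v (outerNormal X p.1) < 0} :=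
    measurableSet_lt (measurable_const.inner ((measurable_outerNormal h.isC1).comp measurable_fst))
      measurable_const
  have h2 : MeasurableSet {p : Vec d × ℝ | p.2 < tauPlus X (p.1, v)} :=
    measurableSet_lt measurable_snd ((measurable_tauPlus h.isOpen).comp
      (measurable_fst.prodMk measurable_const))
  have h3 : MeasurableSet {p : Vec d × ℝ | 0 < p.2} :=
    measurableSet_lt measurable_const measurable_snd
  exact (isClosed_frontier.measurableSet.preimage measurable_fst).inter (h1.inter (h3.inter h2))

/-- The time is recovered from the swept point as its backward travel time, and then so is the entry
point. -/
theorem injOn_sweep_chordSet (h : Admissible X V ν) (v : Vec d) :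
    InjOn (sweep v) (chordSet X v) := by
  rintro ⟨y, t⟩ ⟨hy, -, ht0, ht⟩ ⟨y', t'⟩ ⟨hy', -, ht0', ht'⟩ heq
  have h1 := tauMinus_add_smul_of_notMem (h.notMem_of_mem_frontier hy) ht0 ht
  have h2 := tauMinus_add_smul_of_notMem (h.notMem_of_mem_frontier hy') ht0' ht'
  have heq' : y + t • v = y' + t' • v := heq
  have htt : t = t' := by
    simp only at h1 h2
    rw [← h1, ← h2, heq']
  subst htt
  simpa using heq'

theorem chordSet_subset (h : Admissible X V ν) {v : Vec d} (hv : v ≠ 0) :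
    chordSet X v ⊆ frontier X ×ˢ Icc (-(Metric.diam X / ‖v‖)) (Metric.diam X / ‖v‖) := by
  rintro ⟨y, t⟩ ⟨hy, -, ht0, ht⟩
  have := tauPlus_le h.isBounded (p := (y, v)) hv
  have h0 : 0 ≤ Metric.diam X / ‖v‖ := by positivity [Metric.diam_nonneg (s := X)]
  simp only at ht0 ht this
  exact ⟨hy, by simp only; linarith, by simp only; linarith⟩

/-- The points of `X` whose backward exit is tangential form a null set. -/
theorem volume_diff_sweep_chordSet (h : Admissible X V ν) {v : Vec d} (hv : v ≠ 0) :
    volume (X \ sweep v '' chordSet X v) = 0 := by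
  set T := Metric.diam X / ‖v‖
  set E : Set (Vec d × ℝ) := {y | y ∈ frontier X ∧ inner ℝ v (outerNormal X y) = 0} ×ˢ Icc (-T) T
    with hE
  have hEm : MeasurableSet E :=
    (isClosed_frontier.measurableSet.inter (measurableSet_eq_fun
      (measurable_const.inner (measurable_outerNormal h.isC1)) measurable_const)).prod
      measurableSet_Icc
  -- E collects the tangential boundary points. The density |⟨n,v⟩| vanishes on it, so the upper
  -- sweep bound makes its image null; no information on the size of the tangential set is needed.
  have h1 := ((isNormalField_frontier h.isC1).volume_sweep_le h.isCompact_frontier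
    (continuousOn_outerNormal h.isC1) v (T := T) hEm (prod_mono_left fun y hy => hy.1)).1
  have h2 : ∫⁻ p in E, ENNReal.ofReal |inner ℝ (outerNormal X p.1) v|
      ∂(((Measure.euclideanHausdorffMeasure (d - 1)).restrict (frontier X)).prod volume) = 0 := by
    rw [setLIntegral_congr_fun hEm (g := fun _ => 0), lintegral_zero]
    intro p hp
    simp only
    rw [real_inner_comm, hp.1.2, abs_zero, ENNReal.ofReal_zero]
  rw [h2] at h1
  refine measure_mono_null ?_ (le_antisymm h1 bot_le)
  rintro x ⟨hx, hxn⟩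
  have hfr := sub_tauMinus_smul_mem_frontier h.isOpen h.isBounded (p := (x, v)) hv hx
  have hpos := tauMinus_pos h.isOpen h.isBounded (p := (x, v)) hv hx
  have hposp := tauPlus_pos h.isOpen h.isBounded (p := (x, v)) hv hx
  have hle := tauMinus_le h.isBounded (p := (x, v)) hv
  set t := tauMinus X (x, v) with ht
  simp only at hfr hpos hposp hle
  have hadd : x - t • v + t • v = x := sub_add_cancel _ _
  refine ⟨(x - t • v, t), ⟨⟨hfr, ?_⟩, ?_, hle⟩, hadd⟩
  · refine le_antisymm ?_ ?_
    · -- the characteristic lies in `X` after the entry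
      by_contra! hcon
      have h3 := (isOuterNormal_outerNormal h.isC1 hfr).eventually_notMem h.isOpen hcon
      have h4 : ∀ᶠ s : ℝ in 𝓝[>] 0, s < t := mem_nhdsWithin_of_mem_nhds (Iio_mem_nhds hpos)
      obtain ⟨s, ⟨hs1, hs2⟩, hs3⟩ := ((h3.and h4).and self_mem_nhdsWithin).exists
      have hs3' : 0 < s := hs3
      apply hs1
      have := sub_smul_mem_of_lt_tauMinus (X := X) (p := (x, v)) (s := t - s) (by linarith)
        (by rw [← ht]; linarith)
      simpa [sub_smul, sub_add] using this
    -- A strictly incoming entry point would place x in the swept chord set.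
    · by_contra! hcon
      refine hxn ⟨(x - t • v, t), ⟨hfr, hcon, hpos, ?_⟩, hadd⟩
      have hmem : ∀ s, 0 < s → s < t + tauPlus X (x, v) → (x - t • v) + s • v ∈ X := by
        intro s hs hst
        rcases lt_trichotomy s t with h5 | h5 | h5
        · have := sub_smul_mem_of_lt_tauMinus (X := X) (p := (x, v)) (s := t - s) (by linarith)
            (by rw [← ht]; linarith)
          simpa [sub_smul, sub_add] using this
        · rw [h5, hadd]; exact hx
        · have := add_smul_mem_of_lt_tauPlus (X := X) (p := (x, v)) (s := s - t) (by linarith)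
            (by linarith)
          simpa [sub_smul, sub_add_eq_add_sub, add_sub_assoc] using this
      obtain ⟨s₀, hs₀⟩ := exists_notMem_of_isBounded h.isBounded (p := (x - t • v, v)) hv
      refine lt_of_lt_of_le (by linarith : t < t + tauPlus X (x, v)) (le_csInf ⟨s₀, hs₀⟩ ?_)
      intro s hs
      by_contra! hlt
      exact hs.2 (hmem s hs.1 hlt)
  · simp only; linarith

theorem sweep_chordSet_subset (v : Vec d) : sweep v '' chordSet X v ⊆ X := by
  rintro _ ⟨p, ⟨-, -, h0, ht⟩, rfl⟩
  exact add_smul_mem_of_lt_tauPlus (p := (p.1, v)) h0 ht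

/-- Lebesgue measure on `X` in the coordinates (entry point, time). -/
theorem setLIntegral_eq_chordSet (h : Admissible X V ν) {v : Vec d} (hv : v ≠ 0)
    {F : Vec d → ℝ≥0∞} (hF : Measurable F) :
    ∫⁻ x in X, F x = ∫⁻ p in chordSet X v,
      ENNReal.ofReal |inner ℝ v (outerNormal X p.1)| * F (p.1 + p.2 • v)
        ∂(((Measure.euclideanHausdorffMeasure (d - 1)).restrict (frontier X)).prod volume) := by
  set m := ((Measure.euclideanHausdorffMeasure (d - 1)).restrict (frontier X)).prod
    (volume : Measure ℝ) with hm
  set J : Vec d × ℝ → ℝ≥0∞ := fun p => ENNReal.ofReal |inner ℝ v (outerNormal X p.1)| with hJ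
  have hJm : Measurable J := (continuous_abs.measurable.comp (measurable_const.inner
    ((measurable_outerNormal h.isC1).comp measurable_fst))).ennreal_ofReal
  have hW := h.measurableSet_chordSet v
  have hsw : Measurable (sweep v) := (continuous_sweep v).measurable
  have hmeas : volume.restrict X = ((m.restrict (chordSet X v)).withDensity J).map (sweep v) := by
    ext B hB
    rw [Measure.map_apply hsw hB, withDensity_apply _ (hsw hB), Measure.restrict_restrict (hsw hB),
      Measure.restrict_apply hB]
    set E := sweep v ⁻¹' B ∩ chordSet X v with hE
    have hEm : MeasurableSet E := (hsw hB).inter hW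
    have hb := (isNormalField_frontier h.isC1).volume_sweep_le h.isCompact_frontier
      (continuousOn_outerNormal h.isC1) v hEm (inter_subset_right.trans (h.chordSet_subset hv))
    have hinj : InjOn (sweep v) E := (h.injOn_sweep_chordSet v).mono inter_subset_right
    have hJ' : (fun p : Vec d × ℝ => ENNReal.ofReal |inner ℝ (outerNormal X p.1) v|) = J := by
      ext p; rw [hJ, real_inner_comm]
    rw [hJ'] at hb
    rw [← le_antisymm hb.1 (hb.2 hinj)]
    have himg : sweep v '' E = B ∩ sweep v '' chordSet X v := by
      rw [hE, image_preimage_inter]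
    rw [himg]
    refine le_antisymm ?_ (measure_mono (inter_subset_inter_right _ (sweep_chordSet_subset v)))
    have : B ∩ X ⊆ (B ∩ sweep v '' chordSet X v) ∪ (X \ sweep v '' chordSet X v) := by
      intro x hx
      by_cases hxs : x ∈ sweep v '' chordSet X v
      · exact Or.inl ⟨hx.1, hxs⟩
      · exact Or.inr ⟨hx.2, hxs⟩
    refine (measure_mono this).trans ((measure_union_le _ _).trans ?_)
    rw [h.volume_diff_sweep_chordSet hv, add_zero]
  rw [hmeas, lintegral_map hF hsw, lintegral_withDensity_eq_lintegral_mul _ hJm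
    (g := fun p => F (sweep v p)) (hF.comp hsw)]
  rfl

/-- Disintegration of `dx dv` along characteristics, from the incoming boundary. -/
theorem lintegral_phase_eq_minus (h : Admissible X V ν) {F : Vec d × Vec d → ℝ≥0∞}
    (hF : Measurable F) :
    ∫⁻ p, F p ∂phaseMeasure X ν = ∫⁻ p in gammaMinus X V,
      (∫⁻ t in Ioo 0 (tauPlus X p), F (p.1 + t • p.2, p.2)) ∂xi X ν := by
  have := h.finite
  have := h.isFiniteMeasure_boundary
  set μ := (Measure.euclideanHausdorffMeasure (d - 1)).restrict (frontier X) with hμ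
  set J : Vec d × Vec d → ℝ≥0∞ := fun p => ENNReal.ofReal |inner ℝ p.2 (outerNormal X p.1)| with hJ
  have hJm : Measurable J := h.measurable_xi_density
  set I : (Vec d × Vec d) × ℝ → ℝ≥0∞ := fun z =>
    {z : (Vec d × Vec d) × ℝ | 0 < z.2 ∧ z.2 < tauPlus X z.1}.indicator
      (fun z => F (z.1.1 + z.2 • z.1.2, z.1.2)) z with hI
  have hIm : Measurable I := by
    refine Measurable.indicator (hF.comp (by fun_prop)) ?_
    exact (measurableSet_lt measurable_const measurable_snd).inter
      (measurableSet_lt measurable_snd ((measurable_tauPlus h.isOpen).comp measurable_fst))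
  have hinner : ∀ p : Vec d × Vec d, ∫⁻ t in Ioo 0 (tauPlus X p), F (p.1 + t • p.2, p.2)
      = ∫⁻ t, I (p, t) := fun p => by
    rw [← lintegral_indicator measurableSet_Ioo]
    rfl
  have hGm : Measurable fun p => ∫⁻ t, I (p, t) := hIm.lintegral_prod_right'
  simp_rw [hinner]
  rw [xi, restrict_withDensity h.measurableSet_gammaMinus,
    lintegral_withDensity_eq_lintegral_mul _ hJm hGm,
    ← lintegral_indicator h.measurableSet_gammaMinus,
    lintegral_prod_symm _ ((hJm.mul hGm).indicator h.measurableSet_gammaMinus).aemeasurable,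
    phaseMeasure, lintegral_prod_symm _ hF.aemeasurable]
  refine lintegral_congr_ae ?_
  filter_upwards [h.ae_mem] with v hv
  rw [h.setLIntegral_eq_chordSet (h.velocity_ne_zero hv) (F := fun x => F (x, v))
    (hF.comp (by fun_prop)),
    ← lintegral_indicator (h.measurableSet_chordSet v)]
  have hm1 : Measurable fun p : Vec d × ℝ => (chordSet X v).indicator (fun p : Vec d × ℝ =>
      ENNReal.ofReal |inner ℝ v (outerNormal X p.1)| * F (p.1 + p.2 • v, v)) p := by
    refine Measurable.indicator ?_ (h.measurableSet_chordSet v)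
    exact (hJm.comp (measurable_fst.prodMk measurable_const)).mul (hF.comp (by fun_prop))
  rw [lintegral_prod _ hm1.aemeasurable]
  refine lintegral_congr_ae ?_
  filter_upwards [ae_restrict_mem isClosed_frontier.measurableSet] with y hy
  by_cases hyv : inner ℝ v (outerNormal X y) < 0
  · have hmem : (y, v) ∈ gammaMinus X V := ⟨hy, hv, hyv⟩
    rw [indicator_of_mem hmem]
    simp only [Pi.mul_apply]
    rw [← lintegral_const_mul _ (f := fun t => I ((y, v), t)) (hIm.comp measurable_prodMk_left)]
    refine lintegral_congr fun t => ?_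
    by_cases ht : 0 < t ∧ t < tauPlus X (y, v)
    · rw [indicator_of_mem (show (y, t) ∈ chordSet X v from ⟨hy, hyv, ht⟩), hI]
      simp only [mem_ofPred_eq, ht, and_self, indicator_of_mem, hJ]
    · rw [indicator_of_notMem (show (y, t) ∉ chordSet X v from fun hc => ht hc.2.2), hI]
      simp only [mem_ofPred_eq, ht, not_false_eq_true, indicator_of_notMem, mul_zero]
  · have hmem : (y, v) ∉ gammaMinus X V := fun hc => hyv hc.2.2
    rw [indicator_of_notMem hmem, lintegral_eq_zero_of_ae_eq_zero]
    filter_upwards with t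
    exact indicator_of_notMem (fun hc => hyv hc.2.1) _

end Admissible

/-! ### Reflection of the velocity -/

/-- `(x,v) ↦ (x,-v)`. -/
def reflect (p : Vec d × Vec d) : Vec d × Vec d := (p.1, -p.2)

theorem measurable_reflect : Measurable (reflect (d := d)) := by
  unfold reflect; fun_prop

theorem reflect_reflect (p : Vec d × Vec d) : reflect (reflect p) = p := by
  simp [reflect]

namespace Admissible

theorem measurePreserving_reflect_phase (h : Admissible X V ν) :
    MeasurePreserving reflect (phaseMeasure X ν) (phaseMeasure X ν) := by
  have := h.finite
  exact (MeasurePreserving.id (volume.restrict X)).prod h.map_neg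

theorem measurePreserving_reflect_xi (h : Admissible X V ν) :
    MeasurePreserving reflect (xi X ν) (xi X ν) := by
  have := h.finite
  have := h.isFiniteMeasure_boundary
  set μ := (Measure.euclideanHausdorffMeasure (d - 1)).restrict (frontier X)
  have h1 : MeasurePreserving (reflect (d := d)) (μ.prod ν) (μ.prod ν) :=
    (MeasurePreserving.id μ).prod h.map_neg
  refine ⟨measurable_reflect, ?_⟩
  ext B hB
  rw [Measure.map_apply measurable_reflect hB, xi, withDensity_apply _ (measurable_reflect hB),
    withDensity_apply _ hB, ← h1.setLIntegral_comp_preimage hB h.measurable_xi_density]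
  simp only [reflect, inner_neg_left, abs_neg, μ]

theorem reflect_preimage_gammaPlus (h : Admissible X V ν) :
    reflect ⁻¹' gammaPlus X V = gammaMinus X V := by
  ext p
  simp only [mem_preimage, gammaPlus, gammaMinus, reflect, mem_ofPred_eq, inner_neg_left,
    Left.neg_pos_iff]
  exact ⟨fun hp => ⟨hp.1, by simpa using h.neg_mem _ hp.2.1, hp.2.2⟩,
    fun hp => ⟨hp.1, h.neg_mem _ hp.2.1, hp.2.2⟩⟩

theorem measurePreserving_reflect_gamma (h : Admissible X V ν) :
    MeasurePreserving reflect ((xi X ν).restrict (gammaMinus X V))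
      ((xi X ν).restrict (gammaPlus X V)) := by
  have := h.measurePreserving_reflect_xi.restrict_preimage h.measurableSet_gammaPlus
  rwa [h.reflect_preimage_gammaPlus] at this

/-- Disintegration of `dx dv` along characteristics, from the outgoing boundary. -/
theorem lintegral_phase_eq_plus (h : Admissible X V ν) {F : Vec d × Vec d → ℝ≥0∞}
    (hF : Measurable F) :
    ∫⁻ p, F p ∂phaseMeasure X ν = ∫⁻ p in gammaPlus X V,
      (∫⁻ t in Ioo 0 (tauMinus X p), F (p.1 - t • p.2, p.2)) ∂xi X ν := by
  have hIm : Measurable fun p : Vec d × Vec d =>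
      ∫⁻ t in Ioo 0 (tauMinus X p), F (p.1 - t • p.2, p.2) := by
    have h1 : Measurable fun z : (Vec d × Vec d) × ℝ =>
        {z : (Vec d × Vec d) × ℝ | 0 < z.2 ∧ z.2 < tauMinus X z.1}.indicator
          (fun z => F (z.1.1 - z.2 • z.1.2, z.1.2)) z := by
      refine Measurable.indicator (hF.comp (by fun_prop)) ?_
      exact (measurableSet_lt measurable_const measurable_snd).inter
        (measurableSet_lt measurable_snd ((measurable_tauMinus h.isOpen).comp measurable_fst))
    convert h1.lintegral_prod_right' (ν := volume) using 2 with p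
    rw [← lintegral_indicator measurableSet_Ioo]
    rfl
  rw [← h.measurePreserving_reflect_phase.lintegral_comp hF,
    h.lintegral_phase_eq_minus (F := fun p => F (reflect p)) (hF.comp measurable_reflect),
    ← h.measurePreserving_reflect_gamma.lintegral_comp hIm]
  refine lintegral_congr fun p => ?_
  simp only [reflect, tauMinus_eq_tauPlus, neg_neg, smul_neg, sub_neg_eq_add]

end Admissible

end

section

variable {d : ℕ} {X V : Set (Vec d)} {ν : Measure (Vec d)}

/-! ### Integration along characteristics -/

/-- The measure `dm dt` on `{(p,t) : 0 < t < τ(p)}`. -/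
def chordMeasure (m : Measure (Vec d × Vec d)) (τ : Vec d × Vec d → ℝ) :
    Measure ((Vec d × Vec d) × ℝ) :=
  (m.prod volume).restrict {z | 0 < z.2 ∧ z.2 < τ z.1}

section chordMeasure

variable {m : Measure (Vec d × Vec d)} {τ : Vec d × Vec d → ℝ}

theorem measurableSet_chord (hτ : Measurable τ) :
    MeasurableSet {z : (Vec d × Vec d) × ℝ | 0 < z.2 ∧ z.2 < τ z.1} :=
  (measurableSet_lt measurable_const measurable_snd).inter
    (measurableSet_lt measurable_snd (hτ.comp measurable_fst))

theorem lintegral_chordMeasure (hτ : Measurable τ) {F : (Vec d × Vec d) × ℝ → ℝ≥0∞}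
    (hF : AEMeasurable F (chordMeasure m τ)) :
    ∫⁻ z, F z ∂chordMeasure m τ = ∫⁻ p, (∫⁻ t in Ioo 0 (τ p), F (p, t)) ∂m := by
  rw [chordMeasure, ← lintegral_indicator (measurableSet_chord hτ), lintegral_prod _
    ((aemeasurable_indicator_iff (measurableSet_chord hτ)).2 hF)]
  refine lintegral_congr fun p => ?_
  rw [← lintegral_indicator measurableSet_Ioo]
  rfl

theorem ae_chord (hτ : Measurable τ) {q : (Vec d × Vec d) × ℝ → Prop}
    (hq : ∀ᵐ z ∂chordMeasure m τ, q z) :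
    ∀ᵐ p ∂m, ∀ᵐ t ∂volume.restrict (Ioo 0 (τ p)), q (p, t) := by
  rw [chordMeasure, ae_restrict_iff' (measurableSet_chord hτ)] at hq
  filter_upwards [Measure.ae_ae_of_ae_prod hq] with p hp
  rw [ae_restrict_iff' measurableSet_Ioo]
  exact hp

theorem intervalIntegral_eq_Ioo {f : ℝ → ℝ} {a : ℝ} (ha : 0 ≤ a) :
    ∫ t in (0 : ℝ)..a, f t = ∫ t in Ioo 0 a, f t := by
  rw [intervalIntegral.integral_of_le ha, integral_Ioc_eq_integral_Ioo]

theorem aestronglyMeasurable_chord_integral (hτ : Measurable τ) (hτ0 : ∀ p, 0 ≤ τ p)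
    {G : Vec d × Vec d → ℝ → ℝ}
    (hG : AEStronglyMeasurable (fun z : (Vec d × Vec d) × ℝ => G z.1 z.2) (chordMeasure m τ)) :
    AEStronglyMeasurable (fun p => ∫ t in (0 : ℝ)..τ p, G p t) m := by
  have h1 := ((aestronglyMeasurable_indicator_iff (measurableSet_chord hτ)).2 hG).integral_prod_right'
  refine h1.congr (ae_of_all _ fun p => ?_)
  simp only
  rw [intervalIntegral_eq_Ioo (hτ0 p), ← integral_indicator measurableSet_Ioo]
  rfl

theorem integral_chordMeasure [SFinite m] (hτ : Measurable τ) (hτ0 : ∀ p, 0 ≤ τ p)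
    {G : (Vec d × Vec d) × ℝ → ℝ} (hG : Integrable G (chordMeasure m τ)) :
    ∫ z, G z ∂chordMeasure m τ = ∫ p, (∫ t in (0 : ℝ)..τ p, G (p, t)) ∂m := by
  rw [chordMeasure, ← integral_indicator (measurableSet_chord hτ),
    integral_prod _ ((integrable_indicator_iff (measurableSet_chord hτ)).2 hG)]
  refine integral_congr_ae (ae_of_all _ fun p => ?_)
  simp only
  rw [intervalIntegral_eq_Ioo (hτ0 p), ← integral_indicator measurableSet_Ioo]
  rfl

theorem ae_intervalIntegrable_chord [SFinite m] (hτ : Measurable τ) (hτ0 : ∀ p, 0 ≤ τ p)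
    {G : (Vec d × Vec d) × ℝ → ℝ} (hG : Integrable G (chordMeasure m τ)) :
    ∀ᵐ p ∂m, IntervalIntegrable (fun t => G (p, t)) volume 0 (τ p) := by
  have h1 := ((integrable_indicator_iff (measurableSet_chord hτ)).2 hG).prod_right_ae
  filter_upwards [h1] with p hp
  rw [intervalIntegrable_iff_integrableOn_Ioo_of_le (hτ0 p),
    ← integrable_indicator_iff measurableSet_Ioo]
  exact hp

end chordMeasure

namespace Admissible

theorem sFinite_phase (h : Admissible X V ν) : SFinite (phaseMeasure X ν) := by
  have := h.finite
  unfold phaseMeasure; infer_instance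

theorem isFiniteMeasure_phase (h : Admissible X V ν) : IsFiniteMeasure (phaseMeasure X ν) := by
  have := h.finite
  have : IsFiniteMeasure (volume.restrict X) := ⟨by simpa using h.isBounded.measure_lt_top⟩
  unfold phaseMeasure; infer_instance

theorem sFinite_xi_restrict (h : Admissible X V ν) (G : Set (Vec d × Vec d)) :
    SFinite ((xi X ν).restrict G) := by
  have := h.finite
  have := h.isFiniteMeasure_boundary
  unfold xi; infer_instance

theorem ae_phase (h : Admissible X V ν) : ∀ᵐ p ∂phaseMeasure X ν, p.1 ∈ X ∧ p.2 ∈ V := by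
  have := h.finite
  refine Measure.ae_prod_mem_iff_ae_ae_mem (s := X ×ˢ V)
    (h.isOpen.measurableSet.prod h.measurableSet) |>.2 ?_
  filter_upwards [ae_restrict_mem h.isOpen.measurableSet] with x hx
  filter_upwards [h.ae_mem] with v hv
  exact ⟨hx, hv⟩

/-- The disintegration in the form of a measure preserving map, so that null sets, measurability and
integrability pass between phase space and characteristics. -/
theorem measurePreserving_gammaMinus (h : Admissible X V ν) :
    MeasurePreserving (fun z : (Vec d × Vec d) × ℝ => (z.1.1 + z.2 • z.1.2, z.1.2))
      (chordMeasure ((xi X ν).restrict (gammaMinus X V)) (tauPlus X)) (phaseMeasure X ν) := by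
  have := h.sFinite_xi_restrict (gammaMinus X V)
  have hm : Measurable fun z : (Vec d × Vec d) × ℝ => (z.1.1 + z.2 • z.1.2, z.1.2) := by fun_prop
  refine ⟨hm, ?_⟩
  ext B hB
  rw [← lintegral_indicator_one hB, lintegral_map (measurable_one.indicator hB) hm,
    ← lintegral_indicator_one hB, h.lintegral_phase_eq_minus (measurable_one.indicator hB),
    lintegral_chordMeasure (F := fun z => B.indicator 1 (z.1.1 + z.2 • z.1.2, z.1.2))
      (measurable_tauPlus h.isOpen) ((measurable_one.indicator hB).comp hm).aemeasurable]

theorem measurePreserving_gammaPlus (h : Admissible X V ν) :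
    MeasurePreserving (fun z : (Vec d × Vec d) × ℝ => (z.1.1 - z.2 • z.1.2, z.1.2))
      (chordMeasure ((xi X ν).restrict (gammaPlus X V)) (tauMinus X)) (phaseMeasure X ν) := by
  have := h.sFinite_xi_restrict (gammaPlus X V)
  have hm : Measurable fun z : (Vec d × Vec d) × ℝ => (z.1.1 - z.2 • z.1.2, z.1.2) := by fun_prop
  refine ⟨hm, ?_⟩
  ext B hB
  rw [← lintegral_indicator_one hB, lintegral_map (measurable_one.indicator hB) hm,
    ← lintegral_indicator_one hB, h.lintegral_phase_eq_plus (measurable_one.indicator hB),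
    lintegral_chordMeasure (F := fun z => B.indicator 1 (z.1.1 - z.2 • z.1.2, z.1.2))
      (measurable_tauMinus h.isOpen) ((measurable_one.indicator hB).comp hm).aemeasurable]

/-- Membership in the two parametrizations of the set of pairs of points on a characteristic. -/
theorem mem_chord_iff (h : Admissible X V ν) {x v : Vec d} (hv : v ∈ V) {t : ℝ} :
    (x ∈ X ∧ 0 < t ∧ t < tauMinus X (x, v)) ↔
      (x - t • v ∈ X ∧ 0 < t ∧ t < tauPlus X (x - t • v, v)) := by
  have hv0 := h.velocity_ne_zero hv
  constructor
  · rintro ⟨hx, h0, ht⟩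
    have h1 := tauPlus_add_smul h.isOpen h.isBounded (x := x) (v := v) (t := -t) hv0
      (by linarith [tauPlus_nonneg X (x, v)]) (by linarith) hx
    have h2 := tauPlus_pos h.isOpen h.isBounded (p := (x, v)) hv0 hx
    rw [neg_smul, ← sub_eq_add_neg] at h1
    exact ⟨sub_smul_mem_of_lt_tauMinus (p := (x, v)) h0 ht, h0, by rw [h1]; linarith⟩
  · rintro ⟨hx, h0, ht⟩
    have h1 := tauMinus_add_smul h.isOpen h.isBounded (x := x - t • v) (v := v) (t := t) hv0
      ht.le (by linarith [tauMinus_nonneg X (x - t • v, v)]) hx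
    have h2 := tauMinus_pos h.isOpen h.isBounded (p := (x - t • v, v)) hv0 hx
    have h3 := add_smul_mem_of_lt_tauPlus (p := (x - t • v, v)) h0 ht
    simp only [sub_add_cancel] at h1 h3
    exact ⟨h3, h0, by rw [h1]; linarith⟩

/-- With t and v fixed this is a translation of Lebesgue measure in x, and `mem_chord_iff` matches
the two domains. It exchanges the roles of the two points on a chord, and carries both the L² bound
and the adjoint formula for the transport solution operator. -/
theorem measurePreserving_back (h : Admissible X V ν) :
    MeasurePreserving (fun z : (Vec d × Vec d) × ℝ => ((z.1.1 - z.2 • z.1.2, z.1.2), z.2))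
      (chordMeasure (phaseMeasure X ν) (tauMinus X))
      (chordMeasure (phaseMeasure X ν) (tauPlus X)) := by
  have := h.finite
  have := h.sFinite_phase
  have hm : Measurable fun z : (Vec d × Vec d) × ℝ => ((z.1.1 - z.2 • z.1.2, z.1.2), z.2) := by
    fun_prop
  have htm := measurable_tauMinus h.isOpen
  have htp := measurable_tauPlus h.isOpen
  have hrep : ∀ {τ : Vec d × Vec d → ℝ}, Measurable τ → ∀ {F : (Vec d × Vec d) × ℝ → ℝ≥0∞},
      Measurable F → ∫⁻ z, F z ∂chordMeasure (phaseMeasure X ν) τ =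
        ∫⁻ t, ∫⁻ v, ∫⁻ x, {y : (Vec d × Vec d) × ℝ | y.1.1 ∈ X ∧ 0 < y.2 ∧ y.2 < τ y.1}.indicator F
          ((x, v), t) ∂volume ∂ν := by
    intro τ hτ F hF
    have hS := measurableSet_chord hτ
    have hFi := hF.indicator hS
    rw [chordMeasure, ← lintegral_indicator hS, lintegral_prod_symm _ hFi.aemeasurable]
    refine lintegral_congr fun t => ?_
    rw [phaseMeasure, lintegral_prod_symm
      (fun p => {z : (Vec d × Vec d) × ℝ | 0 < z.2 ∧ z.2 < τ z.1}.indicator F (p, t))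
      (hFi.comp measurable_prodMk_right).aemeasurable]
    refine lintegral_congr fun v => ?_
    rw [← lintegral_indicator h.isOpen.measurableSet]
    refine lintegral_congr fun x => ?_
    by_cases hx : x ∈ X
    · rw [indicator_of_mem hx]
      by_cases ht : 0 < t ∧ t < τ (x, v)
      · rw [indicator_of_mem (by exact ht), indicator_of_mem (by exact ⟨hx, ht⟩)]
      · rw [indicator_of_notMem (by exact ht), indicator_of_notMem (by exact fun hc => ht hc.2)]
    · rw [indicator_of_notMem hx, indicator_of_notMem (by exact fun hc => hx hc.1)]
  refine ⟨hm, ?_⟩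
  ext B hB
  have h1 : Measurable (B.indicator (1 : (Vec d × Vec d) × ℝ → ℝ≥0∞)) := measurable_one.indicator hB
  rw [← lintegral_indicator_one hB, lintegral_map h1 hm, ← lintegral_indicator_one hB, hrep htp h1,
    hrep htm (F := fun z => B.indicator 1 ((z.1.1 - z.2 • z.1.2, z.1.2), z.2)) (h1.comp hm)]
  refine lintegral_congr fun t => lintegral_congr_ae ?_
  filter_upwards [h.ae_mem] with v hv
  refine Eq.trans ?_ (lintegral_sub_right_eq_self _ (t • v))
  refine lintegral_congr fun x => ?_
  by_cases hx : x ∈ X ∧ 0 < t ∧ t < tauMinus X (x, v)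
  · refine (indicator_of_mem (by exact hx) _).trans (indicator_of_mem ?_ _).symm
    exact (h.mem_chord_iff hv).1 hx
  · refine (indicator_of_notMem (by exact hx) _).trans (indicator_of_notMem ?_ _).symm
    exact fun hc => hx ((h.mem_chord_iff hv).2 hc)

theorem measurePreserving_phase_back (h : Admissible X V ν) {q : Vec d × Vec d → Prop}
    (hq : ∀ᵐ p ∂phaseMeasure X ν, q p) :
    ∀ᵐ z ∂chordMeasure (phaseMeasure X ν) (tauMinus X), q (z.1.1 - z.2 • z.1.2, z.1.2) := by
  have := h.sFinite_phase
  have h1 : ∀ᵐ z ∂chordMeasure (phaseMeasure X ν) (tauPlus X), q z.1 := by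
    refine ae_restrict_of_ae ?_
    exact Measure.quasiMeasurePreserving_fst.ae hq
  exact h.measurePreserving_back.quasiMeasurePreserving.ae h1

/-- A property that holds almost everywhere holds almost everywhere on almost every backward
characteristic. -/
theorem ae_back (h : Admissible X V ν) {q : Vec d × Vec d → Prop}
    (hq : ∀ᵐ p ∂phaseMeasure X ν, q p) :
    ∀ᵐ p ∂phaseMeasure X ν, ∀ᵐ t ∂volume.restrict (Ioo 0 (tauMinus X p)),
      q (p.1 - t • p.2, p.2) := by
  have := h.sFinite_phase
  exact ae_chord (measurable_tauMinus h.isOpen) (h.measurePreserving_phase_back hq)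

theorem ae_gammaMinus (h : Admissible X V ν) {q : Vec d × Vec d → Prop}
    (hq : ∀ᵐ p ∂phaseMeasure X ν, q p) :
    ∀ᵐ p ∂(xi X ν).restrict (gammaMinus X V), ∀ᵐ t ∂volume.restrict (Ioo 0 (tauPlus X p)),
      q (p.1 + t • p.2, p.2) := by
  have := h.sFinite_xi_restrict (gammaMinus X V)
  exact ae_chord (measurable_tauPlus h.isOpen)
    (h.measurePreserving_gammaMinus.quasiMeasurePreserving.ae hq)

theorem ae_gammaPlus (h : Admissible X V ν) {q : Vec d × Vec d → Prop}
    (hq : ∀ᵐ p ∂phaseMeasure X ν, q p) :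
    ∀ᵐ p ∂(xi X ν).restrict (gammaPlus X V), ∀ᵐ t ∂volume.restrict (Ioo 0 (tauMinus X p)),
      q (p.1 - t • p.2, p.2) := by
  have := h.sFinite_xi_restrict (gammaPlus X V)
  exact ae_chord (measurable_tauMinus h.isOpen)
    (h.measurePreserving_gammaPlus.quasiMeasurePreserving.ae hq)

theorem ae_gammaPlus_mem (h : Admissible X V ν) :
    ∀ᵐ p ∂(xi X ν).restrict (gammaPlus X V), p ∈ gammaPlus X V :=
  ae_restrict_mem h.measurableSet_gammaPlus

theorem ae_gammaMinus_mem (h : Admissible X V ν) :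
    ∀ᵐ p ∂(xi X ν).restrict (gammaMinus X V), p ∈ gammaMinus X V :=
  ae_restrict_mem h.measurableSet_gammaMinus

/-- A property that holds almost everywhere on almost every characteristic from `Γ₋` holds almost
everywhere. -/
theorem ae_phase_of_gammaMinus (h : Admissible X V ν) {q : Vec d × Vec d → Prop}
    (hqm : MeasurableSet {p | q p})
    (hq : ∀ᵐ p ∂(xi X ν).restrict (gammaMinus X V),
      ∀ᵐ t ∂volume.restrict (Ioo 0 (tauPlus X p)), q (p.1 + t • p.2, p.2)) :
    ∀ᵐ p ∂phaseMeasure X ν, q p := by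
  have h1 : Measurable ({p | q p}ᶜ.indicator (1 : Vec d × Vec d → ℝ≥0∞)) :=
    measurable_one.indicator hqm.compl
  rw [ae_iff]
  change phaseMeasure X ν {p | q p}ᶜ = 0
  rw [← lintegral_indicator_one hqm.compl, h.lintegral_phase_eq_minus h1]
  refine lintegral_eq_zero_of_ae_eq_zero ?_
  filter_upwards [hq] with p hp
  refine lintegral_eq_zero_of_ae_eq_zero ?_
  filter_upwards [hp] with t ht
  exact indicator_of_notMem (not_not_intro ht) _

theorem entry_eq (h : Admissible X V ν) {p : Vec d × Vec d} (hp : p ∈ gammaMinus X V) {t : ℝ}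
    (h0 : 0 < t) (ht : t < tauPlus X p) :
    tauMinus X (p.1 + t • p.2, p.2) = t :=
  tauMinus_add_smul_of_notMem (h.notMem_of_mem_frontier hp.1) h0 ht

/-- Almost every point enters through a point of `Γ₋` outside of a given null set. -/
theorem ae_entry (h : Admissible X V ν) {q : Vec d × Vec d → Prop}
    (hq : ∀ᵐ p ∂(xi X ν).restrict (gammaMinus X V), q p) :
    ∀ᵐ p ∂phaseMeasure X ν, (p.1 - tauMinus X p • p.2, p.2) ∈ gammaMinus X V ∧
      q (p.1 - tauMinus X p • p.2, p.2) := by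
  obtain ⟨N, hN, hNm, hN0⟩ := exists_measurable_superset_of_null (ae_iff.1 hq)
  have hem : Measurable fun p : Vec d × Vec d => (p.1 - tauMinus X p • p.2, p.2) :=
    (measurable_fst.sub ((measurable_tauMinus h.isOpen).smul measurable_snd)).prodMk measurable_snd
  have h1 : ∀ᵐ p ∂phaseMeasure X ν, (p.1 - tauMinus X p • p.2, p.2) ∈ gammaMinus X V \ N := by
    refine h.ae_phase_of_gammaMinus (hem (h.measurableSet_gammaMinus.diff hNm)) ?_
    filter_upwards [h.ae_gammaMinus_mem, measure_eq_zero_iff_ae_notMem.1 hN0] with p hp hpN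
    filter_upwards [ae_restrict_mem measurableSet_Ioo] with t ht
    rw [h.entry_eq hp ht.1 ht.2, add_sub_cancel_right]
    exact ⟨hp, hpN⟩
  filter_upwards [h1] with p hp
  refine ⟨hp.1, ?_⟩
  by_contra hc
  exact hp.2 (hN hc)

end Admissible

end

section

/-! ### Operators on `L²` induced by operators on functions -/

section Induced

variable {α : Type*} [MeasurableSpace α] {m : Measure α}

theorem eLpNorm_two_sq (f : α → ℝ) : eLpNorm f 2 m ^ 2 = ∫⁻ x, ‖f x‖ₑ ^ 2 ∂m := by
  rw [eLpNorm_eq_lintegral_rpow_enorm_toReal (by norm_num) (by norm_num), ← ENNReal.rpow_natCast,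
    ← ENNReal.rpow_mul]
  simp

theorem lintegral_enorm_sq_lt_top {f : α → ℝ} (hf : MemLp f 2 m) : ∫⁻ x, ‖f x‖ₑ ^ 2 ∂m < ⊤ := by
  rw [← eLpNorm_two_sq]
  exact ENNReal.pow_lt_top hf.2

theorem memLp_two_of_lintegral {f : α → ℝ} (hf : AEStronglyMeasurable f m)
    (h : ∫⁻ x, ‖f x‖ₑ ^ 2 ∂m < ⊤) : MemLp f 2 m := by
  rw [← eLpNorm_two_sq] at h
  exact ⟨hf, (ENNReal.pow_lt_top_iff.1 h).resolve_right (by norm_num)⟩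

theorem eLpNorm_two_le_of_sq_le {f g : α → ℝ} {M : ℝ≥0∞}
    (h : ∫⁻ x, ‖f x‖ₑ ^ 2 ∂m ≤ M ^ 2 * ∫⁻ x, ‖g x‖ₑ ^ 2 ∂m) :
    eLpNorm f 2 m ≤ M * eLpNorm g 2 m := by
  rw [← eLpNorm_two_sq, ← eLpNorm_two_sq, ← mul_pow] at h
  exact (ENNReal.pow_le_pow_left_iff (by norm_num)).1 h

theorem sq_lintegral_mul_le {f g : α → ℝ≥0∞} (hf : AEMeasurable f m) (hg : AEMeasurable g m) :
    (∫⁻ x, f x * g x ∂m) ^ 2 ≤ (∫⁻ x, f x ^ 2 ∂m) * ∫⁻ x, g x ^ 2 ∂m := by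
  have h := ENNReal.lintegral_mul_le_Lp_mul_Lq m Real.HolderConjugate.two_two hf hg
  calc _ ≤ _ := pow_le_pow_left' h 2
    _ = _ := by
      rw [mul_pow, ← ENNReal.rpow_natCast, ← ENNReal.rpow_natCast, ← ENNReal.rpow_mul,
        ← ENNReal.rpow_mul]
      simp

theorem sq_lintegral_mul_le_weighted {a f : α → ℝ≥0∞} (ha : AEMeasurable a m)
    (hf : AEMeasurable f m) :
    (∫⁻ x, a x * f x ∂m) ^ 2 ≤ (∫⁻ x, a x ∂m) * ∫⁻ x, a x * f x ^ 2 ∂m := by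
  have h := sq_lintegral_mul_le (m := m) (f := fun x => a x ^ (1 / 2 : ℝ))
    (g := fun x => a x ^ (1 / 2 : ℝ) * f x) (ha.pow_const _) ((ha.pow_const _).mul hf)
  have h1 : ∀ x, (a x ^ (1 / 2 : ℝ)) * (a x ^ (1 / 2 : ℝ)) = a x := fun x => by
    rw [← ENNReal.rpow_add_of_nonneg _ _ (by norm_num) (by norm_num)]; norm_num
  have h2 : ∀ x, (a x ^ (1 / 2 : ℝ)) ^ 2 = a x := fun x => by rw [pow_two, h1]
  simpa only [← mul_assoc, h1, h2, mul_pow] using h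

/-- Transport and scattering are defined on functions pointwise. The conclusion allows any
representative g of f, so that formulas for compositions can be chained without choosing
representatives. -/
theorem exists_clm (A : (α → ℝ) → α → ℝ) (M : ℝ) (hM : 0 ≤ M)
    (hcongr : ∀ f g, f =ᵐ[m] g → A f =ᵐ[m] A g)
    (hadd : ∀ f g, MemLp f 2 m → MemLp g 2 m → A (f + g) =ᵐ[m] A f + A g)
    (hsmul : ∀ (c : ℝ) f, A (c • f) =ᵐ[m] c • A f)
    (hmeas : ∀ f, MemLp f 2 m → AEStronglyMeasurable (A f) m)
    (hbound : ∀ f, MemLp f 2 m →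
      ∫⁻ x, ‖A f x‖ₑ ^ 2 ∂m ≤ ENNReal.ofReal M ^ 2 * ∫⁻ x, ‖f x‖ₑ ^ 2 ∂m) :
    ∃ L : Lp ℝ 2 m →L[ℝ] Lp ℝ 2 m, ‖L‖ ≤ M ∧
      ∀ (f : Lp ℝ 2 m) (g : α → ℝ), f =ᵐ[m] g → L f =ᵐ[m] A g := by
  have hmem : ∀ f, MemLp f 2 m → MemLp (A f) 2 m := fun f hf =>
    memLp_two_of_lintegral (hmeas f hf) ((hbound f hf).trans_lt
      (ENNReal.mul_lt_top (ENNReal.pow_lt_top ENNReal.ofReal_lt_top) (lintegral_enorm_sq_lt_top hf)))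
  let L₀ : Lp ℝ 2 m →ₗ[ℝ] Lp ℝ 2 m :=
    { toFun := fun f => (hmem f (Lp.memLp f)).toLp _
      map_add' := fun f g => by
        rw [← MemLp.toLp_add]
        refine (MemLp.toLp_eq_toLp_iff _ _).2 ?_
        exact (hcongr _ _ (Lp.coeFn_add f g)).trans (hadd _ _ (Lp.memLp f) (Lp.memLp g))
      map_smul' := fun c f => by
        rw [RingHom.id_apply, ← MemLp.toLp_const_smul]
        refine (MemLp.toLp_eq_toLp_iff _ _).2 ?_
        exact (hcongr _ _ (Lp.coeFn_smul c f)).trans (hsmul c _) }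
  refine ⟨L₀.mkContinuous M fun f => ?_, L₀.mkContinuous_norm_le hM _, fun f g hfg => ?_⟩
  · change ‖(hmem f (Lp.memLp f)).toLp _‖ ≤ _
    rw [Lp.norm_toLp, Lp.norm_def, ← ENNReal.toReal_ofReal hM, ← ENNReal.toReal_mul]
    refine ENNReal.toReal_mono (ENNReal.mul_ne_top ENNReal.ofReal_ne_top (Lp.eLpNorm_ne_top f)) ?_
    exact eLpNorm_two_le_of_sq_le (hbound f (Lp.memLp f))
  · exact (MemLp.coeFn_toLp (hmem f (Lp.memLp f))).trans (hcongr _ _ hfg)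

theorem norm_sq_eq_lintegral (f : Lp ℝ 2 m) :
    ENNReal.ofReal (‖f‖ ^ 2) = ∫⁻ x, ‖f x‖ₑ ^ 2 ∂m := by
  rw [← eLpNorm_two_sq, ENNReal.ofReal_pow (norm_nonneg _), Lp.norm_def,
    ENNReal.ofReal_toReal (Lp.eLpNorm_ne_top f)]

theorem inner_eq_integral (f g : Lp ℝ 2 m) : inner ℝ f g = ∫ x, f x * g x ∂m := by
  rw [L2.inner_def]
  refine integral_congr_ae (ae_of_all _ fun x => ?_)
  simp [mul_comm]

end Induced

variable {d : ℕ} {X V : Set (Vec d)} {ν : Measure (Vec d)}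

/-! ### Bounded coefficients -/

/-- `σ` is measurable and takes values in `[a,b]`. -/
def BoundedBy (a b : ℝ) (σ : Vec d × Vec d → ℝ) : Prop :=
  Measurable σ ∧ ∀ p, a ≤ σ p ∧ σ p ≤ b

namespace BoundedBy

variable {a b : ℝ} {σ : Vec d × Vec d → ℝ}

theorem intervalIntegrable (hσ : BoundedBy a b σ) {g : ℝ → Vec d × Vec d} (hg : Measurable g)
    (s t : ℝ) : IntervalIntegrable (fun r => σ (g r)) volume s t := by
  refine (intervalIntegrable_const (c := max |a| |b|)).mono_fun
    (hσ.1.comp hg).aestronglyMeasurable (ae_of_all _ fun r => ?_)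
  simp only [Real.norm_eq_abs]
  rw [abs_of_nonneg (le_max_of_le_left (abs_nonneg a))]
  exact abs_le_max_abs_abs (hσ.2 _).1 (hσ.2 _).2

theorem back (hσ : BoundedBy a b σ) (p : Vec d × Vec d) (s t : ℝ) :
    IntervalIntegrable (fun r => σ (p.1 - r • p.2, p.2)) volume s t :=
  hσ.intervalIntegrable (g := fun r => (p.1 - r • p.2, p.2)) (by fun_prop) s t

theorem forth (hσ : BoundedBy a b σ) (p : Vec d × Vec d) (s t : ℝ) :
    IntervalIntegrable (fun r => σ (p.1 + r • p.2, p.2)) volume s t :=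
  hσ.intervalIntegrable (g := fun r => (p.1 + r • p.2, p.2)) (by fun_prop) s t

theorem EMinus_le (hσ : BoundedBy a b σ) (p : Vec d × Vec d) {t : ℝ} (ht : 0 ≤ t) :
    EMinus σ p t ≤ Real.exp (-a * t) := by
  unfold EMinus
  refine Real.exp_le_exp.2 ?_
  have := intervalIntegral.integral_mono_on ht (intervalIntegrable_const (c := a)) (hσ.back p 0 t)
    (fun s _ => (hσ.2 _).1)
  simp at this
  nlinarith

theorem le_EMinus (hσ : BoundedBy a b σ) (p : Vec d × Vec d) {t : ℝ} (ht : 0 ≤ t) :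
    Real.exp (-b * t) ≤ EMinus σ p t := by
  unfold EMinus
  refine Real.exp_le_exp.2 ?_
  have := intervalIntegral.integral_mono_on ht (hσ.back p 0 t) (intervalIntegrable_const (c := b))
    (fun s _ => (hσ.2 _).2)
  simp at this
  nlinarith

theorem neg (hσ : BoundedBy a b σ) : BoundedBy (-b) (-a) (fun p => -σ p) :=
  ⟨hσ.1.neg, fun p => ⟨neg_le_neg (hσ.2 p).2, neg_le_neg (hσ.2 p).1⟩⟩

theorem measurable_EMinus (hσ : BoundedBy a b σ) :
    Measurable fun z : (Vec d × Vec d) × ℝ => EMinus σ z.1 z.2 := by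
  -- Rescaling time puts all the integrals on the fixed interval [0,1], where measurability in
  -- parameters is available.
  have h1 : (fun z : (Vec d × Vec d) × ℝ => EMinus σ z.1 z.2) = fun z =>
      Real.exp (-(z.2 * ∫ r in (0 : ℝ)..1, σ (z.1.1 - (z.2 * r) • z.1.2, z.1.2))) := by
    ext z
    unfold EMinus
    have := intervalIntegral.smul_integral_comp_mul_left
      (fun s => σ (z.1.1 - s • z.1.2, z.1.2)) z.2 (a := 0) (b := 1)
    rw [smul_eq_mul, mul_zero, mul_one] at this
    rw [← this]
  rw [h1]
  have h2 : Measurable fun z : (Vec d × Vec d) × ℝ =>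
      ∫ r in (0 : ℝ)..1, σ (z.1.1 - (z.2 * r) • z.1.2, z.1.2) := by
    simp_rw [intervalIntegral.integral_of_le zero_le_one]
    have h3 : Measurable fun y : ((Vec d × Vec d) × ℝ) × ℝ =>
        σ (y.1.1.1 - (y.1.2 * y.2) • y.1.1.2, y.1.1.2) := hσ.1.comp (by fun_prop)
    exact (h3.stronglyMeasurable.integral_prod_right').measurable
  exact Real.measurable_exp.comp (measurable_snd.mul h2).neg

end BoundedBy

/-- An essentially bounded function has a representative that is bounded and measurable. -/
theorem exists_boundedBy {m : Measure (Vec d × Vec d)} {σ : Vec d × Vec d → ℝ}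
    (hσ : AEStronglyMeasurable σ m) {a b : ℝ} (hab : a ≤ b) (h : ∀ᵐ p ∂m, a ≤ σ p ∧ σ p ≤ b) :
    ∃ σ', BoundedBy a b σ' ∧ σ =ᵐ[m] σ' := by
  refine ⟨fun p => max a (min b (hσ.mk σ p)), ⟨?_, fun p => ⟨le_max_left _ _, ?_⟩⟩, ?_⟩
  · exact measurable_const.max (measurable_const.min hσ.stronglyMeasurable_mk.measurable)
  · exact max_le hab (min_le_left _ _)
  · filter_upwards [h, hσ.ae_eq_mk] with p hp hp'
    rw [← hp', min_eq_right hp.2, max_eq_right hp.1]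

/-! ### The operator `T_{Γ₋}⁻¹` -/

namespace Admissible

theorem EMinus_congr {σ σ' : Vec d × Vec d → ℝ} {p : Vec d × Vec d} {a : ℝ}
    (h : ∀ᵐ t ∂volume.restrict (Ioo 0 a), σ (p.1 - t • p.2, p.2) = σ' (p.1 - t • p.2, p.2))
    {t : ℝ} (h0 : 0 ≤ t) (ht : t ≤ a) : EMinus σ p t = EMinus σ' p t := by
  unfold EMinus
  rw [intervalIntegral_eq_Ioo h0, intervalIntegral_eq_Ioo h0]
  congr 2
  exact integral_congr_ae (ae_restrict_of_ae_restrict_of_subset (Ioo_subset_Ioo_right ht) h)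

theorem TMinusInv_congr_of_ae {σ σ' f f' : Vec d × Vec d → ℝ} {p : Vec d × Vec d}
    (h : ∀ᵐ t ∂volume.restrict (Ioo 0 (tauMinus X p)),
      σ (p.1 - t • p.2, p.2) = σ' (p.1 - t • p.2, p.2))
    (hf : ∀ᵐ t ∂volume.restrict (Ioo 0 (tauMinus X p)),
      f (p.1 - t • p.2, p.2) = f' (p.1 - t • p.2, p.2)) :
    TMinusInv X σ f p = TMinusInv X σ' f' p := by
  unfold TMinusInv
  rw [intervalIntegral_eq_Ioo (tauMinus_nonneg X p), intervalIntegral_eq_Ioo (tauMinus_nonneg X p)]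
  refine integral_congr_ae ?_
  filter_upwards [hf, ae_restrict_mem measurableSet_Ioo] with t ht ht'
  rw [ht, EMinus_congr h ht'.1.le ht'.2.le]

theorem TMinusInv_congr (h : Admissible X V ν) {σ σ' f f' : Vec d × Vec d → ℝ}
    (hσ : σ =ᵐ[phaseMeasure X ν] σ') (hf : f =ᵐ[phaseMeasure X ν] f') :
    TMinusInv X σ f =ᵐ[phaseMeasure X ν] TMinusInv X σ' f' := by
  filter_upwards [h.ae_back hσ, h.ae_back hf] with p h1 h2
  exact TMinusInv_congr_of_ae h1 h2

theorem aestronglyMeasurable_TMinusInv (h : Admissible X V ν) {a b : ℝ}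
    {σ f : Vec d × Vec d → ℝ} (hσ : BoundedBy a b σ)
    (hf : AEStronglyMeasurable f (phaseMeasure X ν)) :
    AEStronglyMeasurable (TMinusInv X σ f) (phaseMeasure X ν) := by
  have := h.sFinite_phase
  refine aestronglyMeasurable_chord_integral (measurable_tauMinus h.isOpen) (tauMinus_nonneg X)
    (G := fun p t => EMinus σ p t * f (p.1 - t • p.2, p.2)) ?_
  refine hσ.measurable_EMinus.aestronglyMeasurable.mul ?_
  have h1 : AEStronglyMeasurable (fun z : (Vec d × Vec d) × ℝ => f z.1)
      (chordMeasure (phaseMeasure X ν) (tauPlus X)) :=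
    (hf.comp_quasiMeasurePreserving Measure.quasiMeasurePreserving_fst).mono_measure
      Measure.restrict_le_self
  exact h1.comp_quasiMeasurePreserving h.measurePreserving_back.quasiMeasurePreserving

/-- Integration over pairs of points on one chord: on the left the pair is indexed by its later
point, on the right by its earlier one. -/
theorem lintegral_back (h : Admissible X V ν) {a : ℝ → ℝ≥0∞} (ha : Measurable a)
    {F : Vec d × Vec d → ℝ≥0∞} (hF : AEMeasurable F (phaseMeasure X ν)) :
    ∫⁻ p, (∫⁻ t in Ioo 0 (tauMinus X p), a t * F (p.1 - t • p.2, p.2)) ∂phaseMeasure X ν =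
      ∫⁻ p, F p * (∫⁻ t in Ioo 0 (tauPlus X p), a t) ∂phaseMeasure X ν := by
  have := h.sFinite_phase
  have h0 : AEMeasurable (fun z : (Vec d × Vec d) × ℝ => F z.1)
      (chordMeasure (phaseMeasure X ν) (tauPlus X)) :=
    (hF.comp_quasiMeasurePreserving Measure.quasiMeasurePreserving_fst).mono_measure
      Measure.restrict_le_self
  have h1 : AEMeasurable (fun z : (Vec d × Vec d) × ℝ => a z.2 * F z.1)
      (chordMeasure (phaseMeasure X ν) (tauPlus X)) :=
    (ha.comp measurable_snd).aemeasurable.mul h0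
  have h2 := h.measurePreserving_back.map_eq ▸
    lintegral_map' (f := fun z : (Vec d × Vec d) × ℝ => a z.2 * F z.1)
      (by rw [h.measurePreserving_back.map_eq]; exact h1)
      h.measurePreserving_back.measurable.aemeasurable
  have h3 := h1.comp_quasiMeasurePreserving h.measurePreserving_back.quasiMeasurePreserving
  rw [lintegral_chordMeasure (measurable_tauPlus h.isOpen) h1,
    lintegral_chordMeasure (measurable_tauMinus h.isOpen)
      (F := fun z => a z.2 * F (z.1.1 - z.2 • z.1.2, z.1.2)) h3] at h2
  rw [← h2]
  refine lintegral_congr fun p => ?_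
  simp only
  rw [mul_comm, lintegral_mul_const _ ha]

theorem ae_aemeasurable_back (h : Admissible X V ν)
    {F : Vec d × Vec d → ℝ≥0∞} (hF : AEMeasurable F (phaseMeasure X ν)) :
    ∀ᵐ p ∂phaseMeasure X ν, AEMeasurable (fun t => F (p.1 - t • p.2, p.2))
      (volume.restrict (Ioo 0 (tauMinus X p))) := by
  filter_upwards [h.ae_back hF.ae_eq_mk] with p hp
  exact ⟨fun t => hF.mk F (p.1 - t • p.2, p.2), hF.measurable_mk.comp (by fun_prop), hp⟩

/-- The `L²` bound for integrals along characteristics. -/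
theorem lintegral_sq_back_le (h : Admissible X V ν) {a : ℝ → ℝ≥0∞} (ha : Measurable a)
    {F : Vec d × Vec d → ℝ≥0∞} (hF : AEMeasurable F (phaseMeasure X ν)) {M : ℝ≥0∞}
    (hM : ∀ p : Vec d × Vec d, p.2 ∈ V → ∫⁻ t in Ioo 0 (tauPlus X p), a t ≤ M)
    (hM' : ∀ p : Vec d × Vec d, p.2 ∈ V → ∫⁻ t in Ioo 0 (tauMinus X p), a t ≤ M) :
    ∫⁻ p, (∫⁻ t in Ioo 0 (tauMinus X p), a t * F (p.1 - t • p.2, p.2)) ^ 2 ∂phaseMeasure X ν ≤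
      M ^ 2 * ∫⁻ p, F p ^ 2 ∂phaseMeasure X ν := by
  -- Schur's test. Cauchy–Schwarz with weight a costs one factor M from the backward chord; after
  -- exchanging the two points the second factor M comes from the forward chord.
  have h1 : ∀ᵐ p ∂phaseMeasure X ν,
      (∫⁻ t in Ioo 0 (tauMinus X p), a t * F (p.1 - t • p.2, p.2)) ^ 2 ≤
        M * ∫⁻ t in Ioo 0 (tauMinus X p), a t * F (p.1 - t • p.2, p.2) ^ 2 := by
    filter_upwards [h.ae_phase, h.ae_aemeasurable_back hF] with p hp hp'
    refine (sq_lintegral_mul_le_weighted ha.aemeasurable hp').trans ?_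
    gcongr
    exact hM' p hp.2
  refine (lintegral_mono_ae h1).trans ?_
  have hm : AEMeasurable (fun p => ∫⁻ t in Ioo 0 (tauMinus X p),
      a t * F (p.1 - t • p.2, p.2) ^ 2) (phaseMeasure X ν) := by
    obtain ⟨G, hG, hFG⟩ := hF
    have h2 : Measurable fun z : (Vec d × Vec d) × ℝ =>
        {z : (Vec d × Vec d) × ℝ | 0 < z.2 ∧ z.2 < tauMinus X z.1}.indicator
          (fun z => a z.2 * G (z.1.1 - z.2 • z.1.2, z.1.2) ^ 2) z :=
      ((ha.comp measurable_snd).mul ((hG.comp (by fun_prop)).pow_const 2)).indicator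
        (measurableSet_chord (measurable_tauMinus h.isOpen))
    refine ⟨_, h2.lintegral_prod_right' (ν := volume), ?_⟩
    filter_upwards [h.ae_back hFG] with p hp
    rw [← lintegral_indicator measurableSet_Ioo]
    refine lintegral_congr_ae ?_
    rw [Filter.EventuallyEq, ae_restrict_iff' measurableSet_Ioo] at *
    filter_upwards [hp] with t ht
    by_cases htm : t ∈ Ioo 0 (tauMinus X p)
    · rw [indicator_of_mem htm, indicator_of_mem (by exact htm), ht htm]
    · rw [indicator_of_notMem htm, indicator_of_notMem (by exact htm)]
  rw [lintegral_const_mul'' _ hm, h.lintegral_back ha (hF.pow_const 2), pow_two, mul_assoc,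
    ← lintegral_const_mul'' _ (hF.pow_const 2)]
  gcongr 1
  refine lintegral_mono_ae ?_
  filter_upwards [h.ae_phase] with p hp
  rw [mul_comm]
  gcongr
  exact hM p hp.2

theorem enorm_TMinusInv_le {a b : ℝ} {σ f : Vec d × Vec d → ℝ} (hσ : BoundedBy a b σ)
    (p : Vec d × Vec d) :
    ‖TMinusInv X σ f p‖ₑ ≤ ∫⁻ t in Ioo 0 (tauMinus X p),
      ENNReal.ofReal (Real.exp (-a * t)) * ‖f (p.1 - t • p.2, p.2)‖ₑ := by
  unfold TMinusInv
  rw [intervalIntegral_eq_Ioo (tauMinus_nonneg X p)]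
  refine (enorm_integral_le_lintegral_enorm _).trans ?_
  refine setLIntegral_mono' measurableSet_Ioo fun t ht => ?_
  rw [enorm_mul]
  gcongr
  rw [EMinus, Real.enorm_eq_ofReal (Real.exp_pos _).le, ← EMinus]
  exact ENNReal.ofReal_le_ofReal (hσ.EMinus_le p ht.1.le)

end Admissible

end

section

variable {d : ℕ} {X V : Set (Vec d)} {ν : Measure (Vec d)}

namespace Admissible

/-! ### `T_{Γ₋}⁻¹` on `L²` -/

theorem ae_intervalIntegrable_back (h : Admissible X V ν) {f : Vec d × Vec d → ℝ}
    (hf : Integrable f (phaseMeasure X ν)) :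
    ∀ᵐ p ∂phaseMeasure X ν, IntervalIntegrable (fun t => f (p.1 - t • p.2, p.2)) volume 0
      (tauMinus X p) := by
  have := h.sFinite_phase
  obtain ⟨D, hD, hDt⟩ := h.exists_tau_le
  have h1 : Integrable (fun z : (Vec d × Vec d) × ℝ => f z.1)
      (chordMeasure (phaseMeasure X ν) (tauPlus X)) := by
    have h0 : AEStronglyMeasurable (fun z : (Vec d × Vec d) × ℝ => f z.1)
        (chordMeasure (phaseMeasure X ν) (tauPlus X)) :=
      (hf.1.comp_quasiMeasurePreserving Measure.quasiMeasurePreserving_fst).mono_measure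
        Measure.restrict_le_self
    refine ⟨h0, ?_⟩
    rw [hasFiniteIntegral_iff_enorm, lintegral_chordMeasure (measurable_tauPlus h.isOpen)
      h0.enorm]
    have h2 : ∀ᵐ p ∂phaseMeasure X ν, (∫⁻ _ in Ioo 0 (tauPlus X p), ‖f p‖ₑ) ≤
        ENNReal.ofReal D * ‖f p‖ₑ := by
      filter_upwards [h.ae_phase] with p hp
      rw [lintegral_const, mul_comm]
      gcongr
      simpa using ENNReal.ofReal_le_ofReal (hDt p hp.2).1
    refine (lintegral_mono_ae h2).trans_lt ?_
    rw [lintegral_const_mul' _ _ ENNReal.ofReal_ne_top]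
    exact ENNReal.mul_lt_top ENNReal.ofReal_lt_top hf.2
  have h2 : Integrable (fun z : (Vec d × Vec d) × ℝ => f (z.1.1 - z.2 • z.1.2, z.1.2))
      (chordMeasure (phaseMeasure X ν) (tauMinus X)) :=
    h.measurePreserving_back.integrable_comp_of_integrable h1
  exact ae_intervalIntegrable_chord (measurable_tauMinus h.isOpen) (tauMinus_nonneg X) h2

end Admissible

theorem BoundedBy.continuous_EMinus {a b : ℝ} {σ : Vec d × Vec d → ℝ} (hσ : BoundedBy a b σ)
    (p : Vec d × Vec d) : Continuous (EMinus σ p) :=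
  Real.continuous_exp.comp (intervalIntegral.continuous_primitive (hσ.back p) 0).neg

namespace Admissible

theorem TMinusInv_add {a b : ℝ} {σ f g : Vec d × Vec d → ℝ}
    (hσ : BoundedBy a b σ) {p : Vec d × Vec d}
    (hf : IntervalIntegrable (fun t => f (p.1 - t • p.2, p.2)) volume 0 (tauMinus X p))
    (hg : IntervalIntegrable (fun t => g (p.1 - t • p.2, p.2)) volume 0 (tauMinus X p)) :
    TMinusInv X σ (f + g) p = TMinusInv X σ f p + TMinusInv X σ g p := by
  unfold TMinusInv
  rw [← intervalIntegral.integral_add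
    (hf.continuousOn_mul (hσ.continuous_EMinus p).continuousOn)
    (hg.continuousOn_mul (hσ.continuous_EMinus p).continuousOn)]
  simp [mul_add]

theorem TMinusInv_smul (σ : Vec d × Vec d → ℝ) (c : ℝ) (f : Vec d × Vec d → ℝ) :
    TMinusInv X σ (c • f) = c • TMinusInv X σ f := by
  ext p
  unfold TMinusInv
  rw [Pi.smul_apply, smul_eq_mul, ← intervalIntegral.integral_const_mul]
  refine intervalIntegral.integral_congr fun t _ => ?_
  simp only [Pi.smul_apply, smul_eq_mul]
  ring

theorem lintegral_sq_TMinusInv_le (h : Admissible X V ν) {a b M : ℝ} {σ f : Vec d × Vec d → ℝ}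
    (hσ : BoundedBy a b σ) (hf : AEStronglyMeasurable f (phaseMeasure X ν))
    (hM : ∀ p : Vec d × Vec d, p.2 ∈ V → ∀ T, T = tauPlus X p ∨ T = tauMinus X p →
      ∫⁻ t in Ioo 0 T, ENNReal.ofReal (Real.exp (-a * t)) ≤ ENNReal.ofReal M) :
    ∫⁻ p, ‖TMinusInv X σ f p‖ₑ ^ 2 ∂phaseMeasure X ν ≤
      ENNReal.ofReal M ^ 2 * ∫⁻ p, ‖f p‖ₑ ^ 2 ∂phaseMeasure X ν := by
  refine le_trans (lintegral_mono fun p => pow_le_pow_left' (enorm_TMinusInv_le hσ p) 2) ?_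
  exact h.lintegral_sq_back_le (by fun_prop) hf.enorm (fun p hp => hM p hp _ (Or.inl rfl))
    (fun p hp => hM p hp _ (Or.inr rfl))

theorem exists_clm_TMinusInv_of_le (h : Admissible X V ν) {a b M : ℝ} {σ : Vec d × Vec d → ℝ}
    (hσ : BoundedBy a b σ) (hM0 : 0 ≤ M)
    (hM : ∀ p : Vec d × Vec d, p.2 ∈ V → ∀ T, T = tauPlus X p ∨ T = tauMinus X p →
      ∫⁻ t in Ioo 0 T, ENNReal.ofReal (Real.exp (-a * t)) ≤ ENNReal.ofReal M) :
    ∃ L : Lp ℝ 2 (phaseMeasure X ν) →L[ℝ] Lp ℝ 2 (phaseMeasure X ν), ‖L‖ ≤ M ∧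
      ∀ (f : Lp ℝ 2 (phaseMeasure X ν)) (g : Vec d × Vec d → ℝ), f =ᵐ[phaseMeasure X ν] g →
        L f =ᵐ[phaseMeasure X ν] TMinusInv X σ g := by
  have := h.isFiniteMeasure_phase
  refine exists_clm (TMinusInv X σ) M hM0 (fun f g hfg => h.TMinusInv_congr (ae_eq_refl σ) hfg)
    (fun f g hf hg => ?_) (fun c f => by rw [TMinusInv_smul])
    (fun f hf => h.aestronglyMeasurable_TMinusInv hσ hf.1)
    (fun f hf => h.lintegral_sq_TMinusInv_le hσ hf.1 hM)
  filter_upwards [h.ae_intervalIntegrable_back (hf.integrable (by norm_num)),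
    h.ae_intervalIntegrable_back (hg.integrable (by norm_num))] with p h1 h2
  exact TMinusInv_add hσ h1 h2

theorem lintegral_exp_le {a : ℝ} (ha : 0 < a) (T : ℝ) :
    ∫⁻ t in Ioo 0 T, ENNReal.ofReal (Real.exp (-a * t)) ≤ ENNReal.ofReal (1 / a) := by
  have h1 : IntegrableOn (fun t => Real.exp (-a * t)) (Ioi 0) := integrableOn_exp_mul_Ioi (by linarith) 0
  refine (lintegral_mono_set Ioo_subset_Ioi_self).trans ?_
  rw [← ofReal_integral_eq_lintegral_ofReal h1 (ae_of_all _ fun t => (Real.exp_pos _).le),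
    integral_exp_mul_Ioi (by linarith) 0]
  simp

/-- Schur's test with ∫ e^{-at} dt ≤ 1/a, independently of the chord length. Compared with the bound
on K, this norm is what makes the scaled problem subcritical. -/
theorem exists_clm_TMinusInv_of_pos (h : Admissible X V ν) {a b : ℝ} {σ : Vec d × Vec d → ℝ}
    (hσ : BoundedBy a b σ) (ha : 0 < a) :
    ∃ L : Lp ℝ 2 (phaseMeasure X ν) →L[ℝ] Lp ℝ 2 (phaseMeasure X ν), ‖L‖ ≤ 1 / a ∧
      ∀ (f : Lp ℝ 2 (phaseMeasure X ν)) (g : Vec d × Vec d → ℝ), f =ᵐ[phaseMeasure X ν] g →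
        L f =ᵐ[phaseMeasure X ν] TMinusInv X σ g :=
  h.exists_clm_TMinusInv_of_le hσ (by positivity) fun _ _ T _ => lintegral_exp_le ha T

/-- Chords have bounded length, so the weight stays integrable whatever the sign of a. This is
needed for the absorption -σ, where the weight grows. -/
theorem exists_exp_bound (h : Admissible X V ν) (a : ℝ) :
    ∃ M : ℝ, 0 ≤ M ∧ ∀ p : Vec d × Vec d, p.2 ∈ V → ∀ T, T = tauPlus X p ∨ T = tauMinus X p →
      ∫⁻ t in Ioo 0 T, ENNReal.ofReal (Real.exp (-a * t)) ≤ ENNReal.ofReal M := by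
  obtain ⟨D, hD, hDt⟩ := h.exists_tau_le
  refine ⟨Real.exp (|a| * D) * D, by positivity, fun p hp T hT => ?_⟩
  have hTD : T ≤ D := by
    rcases hT with rfl | rfl
    exacts [(hDt p hp).1, (hDt p hp).2]
  have h1 : ∀ t ∈ Ioo 0 T, ENNReal.ofReal (Real.exp (-a * t)) ≤
      ENNReal.ofReal (Real.exp (|a| * D)) := fun t ht => by
    refine ENNReal.ofReal_le_ofReal (Real.exp_le_exp.2 ?_)
    have h2 : -a * t ≤ |a| * t := mul_le_mul_of_nonneg_right (neg_le_abs a) ht.1.le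
    have h3 : |a| * t ≤ |a| * D := mul_le_mul_of_nonneg_left (ht.2.le.trans hTD) (abs_nonneg a)
    linarith
  refine (setLIntegral_mono' measurableSet_Ioo h1).trans ?_
  rw [setLIntegral_const, ENNReal.ofReal_mul (Real.exp_pos _).le]
  gcongr
  simpa using ENNReal.ofReal_le_ofReal hTD

theorem exists_clm_TMinusInv (h : Admissible X V ν) {a b : ℝ} {σ : Vec d × Vec d → ℝ}
    (hσ : BoundedBy a b σ) :
    ∃ L : Lp ℝ 2 (phaseMeasure X ν) →L[ℝ] Lp ℝ 2 (phaseMeasure X ν),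
      ∀ (f : Lp ℝ 2 (phaseMeasure X ν)) (g : Vec d × Vec d → ℝ), f =ᵐ[phaseMeasure X ν] g →
        L f =ᵐ[phaseMeasure X ν] TMinusInv X σ g := by
  obtain ⟨M, hM0, hM⟩ := h.exists_exp_bound a
  obtain ⟨L, -, hL⟩ := h.exists_clm_TMinusInv_of_le hσ hM0 hM
  exact ⟨L, hL⟩

end Admissible

/-! ### The scattering operator on `L²` -/

/-- `k` is measurable and `‖k(x)‖_{L²(V × V)} ≤ M` for almost every `x`. -/
def KernelBound (X : Set (Vec d)) (ν : Measure (Vec d)) (k : Vec d × Vec d × Vec d → ℝ) (M : ℝ) :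
    Prop :=
  Measurable k ∧ ∀ᵐ x ∂volume.restrict X, ∫⁻ w, ‖k (x, w)‖ₑ ^ 2 ∂ν.prod ν ≤ ENNReal.ofReal M ^ 2

namespace Admissible

theorem ae_kernel (h : Admissible X V ν) {q : Vec d × Vec d × Vec d → Prop}
    (hq : ∀ᵐ z ∂kernelMeasure X ν, q z) :
    ∀ᵐ p ∂phaseMeasure X ν, ∀ᵐ v' ∂ν, q (p.1, v', p.2) := by
  have := h.finite
  have h1 : MeasurePreserving (fun z : (Vec d × Vec d) × Vec d => (z.1.1, z.2, z.1.2))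
      ((phaseMeasure X ν).prod ν) (kernelMeasure X ν) :=
    ((MeasurePreserving.id (volume.restrict X)).prod (Measure.measurePreserving_swap
      (μ := ν) (ν := ν))).comp (measurePreserving_prodAssoc (volume.restrict X) ν ν)
  exact Measure.ae_ae_of_ae_prod (h1.quasiMeasurePreserving.ae hq)

theorem ae_position (h : Admissible X V ν) {q : Vec d → Prop}
    (hq : ∀ᵐ x ∂volume.restrict X, q x) : ∀ᵐ p ∂phaseMeasure X ν, q p.1 := by
  have := h.finite
  exact Measure.quasiMeasurePreserving_fst.ae hq

theorem ae_velocity (h : Admissible X V ν) {q : Vec d × Vec d → Prop}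
    (hq : ∀ᵐ p ∂phaseMeasure X ν, q p) : ∀ᵐ p ∂phaseMeasure X ν, ∀ᵐ v' ∂ν, q (p.1, v') := by
  have := h.finite
  exact h.ae_position (q := fun x => ∀ᵐ v' ∂ν, q (x, v')) (Measure.ae_ae_of_ae_prod hq)

theorem KOp_congr (h : Admissible X V ν) {k k' : Vec d × Vec d × Vec d → ℝ}
    {u u' : Vec d × Vec d → ℝ} (hk : k =ᵐ[kernelMeasure X ν] k')
    (hu : u =ᵐ[phaseMeasure X ν] u') : KOp ν k u =ᵐ[phaseMeasure X ν] KOp ν k' u' := by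
  filter_upwards [h.ae_kernel hk, h.ae_velocity hu] with p h1 h2
  refine integral_congr_ae ?_
  filter_upwards [h1, h2] with v' h3 h4
  rw [h3, h4]

theorem ae_memLp_velocity (h : Admissible X V ν) {u : Vec d × Vec d → ℝ}
    (hu : MemLp u 2 (phaseMeasure X ν)) :
    ∀ᵐ x ∂volume.restrict X, MemLp (fun v => u (x, v)) 2 ν := by
  have := h.finite
  have h1 := lintegral_enorm_sq_lt_top hu
  rw [phaseMeasure, lintegral_prod _ (by exact hu.1.enorm.pow_const 2)] at h1
  have h2 := ae_lt_top' (AEMeasurable.lintegral_prod_right' (by exact hu.1.enorm.pow_const 2)) h1.ne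
  have h3 := (show AEStronglyMeasurable u ((volume.restrict X).prod ν) from hu.1).prodMk_left
  filter_upwards [h2, h3] with x hx hx'
  exact memLp_two_of_lintegral hx' hx

theorem aestronglyMeasurable_KOp (h : Admissible X V ν) {k : Vec d × Vec d × Vec d → ℝ}
    {u : Vec d × Vec d → ℝ} (hk : Measurable k) (hu : AEStronglyMeasurable u (phaseMeasure X ν)) :
    AEStronglyMeasurable (KOp ν k u) (phaseMeasure X ν) := by
  have := h.finite
  refine AEStronglyMeasurable.congr ?_ (h.KOp_congr (ae_eq_refl k) hu.ae_eq_mk).symm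
  have h1 : Measurable fun z : (Vec d × Vec d) × Vec d =>
      k (z.1.1, z.2, z.1.2) * hu.mk u (z.1.1, z.2) :=
    (hk.comp (by fun_prop)).mul (hu.stronglyMeasurable_mk.measurable.comp (by fun_prop))
  exact h1.stronglyMeasurable.integral_prod_right'.aestronglyMeasurable

theorem ae_memLp_kernel (h : Admissible X V ν) {k : Vec d × Vec d × Vec d → ℝ} {M : ℝ}
    (hk : KernelBound X ν k M) :
    ∀ᵐ p ∂phaseMeasure X ν, MemLp (fun v' => k (p.1, v', p.2)) 2 ν := by
  have := h.finite
  have hmeas : Measurable fun p : Vec d × Vec d => ∫⁻ v', ‖k (p.1, v', p.2)‖ₑ ^ 2 ∂ν :=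
    Measurable.lintegral_prod_right' (f := fun z : (Vec d × Vec d) × Vec d =>
      ‖k (z.1.1, z.2, z.1.2)‖ₑ ^ 2) ((hk.1.comp (by fun_prop)).enorm.pow_const 2)
  have h1 : ∀ᵐ p ∂phaseMeasure X ν, ∫⁻ v', ‖k (p.1, v', p.2)‖ₑ ^ 2 ∂ν < ⊤ := by
    refine (Measure.ae_prod_iff_ae_ae (measurableSet_lt hmeas measurable_const)).2 ?_
    filter_upwards [hk.2] with x hx
    rw [lintegral_prod_symm _ (by exact ((hk.1.comp (by fun_prop)).enorm.pow_const 2).aemeasurable)] at hx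
    exact ae_lt_top (hmeas.comp (by fun_prop : Measurable fun v => (x, v))) 
      (hx.trans_lt (ENNReal.pow_lt_top ENNReal.ofReal_lt_top)).ne
  filter_upwards [h1] with p hp
  exact memLp_two_of_lintegral (hk.1.comp (by fun_prop)).aestronglyMeasurable hp

theorem ae_integrable_KOp (h : Admissible X V ν) {k : Vec d × Vec d × Vec d → ℝ} {M : ℝ}
    (hk : KernelBound X ν k M) {u : Vec d × Vec d → ℝ} (hu : MemLp u 2 (phaseMeasure X ν)) :
    ∀ᵐ p ∂phaseMeasure X ν, Integrable (fun v' => k (p.1, v', p.2) * u (p.1, v')) ν := by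
  filter_upwards [h.ae_memLp_kernel hk, h.ae_position (h.ae_memLp_velocity hu)] with p h1 h2
  exact h1.integrable_mul h2

/-- For each x the operator acts on velocities only and its norm is at most the Hilbert–Schmidt
norm. -/
theorem lintegral_sq_KOp_le (h : Admissible X V ν) {k : Vec d × Vec d × Vec d → ℝ} {M : ℝ}
    (hk : KernelBound X ν k M) {u : Vec d × Vec d → ℝ} (hu : MemLp u 2 (phaseMeasure X ν)) :
    ∫⁻ p, ‖KOp ν k u p‖ₑ ^ 2 ∂phaseMeasure X ν ≤
      ENNReal.ofReal M ^ 2 * ∫⁻ p, ‖u p‖ₑ ^ 2 ∂phaseMeasure X ν := by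
  have := h.finite
  have hum : AEMeasurable (fun p => ‖u p‖ₑ ^ 2) ((volume.restrict X).prod ν) := hu.1.enorm.pow_const 2
  have hKm := (h.aestronglyMeasurable_KOp hk.1 hu.1).enorm.pow_const 2
  rw [phaseMeasure] at hKm ⊢
  rw [lintegral_prod _ hum, lintegral_prod _ hKm, ← lintegral_const_mul'' _ hum.lintegral_prod_right']
  refine lintegral_mono_ae ?_
  filter_upwards [hk.2, h.ae_memLp_velocity hu] with x hx hxu
  have h1 : ∀ v, ‖KOp ν k u (x, v)‖ₑ ^ 2 ≤
      (∫⁻ v', ‖k (x, v', v)‖ₑ ^ 2 ∂ν) * ∫⁻ v', ‖u (x, v')‖ₑ ^ 2 ∂ν := fun v => by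
    refine le_trans (pow_le_pow_left' (enorm_integral_le_lintegral_enorm _) 2) ?_
    simp only [enorm_mul]
    exact sq_lintegral_mul_le (hk.1.comp (by fun_prop)).enorm.aemeasurable hxu.1.enorm
  refine (lintegral_mono h1).trans ?_
  rw [lintegral_prod_symm _ (by exact ((hk.1.comp (by fun_prop)).enorm.pow_const 2).aemeasurable)] at hx
  rw [lintegral_mul_const]
  · gcongr
  · exact Measurable.lintegral_prod_left' (f := fun w : Vec d × Vec d => ‖k (x, w)‖ₑ ^ 2)
      ((hk.1.comp (by fun_prop)).enorm.pow_const 2)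

theorem KOp_smul (k : Vec d × Vec d × Vec d → ℝ) (c : ℝ) (f : Vec d × Vec d → ℝ) :
    KOp ν k (c • f) = c • KOp ν k f := by
  ext p
  unfold KOp
  rw [Pi.smul_apply, smul_eq_mul, ← integral_const_mul]
  refine integral_congr_ae (ae_of_all _ fun v' => ?_)
  simp only [Pi.smul_apply, smul_eq_mul]
  ring

theorem KOp_const_mul (k : Vec d × Vec d × Vec d → ℝ) (c : ℝ) (f : Vec d × Vec d → ℝ) :
    KOp ν (fun q => c * k q) f = c • KOp ν k f := by
  ext p
  unfold KOp
  rw [Pi.smul_apply, smul_eq_mul, ← integral_const_mul]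
  refine integral_congr_ae (ae_of_all _ fun v' => ?_)
  simp only
  ring

theorem KOp_add (h : Admissible X V ν) {k : Vec d × Vec d × Vec d → ℝ} {M : ℝ}
    (hk : KernelBound X ν k M) {f g : Vec d × Vec d → ℝ} (hf : MemLp f 2 (phaseMeasure X ν))
    (hg : MemLp g 2 (phaseMeasure X ν)) :
    KOp ν k (f + g) =ᵐ[phaseMeasure X ν] KOp ν k f + KOp ν k g := by
  filter_upwards [h.ae_integrable_KOp hk hf, h.ae_integrable_KOp hk hg] with p h1 h2
  unfold KOp
  rw [Pi.add_apply, ← integral_add h1 h2]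
  simp [mul_add]

theorem exists_clm_KOp (h : Admissible X V ν) {k : Vec d × Vec d × Vec d → ℝ} {M : ℝ}
    (hM : 0 ≤ M) (hk : KernelBound X ν k M) :
    ∃ L : Lp ℝ 2 (phaseMeasure X ν) →L[ℝ] Lp ℝ 2 (phaseMeasure X ν), ‖L‖ ≤ M ∧
      ∀ (f : Lp ℝ 2 (phaseMeasure X ν)) (g : Vec d × Vec d → ℝ), f =ᵐ[phaseMeasure X ν] g →
        L f =ᵐ[phaseMeasure X ν] KOp ν k g :=
  exists_clm (KOp ν k) M hM (fun _ _ hfg => h.KOp_congr (ae_eq_refl k) hfg)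
    (fun _ _ hf hg => h.KOp_add hk hf hg) (fun c f => by rw [KOp_smul])
    (fun _ hf => h.aestronglyMeasurable_KOp hk.1 hf.1) (fun _ hf => h.lintegral_sq_KOp_le hk hf)

end Admissible

end

section

variable {d : ℕ} {X V : Set (Vec d)} {ν : Measure (Vec d)}

namespace Admissible

/-! ### Reflection and the adjoint of `T_{Γ₋}⁻¹` -/

theorem exists_clm_reflect (h : Admissible X V ν) :
    ∃ J : Lp ℝ 2 (phaseMeasure X ν) →L[ℝ] Lp ℝ 2 (phaseMeasure X ν),
      ∀ (f : Lp ℝ 2 (phaseMeasure X ν)) (g : Vec d × Vec d → ℝ), f =ᵐ[phaseMeasure X ν] g →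
        J f =ᵐ[phaseMeasure X ν] fun p => g (reflect p) := by
  have hr := h.measurePreserving_reflect_phase
  obtain ⟨J, -, hJ⟩ := exists_clm (m := phaseMeasure X ν) (fun f p => f (reflect p)) 1 zero_le_one
    (fun f g hfg => hr.quasiMeasurePreserving.ae_eq_comp hfg)
    (fun f g _ _ => ae_eq_refl _) (fun c f => ae_eq_refl _)
    (fun f hf => hf.1.comp_measurePreserving hr) (fun f hf => by
      rw [ENNReal.ofReal_one, one_pow, one_mul]
      have h1 := lintegral_map' (f := fun p => ‖f p‖ₑ ^ 2)
        (hr.map_eq.symm ▸ hf.1.enorm.pow_const 2) hr.measurable.aemeasurable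
      rw [hr.map_eq] at h1
      exact h1.ge)
  exact ⟨J, hJ⟩

/-- Reversing the velocity exchanges forward and backward chords and turns the growing weight of σ
into the backward weight of -σ. Bounds and congruences for `TPlusInv` are deduced from those for
`TMinusInv` in this way. -/
theorem TPlusInv_eq_reflect (X : Set (Vec d)) (σ f : Vec d × Vec d → ℝ) (p : Vec d × Vec d) :
    TPlusInv X σ f p =
      -TMinusInv X (fun q => -σ (reflect q)) (fun q => f (reflect q)) (reflect p) := by
  obtain ⟨x, v⟩ := p
  simp [TPlusInv, TMinusInv, reflect, tauMinus_eq_tauPlus, EPlus, EMinus]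

theorem measurePreserving_forth (h : Admissible X V ν) :
    MeasurePreserving (fun z : (Vec d × Vec d) × ℝ => ((z.1.1 + z.2 • z.1.2, z.1.2), z.2))
      (chordMeasure (phaseMeasure X ν) (tauPlus X))
      (chordMeasure (phaseMeasure X ν) (tauMinus X)) := by
  have hm : Measurable fun z : (Vec d × Vec d) × ℝ => ((z.1.1 + z.2 • z.1.2, z.1.2), z.2) := by
    fun_prop
  refine ⟨hm, ?_⟩
  rw [← h.measurePreserving_back.map_eq, Measure.map_map hm h.measurePreserving_back.measurable]
  simp [Function.comp_def]

theorem TPlusInv_congr (h : Admissible X V ν) {σ σ' f f' : Vec d × Vec d → ℝ}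
    (hσ : σ =ᵐ[phaseMeasure X ν] σ') (hf : f =ᵐ[phaseMeasure X ν] f') :
    TPlusInv X σ f =ᵐ[phaseMeasure X ν] TPlusInv X σ' f' := by
  have hr := h.measurePreserving_reflect_phase.quasiMeasurePreserving
  have h1 : (fun q => -σ (reflect q)) =ᵐ[phaseMeasure X ν] fun q => -σ' (reflect q) := by
    filter_upwards [hr.ae hσ] with p hp
    rw [hp]
  have h2 : (fun q => f (reflect q)) =ᵐ[phaseMeasure X ν] fun q => f' (reflect q) := hr.ae hf
  filter_upwards [hr.ae (h.TMinusInv_congr h1 h2)] with p hp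
  rw [TPlusInv_eq_reflect, TPlusInv_eq_reflect, hp]

end Admissible

theorem BoundedBy.reflect {a b : ℝ} {σ : Vec d × Vec d → ℝ} (hσ : BoundedBy a b σ) :
    BoundedBy a b (fun p => σ (Transport.reflect p)) :=
  ⟨hσ.1.comp measurable_reflect, fun _ => hσ.2 _⟩

namespace Admissible

theorem exists_clm_TPlusInv (h : Admissible X V ν) {a b : ℝ} {σ : Vec d × Vec d → ℝ}
    (hσ : BoundedBy a b σ) :
    ∃ L : Lp ℝ 2 (phaseMeasure X ν) →L[ℝ] Lp ℝ 2 (phaseMeasure X ν),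
      ∀ (f : Lp ℝ 2 (phaseMeasure X ν)) (g : Vec d × Vec d → ℝ), f =ᵐ[phaseMeasure X ν] g →
        L f =ᵐ[phaseMeasure X ν] TPlusInv X σ g := by
  obtain ⟨J, hJ⟩ := h.exists_clm_reflect
  obtain ⟨U, hU⟩ := h.exists_clm_TMinusInv hσ.reflect.neg
  refine ⟨-(J.comp (U.comp J)), fun f g hfg => ?_⟩
  have h1 := hJ _ _ (hU _ _ (hJ f g hfg))
  refine (Lp.coeFn_neg _).trans ?_
  filter_upwards [h1] with p hp
  rw [Pi.neg_apply, TPlusInv_eq_reflect]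
  exact congrArg Neg.neg hp

theorem EMinus_forth (σ : Vec d × Vec d → ℝ) (p : Vec d × Vec d) (t : ℝ) :
    EMinus σ (p.1 + t • p.2, p.2) t = EPlus (fun q => -σ q) p t := by
  unfold EMinus EPlus
  have := intervalIntegral.integral_comp_sub_left
    (fun s => σ (p.1 + s • p.2, p.2)) (a := 0) (b := t) t
  rw [sub_zero, sub_self] at this
  rw [intervalIntegral.integral_neg, ← this]
  congr 2
  refine intervalIntegral.integral_congr fun s _ => ?_
  simp only [sub_smul, add_sub_assoc]

theorem integrable_chord_mul (h : Admissible X V ν) {a b : ℝ} {σ f g : Vec d × Vec d → ℝ}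
    (hσ : BoundedBy a b σ) (hf : MemLp f 2 (phaseMeasure X ν))
    (hg : MemLp g 2 (phaseMeasure X ν)) :
    Integrable (fun z : (Vec d × Vec d) × ℝ =>
      f z.1 * (EMinus σ z.1 z.2 * g (z.1.1 - z.2 • z.1.2, z.1.2)))
      (chordMeasure (phaseMeasure X ν) (tauMinus X)) := by
  have := h.sFinite_phase
  have hfst : ∀ {u : Vec d × Vec d → ℝ} {τ : Vec d × Vec d → ℝ}, MemLp u 2 (phaseMeasure X ν) →
      AEStronglyMeasurable (fun z : (Vec d × Vec d) × ℝ => u z.1)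
      (chordMeasure (phaseMeasure X ν) τ) := fun hu =>
    (hu.1.comp_quasiMeasurePreserving Measure.quasiMeasurePreserving_fst).mono_measure
      Measure.restrict_le_self
  have hm : AEStronglyMeasurable (fun z : (Vec d × Vec d) × ℝ =>
      f z.1 * (EMinus σ z.1 z.2 * g (z.1.1 - z.2 • z.1.2, z.1.2)))
      (chordMeasure (phaseMeasure X ν) (tauMinus X)) :=
    (hfst hf).mul (hσ.measurable_EMinus.aestronglyMeasurable.mul
      ((hfst hg).comp_quasiMeasurePreserving h.measurePreserving_back.quasiMeasurePreserving))
  obtain ⟨D, hD, hDt⟩ := h.exists_tau_le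
  set B := Real.exp (|a| * D) with hB
  refine ⟨hm, ?_⟩
  rw [hasFiniteIntegral_iff_enorm, lintegral_chordMeasure (measurable_tauMinus h.isOpen) hm.enorm]
  have h1 : ∀ᵐ p ∂phaseMeasure X ν, (∫⁻ t in Ioo 0 (tauMinus X p),
      ‖f p * (EMinus σ p t * g (p.1 - t • p.2, p.2))‖ₑ) ≤
      ENNReal.ofReal B * (‖f p‖ₑ ^ 2 * ENNReal.ofReal D +
        ∫⁻ t in Ioo 0 (tauMinus X p), 1 * ‖g (p.1 - t • p.2, p.2)‖ₑ ^ 2) := by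
    filter_upwards [h.ae_phase] with p hp
    have h2 : ∀ t ∈ Ioo 0 (tauMinus X p), ‖f p * (EMinus σ p t * g (p.1 - t • p.2, p.2))‖ₑ ≤
        ENNReal.ofReal B * (‖f p‖ₑ ^ 2 + 1 * ‖g (p.1 - t • p.2, p.2)‖ₑ ^ 2) := by
      intro t ht
      have h3 : EMinus σ p t ≤ B := by
        refine (hσ.EMinus_le p ht.1.le).trans (Real.exp_le_exp.2 ?_)
        have h2 : -a * t ≤ |a| * t := mul_le_mul_of_nonneg_right (neg_le_abs a) ht.1.le
        have h3 : |a| * t ≤ |a| * D :=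
          mul_le_mul_of_nonneg_left (ht.2.le.trans (hDt p hp.2).2) (abs_nonneg a)
        linarith
      have hE : 0 < EMinus σ p t := Real.exp_pos _
      simp only [← ofReal_norm, Real.norm_eq_abs, ← ENNReal.ofReal_pow (abs_nonneg _),
        one_mul]
      rw [← ENNReal.ofReal_add (by positivity) (by positivity), ← ENNReal.ofReal_mul (by positivity)]
      refine ENNReal.ofReal_le_ofReal ?_
      rw [abs_mul, abs_mul, abs_of_pos hE, sq_abs, sq_abs, mul_left_comm]
      refine mul_le_mul h3 ?_ (by positivity) (by positivity)
      nlinarith [sq_nonneg (|f p| - |g (p.1 - t • p.2, p.2)|), sq_abs (f p),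
        sq_abs (g (p.1 - t • p.2, p.2)), sq_nonneg (f p), sq_nonneg (g (p.1 - t • p.2, p.2))]
    refine (setLIntegral_mono' measurableSet_Ioo h2).trans ?_
    rw [lintegral_const_mul' _ _ ENNReal.ofReal_ne_top, lintegral_add_left measurable_const,
      setLIntegral_const]
    gcongr
    simpa using ENNReal.ofReal_le_ofReal (hDt p hp.2).2
  refine (lintegral_mono_ae h1).trans_lt ?_
  rw [lintegral_const_mul' _ _ ENNReal.ofReal_ne_top, lintegral_add_left' (by
      exact (hf.1.enorm.pow_const 2).mul_const _), lintegral_mul_const' _ _ ENNReal.ofReal_ne_top,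
    h.lintegral_back (F := fun p => ‖g p‖ₑ ^ 2) measurable_const (hg.1.enorm.pow_const 2)]
  refine ENNReal.mul_lt_top ENNReal.ofReal_lt_top (ENNReal.add_lt_top.2 ⟨ENNReal.mul_lt_top
    (lintegral_enorm_sq_lt_top hf) ENNReal.ofReal_lt_top, ?_⟩)
  have h4 : ∀ᵐ p ∂phaseMeasure X ν, ‖g p‖ₑ ^ 2 * (∫⁻ _ in Ioo 0 (tauPlus X p), 1) ≤
      ‖g p‖ₑ ^ 2 * ENNReal.ofReal D := by
    filter_upwards [h.ae_phase] with p hp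
    gcongr
    simpa using ENNReal.ofReal_le_ofReal (hDt p hp.2).1
  refine (lintegral_mono_ae h4).trans_lt ?_
  rw [lintegral_mul_const' _ _ ENNReal.ofReal_ne_top]
  exact ENNReal.mul_lt_top (lintegral_enorm_sq_lt_top hg) ENNReal.ofReal_lt_top

/-- Both sides are one integral over pairs of points on a chord, indexed by the later or by the
earlier point; `EMinus_forth` identifies the weights. The sign is the one in the definition of
`TPlusInv`. -/
theorem integral_mul_TMinusInv (h : Admissible X V ν) {a b : ℝ} {σ f g : Vec d × Vec d → ℝ}
    (hσ : BoundedBy a b σ) (hf : MemLp f 2 (phaseMeasure X ν))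
    (hg : MemLp g 2 (phaseMeasure X ν)) :
    ∫ p, f p * TMinusInv X σ g p ∂phaseMeasure X ν =
      -∫ p, TPlusInv X (fun q => -σ q) f p * g p ∂phaseMeasure X ν := by
  have := h.sFinite_phase
  have hi := h.integrable_chord_mul hσ hf hg
  have h1 := integral_chordMeasure (measurable_tauMinus h.isOpen) (tauMinus_nonneg X) hi
  rw [← h.measurePreserving_forth.map_eq] at hi
  have h2 := integral_map h.measurePreserving_forth.measurable.aemeasurable hi.1
  have hi' := h.measurePreserving_forth.integrable_comp_of_integrable
    (h.measurePreserving_forth.map_eq ▸ hi)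
  rw [h.measurePreserving_forth.map_eq] at h2
  have h3 := integral_chordMeasure (measurable_tauPlus h.isOpen) (tauPlus_nonneg X) hi'
  rw [h1] at h2
  have h4 : ∫ p, f p * TMinusInv X σ g p ∂phaseMeasure X ν =
      ∫ p, (∫ t in (0 : ℝ)..tauMinus X p, f p * (EMinus σ p t * g (p.1 - t • p.2, p.2)))
        ∂phaseMeasure X ν := by
    refine integral_congr_ae (ae_of_all _ fun p => ?_)
    simp only [TMinusInv]
    rw [intervalIntegral.integral_const_mul]
  rw [h4, h2]
  refine h3.trans ?_
  rw [← integral_neg]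
  refine integral_congr_ae (ae_of_all _ fun p => ?_)
  simp only [TPlusInv, Function.comp]
  rw [neg_mul, neg_neg, ← intervalIntegral.integral_mul_const]
  refine intervalIntegral.integral_congr fun t _ => ?_
  simp only [add_sub_cancel_right]
  rw [EMinus_forth]
  ring

/-! ### Symmetry properties of the scattering operator -/

theorem KOp_reflect (h : Admissible X V ν) {k : Vec d × Vec d × Vec d → ℝ}
    (hk : IsSymmetricEvenKernel X ν k) (u : Vec d × Vec d → ℝ) :
    ∀ᵐ p ∂phaseMeasure X ν, KOp ν k u (reflect p) = KOp ν k u p := by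
  filter_upwards [h.ae_kernel hk] with p hp
  refine integral_congr_ae ?_
  filter_upwards [hp] with v' hv'
  simp only [reflect]
  rw [hv'.2]

/-- On functions of position alone, symmetry of k makes K multiplication by σ_s. This is why the
test function for the quadratic form depends on x only: K is then controlled from below by M₁. -/
theorem KOp_position (h : Admissible X V ν) {k : Vec d × Vec d × Vec d → ℝ}
    (hk : IsSymmetricEvenKernel X ν k) (w : Vec d → ℝ) :
    KOp ν k (fun p => w p.1) =ᵐ[phaseMeasure X ν] fun p => w p.1 * sigmaS ν k p := by
  filter_upwards [h.ae_kernel hk] with p hp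
  unfold KOp sigmaS
  rw [← integral_const_mul]
  refine integral_congr_ae ?_
  filter_upwards [hp] with v' hv'
  rw [hv'.1, mul_comm]

theorem integrable_kernel_mul (h : Admissible X V ν) {k : Vec d × Vec d × Vec d → ℝ} {M : ℝ}
    (hk : KernelBound X ν k M) {f g : Vec d × Vec d → ℝ} (hf : MemLp f 2 (phaseMeasure X ν))
    (hg : MemLp g 2 (phaseMeasure X ν)) :
    Integrable (fun z : (Vec d × Vec d) × Vec d =>
      k (z.1.1, z.2, z.1.2) * f (z.1.1, z.2) * g z.1) ((phaseMeasure X ν).prod ν) := by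
  have := h.finite
  have := h.sFinite_phase
  have hmp : MeasurePreserving (fun z : (Vec d × Vec d) × Vec d => ((z.1.1, z.2), z.1.2))
      ((phaseMeasure X ν).prod ν) ((phaseMeasure X ν).prod ν) :=
    ((measurePreserving_prodAssoc (volume.restrict X) ν ν).symm MeasurableEquiv.prodAssoc).comp
      (((MeasurePreserving.id (volume.restrict X)).prod (Measure.measurePreserving_swap
        (μ := ν) (ν := ν))).comp (measurePreserving_prodAssoc (volume.restrict X) ν ν))
  have hfst : ∀ {u : Vec d × Vec d → ℝ}, MemLp u 2 (phaseMeasure X ν) →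
      AEStronglyMeasurable (fun z : (Vec d × Vec d) × Vec d => u z.1) ((phaseMeasure X ν).prod ν) :=
    fun hu => hu.1.comp_quasiMeasurePreserving Measure.quasiMeasurePreserving_fst
  have hm1 : AEStronglyMeasurable (fun z : (Vec d × Vec d) × Vec d =>
      k (z.1.1, z.2, z.1.2) * f (z.1.1, z.2)) ((phaseMeasure X ν).prod ν) :=
    (hk.1.comp (by fun_prop)).aestronglyMeasurable.mul
      ((hfst hf).comp_quasiMeasurePreserving hmp.quasiMeasurePreserving)
  refine ⟨hm1.mul (hfst hg), ?_⟩
  have habs : KernelBound X ν (fun q => |k q|) M := ⟨hk.1.norm, by simpa using hk.2⟩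
  have hfa : MemLp (fun p => |f p|) 2 (phaseMeasure X ν) := hf.norm
  have h1 := h.lintegral_sq_KOp_le habs hfa
  rw [hasFiniteIntegral_iff_enorm, lintegral_prod (fun z : (Vec d × Vec d) × Vec d =>
    ‖k (z.1.1, z.2, z.1.2) * f (z.1.1, z.2) * g z.1‖ₑ) (hm1.mul (hfst hg)).enorm]
  have h2 : ∀ᵐ p ∂phaseMeasure X ν, ∫⁻ v', ‖k (p.1, v', p.2) * f (p.1, v') * g p‖ₑ ∂ν =
      ‖KOp ν (fun q => |k q|) (fun p => |f p|) p‖ₑ * ‖g p‖ₑ := by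
    filter_upwards [h.ae_integrable_KOp hk hf] with p hp
    simp_rw [enorm_mul (_ * _)]
    rw [lintegral_mul_const' _ _ enorm_ne_top, ← ofReal_integral_norm_eq_lintegral_enorm hp, KOp,
      Real.enorm_eq_ofReal (integral_nonneg fun _ => mul_nonneg (abs_nonneg _) (abs_nonneg _))]
    simp only [Real.norm_eq_abs, abs_mul]
  rw [lintegral_congr_ae h2]
  have h3 := sq_lintegral_mul_le (m := phaseMeasure X ν)
    (h.aestronglyMeasurable_KOp habs.1 hfa.1).enorm hg.1.enorm
  have h4 := h3.trans_lt (ENNReal.mul_lt_top (h1.trans_lt (ENNReal.mul_lt_top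
    (ENNReal.pow_lt_top ENNReal.ofReal_lt_top) (lintegral_enorm_sq_lt_top hfa)))
    (lintegral_enorm_sq_lt_top hg))
  exact (ENNReal.pow_lt_top_iff.1 h4).resolve_right (by norm_num)

theorem integral_KOp_mul (h : Admissible X V ν) {k : Vec d × Vec d × Vec d → ℝ} {M : ℝ}
    (hk : KernelBound X ν k M) (hks : IsSymmetricEvenKernel X ν k) {f g : Vec d × Vec d → ℝ}
    (hf : MemLp f 2 (phaseMeasure X ν)) (hg : MemLp g 2 (phaseMeasure X ν)) :
    ∫ p, KOp ν k f p * g p ∂phaseMeasure X ν = ∫ p, f p * KOp ν k g p ∂phaseMeasure X ν := by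
  have := h.finite
  have := h.sFinite_phase
  have hmp : MeasurePreserving (fun z : (Vec d × Vec d) × Vec d => ((z.1.1, z.2), z.1.2))
      ((phaseMeasure X ν).prod ν) ((phaseMeasure X ν).prod ν) :=
    ((measurePreserving_prodAssoc (volume.restrict X) ν ν).symm MeasurableEquiv.prodAssoc).comp
      (((MeasurePreserving.id (volume.restrict X)).prod (Measure.measurePreserving_swap
        (μ := ν) (ν := ν))).comp (measurePreserving_prodAssoc (volume.restrict X) ν ν))
  have hi := h.integrable_kernel_mul hk hf hg
  have h1 := integral_map hmp.measurable.aemeasurable (hmp.map_eq.symm ▸ hi.1)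
  rw [hmp.map_eq, integral_prod _ hi] at h1
  have hi' := hmp.integrable_comp_of_integrable hi
  have h2 : ∫ p, KOp ν k f p * g p ∂phaseMeasure X ν =
      ∫ p, (∫ v', k (p.1, v', p.2) * f (p.1, v') * g p ∂ν) ∂phaseMeasure X ν := by
    simp only [KOp, integral_mul_const]
  rw [h2, h1]
  refine (integral_prod _ hi').trans (integral_congr_ae ?_)
  filter_upwards [h.ae_kernel hks] with p hp
  simp only [KOp, Function.comp]
  rw [← integral_const_mul]
  refine integral_congr_ae ?_
  filter_upwards [hp] with v' hv'
  rw [hv'.1]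
  ring

end Admissible

end

section

/-! ### Fourier transform of averages along segments -/

section Fourier

open FourierTransform SchwartzMap

variable {d : ℕ}

/-- Plancherel's theorem for integrable square integrable functions. -/
theorem lintegral_fourier_sq {f : Vec d → ℂ} (h1 : Integrable f) (h2 : MemLp f 2 volume) :
    ∫⁻ ξ, ‖𝓕 f ξ‖ₑ ^ 2 = ∫⁻ x, ‖f x‖ₑ ^ 2 := by
  set F : Lp ℂ 2 (volume : Measure (Vec d)) := 𝓕 (h2.toLp f) with hF
  have hcont : Continuous (𝓕 f) :=
    VectorFourier.fourierIntegral_continuous Real.continuous_fourierChar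
      (innerSL ℝ).continuous₂ h1
  -- The L² transform and the integral transform are compared by testing against smooth compactly
  -- supported g: in both cases the pairing with g moves the transform onto g.
  have hae : ∀ᵐ ξ, F ξ = 𝓕 f ξ := by
    refine ae_eq_of_integral_contDiff_smul_eq ((Lp.memLp F).locallyIntegrable (by norm_num))
      hcont.locallyIntegrable fun g hg hgc => ?_
    have hg1 : HasCompactSupport (Complex.ofRealCLM ∘ g) := hgc.comp_left rfl
    have hg2 : ContDiff ℝ ∞ (Complex.ofRealCLM ∘ g) := by fun_prop
    set G := hg1.toSchwartzMap hg2 with hG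
    have hGx : ∀ x, G x = (g x : ℂ) := fun x => rfl
    have e1 := congrArg (fun T => T G) (Lp.fourier_toTemperedDistribution_eq (h2.toLp f))
    simp only [TemperedDistribution.fourier_apply, Lp.toTemperedDistribution_apply] at e1
    have e2 : ∫ x, 𝓕 G x • (h2.toLp f) x = ∫ x, 𝓕 G x • f x := by
      refine integral_congr_ae ?_
      filter_upwards [h2.coeFn_toLp] with x hx
      rw [hx]
    have e3 := VectorFourier.integral_fourierIntegral_smul_eq_flip (e := Real.fourierChar)
      (L := innerₗ (Vec d)) (μ := volume) (ν := volume) Real.continuous_fourierChar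
      (innerSL ℝ).continuous₂ h1 G.integrable
    have e4 : ∫ ξ, g ξ • F ξ = ∫ ξ, G ξ • F ξ := by
      refine integral_congr_ae (ae_of_all _ fun ξ => ?_)
      simp [hGx]
    rw [e4, ← e1, e2]
    have e5 : ∀ x, 𝓕 G x = VectorFourier.fourierIntegral Real.fourierChar volume
        (innerₗ (Vec d)).flip G x := fun x => by
      rw [flip_innerₗ]; rfl
    simp_rw [e5]
    refine (integral_congr_ae (ae_of_all _ fun x => ?_)).trans
      (e3.symm.trans (integral_congr_ae (ae_of_all _ fun ξ => ?_)))
    · simp only [smul_eq_mul]; ring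
    · simp only [smul_eq_mul, Complex.real_smul, hGx]; rw [mul_comm]; rfl
  have hn : ‖F‖ₑ ^ 2 = ‖h2.toLp f‖ₑ ^ 2 := by
    rw [hF, ← ofReal_norm, Lp.norm_fourier_eq, ofReal_norm]
  have key : ∀ u : Lp ℂ 2 (volume : Measure (Vec d)), ‖u‖ₑ ^ 2 = ∫⁻ x, ‖u x‖ₑ ^ 2 := fun u => by
    rw [Lp.enorm_def, eLpNorm_eq_lintegral_rpow_enorm_toReal (by norm_num) (by norm_num),
      ← ENNReal.rpow_natCast, ← ENNReal.rpow_mul]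
    simp
  rw [key, key] at hn
  calc ∫⁻ ξ, ‖𝓕 f ξ‖ₑ ^ 2 = ∫⁻ ξ, ‖F ξ‖ₑ ^ 2 := lintegral_congr_ae (by
        filter_upwards [hae] with ξ hξ; rw [hξ])
    _ = _ := hn
    _ = _ := lintegral_congr_ae (by filter_upwards [h2.coeFn_toLp] with ξ hξ; rw [hξ])

/-- The average of `w` over the segment from `x - ε v` to `x`. -/
def segmentAverage (ε : ℝ) (w : Vec d → ℝ) (p : Vec d × Vec d) : ℝ :=
  ε⁻¹ * ∫ s in (0 : ℝ)..ε, w (p.1 - s • p.2)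

/-- The Fourier multiplier of averages over segments. -/
def averageSymbol (ε τ : ℝ) : ℂ :=
  (ε : ℂ)⁻¹ * ∫ s in (0 : ℝ)..ε, Complex.exp (((-2 * Real.pi * τ) * Complex.I) * s)

theorem integrable_segment {w : Vec d → ℝ} (hw : Measurable w) (hwi : Integrable w) (v : Vec d)
    (ε : ℝ) : Integrable (fun z : Vec d × ℝ => w (z.1 - z.2 • v))
      (volume.prod (volume.restrict (Ioc 0 ε))) := by
  have hm : Measurable fun z : Vec d × ℝ => w (z.1 - z.2 • v) := hw.comp (by fun_prop)
  refine ⟨hm.aestronglyMeasurable, ?_⟩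
  rw [hasFiniteIntegral_iff_enorm, lintegral_prod_symm _ hm.enorm.aemeasurable]
  have : ∀ s : ℝ, ∫⁻ x : Vec d, ‖w (x - s • v)‖ₑ = ∫⁻ x, ‖w x‖ₑ := fun s =>
    lintegral_sub_right_eq_self (fun x => ‖w x‖ₑ) _
  simp only [this]
  rw [setLIntegral_const]
  exact ENNReal.mul_lt_top hwi.2 (by simp)

/-- Translation by s v multiplies the transform by a character in s v·ξ; Fubini averages these
characters over s. -/
theorem fourier_segmentAverage {ε : ℝ} (hε : 0 < ε) {w : Vec d → ℝ} (hw : Measurable w)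
    (hwi : Integrable w) (v ξ : Vec d) :
    𝓕 (fun x => (segmentAverage ε w (x, v) : ℂ)) ξ =
      averageSymbol ε (inner ℝ v ξ) * 𝓕 (fun x => (w x : ℂ)) ξ := by
  have hi := (integrable_segment hw hwi v ε).ofReal (𝕜 := ℂ)
  have hi2 : Integrable (fun z : Vec d × ℝ =>
      Complex.exp ((↑(-2 * Real.pi * inner ℝ z.1 ξ) * Complex.I)) * (w (z.1 - z.2 • v) : ℂ))
      (volume.prod (volume.restrict (Ioc 0 ε))) := by
    refine hi.bdd_mul (c := 1) (by fun_prop) (ae_of_all _ fun z => ?_)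
    rw [Complex.norm_exp_ofReal_mul_I]
  have h1 : ∀ x : Vec d, Complex.exp ((↑(-2 * Real.pi * inner ℝ x ξ) * Complex.I)) •
      (segmentAverage ε w (x, v) : ℂ) = (ε : ℂ)⁻¹ * ∫ s in Ioc 0 ε,
        Complex.exp ((↑(-2 * Real.pi * inner ℝ x ξ) * Complex.I)) * (w (x - s • v) : ℂ) := by
    intro x
    rw [segmentAverage, intervalIntegral.integral_of_le hε.le, smul_eq_mul,
      Complex.ofReal_mul ε⁻¹, Complex.ofReal_inv, integral_const_mul, ← integral_complex_ofReal]
    ring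
  have h2 : ∀ s : ℝ, ∫ x : Vec d, Complex.exp ((↑(-2 * Real.pi * inner ℝ x ξ) * Complex.I)) *
      (w (x - s • v) : ℂ) = Complex.exp (((-2 * Real.pi * (inner ℝ v ξ : ℝ)) * Complex.I) * s) *
        ∫ x : Vec d, Complex.exp ((↑(-2 * Real.pi * inner ℝ x ξ) * Complex.I)) * (w x : ℂ) := by
    intro s
    rw [← integral_const_mul]
    refine Eq.trans ?_ (integral_sub_right_eq_self _ (s • v))
    refine integral_congr_ae (ae_of_all _ fun x => ?_)
    simp only
    rw [← mul_assoc, ← Complex.exp_add]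
    congr 2
    rw [inner_sub_left, real_inner_smul_left]
    push_cast
    ring
  rw [Real.fourier_eq', Real.fourier_eq']
  simp only [h1]
  rw [integral_const_mul, integral_integral_swap hi2]
  simp only [h2, smul_eq_mul]
  rw [integral_mul_const, averageSymbol, intervalIntegral.integral_of_le hε.le, ← mul_assoc]

theorem continuous_averageSymbol (ε : ℝ) : Continuous (averageSymbol ε) := by
  unfold averageSymbol
  refine continuous_const.mul ?_
  exact intervalIntegral.continuous_parametric_intervalIntegral_of_continuous' (by fun_prop) 0 ε

theorem norm_averageSymbol_le_one {ε : ℝ} (hε : 0 < ε) (τ : ℝ) : ‖averageSymbol ε τ‖ ≤ 1 := by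
  unfold averageSymbol
  rw [norm_mul, norm_inv, Complex.norm_real, Real.norm_of_nonneg hε.le]
  have h := intervalIntegral.norm_integral_le_of_norm_le_const (a := 0) (b := ε) (C := 1)
    (f := fun s : ℝ => Complex.exp (((-2 * Real.pi * τ) * Complex.I) * s)) fun s _ => by
      rw [show ((-2 * Real.pi * τ : ℂ) * Complex.I) * s = ((-2 * Real.pi * τ * s : ℝ) : ℂ) *
        Complex.I by push_cast; ring, Complex.norm_exp_ofReal_mul_I]
  rw [sub_zero, abs_of_pos hε, one_mul] at h
  rw [inv_mul_le_iff₀ hε, mul_one]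
  exact h

theorem tendsto_averageSymbol {ε : ℝ} (hε : 0 < ε) {t : ℕ → ℝ}
    (ht : Tendsto (fun n => |t n|) atTop atTop) :
    Tendsto (fun n => averageSymbol ε (t n)) atTop (𝓝 0) := by
  have hbound : ∀ τ : ℝ, τ ≠ 0 → ‖averageSymbol ε τ‖ ≤ ε⁻¹ * (2 / (2 * Real.pi) * |τ|⁻¹) := by
    intro τ hτ
    have hc : ((-2 * Real.pi * τ : ℂ) * Complex.I) ≠ 0 := by
      simp [hτ, Real.pi_ne_zero]
    unfold averageSymbol
    rw [integral_exp_mul_complex hc, norm_mul, norm_inv, Complex.norm_real,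
      Real.norm_of_nonneg hε.le]
    refine mul_le_mul_of_nonneg_left ?_ (by positivity)
    rw [norm_div]
    have h1 : ‖((-2 * Real.pi * τ : ℂ) * Complex.I)‖ = 2 * Real.pi * |τ| := by
      simp [abs_of_pos Real.pi_pos]
    have h2 : ∀ s : ℝ, ‖Complex.exp ((-2 * Real.pi * τ : ℂ) * Complex.I * s)‖ = 1 := fun s => by
      rw [show ((-2 * Real.pi * τ : ℂ) * Complex.I) * s = ((-2 * Real.pi * τ * s : ℝ) : ℂ) *
        Complex.I by push_cast; ring, Complex.norm_exp_ofReal_mul_I]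
    rw [h1, ← div_eq_mul_inv, div_div]
    have h3 := norm_sub_le (Complex.exp ((-2 * Real.pi * τ : ℂ) * Complex.I * ε))
      (Complex.exp ((-2 * Real.pi * τ : ℂ) * Complex.I * (0 : ℝ)))
    rw [h2, h2] at h3
    gcongr
    linarith
  refine squeeze_zero_norm' ?_ (a := fun n => ε⁻¹ * (2 / (2 * Real.pi) * |t n|⁻¹)) ?_
  · filter_upwards [ht.eventually_gt_atTop 0] with n hn
    exact hbound _ (abs_pos.1 hn)
  · simpa using (ht.inv_tendsto_atTop.const_mul (2 / (2 * Real.pi))).const_mul ε⁻¹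

/-- If hyperplanes through the origin are null, the mean over `v` of the multipliers of averages in
the direction `v` vanishes at infinity. -/
theorem tendsto_lintegral_averageSymbol {ν : Measure (Vec d)}
    (hν : ∀ e : Vec d, e ≠ 0 → ν {v | inner ℝ e v = 0} = 0) {g : Vec d → ℝ} (hg : Measurable g)
    (hg2 : ∫⁻ v, ‖g v‖ₑ ^ 2 ∂ν < ⊤) {ε : ℝ} (hε : 0 < ε) :
    Tendsto (fun ξ => ∫⁻ v, ‖g v‖ₑ ^ 2 * ‖averageSymbol ε (inner ℝ v ξ)‖ₑ ^ 2 ∂ν)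
      (comap norm atTop) (𝓝 0) := by
  refine tendsto_of_subseq_tendsto fun ξ hξ => ?_
  have hξn : Tendsto (fun n => ‖ξ n‖) atTop atTop := tendsto_comap_iff.1 hξ
  -- Along a subsequence the directions ξ/|ξ| converge to a unit vector e. For every v off the null
  -- hyperplane orthogonal to e one has |v·ξ| → ∞, so the symbol tends to 0 and dominated
  -- convergence applies.
  obtain ⟨e, -, φ, hφ, he⟩ := (isCompact_closedBall (0 : Vec d) 1).tendsto_subseq
    (x := fun n => ‖ξ n‖⁻¹ • ξ n) fun n => by
      rw [mem_closedBall_zero_iff, norm_smul, norm_inv, norm_norm]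
      exact inv_mul_le_one
  have hξφ : Tendsto (fun n => ‖ξ (φ n)‖) atTop atTop := hξn.comp hφ.tendsto_atTop
  have hpos : ∀ᶠ n in atTop, 0 < ‖ξ (φ n)‖ := hξφ.eventually_gt_atTop 0
  have hen : ‖e‖ = 1 := by
    refine tendsto_nhds_unique he.norm (tendsto_const_nhds.congr' ?_)
    filter_upwards [hpos] with n hn
    simp only [Function.comp]
    rw [norm_smul, norm_inv, norm_norm, inv_mul_cancel₀ hn.ne']
  have he0 : e ≠ 0 := by
    rintro rfl
    simp at hen
  refine ⟨φ, ?_⟩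
  have hm : ∀ n, Measurable fun v : Vec d =>
      ‖g v‖ₑ ^ 2 * ‖averageSymbol ε (inner ℝ v (ξ (φ n)))‖ₑ ^ 2 := fun n =>
    (hg.enorm.pow_const 2).mul ((((continuous_averageSymbol ε).comp
      (by fun_prop : Continuous fun v : Vec d => inner ℝ v (ξ (φ n)))).enorm.measurable).pow_const 2)
  have h0 : (0 : ℝ≥0∞) = ∫⁻ _ : Vec d, 0 ∂ν := by simp
  rw [h0]
  refine tendsto_lintegral_of_dominated_convergence (fun v => ‖g v‖ₑ ^ 2) hm
    (fun n => ae_of_all _ fun v => ?_) hg2.ne ?_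
  · refine mul_le_of_le_one_right' (pow_le_one' ?_ 2)
    rw [← ofReal_norm]
    exact ENNReal.ofReal_le_one.2 (norm_averageSymbol_le_one hε _)
  · filter_upwards [measure_eq_zero_iff_ae_notMem.1 (hν e he0)] with v hv
    have hv' : inner ℝ e v ≠ 0 := hv
    have h1 : Tendsto (fun n => |inner ℝ v (‖ξ (φ n)‖⁻¹ • ξ (φ n))|) atTop (𝓝 |inner ℝ e v|) := by
      rw [real_inner_comm]
      exact (Filter.Tendsto.inner (𝕜 := ℝ) tendsto_const_nhds he).abs
    have h2 : Tendsto (fun n => |inner ℝ v (ξ (φ n))|) atTop atTop := by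
      refine (hξφ.atTop_mul_pos (abs_pos.2 hv') h1).congr' ?_
      filter_upwards [hpos] with n hn
      rw [real_inner_smul_right, abs_mul, abs_inv, abs_norm, ← mul_assoc, mul_inv_cancel₀ hn.ne',
        one_mul]
    have h3 := (tendsto_averageSymbol hε h2).enorm
    rw [enorm_zero] at h3
    have h4 := ENNReal.Tendsto.const_mul (a := ‖g v‖ₑ ^ 2)
      (ENNReal.Tendsto.pow (n := 2) h3) (Or.inr (by finiteness))
    simpa using h4

end Fourier

end

section

/-! ### Averages of weakly null sequences -/

section Average

open FourierTransform

variable {d : ℕ}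

theorem sq_lintegral_le_of_support {X : Set (Vec d)} (hX : MeasurableSet X) {w : Vec d → ℝ}
    (hw : Measurable w) (hs : ∀ x, x ∉ X → w x = 0) :
    (∫⁻ x, ‖w x‖ₑ) ^ 2 ≤ volume X * ∫⁻ x, ‖w x‖ₑ ^ 2 := by
  have h1 := sq_lintegral_mul_le (m := (volume : Measure (Vec d)))
    (f := X.indicator 1) (g := fun x => ‖w x‖ₑ) (measurable_one.indicator hX).aemeasurable
    hw.enorm.aemeasurable
  have h2 : ∀ x, X.indicator (1 : Vec d → ℝ≥0∞) x * ‖w x‖ₑ = ‖w x‖ₑ := fun x => by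
    by_cases hx : x ∈ X
    · simp [hx]
    · simp [hx, hs x hx]
  have h3 : ∀ x, X.indicator (1 : Vec d → ℝ≥0∞) x ^ 2 = X.indicator 1 x := fun x => by
    by_cases hx : x ∈ X <;> simp [hx]
  simp only [h2, h3, lintegral_indicator_one hX] at h1
  exact h1

theorem measurable_segmentAverage (ε : ℝ) {w : Vec d → ℝ} (hw : Measurable w) :
    Measurable (segmentAverage ε w) := by
  unfold segmentAverage
  refine measurable_const.mul ?_
  have h1 : Measurable fun z : (Vec d × Vec d) × ℝ => w (z.1.1 - z.2 • z.1.2) :=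
    hw.comp (by fun_prop)
  have h2 := fun m : Measure ℝ => fun [SFinite m] =>
    (h1.stronglyMeasurable.integral_prod_right' (ν := m)).measurable
  unfold intervalIntegral
  exact (h2 _).sub (h2 _)

theorem integrable_segmentAverage {ε : ℝ} (hε : 0 < ε) {w : Vec d → ℝ} (hw : Measurable w)
    (hwi : Integrable w) (v : Vec d) : Integrable fun x => segmentAverage ε w (x, v) := by
  unfold segmentAverage
  refine Integrable.const_mul ?_ _
  simp only [intervalIntegral.integral_of_le hε.le]
  exact (integrable_segment hw hwi v ε).integral_prod_left

theorem lintegral_sq_segmentAverage_lt_top {ε : ℝ} (hε : 0 < ε) {w : Vec d → ℝ}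
    (hw : Measurable w) (hw2 : ∫⁻ x, ‖w x‖ₑ ^ 2 < ⊤) (v : Vec d) :
    ∫⁻ x, ‖segmentAverage ε w (x, v)‖ₑ ^ 2 < ⊤ := by
  have hm : Measurable fun z : Vec d × ℝ => ‖w (z.1 - z.2 • v)‖ₑ ^ 2 :=
    (hw.comp (by fun_prop)).enorm.pow_const 2
  have h1 : ∀ x, ‖segmentAverage ε w (x, v)‖ₑ ^ 2 ≤
      ‖ε⁻¹‖ₑ ^ 2 * (ENNReal.ofReal ε * ∫⁻ s in Ioc 0 ε, ‖w (x - s • v)‖ₑ ^ 2) := fun x => by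
    rw [segmentAverage, enorm_mul, mul_pow, intervalIntegral.integral_of_le hε.le]
    gcongr
    refine (pow_le_pow_left' (enorm_integral_le_lintegral_enorm _) 2).trans ?_
    have := sq_lintegral_mul_le (m := volume.restrict (Ioc 0 ε)) (f := fun _ => 1)
      (g := fun s => ‖w (x - s • v)‖ₑ) aemeasurable_const
      (hw.comp (by fun_prop)).enorm.aemeasurable
    simpa using this
  refine (lintegral_mono h1).trans_lt ?_
  rw [lintegral_const_mul' _ _ (by finiteness), lintegral_const_mul' _ _ (by finiteness),
    lintegral_lintegral_swap hm.aemeasurable]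
  have : ∀ s : ℝ, ∫⁻ x : Vec d, ‖w (x - s • v)‖ₑ ^ 2 = ∫⁻ x, ‖w x‖ₑ ^ 2 := fun s =>
    lintegral_sub_right_eq_self (fun x => ‖w x‖ₑ ^ 2) _
  simp only [this]
  rw [setLIntegral_const, Real.volume_Ioc]
  finiteness

theorem lintegral_sq_segmentAverage_eq {ε : ℝ} (hε : 0 < ε) {w : Vec d → ℝ} (hw : Measurable w)
    (hwi : Integrable w) (hw2 : ∫⁻ x, ‖w x‖ₑ ^ 2 < ⊤) (v : Vec d) :
    ∫⁻ x, ‖segmentAverage ε w (x, v)‖ₑ ^ 2 =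
      ∫⁻ ξ, ‖averageSymbol ε (inner ℝ v ξ)‖ₑ ^ 2 * ‖𝓕 (fun x => (w x : ℂ)) ξ‖ₑ ^ 2 := by
  have hi := integrable_segmentAverage hε hw hwi v
  have h2 := memLp_two_of_lintegral hi.1 (lintegral_sq_segmentAverage_lt_top hε hw hw2 v)
  have h3 := lintegral_fourier_sq hi.ofReal h2.ofReal
  have h4 : ∀ r : ℝ, ‖(r : ℂ)‖ₑ = ‖r‖ₑ := fun r => by
    rw [← ofReal_norm, Complex.norm_real, ofReal_norm]
  simp only [RCLike.ofReal_eq_complex_ofReal] at h3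
  rw [funext (fun x => congrArg (· ^ 2) (h4 (segmentAverage ε w (x, v))))] at h3
  rw [← h3]
  refine lintegral_congr fun ξ => ?_
  have h5 := fourier_segmentAverage hε hw hwi v ξ
  rw [h5, enorm_mul, mul_pow]

/-- The value at ξ is the pairing with a cosine and a sine, both bounded continuous test functions.
-/
theorem tendsto_fourier_of_weak {w : ℕ → Vec d → ℝ} (hwi : ∀ n, Integrable (w n))
    (hweak : ∀ ψ : Vec d → ℝ, Continuous ψ → (∀ x, |ψ x| ≤ 1) →
      Tendsto (fun n => ∫ x, w n x * ψ x) atTop (𝓝 0)) (ξ : Vec d) :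
    Tendsto (fun n => 𝓕 (fun x => (w n x : ℂ)) ξ) atTop (𝓝 0) := by
  set θ : Vec d → ℝ := fun x => -2 * Real.pi * inner ℝ x ξ with hθ
  have hθc : Continuous θ := by fun_prop
  have hi : ∀ n, Integrable fun x => (w n x * Real.cos (θ x) : ℝ) := fun n =>
    (hwi n).mul_bdd (c := 1) (by fun_prop) (ae_of_all _ fun x => Real.abs_cos_le_one _)
  have hi' : ∀ n, Integrable fun x => (w n x * Real.sin (θ x) : ℝ) := fun n =>
    (hwi n).mul_bdd (c := 1) (by fun_prop) (ae_of_all _ fun x => Real.abs_sin_le_one _)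
  have heq : ∀ n, 𝓕 (fun x => (w n x : ℂ)) ξ =
      ((∫ x, w n x * Real.cos (θ x) : ℝ) : ℂ) + ((∫ x, w n x * Real.sin (θ x) : ℝ) : ℂ) *
        Complex.I := fun n => by
    rw [Real.fourier_eq', ← integral_complex_ofReal, ← integral_complex_ofReal,
      ← integral_mul_const, ← integral_add (hi n).ofReal ((hi' n).ofReal.mul_const _)]
    refine integral_congr_ae (ae_of_all _ fun x => ?_)
    change Complex.exp ((θ x : ℂ) * Complex.I) * (w n x : ℂ) = _
    simp only
    rw [Complex.exp_mul_I, ← Complex.ofReal_cos, ← Complex.ofReal_sin]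
    push_cast
    ring
  have h1 := hweak (fun x => Real.cos (θ x)) (by fun_prop) fun x => Real.abs_cos_le_one _
  have h2 := hweak (fun x => Real.sin (θ x)) (by fun_prop) fun x => Real.abs_sin_le_one _
  have h3 := ((Complex.continuous_ofReal.tendsto 0).comp h1).add
    (((Complex.continuous_ofReal.tendsto 0).comp h2).mul_const Complex.I)
  simp only [Complex.ofReal_zero, zero_mul, add_zero] at h3
  refine h3.congr fun n => ?_
  rw [heq]
  rfl

/-- Averages of weakly null sequences over segments tend to zero strongly, in mean over the
directions. -/
theorem tendsto_lintegral_segmentAverage {ν : Measure (Vec d)} [SFinite ν]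
    (hν : ∀ e : Vec d, e ≠ 0 → ν {v | inner ℝ e v = 0} = 0) {g : Vec d → ℝ} (hg : Measurable g)
    (hg2 : ∫⁻ v, ‖g v‖ₑ ^ 2 ∂ν < ⊤) {ε : ℝ} (hε : 0 < ε) {X : Set (Vec d)}
    (hX : MeasurableSet X) (hXb : Bornology.IsBounded X) {w : ℕ → Vec d → ℝ}
    (hw : ∀ n, Measurable (w n)) (hs : ∀ n x, x ∉ X → w n x = 0) {M : ℝ≥0∞} (hM : M ≠ ⊤)
    (hwM : ∀ n, ∫⁻ x, ‖w n x‖ₑ ^ 2 ≤ M)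
    (hweak : ∀ ψ : Vec d → ℝ, Continuous ψ → (∀ x, |ψ x| ≤ 1) →
      Tendsto (fun n => ∫ x, w n x * ψ x) atTop (𝓝 0)) :
    Tendsto (fun n => ∫⁻ v, ‖g v‖ₑ ^ 2 * (∫⁻ x, ‖segmentAverage ε (w n) (x, v)‖ₑ ^ 2) ∂ν)
      atTop (𝓝 0) := by
  have hXf : volume X ≠ ⊤ := hXb.measure_lt_top.ne
  have hw1 : ∀ n, (∫⁻ x, ‖w n x‖ₑ) ^ 2 ≤ volume X * M := fun n =>
    (sq_lintegral_le_of_support hX (hw n) (hs n)).trans (by gcongr; exact hwM n)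
  have hwi : ∀ n, Integrable (w n) := fun n => ⟨(hw n).aestronglyMeasurable,
    (ENNReal.pow_lt_top_iff.1 ((hw1 n).trans_lt (by finiteness))).resolve_right (by norm_num)⟩
  have hFc : ∀ n, Continuous (𝓕 fun x => (w n x : ℂ)) := fun n =>
    VectorFourier.fourierIntegral_continuous Real.continuous_fourierChar
      (innerSL ℝ).continuous₂ (hwi n).ofReal
  have hF1 : ∀ n ξ, ‖𝓕 (fun x => (w n x : ℂ)) ξ‖ₑ ^ 2 ≤ volume X * M := fun n ξ => by
    refine (pow_le_pow_left' ?_ 2).trans (hw1 n)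
    rw [Real.fourier_eq]
    refine (enorm_integral_le_lintegral_enorm _).trans (lintegral_mono fun x => ?_)
    rw [← ofReal_norm, ← ofReal_norm, Circle.norm_smul, Complex.norm_real]
  have hF2 : ∀ n, ∫⁻ ξ, ‖𝓕 (fun x => (w n x : ℂ)) ξ‖ₑ ^ 2 ≤ M := fun n => by
    have h2 := memLp_two_of_lintegral (hwi n).1 ((hwM n).trans_lt hM.lt_top)
    refine (lintegral_fourier_sq (hwi n).ofReal h2.ofReal).le.trans (le_trans (le_of_eq ?_) (hwM n))
    refine lintegral_congr fun x => ?_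
    rw [← ofReal_norm, ← ofReal_norm]
    simp
  set m : Vec d → ℝ≥0∞ := fun ξ => ∫⁻ v, ‖g v‖ₑ ^ 2 * ‖averageSymbol ε (inner ℝ v ξ)‖ₑ ^ 2 ∂ν
    with hm
  have hker : Measurable fun z : Vec d × Vec d =>
      ‖g z.1‖ₑ ^ 2 * ‖averageSymbol ε (inner ℝ z.1 z.2)‖ₑ ^ 2 :=
    ((hg.comp measurable_fst).enorm.pow_const 2).mul ((((continuous_averageSymbol ε).comp
      (by fun_prop : Continuous fun z : Vec d × Vec d => inner ℝ z.1 z.2)).enorm.measurable).pow_const 2)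
  have heq : ∀ n, ∫⁻ v, ‖g v‖ₑ ^ 2 * (∫⁻ x, ‖segmentAverage ε (w n) (x, v)‖ₑ ^ 2) ∂ν =
      ∫⁻ ξ, m ξ * ‖𝓕 (fun x => (w n x : ℂ)) ξ‖ₑ ^ 2 := fun n => by
    have h1 : ∀ v, ‖g v‖ₑ ^ 2 * (∫⁻ x, ‖segmentAverage ε (w n) (x, v)‖ₑ ^ 2) =
        ∫⁻ ξ, ‖g v‖ₑ ^ 2 * ‖averageSymbol ε (inner ℝ v ξ)‖ₑ ^ 2 *
          ‖𝓕 (fun x => (w n x : ℂ)) ξ‖ₑ ^ 2 := fun v => by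
      rw [lintegral_sq_segmentAverage_eq hε (hw n) (hwi n) ((hwM n).trans_lt hM.lt_top),
        ← lintegral_const_mul' _ _ (by finiteness)]
      simp only [mul_assoc]
    simp only [h1]
    rw [lintegral_lintegral_swap (hker.mul
      (((hFc n).comp continuous_snd).enorm.measurable.pow_const 2)).aemeasurable]
    refine lintegral_congr fun ξ => ?_
    rw [lintegral_mul_const' _ _ (by finiteness)]
  simp only [heq]
  rw [ENNReal.tendsto_nhds_zero]
  intro δ hδ
  -- Bound on the mean symbol at high frequencies: as ∫|ŵₙ|² ≤ M, these contribute at most δ/2. The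
  -- summand 1 keeps the denominator away from zero.
  set δ' := δ / 2 / (M + 1) with hδ'
  have hδ'0 : 0 < δ' := ENNReal.div_pos (ENNReal.half_pos hδ.ne').ne' (by finiteness)
  have h1 := (ENNReal.tendsto_nhds_zero.1 (tendsto_lintegral_averageSymbol hν hg hg2 hε)) δ' hδ'0
  obtain ⟨R, hR⟩ := eventually_atTop.1 (eventually_comap.1 h1)
  set G := ∫⁻ v, ‖g v‖ₑ ^ 2 ∂ν with hG
  have hmG : ∀ ξ, m ξ ≤ G := fun ξ => lintegral_mono fun v => by
    refine mul_le_of_le_one_right' (pow_le_one' ?_ 2)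
    rw [← ofReal_norm]
    exact ENNReal.ofReal_le_one.2 (norm_averageSymbol_le_one hε _)
  -- At low frequencies the transforms tend to 0 pointwise and are uniformly bounded, since the wₙ
  -- live on a bounded set and so are bounded in L¹.
  have h2 : Tendsto (fun n => ∫⁻ ξ in Metric.ball 0 R, G * ‖𝓕 (fun x => (w n x : ℂ)) ξ‖ₑ ^ 2)
      atTop (𝓝 0) := by
    have h0 : (0 : ℝ≥0∞) = ∫⁻ _ in Metric.ball (0 : Vec d) R, 0 := by simp
    rw [h0]
    refine tendsto_lintegral_of_dominated_convergence (fun _ => G * (volume X * M))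
      (fun n => measurable_const.mul ((hFc n).enorm.measurable.pow_const 2))
      (fun n => ae_of_all _ fun ξ => mul_le_mul' le_rfl (hF1 n ξ)) ?_ (ae_of_all _ fun ξ => ?_)
    · rw [setLIntegral_const]
      have := (Metric.isBounded_ball (x := (0 : Vec d)) (r := R)).measure_lt_top (μ := volume)
      finiteness
    · have h3 := (tendsto_fourier_of_weak hwi hweak ξ).enorm
      rw [enorm_zero] at h3
      have h4 := ENNReal.Tendsto.const_mul (a := G) (ENNReal.Tendsto.pow (n := 2) h3)
        (Or.inr hg2.ne)
      simpa using h4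
  filter_upwards [ENNReal.tendsto_nhds_zero.1 h2 (δ / 2) (ENNReal.half_pos hδ.ne')] with n hn
  have h3 : ∀ ξ, m ξ * ‖𝓕 (fun x => (w n x : ℂ)) ξ‖ₑ ^ 2 ≤
      (Metric.ball 0 R).indicator (fun ξ => G * ‖𝓕 (fun x => (w n x : ℂ)) ξ‖ₑ ^ 2) ξ +
        δ' * ‖𝓕 (fun x => (w n x : ℂ)) ξ‖ₑ ^ 2 := fun ξ => by
    by_cases hξ : ξ ∈ Metric.ball (0 : Vec d) R
    · rw [indicator_of_mem hξ]
      exact le_add_right (by gcongr; exact hmG ξ)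
    · rw [indicator_of_notMem hξ, zero_add]
      gcongr
      exact hR ‖ξ‖ (by simpa using hξ) ξ rfl
  refine (lintegral_mono h3).trans ?_
  rw [lintegral_add_left (f := (Metric.ball 0 R).indicator
    (fun ξ => G * ‖𝓕 (fun x => (w n x : ℂ)) ξ‖ₑ ^ 2))
    ((measurable_const.mul ((hFc n).enorm.measurable.pow_const 2)).indicator measurableSet_ball), lintegral_indicator measurableSet_ball,
    lintegral_const_mul δ' ((hFc n).enorm.measurable.pow_const 2)]
  calc _ ≤ δ / 2 + δ' * (M + 1) := by
        gcongr
        exact (hF2 n).trans le_self_add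
    _ ≤ δ / 2 + δ / 2 := by
        gcongr
        exact (ENNReal.div_mul_cancel (by simp) (by finiteness)).le
    _ = δ := ENNReal.add_halves δ

end Average

end

section

/-! ### Regularity of integrals along characteristics -/

/-- After the cut-off, E may jump at 0 and at τ, and each jump costs A² on an interval of length s.
In between, the Lipschitz bound costs L²s² ≤ L²s pointwise. -/
theorem lintegral_sq_sub_translate_le {E : ℝ → ℝ} {A L τ s : ℝ} (hEA : ∀ t ∈ Icc 0 τ, |E t| ≤ A)
    (hEL : ∀ r ∈ Icc 0 τ, ∀ t ∈ Icc 0 τ, |E t - E r| ≤ L * |t - r|) (hτ : 0 ≤ τ) (hs : 0 < s)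
    (hs1 : s ≤ 1) :
    ∫⁻ t, ‖(Ioc 0 τ).indicator E t - (Ioc 0 τ).indicator E (t - s)‖ₑ ^ 2 ≤
      ENNReal.ofReal ((2 * A ^ 2 + L ^ 2 * τ) * s) := by
  have h1 : ∀ t, ‖(Ioc 0 τ).indicator E t - (Ioc 0 τ).indicator E (t - s)‖ₑ ^ 2 ≤
      (Ioc 0 s).indicator (fun _ => ENNReal.ofReal (A ^ 2)) t +
      ((Ioc τ (τ + s)).indicator (fun _ => ENNReal.ofReal (A ^ 2)) t +
      (Ioc 0 τ).indicator (fun _ => ENNReal.ofReal (L ^ 2 * s)) t) := by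
    intro t
    have hsq : ∀ y c : ℝ, |y| ≤ c → ‖y‖ₑ ^ 2 ≤ ENNReal.ofReal (c ^ 2) := fun y c hy => by
      rw [← ofReal_norm, ← ENNReal.ofReal_pow (norm_nonneg _)]
      exact ENNReal.ofReal_le_ofReal (pow_le_pow_left₀ (norm_nonneg _) hy 2)
    by_cases h : t ∈ Ioc 0 τ
    · rw [indicator_of_mem h (f := E)]
      by_cases h' : t - s ∈ Ioc 0 τ
      · rw [indicator_of_mem h', indicator_of_mem h]
        refine le_add_left (le_add_left ?_)
        refine (hsq _ _ (hEL _ ⟨h'.1.le, h'.2⟩ _ ⟨h.1.le, h.2⟩)).trans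
          (ENNReal.ofReal_le_ofReal ?_)
        rw [sub_sub_cancel, abs_of_pos hs, mul_pow]
        have : s ^ 2 ≤ s := by nlinarith
        gcongr
      · rw [indicator_of_notMem h', sub_zero]
        have h2 : t ∈ Ioc 0 s := ⟨h.1, by
          by_contra! hc
          exact h' ⟨by linarith, by linarith [h.2]⟩⟩
        rw [indicator_of_mem h2]
        exact le_add_right (hsq _ _ (hEA t ⟨h.1.le, h.2⟩))
    · rw [indicator_of_notMem h (f := E), zero_sub, enorm_neg]
      by_cases h' : t - s ∈ Ioc 0 τ
      · rw [indicator_of_mem h']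
        have h2 : t ∈ Ioc τ (τ + s) := ⟨by
          by_contra! hc
          exact h ⟨by linarith [h'.1], hc⟩, by linarith [h'.2]⟩
        rw [indicator_of_mem h2]
        exact le_add_left (le_add_right (hsq _ _ (hEA _ ⟨h'.1.le, h'.2⟩)))
      · rw [indicator_of_notMem h']
        simp
  refine (lintegral_mono h1).trans (le_of_eq ?_)
  rw [lintegral_add_left (measurable_const.indicator measurableSet_Ioc),
    lintegral_add_left (measurable_const.indicator measurableSet_Ioc),
    lintegral_indicator_const measurableSet_Ioc, lintegral_indicator_const measurableSet_Ioc,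
    lintegral_indicator_const measurableSet_Ioc, Real.volume_Ioc, Real.volume_Ioc, Real.volume_Ioc,
    ← ENNReal.ofReal_mul (by positivity), ← ENNReal.ofReal_mul (by positivity),
    ← ENNReal.ofReal_mul (by positivity), ← ENNReal.ofReal_add (by nlinarith [sq_nonneg A])
      (by positivity), ← ENNReal.ofReal_add (by nlinarith [sq_nonneg A])
      (by nlinarith [sq_nonneg A, mul_nonneg (mul_nonneg (sq_nonneg L) hs.le) hτ])]
  congr 1
  ring

/-- Replacing `W` by its averages over intervals of length `ε` changes an integral with a Lipschitz
weight by `O(√ε)` in terms of the `L²` norm of `W`. -/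
theorem enorm_sq_sub_average_le {E W : ℝ → ℝ} {A L τ D ε : ℝ} (hE : Continuous E) (hA : 0 < A) (hEA : ∀ t ∈ Icc 0 τ, |E t| ≤ A)
    (hEL : ∀ r ∈ Icc 0 τ, ∀ t ∈ Icc 0 τ, |E t - E r| ≤ L * |t - r|) (hτ : 0 ≤ τ) (hτD : τ ≤ D)
    (hε : 0 < ε) (hε1 : ε ≤ 1) (hW : Measurable W) :
    ‖(∫ t in (0 : ℝ)..τ, E t * W t) -
      ∫ t in (0 : ℝ)..τ, E t * (ε⁻¹ * ∫ s in (0 : ℝ)..ε, W (t + s))‖ₑ ^ 2 ≤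
      ENNReal.ofReal ((2 * A ^ 2 + L ^ 2 * D) * ε) * ∫⁻ t in Ioo 0 (D + 2), ‖W t‖ₑ ^ 2 := by
  have hD : 0 ≤ D := hτ.trans hτD
  set I := ∫⁻ t in Ioo 0 (D + 2), ‖W t‖ₑ ^ 2 with hI
  rcases eq_or_ne I ⊤ with hIt | hIt
  · rw [hIt, ENNReal.mul_top]
    · exact le_top
    · exact (ENNReal.ofReal_pos.2 (by positivity)).ne'
  set Eb := (Ioc 0 τ).indicator E with hEb
  -- Only times t + s ≤ D + 1 occur, so this cut-off changes no integral while making W integrable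
  -- on the line.
  set Wb := (Ioo 0 (D + 2)).indicator W with hWb
  have hEbm : Measurable Eb := hE.measurable.indicator measurableSet_Ioc
  have hWbm : Measurable Wb := hW.indicator measurableSet_Ioo
  have hWb2 : ∫⁻ t, ‖Wb t‖ₑ ^ 2 = I := by
    rw [hI, ← lintegral_indicator measurableSet_Ioo]
    refine lintegral_congr fun t => ?_
    by_cases ht : t ∈ Ioo 0 (D + 2) <;> simp [hWb, ht]
  have hWbi : Integrable Wb := by
    rw [hWb, integrable_indicator_iff measurableSet_Ioo]
    have : MemLp W 2 (volume.restrict (Ioo 0 (D + 2))) :=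
      memLp_two_of_lintegral hW.aestronglyMeasurable hIt.lt_top
    exact this.integrable (by norm_num)
  have hEbA : ∀ t, ‖Eb t‖ ≤ A := fun t => by
    by_cases ht : t ∈ Ioc 0 τ
    · rw [hEb, indicator_of_mem ht]
      exact hEA t ⟨ht.1.le, ht.2⟩
    · rw [hEb, indicator_of_notMem ht, norm_zero]
      exact hA.le
  have hF : Integrable (fun z : ℝ × ℝ => Eb z.1 * Wb (z.1 + z.2))
      (volume.prod (volume.restrict (Ioc 0 ε))) := by
    refine Integrable.bdd_mul (c := A) ?_ (hEbm.comp measurable_fst).aestronglyMeasurable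
      (ae_of_all _ fun z => hEbA z.1)
    have hm : Measurable fun z : ℝ × ℝ => Wb (z.1 + z.2) := hWbm.comp (by fun_prop)
    refine ⟨hm.aestronglyMeasurable, ?_⟩
    rw [hasFiniteIntegral_iff_enorm, lintegral_prod_symm _ hm.enorm.aemeasurable]
    have : ∀ s : ℝ, ∫⁻ x : ℝ, ‖Wb (x + s)‖ₑ = ∫⁻ x, ‖Wb x‖ₑ := fun s =>
      lintegral_add_right_eq_self (fun x => ‖Wb x‖ₑ) _
    simp only [this]
    rw [setLIntegral_const]
    exact ENNReal.mul_lt_top hWbi.2 (by simp)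
  have h1 : ∫ t in (0 : ℝ)..τ, E t * W t = ∫ t, Eb t * Wb t := by
    rw [intervalIntegral.integral_of_le hτ, ← integral_indicator measurableSet_Ioc]
    refine integral_congr_ae (ae_of_all _ fun t => ?_)
    simp only
    by_cases ht : t ∈ Ioc 0 τ
    · have ht' : t ∈ Ioo 0 (D + 2) := ⟨ht.1, by linarith [ht.2]⟩
      simp [hEb, hWb, ht, ht']
    · simp [hEb, ht]
  have h2 : ∫ t in (0 : ℝ)..τ, E t * (ε⁻¹ * ∫ s in (0 : ℝ)..ε, W (t + s)) =
      ε⁻¹ * ∫ s in Ioc 0 ε, ∫ t, Eb t * Wb (t + s) := by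
    rw [← integral_integral_swap hF, intervalIntegral.integral_of_le hτ, ← integral_const_mul,
      ← integral_indicator measurableSet_Ioc]
    refine integral_congr_ae (ae_of_all _ fun t => ?_)
    simp only
    by_cases ht : t ∈ Ioc 0 τ
    · rw [indicator_of_mem ht, intervalIntegral.integral_of_le hε.le, mul_left_comm,
        ← integral_const_mul]
      congr 1
      refine setIntegral_congr_fun measurableSet_Ioc fun s hs => ?_
      have ht' : t + s ∈ Ioo 0 (D + 2) := ⟨by linarith [ht.1, hs.1], by
        linarith [ht.2, hs.2]⟩
      simp [hEb, hWb, ht, ht']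
    · rw [indicator_of_notMem ht]
      simp [hEb, ht]
  have h3 : Integrable (fun s => ∫ t, Eb t * Wb (t + s)) (volume.restrict (Ioc 0 ε)) :=
    hF.integral_prod_right
  have h4 : ∀ s ∈ Ioc 0 ε, ‖(∫ t, Eb t * Wb t) - ∫ t, Eb t * Wb (t + s)‖ₑ ^ 2 ≤
      ENNReal.ofReal ((2 * A ^ 2 + L ^ 2 * D) * ε) * I := by
    intro s hs
    -- The translation is moved from W, about which only the L² norm is known, onto the regular
    -- weight.
    have e1 : ∫ t, Eb t * Wb (t + s) = ∫ t, Eb (t - s) * Wb t := by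
      refine Eq.trans ?_ (integral_add_right_eq_self (fun t => Eb (t - s) * Wb t) s)
      simp
    have hEs : Measurable fun t => Eb (t - s) := hEbm.comp (by fun_prop)
    rw [e1, ← integral_sub (hWbi.bdd_mul (c := A) hEbm.aestronglyMeasurable (ae_of_all _ hEbA))
      (hWbi.bdd_mul (f := fun t => Eb (t - s)) (c := A) hEs.aestronglyMeasurable
        (ae_of_all _ fun t => hEbA _))]
    simp only [← sub_mul]
    calc ‖∫ t, (Eb t - Eb (t - s)) * Wb t‖ₑ ^ 2
        ≤ (∫⁻ t, ‖Eb t - Eb (t - s)‖ₑ * ‖Wb t‖ₑ) ^ 2 := by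
          refine pow_le_pow_left' ((enorm_integral_le_lintegral_enorm _).trans_eq ?_) 2
          simp only [enorm_mul]
      _ ≤ (∫⁻ t, ‖Eb t - Eb (t - s)‖ₑ ^ 2) * ∫⁻ t, ‖Wb t‖ₑ ^ 2 :=
          sq_lintegral_mul_le
            (hEbm.sub hEs).enorm.aemeasurable hWbm.enorm.aemeasurable
      _ ≤ _ := by
          rw [hWb2]
          refine mul_le_mul' ((lintegral_sq_sub_translate_le hEA hEL hτ hs.1
            (hs.2.trans hε1)).trans (ENNReal.ofReal_le_ofReal ?_)) le_rfl
          have := hs.2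
          have := hs.1.le
          gcongr
  set B := ENNReal.ofReal ((2 * A ^ 2 + L ^ 2 * D) * ε) * I with hB
  have hBt : B ≠ ⊤ := ENNReal.mul_ne_top ENNReal.ofReal_ne_top hIt
  have h5 : ∀ s ∈ Ioc 0 ε, ‖(∫ t, Eb t * Wb t) - ∫ t, Eb t * Wb (t + s)‖ ≤ √B.toReal := by
    intro s hs
    refine Real.le_sqrt_of_sq_le ?_
    have := ENNReal.toReal_mono hBt (h4 s hs)
    rwa [ENNReal.toReal_pow, toReal_enorm] at this
  have h6 : (∫ t, Eb t * Wb t) - ε⁻¹ * ∫ s in Ioc 0 ε, ∫ t, Eb t * Wb (t + s) =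
      ε⁻¹ * ∫ s in Ioc 0 ε, ((∫ t, Eb t * Wb t) - ∫ t, Eb t * Wb (t + s)) := by
    rw [integral_sub (integrable_const _) h3, setIntegral_const, mul_sub]
    simp [hε.le, hε.ne']
  have h7 : ‖(∫ t, Eb t * Wb t) - ε⁻¹ * ∫ s in Ioc 0 ε, ∫ t, Eb t * Wb (t + s)‖ ≤ √B.toReal := by
    rw [h6, norm_mul, Real.norm_of_nonneg (inv_nonneg.2 hε.le), inv_mul_le_iff₀ hε, mul_comm]
    simpa [hε.le] using norm_setIntegral_le_of_norm_le_const (μ := volume) (s := Ioc 0 ε)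
      (by simp) h5
  rw [h1, h2, ← ofReal_norm, ← ENNReal.ofReal_pow (norm_nonneg _), ← ENNReal.ofReal_toReal hBt]
  refine ENNReal.ofReal_le_ofReal ?_
  rw [← Real.sq_sqrt B.toReal_nonneg]
  gcongr

theorem setLIntegral_segment_le {X : Set (Vec d)} {w : Vec d → ℝ} (hw : Measurable w) (T : ℝ)
    (v : Vec d) : ∫⁻ x in X, ∫⁻ t in Ioo 0 T, ‖w (x - t • v)‖ₑ ^ 2 ≤
      ENNReal.ofReal T * ∫⁻ x, ‖w x‖ₑ ^ 2 := by
  have hmv : Measurable fun z : Vec d × ℝ => ‖w (z.1 - z.2 • v)‖ₑ ^ 2 :=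
    (hw.comp (by fun_prop : Continuous fun z : Vec d × ℝ => z.1 - z.2 • v).measurable).enorm.pow_const _
  refine (setLIntegral_le_lintegral _ _).trans ?_
  rw [lintegral_lintegral_swap hmv.aemeasurable]
  have : ∀ t : ℝ, ∫⁻ x, ‖w (x - t • v)‖ₑ ^ 2 = ∫⁻ x, ‖w x‖ₑ ^ 2 := fun t =>
    lintegral_sub_right_eq_self (fun x => ‖w x‖ₑ ^ 2) _
  simp only [this]
  rw [setLIntegral_const, Real.volume_Ioo, sub_zero, mul_comm]

theorem abs_exp_sub_exp_le {x y m : ℝ} (hx : x ≤ m) (hy : y ≤ m) :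
    |Real.exp x - Real.exp y| ≤ Real.exp m * |x - y| := by
  wlog hxy : y ≤ x generalizing x y
  · rw [abs_sub_comm, abs_sub_comm x]
    exact this hy hx (le_of_not_ge hxy)
  rw [abs_of_nonneg (sub_nonneg.2 (Real.exp_le_exp.2 hxy)), abs_of_nonneg (sub_nonneg.2 hxy)]
  have h1 : Real.exp y = Real.exp x * Real.exp (y - x) := by rw [← Real.exp_add]; congr 1; ring
  calc Real.exp x - Real.exp y = Real.exp x * (1 - Real.exp (y - x)) := by rw [h1]; ring
    _ ≤ Real.exp x * (x - y) := by
        have := Real.add_one_le_exp (y - x)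
        exact mul_le_mul_of_nonneg_left (by linarith) (Real.exp_pos x).le
    _ ≤ _ := mul_le_mul_of_nonneg_right (Real.exp_le_exp.2 hx) (by linarith)

theorem BoundedBy.abs_EMinus_le {a b D : ℝ} {σ : Vec d × Vec d → ℝ} (hσ : BoundedBy a b σ)
    (p : Vec d × Vec d) {t : ℝ} (ht : t ∈ Icc 0 D) : |EMinus σ p t| ≤ Real.exp (|a| * D) := by
  refine (abs_of_pos (Real.exp_pos _)).trans_le ?_
  refine (hσ.EMinus_le p ht.1).trans (Real.exp_le_exp.2 ?_)
  exact (mul_le_mul_of_nonneg_right (neg_le_abs a) ht.1).trans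
    (mul_le_mul_of_nonneg_left ht.2 (abs_nonneg a))

theorem BoundedBy.abs_EMinus_sub_le {a b D : ℝ} {σ : Vec d × Vec d → ℝ} (hσ : BoundedBy a b σ)
    (p : Vec d × Vec d) {r t : ℝ} (hr : r ∈ Icc 0 D) (ht : t ∈ Icc 0 D) :
    |EMinus σ p t - EMinus σ p r| ≤ Real.exp (|a| * D) * max |a| |b| * |t - r| := by
  have h1 : ∀ s ∈ Icc 0 D, -∫ u in (0 : ℝ)..s, σ (p.1 - u • p.2, p.2) ≤ |a| * D := fun s hs =>
    Real.exp_le_exp.1 ((le_abs_self _).trans (hσ.abs_EMinus_le p hs))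
  refine (abs_exp_sub_exp_le (h1 t ht) (h1 r hr)).trans ?_
  rw [mul_assoc]
  gcongr
  rw [neg_sub_neg, intervalIntegral.integral_interval_sub_left (hσ.back p _ _) (hσ.back p _ _),
    abs_sub_comm]
  exact intervalIntegral.norm_integral_le_of_norm_le_const (f := fun u => σ (p.1 - u • p.2, p.2))
    fun u _ => abs_le_max_abs_abs (hσ.2 _).1 (hσ.2 _).2

namespace Admissible

variable {X V : Set (Vec d)} {ν : Measure (Vec d)}

/-- Segments point along the velocity, so on a characteristic the segment average is a sliding
average of t ↦ w(x - tv), and the one-dimensional estimate applies. The bound is uniform in w for a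
given L² norm, so ε can be fixed before passing to the limit along a sequence of w. -/
theorem exists_TMinusInv_sub_average_le (h : Admissible X V ν) {a b : ℝ}
    {σ : Vec d × Vec d → ℝ} (hσ : BoundedBy a b σ) :
    ∃ c : ℝ, 0 ≤ c ∧ ∀ ε : ℝ, 0 < ε → ε ≤ 1 → ∀ g w : Vec d → ℝ, Measurable g → Measurable w →
      ∫⁻ p, ‖TMinusInv X σ (fun p => g p.2 * w p.1) p -
        TMinusInv X σ (fun p => g p.2 * segmentAverage ε w p) p‖ₑ ^ 2 ∂phaseMeasure X ν ≤
      ENNReal.ofReal (c * ε) * ((∫⁻ v, ‖g v‖ₑ ^ 2 ∂ν) * ∫⁻ x, ‖w x‖ₑ ^ 2) := by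
  have := h.finite
  obtain ⟨D, hD, hDt⟩ := h.exists_tau_le
  set A := Real.exp (|a| * D)
  set L := A * max |a| |b|
  have hA : 0 < A := Real.exp_pos _
  have hL : 0 ≤ L := by positivity
  refine ⟨(2 * A ^ 2 + L ^ 2 * D) * (D + 2), by positivity, fun ε hε hε1 g w hg hw => ?_⟩
  have hm : Measurable fun z : (Vec d × Vec d) × ℝ => ‖w (z.1.1 - z.2 • z.1.2)‖ₑ ^ 2 :=
    (hw.comp (by fun_prop : Continuous fun z : (Vec d × Vec d) × ℝ =>
      z.1.1 - z.2 • z.1.2).measurable).enorm.pow_const _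
  have h1 : ∀ᵐ p ∂phaseMeasure X ν, ‖TMinusInv X σ (fun p => g p.2 * w p.1) p -
      TMinusInv X σ (fun p => g p.2 * segmentAverage ε w p) p‖ₑ ^ 2 ≤
      ENNReal.ofReal ((2 * A ^ 2 + L ^ 2 * D) * ε) * (‖g p.2‖ₑ ^ 2 *
        ∫⁻ t in Ioo 0 (D + 2), ‖w (p.1 - t • p.2)‖ₑ ^ 2) := by
    filter_upwards [h.ae_phase] with p hp
    have hτ := (hDt p hp.2).2
    have hmem : ∀ t ∈ Icc 0 (tauMinus X p), t ∈ Icc 0 D := fun t ht => ⟨ht.1, ht.2.trans hτ⟩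
    have key := enorm_sq_sub_average_le (hσ.continuous_EMinus p) hA
      (fun t ht => hσ.abs_EMinus_le p (hmem t ht))
      (fun r hr t ht => hσ.abs_EMinus_sub_le p (hmem r hr) (hmem t ht)) (tauMinus_nonneg X p) hτ
      hε hε1 (W := fun t => w (p.1 - t • p.2)) (hw.comp (by fun_prop))
    have e1 : TMinusInv X σ (fun p => g p.2 * w p.1) p =
        g p.2 * ∫ t in (0 : ℝ)..tauMinus X p, EMinus σ p t * w (p.1 - t • p.2) := by
      unfold TMinusInv
      rw [← intervalIntegral.integral_const_mul]
      refine intervalIntegral.integral_congr fun t _ => ?_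
      simp only
      ring
    have e2 : TMinusInv X σ (fun p => g p.2 * segmentAverage ε w p) p =
        g p.2 * ∫ t in (0 : ℝ)..tauMinus X p, EMinus σ p t *
          (ε⁻¹ * ∫ s in (0 : ℝ)..ε, w (p.1 - (t + s) • p.2)) := by
      unfold TMinusInv segmentAverage
      rw [← intervalIntegral.integral_const_mul]
      refine intervalIntegral.integral_congr fun t _ => ?_
      simp only [add_smul, sub_add_eq_sub_sub]
      ring
    rw [e1, e2, ← mul_sub, enorm_mul, mul_pow, mul_left_comm]
    exact mul_le_mul' le_rfl key
  refine (lintegral_mono_ae h1).trans ?_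
  have hm2 : Measurable fun p : Vec d × Vec d => ‖g p.2‖ₑ ^ 2 *
      ∫⁻ t in Ioo 0 (D + 2), ‖w (p.1 - t • p.2)‖ₑ ^ 2 :=
    ((hg.comp measurable_snd).enorm.pow_const _).mul hm.lintegral_prod_right'
  rw [lintegral_const_mul _ hm2, phaseMeasure, lintegral_prod_symm _ hm2.aemeasurable]
  have h4 : ∀ v : Vec d, ∫⁻ x in X, ‖g v‖ₑ ^ 2 * (∫⁻ t in Ioo 0 (D + 2), ‖w (x - t • v)‖ₑ ^ 2) =
      ‖g v‖ₑ ^ 2 * ∫⁻ x in X, (∫⁻ t in Ioo 0 (D + 2), ‖w (x - t • v)‖ₑ ^ 2) := fun v =>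
    lintegral_const_mul' _ _ (by finiteness)
  simp only [h4]
  calc _ ≤ ENNReal.ofReal ((2 * A ^ 2 + L ^ 2 * D) * ε) *
        ∫⁻ v, ‖g v‖ₑ ^ 2 * (ENNReal.ofReal (D + 2) * ∫⁻ x, ‖w x‖ₑ ^ 2) ∂ν :=
        mul_le_mul' le_rfl (lintegral_mono fun v => mul_le_mul' le_rfl
          (setLIntegral_segment_le hw (D + 2) v))
    _ = _ := by
        rw [lintegral_mul_const _ (hg.enorm.pow_const _),
          show (2 * A ^ 2 + L ^ 2 * D) * (D + 2) * ε = (2 * A ^ 2 + L ^ 2 * D) * ε * (D + 2) by ring,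
          ENNReal.ofReal_mul (p := (2 * A ^ 2 + L ^ 2 * D) * ε) (by positivity)]
        ring

/-- Velocity averaging: the solutions with sources `g(v) wₙ(x)`, `wₙ` weakly null, tend to zero. -/
theorem tendsto_lintegral_TMinusInv_tensor (h : Admissible X V ν) {a b : ℝ}
    {σ : Vec d × Vec d → ℝ} (hσ : BoundedBy a b σ) {g : Vec d → ℝ} (hg : Measurable g)
    (hg2 : ∫⁻ v, ‖g v‖ₑ ^ 2 ∂ν < ⊤) {w : ℕ → Vec d → ℝ}
    (hw : ∀ n, Measurable (w n)) (hs : ∀ n x, x ∉ X → w n x = 0) {M : ℝ≥0∞} (hM : M ≠ ⊤)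
    (hwM : ∀ n, ∫⁻ x, ‖w n x‖ₑ ^ 2 ≤ M)
    (hweak : ∀ ψ : Vec d → ℝ, Continuous ψ → (∀ x, |ψ x| ≤ 1) →
      Tendsto (fun n => ∫ x, w n x * ψ x) atTop (𝓝 0)) :
    Tendsto (fun n => ∫⁻ p, ‖TMinusInv X σ (fun p => g p.2 * w n p.1) p‖ₑ ^ 2 ∂phaseMeasure X ν)
      atTop (𝓝 0) := by
  have := h.finite
  obtain ⟨c, hc, hcb⟩ := h.exists_TMinusInv_sub_average_le hσ
  obtain ⟨M', hM'0, hM'⟩ := h.exists_exp_bound a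
  set G := ∫⁻ v, ‖g v‖ₑ ^ 2 ∂ν with hG
  have hmeas : ∀ ε n, Measurable fun p : Vec d × Vec d => g p.2 * segmentAverage ε (w n) p :=
    fun ε n => (hg.comp measurable_snd).mul (measurable_segmentAverage ε (hw n))
  have hmeasw : ∀ n, Measurable fun p : Vec d × Vec d => g p.2 * w n p.1 :=
    fun n => (hg.comp measurable_snd).mul ((hw n).comp measurable_fst)
  have hb : ∀ ε, 0 < ε → ε ≤ 1 → ∀ n,
      ∫⁻ p, ‖TMinusInv X σ (fun p => g p.2 * w n p.1) p‖ₑ ^ 2 ∂phaseMeasure X ν ≤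
      2 * (ENNReal.ofReal (c * ε) * (G * M)) + 2 * (ENNReal.ofReal M' ^ 2 *
        ∫⁻ v, ‖g v‖ₑ ^ 2 * (∫⁻ x, ‖segmentAverage ε (w n) (x, v)‖ₑ ^ 2) ∂ν) := by
    intro ε hε hε1 n
    have hS : ∫⁻ p, ‖TMinusInv X σ (fun p => g p.2 * segmentAverage ε (w n) p) p‖ₑ ^ 2
        ∂phaseMeasure X ν ≤ ENNReal.ofReal M' ^ 2 *
        ∫⁻ v, ‖g v‖ₑ ^ 2 * (∫⁻ x, ‖segmentAverage ε (w n) (x, v)‖ₑ ^ 2) ∂ν := by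
      refine (h.lintegral_sq_TMinusInv_le hσ (hmeas ε n).aestronglyMeasurable hM').trans
        (mul_le_mul' le_rfl ?_)
      rw [phaseMeasure, lintegral_prod_symm _ ((hmeas ε n).enorm.pow_const 2).aemeasurable]
      refine lintegral_mono fun v => ?_
      simp only [enorm_mul, mul_pow]
      rw [lintegral_const_mul' _ _ (by finiteness)]
      exact mul_le_mul' le_rfl (setLIntegral_le_lintegral _ _)
    have hmT : ∀ f : Vec d × Vec d → ℝ, Measurable f → AEMeasurable
        (fun p => ‖TMinusInv X σ f p‖ₑ ^ 2) (phaseMeasure X ν) := fun f hf =>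
      (h.aestronglyMeasurable_TMinusInv hσ hf.aestronglyMeasurable).enorm.pow_const 2
    calc _ ≤ ∫⁻ p, (2 * ‖TMinusInv X σ (fun p => g p.2 * w n p.1) p -
          TMinusInv X σ (fun p => g p.2 * segmentAverage ε (w n) p) p‖ₑ ^ 2 +
          2 * ‖TMinusInv X σ (fun p => g p.2 * segmentAverage ε (w n) p) p‖ₑ ^ 2)
            ∂phaseMeasure X ν := by
          refine lintegral_mono fun p => ?_
          set y := TMinusInv X σ (fun p => g p.2 * w n p.1) p
          set z := TMinusInv X σ (fun p => g p.2 * segmentAverage ε (w n) p) p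
          have e : ∀ y : ℝ, ‖y‖ₑ ^ 2 = ENNReal.ofReal (y ^ 2) := fun y => by
            rw [← ofReal_norm, ← ENNReal.ofReal_pow (norm_nonneg _), Real.norm_eq_abs, sq_abs]
          simp only [e]
          rw [← ENNReal.ofReal_ofNat 2, ← ENNReal.ofReal_mul (by norm_num),
            ← ENNReal.ofReal_mul (by norm_num), ← ENNReal.ofReal_add (by positivity) (by positivity)]
          exact ENNReal.ofReal_le_ofReal (by nlinarith [sq_nonneg (y - z - z)])
      _ = 2 * (∫⁻ p, ‖TMinusInv X σ (fun p => g p.2 * w n p.1) p -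
          TMinusInv X σ (fun p => g p.2 * segmentAverage ε (w n) p) p‖ₑ ^ 2 ∂phaseMeasure X ν) +
          2 * ∫⁻ p, ‖TMinusInv X σ (fun p => g p.2 * segmentAverage ε (w n) p) p‖ₑ ^ 2
            ∂phaseMeasure X ν := by
          rw [lintegral_add_right' _ ((hmT _ (hmeas ε n)).const_mul 2),
            lintegral_const_mul' _ _ (by norm_num), lintegral_const_mul' _ _ (by norm_num)]
      _ ≤ _ := add_le_add (mul_le_mul' le_rfl ((hcb ε hε hε1 g (w n) hg (hw n)).trans
            (mul_le_mul' le_rfl (mul_le_mul' le_rfl (hwM n))))) (mul_le_mul' le_rfl hS)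
  have hlim1 : Tendsto (fun ε : ℝ => 2 * (ENNReal.ofReal (c * ε) * (G * M))) (𝓝[>] 0) (𝓝 0) := by
    have h1 : Tendsto (fun ε : ℝ => ENNReal.ofReal (c * ε)) (𝓝[>] 0) (𝓝 0) := by
      have : Tendsto (fun ε : ℝ => ENNReal.ofReal (c * ε)) (𝓝 0) (𝓝 (ENNReal.ofReal (c * 0))) :=
        (ENNReal.continuous_ofReal.comp (continuous_const.mul continuous_id)).tendsto 0
      rw [mul_zero, ENNReal.ofReal_zero] at this
      exact this.mono_left nhdsWithin_le_nhds
    have h2 := ENNReal.Tendsto.mul_const (b := G * M) h1 (Or.inr (ENNReal.mul_ne_top hg2.ne hM))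
    have h3 := ENNReal.Tendsto.const_mul (a := 2) h2 (Or.inr (by norm_num))
    simpa using h3
  rw [ENNReal.tendsto_nhds_zero]
  intro δ hδ
  have hδ2 : 0 < δ / 2 := ENNReal.half_pos hδ.ne'
  obtain ⟨ε, hε, hε'⟩ := ((ENNReal.tendsto_nhds_zero.1 hlim1 _ hδ2).and
    (Ioc_mem_nhdsGT (show (0 : ℝ) < 1 by norm_num))).exists
  have h5 := tendsto_lintegral_segmentAverage h.hyperplane hg hg2 hε'.1 h.isOpen.measurableSet
    h.isBounded hw hs hM hwM hweak
  have h6 := ENNReal.Tendsto.const_mul (a := ENNReal.ofReal M' ^ 2) h5 (Or.inr (by finiteness))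
  have h7 := ENNReal.Tendsto.const_mul (a := 2) h6 (Or.inr (by norm_num))
  rw [mul_zero, mul_zero] at h7
  filter_upwards [ENNReal.tendsto_nhds_zero.1 h7 _ hδ2] with n hn
  calc _ ≤ _ := hb ε hε'.1 hε'.2 n
    _ ≤ δ / 2 + δ / 2 := add_le_add hε hn
    _ = δ := ENNReal.add_halves δ

end Admissible

end

section

variable {d : ℕ} {X V : Set (Vec d)} {ν : Measure (Vec d)}

/-! ### Compactness of scattering followed by transport -/

theorem tendsto_zero_of_lintegral {α : Type*} [MeasurableSpace α] {m : Measure α}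
    {u : ℕ → Lp ℝ 2 m} (hu : Tendsto (fun n => ∫⁻ x, ‖u n x‖ₑ ^ 2 ∂m) atTop (𝓝 0)) :
    Tendsto u atTop (𝓝 0) := by
  rw [tendsto_zero_iff_norm_tendsto_zero]
  simp only [← norm_sq_eq_lintegral] at hu
  have h1 := (ENNReal.tendsto_toReal ENNReal.zero_ne_top).comp hu
  have h2 : Tendsto (fun n => ‖u n‖ ^ 2) atTop (𝓝 0) := by
    refine h1.congr fun n => ?_
    simp
  simpa using (Real.continuous_sqrt.tendsto 0).comp h2 |>.congr fun n => by simp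

theorem enorm_add_sq_le (y z : ℝ) : ‖y + z‖ₑ ^ 2 ≤ 2 * ‖y‖ₑ ^ 2 + 2 * ‖z‖ₑ ^ 2 := by
  have e : ∀ y : ℝ, ‖y‖ₑ ^ 2 = ENNReal.ofReal (y ^ 2) := fun y => by
    rw [← ofReal_norm, ← ENNReal.ofReal_pow (norm_nonneg _), Real.norm_eq_abs, sq_abs]
  simp only [e]
  rw [← ENNReal.ofReal_ofNat 2, ← ENNReal.ofReal_mul (by norm_num),
    ← ENNReal.ofReal_mul (by norm_num), ← ENNReal.ofReal_add (by positivity) (by positivity)]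
  exact ENNReal.ofReal_le_ofReal (by nlinarith [sq_nonneg (y - z)])

theorem KernelBound.add {k k' : Vec d × Vec d × Vec d → ℝ} {M M' : ℝ}
    (hM : 0 ≤ M) (hM' : 0 ≤ M') (hk : KernelBound X ν k M) (hk' : KernelBound X ν k' M') :
    KernelBound X ν (fun q => k q + k' q) (2 * (M + M')) := by
  refine ⟨hk.1.add hk'.1, ?_⟩
  filter_upwards [hk.2, hk'.2] with x h1 h2
  refine (lintegral_mono fun w => enorm_add_sq_le _ _).trans ?_
  have hm : Measurable fun w => 2 * ‖k (x, w)‖ₑ ^ 2 :=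
    ((hk.1.comp (by fun_prop)).enorm.pow_const 2).const_mul 2
  rw [lintegral_add_left hm, lintegral_const_mul' _ _ (by norm_num),
    lintegral_const_mul' _ _ (by norm_num)]
  refine (add_le_add (mul_le_mul' le_rfl h1) (mul_le_mul' le_rfl h2)).trans ?_
  rw [← ENNReal.ofReal_pow hM, ← ENNReal.ofReal_pow hM', ← ENNReal.ofReal_pow (by positivity),
    ← ENNReal.ofReal_ofNat 2, ← ENNReal.ofReal_mul (by norm_num),
    ← ENNReal.ofReal_mul (by norm_num), ← ENNReal.ofReal_add (by positivity) (by positivity)]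
  exact ENNReal.ofReal_le_ofReal (by nlinarith [mul_nonneg hM hM', sq_nonneg M, sq_nonneg M'])

theorem KernelBound.const_mul {k : Vec d × Vec d × Vec d → ℝ} {M : ℝ}
    (hk : KernelBound X ν k M) (c : ℝ) : KernelBound X ν (fun q => c * k q) (|c| * M) := by
  refine ⟨hk.1.const_mul c, ?_⟩
  filter_upwards [hk.2] with x hx
  simp only [enorm_mul, mul_pow]
  rw [lintegral_const_mul' _ _ (by finiteness), ENNReal.ofReal_mul (abs_nonneg c), mul_pow,
    ← Real.norm_eq_abs, ofReal_norm]
  exact mul_le_mul' le_rfl hx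

theorem KernelBound.indicator {k : Vec d × Vec d × Vec d → ℝ} {M : ℝ}
    (hk : KernelBound X ν k M) {D : Set (Vec d)} (hD : MeasurableSet D) :
    KernelBound X ν ((D ×ˢ univ).indicator k) M := by
  refine ⟨hk.1.indicator (hD.prod MeasurableSet.univ), ?_⟩
  filter_upwards [hk.2] with x hx
  refine (lintegral_mono fun w => ?_).trans hx
  refine pow_le_pow_left' ?_ 2
  by_cases h : x ∈ D <;> simp [h]

/-- The operator `L` on `L²` is the scattering operator with kernel `k`. -/
def IsScattering (X : Set (Vec d)) (ν : Measure (Vec d)) (k : Vec d × Vec d × Vec d → ℝ)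
    (L : Lp ℝ 2 (phaseMeasure X ν) →L[ℝ] Lp ℝ 2 (phaseMeasure X ν)) : Prop :=
  ∀ u : Lp ℝ 2 (phaseMeasure X ν), L u =ᵐ[phaseMeasure X ν] KOp ν k u

/-- The localizations in space of the scattering operator with kernel `k`, followed by `U`, are
completely continuous. -/
def IsCompactingKernel (X : Set (Vec d)) (ν : Measure (Vec d))
    (U : Lp ℝ 2 (phaseMeasure X ν) →L[ℝ] Lp ℝ 2 (phaseMeasure X ν))
    (k : Vec d × Vec d × Vec d → ℝ) : Prop :=
  (∃ M, 0 ≤ M ∧ KernelBound X ν k M) ∧ ∀ D, MeasurableSet D → ∀ L,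
    IsScattering X ν ((D ×ˢ univ).indicator k) L → CompletelyContinuous (U.comp L)

theorem IsScattering.eq {k : Vec d × Vec d × Vec d → ℝ}
    {L L' : Lp ℝ 2 (phaseMeasure X ν) →L[ℝ] Lp ℝ 2 (phaseMeasure X ν)}
    (hL : IsScattering X ν k L) (hL' : IsScattering X ν k L') : L = L' := by
  ext1 u
  exact Lp.ext ((hL u).trans (hL' u).symm)

theorem IsScattering.const_mul {k : Vec d × Vec d × Vec d → ℝ}
    {L : Lp ℝ 2 (phaseMeasure X ν) →L[ℝ] Lp ℝ 2 (phaseMeasure X ν)}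
    (hL : IsScattering X ν k L) (c : ℝ) : IsScattering X ν (fun q => c * k q) (c • L) := by
  intro u
  filter_upwards [hL u, Lp.coeFn_smul c (L u)] with p h1 h2
  rw [smul_apply, h2, Pi.smul_apply, h1, Admissible.KOp_const_mul]
  rfl

namespace Admissible

theorem exists_isScattering (h : Admissible X V ν) {k : Vec d × Vec d × Vec d → ℝ} {M : ℝ}
    (hM : 0 ≤ M) (hk : KernelBound X ν k M) : ∃ L, ‖L‖ ≤ M ∧ IsScattering X ν k L := by
  obtain ⟨L, hL, hL'⟩ := h.exists_clm_KOp hM hk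
  exact ⟨L, hL, fun u => hL' u u (ae_eq_refl _)⟩

theorem isScattering_add (h : Admissible X V ν) {k k' : Vec d × Vec d × Vec d → ℝ} {M M' : ℝ}
    (hk : KernelBound X ν k M) (hk' : KernelBound X ν k' M')
    {L L' : Lp ℝ 2 (phaseMeasure X ν) →L[ℝ] Lp ℝ 2 (phaseMeasure X ν)}
    (hL : IsScattering X ν k L) (hL' : IsScattering X ν k' L') :
    IsScattering X ν (fun q => k q + k' q) (L + L') := by
  intro u
  filter_upwards [hL u, hL' u, Lp.coeFn_add (L u) (L' u), h.ae_integrable_KOp hk (Lp.memLp u),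
    h.ae_integrable_KOp hk' (Lp.memLp u)] with p h1 h2 h3 h4 h5
  rw [add_apply, h3, Pi.add_apply, h1, h2]
  unfold KOp
  rw [← integral_add h4 h5]
  simp only [add_mul]

theorem isCompactingKernel_add (h : Admissible X V ν)
    {U : Lp ℝ 2 (phaseMeasure X ν) →L[ℝ] Lp ℝ 2 (phaseMeasure X ν)}
    {k k' : Vec d × Vec d × Vec d → ℝ} (hk : IsCompactingKernel X ν U k)
    (hk' : IsCompactingKernel X ν U k') : IsCompactingKernel X ν U (fun q => k q + k' q) := by
  obtain ⟨⟨M, hM, hkM⟩, hkD⟩ := hk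
  obtain ⟨⟨M', hM', hkM'⟩, hkD'⟩ := hk'
  refine ⟨⟨_, by positivity, hkM.add hM hM' hkM'⟩, fun D hD L hL => ?_⟩
  obtain ⟨L₁, -, hL₁⟩ := h.exists_isScattering hM (hkM.indicator hD)
  obtain ⟨L₂, -, hL₂⟩ := h.exists_isScattering hM' (hkM'.indicator hD)
  have h1 := h.isScattering_add (hkM.indicator hD) (hkM'.indicator hD) hL₁ hL₂
  have h2 : (fun q => (D ×ˢ univ).indicator k q + (D ×ˢ univ).indicator k' q) =
      (D ×ˢ univ).indicator fun q => k q + k' q := (indicator_add _ k k').symm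
  rw [h2] at h1
  rw [hL.eq h1]
  intro u hu
  have := (hkD D hD L₁ hL₁ u hu).add (hkD' D hD L₂ hL₂ u hu)
  simpa using this

end Admissible

theorem IsCompactingKernel.const_mul
    {U : Lp ℝ 2 (phaseMeasure X ν) →L[ℝ] Lp ℝ 2 (phaseMeasure X ν)}
    {k : Vec d × Vec d × Vec d → ℝ} (h : Admissible X V ν) (hk : IsCompactingKernel X ν U k)
    (c : ℝ) : IsCompactingKernel X ν U (fun q => c * k q) := by
  obtain ⟨⟨M, hM, hkM⟩, hkD⟩ := hk
  refine ⟨⟨_, by positivity, hkM.const_mul c⟩, fun D hD L hL => ?_⟩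
  obtain ⟨L₁, -, hL₁⟩ := h.exists_isScattering hM (hkM.indicator hD)
  have h1 := hL₁.const_mul c
  have h2 : (fun q => c * (D ×ˢ univ).indicator k q) = (D ×ˢ univ).indicator fun q => c * k q := by
    ext q
    by_cases hq : q ∈ D ×ˢ (univ : Set (Vec d × Vec d))
    · rw [indicator_of_mem hq, indicator_of_mem hq]
    · rw [indicator_of_notMem hq, indicator_of_notMem hq, mul_zero]
  rw [h2] at h1
  rw [hL.eq h1]
  intro u hu
  have := (hkD D hD L₁ hL₁ u hu).const_smul c
  simpa using this

theorem IsCompactingKernel.indicator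
    {U : Lp ℝ 2 (phaseMeasure X ν) →L[ℝ] Lp ℝ 2 (phaseMeasure X ν)}
    {k : Vec d × Vec d × Vec d → ℝ} (hk : IsCompactingKernel X ν U k) {E : Set (Vec d)}
    (hE : MeasurableSet E) : IsCompactingKernel X ν U ((E ×ˢ univ).indicator k) := by
  obtain ⟨⟨M, hM, hkM⟩, hkD⟩ := hk
  refine ⟨⟨M, hM, hkM.indicator hE⟩, fun D hD L hL => ?_⟩
  rw [indicator_indicator, prod_inter_prod, univ_inter] at hL
  exact hkD _ (hD.inter hE) L hL

namespace Admissible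

/-- Kernels close in L²(V × V) uniformly in x give operators close in norm, and complete continuity
survives norm limits. -/
theorem isCompactingKernel_of_approx (h : Admissible X V ν)
    {U : Lp ℝ 2 (phaseMeasure X ν) →L[ℝ] Lp ℝ 2 (phaseMeasure X ν)}
    {k : Vec d × Vec d × Vec d → ℝ} (hk : Measurable k)
    (happ : ∀ δ : ℝ, 0 < δ → ∃ k', IsCompactingKernel X ν U k' ∧ ∀ᵐ x ∂volume.restrict X,
      ∫⁻ w, ‖k (x, w) - k' (x, w)‖ₑ ^ 2 ∂ν.prod ν ≤ ENNReal.ofReal δ ^ 2) :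
    IsCompactingKernel X ν U k := by
  refine ⟨?_, fun D hD L hL => CompletelyContinuous.of_approx fun ε hε => ?_⟩
  · obtain ⟨k', ⟨⟨M, hM, hkM⟩, -⟩, hk'⟩ := happ 1 one_pos
    have h1 : KernelBound X ν (fun q => k q - k' q) 1 := ⟨hk.sub hkM.1, hk'⟩
    have h2 := h1.add zero_le_one hM hkM
    simp only [sub_add_cancel] at h2
    exact ⟨_, by positivity, h2⟩
  · have hδ : 0 < ε / (‖U‖ + 1) := by positivity
    obtain ⟨k', ⟨⟨M, hM, hkM⟩, hkD⟩, hk'⟩ := happ _ hδ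
    have h1 : KernelBound X ν (fun q => k q - k' q) (ε / (‖U‖ + 1)) := ⟨hk.sub hkM.1, hk'⟩
    obtain ⟨L₁, -, hL₁⟩ := h.exists_isScattering hM (hkM.indicator hD)
    obtain ⟨N, hN, hN'⟩ := h.exists_isScattering hδ.le (h1.indicator hD)
    refine ⟨U.comp L₁, hkD D hD L₁ hL₁, ?_⟩
    have h2 := h.isScattering_add (h1.indicator hD) (hkM.indicator hD) hN' hL₁
    have h3 : (fun q => (D ×ˢ univ).indicator (fun q => k q - k' q) q +
        (D ×ˢ univ).indicator k' q) = (D ×ˢ univ).indicator k := by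
      refine (indicator_add _ (fun q => k q - k' q) k').symm.trans ?_
      simp
    rw [h3] at h2
    have h4 : U.comp L - U.comp L₁ = U.comp N := by
      rw [hL.eq h2, ContinuousLinearMap.comp_add, add_sub_cancel_right]
    rw [h4]
    calc _ ≤ ‖U‖ * ‖N‖ := U.opNorm_comp_le N
      _ ≤ ‖U‖ * (ε / (‖U‖ + 1)) := by gcongr
      _ ≤ ε := by
        rw [mul_div_assoc', div_le_iff₀ (by positivity)]
        nlinarith [norm_nonneg U]

theorem kernelBound_of_bounded (h : Admissible X V ν) {k : Vec d × Vec d × Vec d → ℝ}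
    (hk : Measurable k) (hb : ∀ q, ‖k q‖ ≤ 1) :
    ∃ M, 0 ≤ M ∧ KernelBound X ν k M := by
  have := h.finite
  refine ⟨√((ν.prod ν) univ).toReal, Real.sqrt_nonneg _, hk, ae_of_all _ fun x => ?_⟩
  rw [← ENNReal.ofReal_pow (Real.sqrt_nonneg _), Real.sq_sqrt ENNReal.toReal_nonneg,
    ENNReal.ofReal_toReal (by finiteness)]
  calc _ ≤ ∫⁻ _, 1 ∂ν.prod ν := lintegral_mono fun w => by
        rw [← ofReal_norm]
        refine (pow_le_pow_left' (ENNReal.ofReal_le_ofReal (hb _)) 2).trans_eq (by simp)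
    _ = _ := by simp

/-- For this kernel the scattered function is 1_B(v) w(x), with w the average of u over velocities
in A. Velocity averaging then applies to the weakly null sequence of such w. -/
theorem isCompactingKernel_rectangle (h : Admissible X V ν) {a b : ℝ} {σ : Vec d × Vec d → ℝ}
    (hσ : BoundedBy a b σ) {U : Lp ℝ 2 (phaseMeasure X ν) →L[ℝ] Lp ℝ 2 (phaseMeasure X ν)}
    (hU : ∀ (f : Lp ℝ 2 (phaseMeasure X ν)) (g : Vec d × Vec d → ℝ), f =ᵐ[phaseMeasure X ν] g →
      U f =ᵐ[phaseMeasure X ν] TMinusInv X σ g) {A B : Set (Vec d)} (hA : MeasurableSet A)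
    (hB : MeasurableSet B) :
    IsCompactingKernel X ν U fun q => (A ×ˢ B).indicator 1 q.2 := by
  have := h.finite
  have := h.isFiniteMeasure_phase
  refine ⟨h.kernelBound_of_bounded ((measurable_one.indicator (hA.prod hB)).comp measurable_snd)
    fun q => ?_, fun D hD L hL u hu => tendsto_zero_of_lintegral ?_⟩
  · by_cases hq : q.2 ∈ A ×ˢ B <;> simp [indicator, hq]
  set w : ℕ → Vec d → ℝ := fun n => (D ∩ X).indicator fun x => ∫ v', A.indicator (fun v' => u n (x, v')) v' ∂ν
    with hw
  have hum : ∀ n, Measurable (u n : Vec d × Vec d → ℝ) := fun n => (Lp.stronglyMeasurable (u n)).measurable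
  have hwm : ∀ n, Measurable (w n) := fun n => by
    refine Measurable.indicator ?_ (hD.inter h.isOpen.measurableSet)
    have : StronglyMeasurable fun z : Vec d × Vec d => A.indicator (fun v' => u n (z.1, v')) z.2 := by
      have e : (fun z : Vec d × Vec d => A.indicator (fun v' => u n (z.1, v')) z.2) =
          (univ ×ˢ A).indicator (u n) := by
        ext z
        by_cases hz : z.2 ∈ A <;> simp [indicator, hz]
      rw [e]
      exact ((hum n).indicator (MeasurableSet.univ.prod hA)).stronglyMeasurable
    exact this.integral_prod_right'.measurable
  have hws : ∀ n x, x ∉ X → w n x = 0 := fun n x hx => indicator_of_notMem (fun h => hx h.2) _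
  obtain ⟨⟨M, hM⟩, hweak⟩ := hu
  have key : ∀ n, U (L (u n)) =ᵐ[phaseMeasure X ν]
      TMinusInv X σ fun p => B.indicator 1 p.2 * w n p.1 := fun n => by
    refine hU _ _ ((hL (u n)).trans ?_)
    filter_upwards [h.ae_phase] with p hp
    unfold KOp
    by_cases hpD : p.1 ∈ D
    · simp only [hw]
      rw [indicator_of_mem (show p.1 ∈ D ∩ X from ⟨hpD, hp.1⟩), ← integral_const_mul]
      refine integral_congr_ae (ae_of_all _ fun v' => ?_)
      by_cases hA' : v' ∈ A <;> by_cases hB' : p.2 ∈ B <;> simp [indicator, hpD, hA', hB']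
    · simp [indicator, hpD, hw]
  have hwM : ∀ n, ∫⁻ x, ‖w n x‖ₑ ^ 2 ≤ ν univ * ENNReal.ofReal (M ^ 2) := fun n => by
    have h1 : ∀ x, ‖w n x‖ₑ ^ 2 ≤ X.indicator (fun x => ν univ * ∫⁻ v, ‖u n (x, v)‖ₑ ^ 2 ∂ν) x := by
      intro x
      by_cases hx : x ∈ X
      · rw [indicator_of_mem hx]
        by_cases hx' : x ∈ D ∩ X
        · simp only [hw]
          rw [indicator_of_mem hx']
          calc _ ≤ (∫⁻ v, 1 * ‖u n (x, v)‖ₑ ∂ν) ^ 2 := by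
                refine pow_le_pow_left' ((enorm_integral_le_lintegral_enorm _).trans
                  (lintegral_mono fun v => ?_)) 2
                by_cases hv : v ∈ A <;> simp [hv]
            _ ≤ _ := (sq_lintegral_mul_le aemeasurable_const
                ((hum n).comp (by fun_prop)).enorm.aemeasurable).trans_eq (by simp)
        · simp only [hw]
          rw [indicator_of_notMem hx']
          simp
      · rw [hws n x hx]
        simp
    refine (lintegral_mono h1).trans ?_
    rw [lintegral_indicator h.isOpen.measurableSet, lintegral_const_mul' _ _ (by finiteness)]
    refine mul_le_mul' le_rfl ?_
    refine (lintegral_prod (μ := volume.restrict X) (ν := ν) _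
      (((hum n).enorm.pow_const 2).aemeasurable)).symm.trans_le ?_
    refine (norm_sq_eq_lintegral (u n)).symm.trans_le (ENNReal.ofReal_le_ofReal ?_)
    exact pow_le_pow_left₀ (norm_nonneg _) (hM n) 2
  -- Pairing wₙ with ψ is pairing uₙ with ψ(x) 1_{D × A}(x,v'), so weak nullity is inherited from
  -- uₙ.
  have hpair : ∀ ψ : Vec d → ℝ, Continuous ψ → (∀ x, |ψ x| ≤ 1) →
      Tendsto (fun n => ∫ x, w n x * ψ x) atTop (𝓝 0) := by
    intro ψ hψ hψ1
    have hφm : Measurable fun p : Vec d × Vec d => (D ×ˢ A).indicator (fun p => ψ p.1) p :=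
      Measurable.indicator (by fun_prop) (hD.prod hA)
    have hφ : MemLp (fun p : Vec d × Vec d => (D ×ˢ A).indicator (fun p => ψ p.1) p) 2
        (phaseMeasure X ν) := by
      refine MemLp.of_bound hφm.aestronglyMeasurable 1 (ae_of_all _ fun p => ?_)
      by_cases hp : p ∈ D ×ˢ A
      · rw [indicator_of_mem hp]
        exact hψ1 _
      · rw [indicator_of_notMem hp]
        simp
    refine (hweak (hφ.toLp _)).congr fun n => ?_
    rw [inner_eq_integral]
    have hi : Integrable (fun p => u n p * (D ×ˢ A).indicator (fun p => ψ p.1) p)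
        (phaseMeasure X ν) := (Lp.memLp (u n)).integrable_mul hφ
    have e1 : ∫ p, u n p * hφ.toLp _ p ∂phaseMeasure X ν =
        ∫ p, u n p * (D ×ˢ A).indicator (fun p => ψ p.1) p ∂phaseMeasure X ν := by
      refine integral_congr_ae ?_
      filter_upwards [hφ.coeFn_toLp] with p hp
      rw [hp]
    rw [e1]
    refine (integral_prod (μ := volume.restrict X) (ν := ν) _ hi).trans ?_
    rw [← integral_indicator h.isOpen.measurableSet]
    refine integral_congr_ae (ae_of_all _ fun x => ?_)
    simp only [hw]
    by_cases hx : x ∈ X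
    · rw [indicator_of_mem hx]
      by_cases hx' : x ∈ D
      · rw [indicator_of_mem (show x ∈ D ∩ X from ⟨hx', hx⟩), ← integral_mul_const]
        refine integral_congr_ae (ae_of_all _ fun v => ?_)
        by_cases hv : v ∈ A <;> simp [indicator, hx', hv]
      · simp [indicator, hx']
    · simp [indicator, hx]
  have hB2 : ∫⁻ v, ‖(B.indicator 1 v : ℝ)‖ₑ ^ 2 ∂ν < ⊤ := by
    refine (lintegral_mono (g := fun _ => 1) fun v => ?_).trans_lt (by simp)
    by_cases hv : v ∈ B <;> simp [hv]
  have hlim := h.tendsto_lintegral_TMinusInv_tensor hσ (g := B.indicator 1)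
    (measurable_one.indicator hB) hB2 hwm hws (M := ν univ * ENNReal.ofReal (M ^ 2))
    (by finiteness) hwM hpair
  refine hlim.congr fun n => lintegral_congr_ae ?_
  filter_upwards [key n] with p hp
  rw [← hp]
  rfl

end Admissible

end

/-! ### Compactness for kernels: from rectangles to continuous dependence on position -/

section

variable {d : ℕ} {X V : Set (Vec d)} {ν : Measure (Vec d)}

namespace Admissible

section Compacting

variable {a b : ℝ} {σ : Vec d × Vec d → ℝ}
  {U : Lp ℝ 2 (phaseMeasure X ν) →L[ℝ] Lp ℝ 2 (phaseMeasure X ν)}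

/-- Induction from the π-system of rectangles. For a disjoint union, partial unions approximate: the
kernel does not depend on x, so the squared L² error is the measure of the remainder, uniformly in
x. -/
theorem isCompactingKernel_indicator (h : Admissible X V ν) (hσ : BoundedBy a b σ)
    (hU : ∀ (f : Lp ℝ 2 (phaseMeasure X ν)) (g : Vec d × Vec d → ℝ), f =ᵐ[phaseMeasure X ν] g →
      U f =ᵐ[phaseMeasure X ν] TMinusInv X σ g) {S : Set (Vec d × Vec d)} (hS : MeasurableSet S) :
    IsCompactingKernel X ν U fun q => S.indicator 1 q.2 := by
  have := h.finite
  induction S, hS using MeasurableSpace.induction_on_inter generateFrom_prod.symm isPiSystem_prod with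
  | empty =>
    have := h.isCompactingKernel_rectangle hσ hU (A := ∅) (B := ∅) .empty .empty
    simpa using this
  | basic S hS =>
    obtain ⟨A, hA, B, hB, rfl⟩ := hS
    exact h.isCompactingKernel_rectangle hσ hU hA hB
  | compl S hS ih =>
    have h1 := h.isCompactingKernel_add
      (h.isCompactingKernel_rectangle hσ hU (A := univ) (B := univ) .univ .univ)
      (ih.const_mul h (-1))
    have e : (fun q : Vec d × Vec d × Vec d => (univ ×ˢ univ : Set (Vec d × Vec d)).indicator 1 q.2 +
        -1 * S.indicator (1 : Vec d × Vec d → ℝ) q.2) = fun q => Sᶜ.indicator 1 q.2 := by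
      ext q
      by_cases hq : q.2 ∈ S <;> simp [hq]
    rwa [e] at h1
  | iUnion f hd hf ih =>
    refine h.isCompactingKernel_of_approx ((measurable_one.indicator (.iUnion hf)).comp measurable_snd)
      fun δ hδ => ?_
    have hpart : ∀ n, IsCompactingKernel X ν U fun q =>
        (⋃ i ∈ Finset.range n, f i).indicator 1 q.2 := by
      intro n
      induction n with
      | zero =>
        have := h.isCompactingKernel_rectangle hσ hU (A := ∅) (B := ∅) .empty .empty
        simpa using this
      | succ n ihn =>
        have h1 := h.isCompactingKernel_add ihn (ih n)
        have hdis : Disjoint (⋃ i ∈ Finset.range n, f i) (f n) := by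
          simp only [disjoint_iUnion_left, Finset.mem_range]
          exact fun i hi => hd hi.ne
        have e : (fun q : Vec d × Vec d × Vec d => (⋃ i ∈ Finset.range n, f i).indicator 1 q.2 +
            (f n).indicator (1 : Vec d × Vec d → ℝ) q.2) =
            fun q => (⋃ i ∈ Finset.range (n + 1), f i).indicator 1 q.2 := by
          ext q
          rw [Finset.range_add_one, Finset.set_biUnion_insert, union_comm,
            indicator_union_of_disjoint hdis]
        rwa [e] at h1
    have hlim : Tendsto (fun n => ν.prod ν ((⋃ i, f i) \ ⋃ i ∈ Finset.range n, f i)) atTop (𝓝 0) := by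
      have hmeas : ∀ n, MeasurableSet (⋃ i ∈ Finset.range n, f i) := fun n =>
        Finset.measurableSet_biUnion _ fun i _ => hf i
      have h1 := tendsto_measure_iInter_atTop (μ := ν.prod ν)
        (s := fun n => (⋃ i, f i) \ ⋃ i ∈ Finset.range n, f i)
        (fun n => ((MeasurableSet.iUnion hf).diff (hmeas n)).nullMeasurableSet)
        (fun m n hmn => sdiff_subset_sdiff_right
          (biUnion_subset_biUnion_left fun i hi => Finset.range_mono hmn hi))
        ⟨0, by finiteness⟩
      have h2 : ⋂ n, ((⋃ i, f i) \ ⋃ i ∈ Finset.range n, f i) = ∅ := by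
        rw [eq_empty_iff_forall_notMem]
        intro x hx
        simp only [mem_iInter, Set.mem_sdiff, mem_iUnion, Finset.mem_range, not_exists] at hx
        obtain ⟨i, hi⟩ := (hx 0).1
        exact (hx (i + 1)).2 i (Nat.lt_succ_self i) hi
      rwa [h2, measure_empty] at h1
    obtain ⟨n, hn⟩ := (ENNReal.tendsto_nhds_zero.1 hlim (ENNReal.ofReal δ ^ 2)
      (ENNReal.pow_pos (ENNReal.ofReal_pos.2 hδ) 2)).exists
    refine ⟨_, hpart n, ae_of_all _ fun x => le_trans ?_ hn⟩
    have hmeas : MeasurableSet (⋃ i ∈ Finset.range n, f i) :=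
      Finset.measurableSet_biUnion _ fun i _ => hf i
    rw [← lintegral_indicator_one ((MeasurableSet.iUnion hf).diff hmeas)]
    refine lintegral_mono fun w => ?_
    have hsub : (⋃ i ∈ Finset.range n, f i) ⊆ ⋃ i, f i := iUnion₂_subset fun i _ => subset_iUnion f i
    by_cases h1 : w ∈ ⋃ i ∈ Finset.range n, f i
    · simp only
      rw [indicator_of_mem h1, indicator_of_mem (hsub h1)]
      simp
    · simp only
      rw [indicator_of_notMem h1]
      by_cases h2 : w ∈ ⋃ i, f i
      · rw [indicator_of_mem h2, indicator_of_mem (show w ∈ _ \ _ from ⟨h2, h1⟩)]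
        simp
      · rw [indicator_of_notMem h2]
        simp

theorem isCompactingKernel_simpleFunc (h : Admissible X V ν) (hσ : BoundedBy a b σ)
    (hU : ∀ (f : Lp ℝ 2 (phaseMeasure X ν)) (g : Vec d × Vec d → ℝ), f =ᵐ[phaseMeasure X ν] g →
      U f =ᵐ[phaseMeasure X ν] TMinusInv X σ g) (f : SimpleFunc (Vec d × Vec d) ℝ) :
    IsCompactingKernel X ν U fun q => f q.2 := by
  induction f using SimpleFunc.induction with
  | @const c S hS =>
    have h1 := (h.isCompactingKernel_indicator hσ hU hS).const_mul h c
    have e : (fun q : Vec d × Vec d × Vec d => c * S.indicator (1 : Vec d × Vec d → ℝ) q.2) =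
        fun q => SimpleFunc.piecewise S hS (SimpleFunc.const _ c) (SimpleFunc.const _ 0) q.2 := by
      ext q
      by_cases hq : q.2 ∈ S <;> simp [hq]
    rwa [e] at h1
  | add hfg hf hg => exact h.isCompactingKernel_add hf hg

/-- Kernels in `C(X̄, L²(V × V))` give completely continuous operators after transport. -/
theorem isCompactingKernel_of_continuous (h : Admissible X V ν) (hσ : BoundedBy a b σ)
    (hU : ∀ (f : Lp ℝ 2 (phaseMeasure X ν)) (g : Vec d × Vec d → ℝ), f =ᵐ[phaseMeasure X ν] g →
      U f =ᵐ[phaseMeasure X ν] TMinusInv X σ g) {k k' : Vec d × Vec d × Vec d → ℝ}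
    (hk : IsContinuousKernel X ν k) (hk' : Measurable k') (hkk' : k =ᵐ[kernelMeasure X ν] k') :
    IsCompactingKernel X ν U k' := by
  have := h.finite
  refine h.isCompactingKernel_of_approx hk' fun δ hδ => ?_
  have hkk : ∀ᵐ x ∂volume.restrict X, ∀ᵐ w ∂ν.prod ν, k (x, w) = k' (x, w) :=
    Measure.ae_ae_of_ae_prod hkk'
  have key : ∃ E, MeasurableSet E ∧ closure X ∩ X ⊆ E ∧ ∃ N, IsCompactingKernel X ν U N ∧
      ∀ᵐ x ∂volume.restrict X, x ∈ E →
        ∫⁻ w, ‖k' (x, w) - N (x, w)‖ₑ ^ 2 ∂ν.prod ν ≤ ENNReal.ofReal δ ^ 2 := by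
    -- Near each point of the closure, k is within δ of one simple function of the velocities.
    -- Compactness patches finitely many of these by localization in x, which is why the notion of
    -- compacting kernel includes all localizations.
    refine h.isBounded.isCompact_closure.induction_on (p := fun S => ∃ E, MeasurableSet E ∧
      S ∩ X ⊆ E ∧ ∃ N, IsCompactingKernel X ν U N ∧ ∀ᵐ x ∂volume.restrict X, x ∈ E →
        ∫⁻ w, ‖k' (x, w) - N (x, w)‖ₑ ^ 2 ∂ν.prod ν ≤ ENNReal.ofReal δ ^ 2) ?_ ?_ ?_ ?_
    · exact ⟨∅, .empty, by simp, _, h.isCompactingKernel_simpleFunc hσ hU 0, by simp⟩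
    · rintro s t hst ⟨E, hE, hsE, N, hN⟩
      exact ⟨E, hE, (inter_subset_inter_left _ hst).trans hsE, N, hN⟩
    · rintro s t ⟨E, hE, hsE, N, hN, hN'⟩ ⟨F, hF, htF, N', hNF, hNF'⟩
      -- Using F \ E keeps the two pieces disjoint, so the errors do not add up.
      refine ⟨E ∪ F, hE.union hF, ?_, _, h.isCompactingKernel_add (hN.indicator hE)
        (hNF.indicator (hF.diff hE)), ?_⟩
      · rw [union_inter_distrib_right]
        exact union_subset_union hsE htF
      filter_upwards [hN', hNF'] with x h1 h2 hx
      by_cases hxE : x ∈ E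
      · simpa [indicator, hxE] using h1 hxE
      · have hxF : x ∈ F := hx.resolve_left hxE
        simpa [indicator, hxE, hxF] using h2 hxF
    · intro x hx
      have hδ2 : ENNReal.ofReal δ / 2 ≠ 0 := (ENNReal.half_pos (ENNReal.ofReal_pos.2 hδ).ne').ne'
      obtain ⟨hkx, hlim⟩ := hk.2 x hx
      obtain ⟨N, hN, hN2⟩ := hkx.exists_simpleFunc_eLpNorm_sub_lt (by norm_num) hδ2
      have hnear := ENNReal.tendsto_nhds_zero.1 hlim _ hδ2.bot_lt
      obtain ⟨O, hO, hxO, hOsub⟩ := mem_nhdsWithin.1 hnear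
      refine ⟨O, mem_nhdsWithin_of_mem_nhds (hO.mem_nhds hxO), O, hO.measurableSet, inter_subset_left,
        _, h.isCompactingKernel_simpleFunc hσ hU N, ?_⟩
      filter_upwards [hkk, ae_restrict_mem h.isOpen.measurableSet] with y hy hyX hyO
      have hyc := subset_closure hyX
      have hky := (hk.2 y hyc).1
      have h1 : eLpNorm (fun w => k (y, w) - N w) 2 (ν.prod ν) ≤ ENNReal.ofReal δ := by
        have e : (fun w => k (y, w) - N w) = (fun w => k (y, w) - k (x, w)) +
            ((fun w => k (x, w)) - ⇑N) := by
          ext w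
          simp
        rw [e]
        refine (eLpNorm_add_le (hky.1.sub hkx.1) (hkx.1.sub hN2.1) (by norm_num)).trans ?_
        refine (add_le_add (hOsub ⟨hyO, hyc⟩) hN.le).trans_eq (ENNReal.add_halves _)
      refine le_trans (le_of_eq ?_) (pow_le_pow_left' h1 2)
      rw [eLpNorm_two_sq]
      refine lintegral_congr_ae ?_
      filter_upwards [hy] with w hw
      rw [hw]
  obtain ⟨E, -, hXE, N, hN, hN'⟩ := key
  refine ⟨N, hN, ?_⟩
  filter_upwards [hN', ae_restrict_mem h.isOpen.measurableSet] with x hx hxX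
  exact hx (hXE ⟨subset_closure hxX, hxX⟩)

end Compacting

end Admissible

end

section

variable {d : ℕ} {X V : Set (Vec d)} {ν : Measure (Vec d)}

/-! ### A test function exchanging particles between two balls -/

/-- The function `1` on the ball about `b₀` and `-1` on the ball about `b₁`. -/
def twoBalls (b₀ b₁ : Vec d) (ρ : ℝ) (x : Vec d) : ℝ :=
  (Metric.ball b₀ ρ).indicator 1 x - (Metric.ball b₁ ρ).indicator 1 x

theorem measurable_twoBalls (b₀ b₁ : Vec d) (ρ : ℝ) : Measurable (twoBalls b₀ b₁ ρ) :=
  (measurable_one.indicator Metric.isOpen_ball.measurableSet).sub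
    (measurable_one.indicator Metric.isOpen_ball.measurableSet)

theorem abs_twoBalls_le (b₀ b₁ : Vec d) (ρ : ℝ) (x : Vec d) : |twoBalls b₀ b₁ ρ x| ≤ 1 := by
  unfold twoBalls
  by_cases h0 : x ∈ Metric.ball b₀ ρ <;> by_cases h1 : x ∈ Metric.ball b₁ ρ <;>
    simp only [h0, h1, indicator_of_mem, indicator_of_notMem, not_false_eq_true, Pi.one_apply] <;>
    norm_num

/-- Two points at distance at least 2ρ do not lie in a common ball of radius ρ, so the product
cannot be positive. -/
theorem twoBalls_mul_le {b₀ b₁ x y : Vec d} {ρ : ℝ} (hxy : 2 * ρ ≤ dist x y) :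
    twoBalls b₀ b₁ ρ x * twoBalls b₀ b₁ ρ y ≤ 0 := by
  have h : ∀ b : Vec d, x ∈ Metric.ball b ρ → y ∉ Metric.ball b ρ := fun b hx hy => by
    have := dist_triangle_right x y b
    rw [Metric.mem_ball] at hx hy
    linarith
  unfold twoBalls
  by_cases h0 : x ∈ Metric.ball b₀ ρ
  · have h0' := h _ h0
    by_cases h1 : x ∈ Metric.ball b₁ ρ
    · simp only [h0, h1, indicator_of_mem, Pi.one_apply]
      norm_num
    · simp only [h0, h1, h0', indicator_of_mem, indicator_of_notMem, not_false_eq_true, Pi.one_apply]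
      have := indicator_nonneg (s := Metric.ball b₁ ρ) (f := (1 : Vec d → ℝ))
        (fun _ _ => zero_le_one) y
      linarith
  · by_cases h1 : x ∈ Metric.ball b₁ ρ
    · have h1' := h _ h1
      simp only [h0, h1, h1', indicator_of_mem, indicator_of_notMem, not_false_eq_true, Pi.one_apply]
      have := indicator_nonneg (s := Metric.ball b₀ ρ) (f := (1 : Vec d → ℝ))
        (fun _ _ => zero_le_one) y
      linarith
    · simp only [h0, h1, indicator_of_notMem, not_false_eq_true]
      norm_num

theorem twoBalls_mul_eq {b₀ b₁ x y : Vec d} {ρ : ℝ} (hb : 2 * ρ ≤ dist b₀ b₁)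
    (hx : x ∈ Metric.ball b₀ ρ) (hy : y ∈ Metric.ball b₁ ρ) :
    twoBalls b₀ b₁ ρ x * twoBalls b₀ b₁ ρ y = -1 := by
  have hd := Metric.ball_disjoint_ball (x := b₀) (y := b₁) (δ := ρ) (ε := ρ) (by linarith)
  have h1 := hd.notMem_of_mem_left hx
  have h2 := hd.notMem_of_mem_right hy
  simp [twoBalls, hx, hy, h1, h2]

/-- The pointwise estimate behind the lower bound on the quadratic form. -/
theorem twoBalls_kernel_ge {b₀ b₁ x y : Vec d} {ρ c a C M₁ M₂ M₃ t s s' E : ℝ} {v : Vec d}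
    (hc : 0 < c) (hv : c ≤ ‖v‖) (ht : 0 ≤ t) (hxy : y = x - t • v)
    (hρa : 2 * ρ ≤ c * (a / 2))
    (hM₁ : 0 ≤ M₁) (hs : M₁ ≤ s ∧ s ≤ M₂) (hs' : M₁ ≤ s' ∧ s' ≤ M₂) (hC : 0 ≤ C + M₃)
    (hE0 : 0 ≤ E) (hE : E ≤ Real.exp ((C + M₃) * t)) :
    -(M₂ ^ 2 * Real.exp ((C + M₃) * (a / 2))) ≤
      -(twoBalls b₀ b₁ ρ x * s) * (E * (twoBalls b₀ b₁ ρ y * s')) := by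
  have e : -(twoBalls b₀ b₁ ρ x * s) * (E * (twoBalls b₀ b₁ ρ y * s')) =
      -(twoBalls b₀ b₁ ρ x * twoBalls b₀ b₁ ρ y) * (s * s' * E) := by ring
  have hs0 : 0 ≤ s := hM₁.trans hs.1
  have hs0' : 0 ≤ s' := hM₁.trans hs'.1
  have hM₂ : 0 ≤ M₂ := hs0.trans hs.2
  rw [e]
  rcases le_or_gt (2 * ρ) (dist x y) with h | h
  · have h1 := twoBalls_mul_le (b₀ := b₀) (b₁ := b₁) h
    have h2 : 0 ≤ -(twoBalls b₀ b₁ ρ x * twoBalls b₀ b₁ ρ y) * (s * s' * E) :=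
      mul_nonneg (by linarith) (by positivity)
    have h3 : 0 ≤ M₂ ^ 2 * Real.exp ((C + M₃) * (a / 2)) := by positivity
    linarith
  -- The only remaining case: |x - y| < 2ρ ≤ ca/2 together with speed at least c forces a short
  -- flight, for which the weight is at most e^{(C + M₃)a/2}.
  · have hta : t ≤ a / 2 := by
      rw [hxy, dist_eq_norm, sub_sub_cancel, norm_smul, Real.norm_of_nonneg ht] at h
      have : t * c ≤ t * ‖v‖ := by gcongr
      by_contra! hcon
      nlinarith
    have h1 : |twoBalls b₀ b₁ ρ x * twoBalls b₀ b₁ ρ y| ≤ 1 := by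
      rw [abs_mul]
      exact mul_le_one₀ (abs_twoBalls_le _ _ _ _) (abs_nonneg _) (abs_twoBalls_le _ _ _ _)
    have h2 : s * s' * E ≤ M₂ ^ 2 * Real.exp ((C + M₃) * (a / 2)) := by
      rw [pow_two]
      refine mul_le_mul (mul_le_mul hs.2 hs'.2 hs0' hM₂) (hE.trans ?_) hE0 (by positivity)
      exact Real.exp_le_exp.2 (mul_le_mul_of_nonneg_left hta hC)
    have h3 : 0 ≤ s * s' * E := by positivity
    nlinarith [(abs_le.1 h1).1, (abs_le.1 h1).2]

theorem twoBalls_kernel_ge_of_mem {b₀ b₁ x y : Vec d} {ρ a C M₁ M₂ t s s' E : ℝ}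
    (hb : 2 * ρ ≤ dist b₀ b₁) (hx : x ∈ Metric.ball b₀ ρ) (hy : y ∈ Metric.ball b₁ ρ)
    (hat : a ≤ t) (hM₁ : 0 ≤ M₁) (hs : M₁ ≤ s ∧ s ≤ M₂) (hs' : M₁ ≤ s' ∧ s' ≤ M₂) (hC : 0 ≤ C)
    (hE : Real.exp (C * t) ≤ E) :
    M₁ ^ 2 * Real.exp (C * a) ≤ -(twoBalls b₀ b₁ ρ x * s) * (E * (twoBalls b₀ b₁ ρ y * s')) := by
  have e : -(twoBalls b₀ b₁ ρ x * s) * (E * (twoBalls b₀ b₁ ρ y * s')) =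
      -(twoBalls b₀ b₁ ρ x * twoBalls b₀ b₁ ρ y) * (s * s' * E) := by ring
  rw [e, twoBalls_mul_eq hb hx hy, neg_neg, one_mul, pow_two]
  have hs0 : 0 ≤ s := hM₁.trans hs.1
  refine mul_le_mul (mul_le_mul hs.1 hs'.1 hM₁ hs0) (le_trans ?_ hE) (Real.exp_pos _).le
    (mul_nonneg hs0 (hM₁.trans hs'.1))
  exact Real.exp_le_exp.2 (mul_le_mul_of_nonneg_left hat hC)

namespace Admissible

/-- The configuration of two balls and of the velocities that connect them. -/
theorem exists_twoBalls (h : Admissible X V ν) {c : ℝ} (hc : 0 < c) (hcV : ∀ v ∈ V, c ≤ ‖v‖) :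
    ∃ (b₀ b₁ v₀ : Vec d) (a ρ η : ℝ), 0 < a ∧ 0 < ρ ∧ 0 < η ∧ 2 * ρ ≤ c * (a / 2) ∧
      2 * ρ ≤ dist b₀ b₁ ∧ 0 < ν (Metric.ball v₀ η) ∧ Metric.ball b₀ (ρ / 2) ⊆ X ∧
      ∀ x ∈ Metric.ball b₀ (ρ / 2), ∀ v ∈ Metric.ball v₀ η, v ∈ V → a + η ≤ tauMinus X (x, v) ∧
        ∀ t ∈ Icc a (a + η), x - t • v ∈ Metric.ball b₁ ρ := by
  obtain ⟨b₀, hb₀⟩ := h.isC1.2.1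
  obtain ⟨R, hR, hRX⟩ := Metric.isOpen_iff.1 h.isOpen b₀ hb₀
  have hνV : ν V ≠ 0 := fun h0 => h.ne_zero <| Measure.measure_univ_eq_zero.1 <| le_antisymm
    ((measure_mono (union_compl_self V).ge).trans ((measure_union_le _ _).trans_eq
      (by rw [h0, show ν Vᶜ = 0 from h.ae_mem, add_zero]))) bot_le
  -- A velocity in the support of ν, so that every ball about it has positive measure.
  obtain ⟨v₀, hv₀, hpos⟩ := exists_mem_forall_mem_nhdsWithin_pos_measure hνV
  have hv₀c := hcV v₀ hv₀
  have hN : 0 < ‖v₀‖ := hc.trans_le hv₀c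
  -- The time a keeps flights of length up to 2a with speed at most ‖v₀‖ + 1 inside the ball of
  -- radius R contained in X. The radius ρ makes flights within one ball shorter than a/2. The
  -- tolerance η makes every flight with velocity near v₀ and time in [a, a + η] end in the second
  -- ball.
  set a := min 1 (R / (4 * (‖v₀‖ + 1))) with ha
  have ha0 : 0 < a := by positivity
  have ha1 : a ≤ 1 := min_le_left _ _
  have haR : a * (‖v₀‖ + 1) ≤ R / 4 := by
    have : a ≤ R / (4 * (‖v₀‖ + 1)) := min_le_right _ _
    rw [le_div_iff₀ (by positivity)] at this
    linarith
  set ρ := min (R / 4) (c * a / 4) with hρ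
  have hρ0 : 0 < ρ := by positivity
  have hρR : ρ ≤ R / 4 := min_le_left _ _
  have hρa : ρ ≤ c * a / 4 := min_le_right _ _
  set η := min a (ρ / (4 * (‖v₀‖ + 2))) with hη
  have hη0 : 0 < η := by positivity
  have hηa : η ≤ a := min_le_left _ _
  have hηρ : η * (4 * (‖v₀‖ + 2)) ≤ ρ := by
    rw [← le_div_iff₀ (by positivity)]
    exact min_le_right _ _
  refine ⟨b₀, b₀ - a • v₀, v₀, a, ρ, η, ha0, hρ0, hη0, by linarith, ?_, ?_, ?_, ?_⟩
  · rw [dist_eq_norm, sub_sub_cancel, norm_smul, Real.norm_of_nonneg ha0.le]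
    nlinarith
  · exact hpos _ (mem_nhdsWithin_of_mem_nhds (Metric.ball_mem_nhds _ hη0))
  · exact (Metric.ball_subset_ball (by linarith)).trans hRX
  intro x hx v hv hvV
  rw [Metric.mem_ball, dist_eq_norm] at hx hv
  have hvn : ‖v‖ ≤ ‖v₀‖ + η := by
    have := norm_add_le (v - v₀) v₀
    rw [sub_add_cancel] at this
    linarith
  have hη1 : η ≤ 1 := hηa.trans ha1
  constructor
  · by_contra! hlt
    refine sub_tauMinus_smul_notMem h.isOpen h.isBounded (p := (x, v)) (h.velocity_ne_zero hvV)
      (hRX ?_)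
    rw [Metric.mem_ball, dist_eq_norm]
    have hτ0 := tauMinus_nonneg X (x, v)
    set T := tauMinus X (x, v)
    calc ‖x - T • v - b₀‖ = ‖(x - b₀) - T • v‖ := by congr 1; abel
      _ ≤ ‖x - b₀‖ + T * ‖v‖ := by
        refine (norm_sub_le _ _).trans ?_
        rw [norm_smul, Real.norm_of_nonneg hτ0]
      _ ≤ ρ / 2 + (a + a) * (‖v₀‖ + 1) := by
        have : T * ‖v‖ ≤ (a + a) * (‖v₀‖ + 1) :=
          mul_le_mul (by linarith) (by linarith) (norm_nonneg _) (by positivity)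
        linarith
      _ < R := by linarith
  · intro t ht
    rw [Metric.mem_ball, dist_eq_norm]
    have e : x - t • v - (b₀ - a • v₀) = (x - b₀) - ((t - a) • v + a • (v - v₀)) := by
      rw [smul_sub, sub_smul]
      abel
    rw [e]
    have h1 : ‖(t - a) • v‖ ≤ η * (‖v₀‖ + 1) := by
      rw [norm_smul, Real.norm_of_nonneg (by linarith [ht.1])]
      exact mul_le_mul (by linarith [ht.2]) (by linarith) (norm_nonneg _) hη0.le
    have h2 : ‖a • (v - v₀)‖ ≤ η := by
      rw [norm_smul, Real.norm_of_nonneg ha0.le]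
      nlinarith [norm_nonneg (v - v₀)]
    calc _ ≤ ‖x - b₀‖ + (‖(t - a) • v‖ + ‖a • (v - v₀)‖) :=
          (norm_sub_le _ _).trans (by gcongr; exact norm_add_le _ _)
      _ < ρ / 2 + ρ / 4 := by nlinarith
      _ < ρ := by linarith

/-- Long flights between the balls give e^{Ca} on a set of positive measure, whereas every
contribution of the wrong sign is at most of order e^{(C + M₃)a/2}. All constants other than C come
from the geometry and from the bounds, so C can be chosen before σ and s. -/
theorem exists_test_function (h : Admissible X V ν) {M₁ M₂ M₃ : ℝ} (hM₁ : 0 < M₁) (hM₃ : 0 ≤ M₃) :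
    ∃ C, M₂ ≤ C ∧ 0 < C ∧ ∃ w : Vec d → ℝ, Measurable w ∧ (∀ x, |w x| ≤ 1) ∧
      ∀ (σ s : Vec d × Vec d → ℝ), BoundedBy C (C + M₃) σ →
        AEStronglyMeasurable s (phaseMeasure X ν) →
        (∀ᵐ p ∂phaseMeasure X ν, M₁ ≤ s p ∧ s p ≤ M₂) →
        M₂ * (phaseMeasure X ν).real univ <
          -∫ p, (w p.1 * s p) * TMinusInv X (fun q => -σ q) (fun q => w q.1 * s q) p
            ∂phaseMeasure X ν := by
  have := h.finite
  have := h.isFiniteMeasure_phase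
  obtain ⟨c, hc, hcV⟩ := h.lower
  obtain ⟨D, hD, hDt⟩ := h.exists_tau_le
  obtain ⟨b₀, b₁, v₀, a, ρ, η, ha, hρ, hη, hρa, hb, hνb, hbX, hgeo⟩ := h.exists_twoBalls hc hcV
  set Q := Metric.ball b₀ (ρ / 2) ×ˢ Metric.ball v₀ η with hQ
  have hQm : MeasurableSet Q := Metric.isOpen_ball.measurableSet.prod Metric.isOpen_ball.measurableSet
  set m := (phaseMeasure X ν).real Q with hm
  have hm0 : 0 < m := by
    rw [hm, Measure.real, ENNReal.toReal_pos_iff]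
    refine ⟨?_, by finiteness⟩
    rw [hQ, phaseMeasure, Measure.prod_prod, Measure.restrict_apply Metric.isOpen_ball.measurableSet,
      inter_eq_left.2 hbX]
    exact ENNReal.mul_pos (Metric.measure_ball_pos _ _ (by positivity)).ne' hνb.ne'
  set Pu := (phaseMeasure X ν).real univ with hPu
  have hPu0 : 0 ≤ Pu := measureReal_nonneg
  obtain ⟨C, hCM, hC0, hCbig⟩ : ∃ C, M₂ ≤ C ∧ 0 < C ∧
      M₂ * Pu < M₁ ^ 2 * η * m * Real.exp (C * a) -
        M₂ ^ 2 * Real.exp ((C + M₃) * (a / 2)) * D * Pu := by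
    set A := M₁ ^ 2 * η * m with hA
    set B := M₂ ^ 2 * Real.exp (M₃ * (a / 2)) * D * Pu with hB
    have hA0 : 0 < A := by positivity
    have hB0 : 0 ≤ B := by positivity
    have hlim : Tendsto (fun C : ℝ => Real.exp (C * (a / 2))) atTop atTop :=
      Real.tendsto_exp_atTop.comp (tendsto_id.atTop_mul_const (by positivity))
    -- With y = e^{Ca/2} the required inequality reads A y² - B y > M₂ Pu. It follows from y > 1 and
    -- A y > B + |M₂ Pu|.
    obtain ⟨C, hC1, hC2, hC3⟩ := ((hlim.eventually_gt_atTop (max 1 ((B + |M₂ * Pu|) / A))).and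
      ((eventually_ge_atTop M₂).and (eventually_gt_atTop 0))).exists
    refine ⟨C, hC2, hC3, ?_⟩
    set y := Real.exp (C * (a / 2)) with hy
    have hy1 : 1 < y := (le_max_left _ _).trans_lt hC1
    have hy2 : B + |M₂ * Pu| < A * y := by
      have := (le_max_right _ _).trans_lt hC1
      rw [div_lt_iff₀ hA0] at this
      linarith
    have e1 : Real.exp (C * a) = y * y := by
      rw [hy, ← Real.exp_add]
      congr 1
      ring
    have e2 : M₂ ^ 2 * Real.exp ((C + M₃) * (a / 2)) * D * Pu = B * y := by
      rw [hB, hy, add_mul, Real.exp_add]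
      ring
    rw [e1, e2]
    nlinarith [le_abs_self (M₂ * Pu), abs_nonneg (M₂ * Pu)]
  refine ⟨C, hCM, hC0, twoBalls b₀ b₁ ρ, measurable_twoBalls _ _ _, abs_twoBalls_le _ _ _,
    fun σ s hσ hsm hs => ?_⟩
  set W := twoBalls b₀ b₁ ρ with hW
  set B := M₂ ^ 2 * Real.exp ((C + M₃) * (a / 2)) with hB
  set A := M₁ ^ 2 * Real.exp (C * a) with hA
  have hB0 : 0 ≤ B := by positivity
  have hA0 : 0 ≤ A := by positivity
  have hGm : AEStronglyMeasurable (fun q : Vec d × Vec d => W q.1 * s q) (phaseMeasure X ν) :=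
    ((measurable_twoBalls b₀ b₁ ρ).comp measurable_fst).aestronglyMeasurable.mul hsm
  have hG : MemLp (fun q : Vec d × Vec d => W q.1 * s q) 2 (phaseMeasure X ν) := by
    refine MemLp.of_bound hGm (|M₂|) ?_
    filter_upwards [hs] with p hp
    rw [norm_mul]
    calc _ ≤ 1 * |M₂| := by
          refine mul_le_mul (abs_twoBalls_le _ _ _ _) ?_ (norm_nonneg _) zero_le_one
          rw [Real.norm_eq_abs]
          exact abs_le_abs_of_nonneg (hM₁.le.trans hp.1) hp.2
      _ = _ := one_mul _
  obtain ⟨U, hU⟩ := h.exists_clm_TMinusInv hσ.neg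
  have hUG : MemLp (TMinusInv X (fun q => -σ q) (fun q => W q.1 * s q)) 2 (phaseMeasure X ν) :=
    (memLp_congr_ae (hU _ _ hG.coeFn_toLp)).1 (Lp.memLp _)
  have hint : Integrable (fun p => (W p.1 * s p) *
      TMinusInv X (fun q => -σ q) (fun q => W q.1 * s q) p) (phaseMeasure X ν) :=
    hG.integrable_mul hUG
  -- The loss is at most B at each time, hence at most BD on a chord. On Q the whole time window (a,
  -- a + η) precedes the exit and gains A.
  have hpt : ∀ᵐ p ∂phaseMeasure X ν, Q.indicator (fun _ => A * η) p - B * D ≤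
      -((W p.1 * s p) * TMinusInv X (fun q => -σ q) (fun q => W q.1 * s q) p) := by
    filter_upwards [h.ae_phase, hs, h.ae_back hs,
      h.ae_intervalIntegrable_back (hG.integrable (by norm_num))] with p hp hsp hsb hii
    have hτ0 := tauMinus_nonneg X p
    have hτD := (hDt p hp.2).2
    have hcont := hσ.neg.continuous_EMinus p
    have e : -((W p.1 * s p) * TMinusInv X (fun q => -σ q) (fun q => W q.1 * s q) p) =
        ∫ t in Ioo 0 (tauMinus X p), -(W p.1 * s p) *
          (EMinus (fun q => -σ q) p t * (W (p.1 - t • p.2) * s (p.1 - t • p.2, p.2))) := by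
      rw [← intervalIntegral_eq_Ioo hτ0, intervalIntegral.integral_const_mul, neg_mul]
      rfl
    have hi : IntegrableOn (fun t => -(W p.1 * s p) *
        (EMinus (fun q => -σ q) p t * (W (p.1 - t • p.2) * s (p.1 - t • p.2, p.2))))
        (Ioo 0 (tauMinus X p)) := by
      have h1 := (hii.continuousOn_mul hcont.continuousOn).const_mul (-(W p.1 * s p))
      exact ((intervalIntegrable_iff_integrableOn_Ioo_of_le hτ0).1 h1)
    have hlow : ∀ᵐ t ∂volume.restrict (Ioo 0 (tauMinus X p)),
        (Q.indicator (fun _ => (Ioo a (a + η)).indicator (fun _ => A) t) p) - B ≤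
        -(W p.1 * s p) *
        (EMinus (fun q => -σ q) p t * (W (p.1 - t • p.2) * s (p.1 - t • p.2, p.2))) := by
      filter_upwards [hsb, ae_restrict_mem measurableSet_Ioo] with t hst ht
      have hEle := hσ.neg.EMinus_le p ht.1.le
      have hEge := hσ.neg.le_EMinus p ht.1.le
      rw [neg_neg] at hEle hEge
      have hmain : Q.indicator (fun _ => (Ioo a (a + η)).indicator (fun _ => A) t) p = 0 →
          (Q.indicator (fun _ => (Ioo a (a + η)).indicator (fun _ => A) t) p) - B ≤
          -(W p.1 * s p) *
          (EMinus (fun q => -σ q) p t * (W (p.1 - t • p.2) * s (p.1 - t • p.2, p.2))) := by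
        intro h0
        rw [h0, zero_sub]
        exact twoBalls_kernel_ge hc (hcV _ hp.2) ht.1.le rfl hρa hM₁.le hsp hst (by linarith)
          (Real.exp_pos _).le hEle
      by_cases hpQ : p ∈ Q
      · by_cases hta : t ∈ Ioo a (a + η)
        · rw [indicator_of_mem hpQ, indicator_of_mem hta]
          refine (sub_le_self _ hB0).trans ?_
          exact twoBalls_kernel_ge_of_mem hb (Metric.ball_subset_ball (by linarith) hpQ.1)
            ((hgeo _ hpQ.1 _ hpQ.2 hp.2).2 t (Ioo_subset_Icc_self hta)) hta.1.le hM₁.le hsp hst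
            hC0.le hEge
        · exact hmain (by rw [indicator_of_mem hpQ, indicator_of_notMem hta])
      · exact hmain (indicator_of_notMem hpQ _)
    rw [e]
    have hci : IntegrableOn (fun t => (Q.indicator (fun _ => (Ioo a (a + η)).indicator
        (fun _ => A) t) p) - B) (Ioo 0 (tauMinus X p)) := by
      refine Integrable.sub ?_ (integrable_const _)
      by_cases hpQ : p ∈ Q
      · simp only [indicator_of_mem hpQ]
        exact (integrable_const A).indicator measurableSet_Ioo
      · simp [hpQ]
    refine le_trans ?_ (setIntegral_mono_ae_restrict hci hi hlow)
    rw [integral_sub _ (integrable_const _)]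
    · refine sub_le_sub ?_ ?_
      · by_cases hpQ : p ∈ Q
        · simp only [indicator_of_mem hpQ]
          rw [setIntegral_indicator measurableSet_Ioo, setIntegral_const]
          have hsub : Ioo a (a + η) ⊆ Ioo 0 (tauMinus X p) :=
            Ioo_subset_Ioo ha.le (hgeo _ hpQ.1 _ hpQ.2 hp.2).1
          rw [inter_eq_right.2 hsub]
          simp [hη.le, mul_comm]
        · simp [hpQ]
      · rw [setIntegral_const]
        simp only [Real.volume_real_Ioo, smul_eq_mul, sub_zero]
        rw [max_eq_left hτ0, mul_comm]
        gcongr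
    · by_cases hpQ : p ∈ Q
      · simp only [indicator_of_mem hpQ]
        exact (integrable_const A).indicator measurableSet_Ioo
      · simp [hpQ]
  have hfin := integral_mono_ae (f := fun p => Q.indicator (fun _ => A * η) p - B * D)
    (((integrable_const (A * η)).indicator hQm).sub (integrable_const _)) hint.neg hpt
  rw [integral_sub ((integrable_const (A * η)).indicator hQm) (integrable_const _),
    integral_indicator_const _ hQm, integral_const] at hfin
  have e3 : ∫ p, (-fun p => (W p.1 * s p) *
      TMinusInv X (fun q => -σ q) (fun q => W q.1 * s q) p) p ∂phaseMeasure X ν =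
      -∫ p, (W p.1 * s p) * TMinusInv X (fun q => -σ q) (fun q => W q.1 * s q) p
        ∂phaseMeasure X ν := integral_neg _
  rw [e3] at hfin
  simp only [smul_eq_mul] at hfin
  refine hCbig.trans_le (le_trans (le_of_eq ?_) hfin)
  rw [hA, hB]
  ring

end Admissible

end

section

variable {d : ℕ} {X V : Set (Vec d)} {ν : Measure (Vec d)}

/-! ### The eigenvalue of `K T_{Γ₊}⁻¹` -/

theorem integral_comp_measurePreserving {α β : Type*} [MeasurableSpace α] [MeasurableSpace β]
    {m : Measure α} {n : Measure β} {g : α → β} (hg : MeasurePreserving g m n) {F : β → ℝ}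
    (hF : AEStronglyMeasurable F n) : ∫ x, F (g x) ∂m = ∫ y, F y ∂n := by
  rw [← hg.map_eq] at hF ⊢
  exact (integral_map hg.measurable.aemeasurable hF).symm

namespace Admissible

theorem aestronglyMeasurable_sigmaS (h : Admissible X V ν) {k : Vec d × Vec d × Vec d → ℝ}
    (hk : Measurable k) (hks : IsSymmetricEvenKernel X ν k) :
    AEStronglyMeasurable (sigmaS ν k) (phaseMeasure X ν) := by
  refine (h.aestronglyMeasurable_KOp hk (aestronglyMeasurable_const (b := (1 : ℝ)))).congr ?_
  filter_upwards [h.KOp_position hks fun _ => 1] with p hp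
  simpa using hp

theorem TPlusInv_of_even (h : Admissible X V ν) {σ f : Vec d × Vec d → ℝ}
    (hσ : ∀ p, σ (reflect p) = σ p) (hf : ∀ᵐ p ∂phaseMeasure X ν, f (reflect p) = f p) :
    TPlusInv X σ f =ᵐ[phaseMeasure X ν]
      fun p => -TMinusInv X (fun q => -σ q) f (reflect p) := by
  have h1 := h.TMinusInv_congr (ae_eq_refl fun q => -σ q) hf
  filter_upwards [h.measurePreserving_reflect_phase.quasiMeasurePreserving.ae h1] with p hp
  rw [TPlusInv_eq_reflect, ← hp]
  simp only [hσ]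

theorem inner_TPlusInv (h : Admissible X V ν) {a b : ℝ} {σ : Vec d × Vec d → ℝ}
    (hσ : BoundedBy a b σ) {U T : Lp ℝ 2 (phaseMeasure X ν) →L[ℝ] Lp ℝ 2 (phaseMeasure X ν)}
    (hU : ∀ (f : Lp ℝ 2 (phaseMeasure X ν)) (g : Vec d × Vec d → ℝ), f =ᵐ[phaseMeasure X ν] g →
      U f =ᵐ[phaseMeasure X ν] TMinusInv X (fun q => -σ q) g)
    (hT : ∀ (f : Lp ℝ 2 (phaseMeasure X ν)) (g : Vec d × Vec d → ℝ), f =ᵐ[phaseMeasure X ν] g →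
      T f =ᵐ[phaseMeasure X ν] TPlusInv X σ g) (f g : Lp ℝ 2 (phaseMeasure X ν)) :
    inner ℝ (T f) g = -inner ℝ f (U g) := by
  have h1 := h.integral_mul_TMinusInv hσ.neg (Lp.memLp f) (Lp.memLp g)
  simp only [neg_neg] at h1
  rw [inner_eq_integral, inner_eq_integral]
  have e1 : ∫ p, T f p * g p ∂phaseMeasure X ν = ∫ p, TPlusInv X σ f p * g p ∂phaseMeasure X ν := by
    refine integral_congr_ae ?_
    filter_upwards [hT f f (ae_eq_refl _)] with p hp
    rw [hp]
  have e2 : ∫ p, f p * U g p ∂phaseMeasure X ν =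
      ∫ p, f p * TMinusInv X (fun q => -σ q) g p ∂phaseMeasure X ν := by
    refine integral_congr_ae ?_
    filter_upwards [hU g g (ae_eq_refl _)] with p hp
    rw [hp]
  rw [e1, e2]
  linarith

/-- For large absorption, `K T_{Γ₊}⁻¹` has an eigenvalue larger than `1`. -/
theorem exists_eigenvalue (h : Admissible X V ν) {M₁ M₂ M₃ : ℝ} (hM₁ : 0 < M₁) (hM₃ : 0 ≤ M₃) :
    ∃ C, M₂ ≤ C ∧ 0 < C ∧ ∀ k k' : Vec d × Vec d × Vec d → ℝ, IsContinuousKernel X ν k →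
      Measurable k' → k =ᵐ[kernelMeasure X ν] k' → IsSymmetricEvenKernel X ν k' →
      IsNonnegOperator X ν k' →
      (∀ᵐ p ∂phaseMeasure X ν, M₁ ≤ sigmaS ν k' p ∧ sigmaS ν k' p ≤ M₂) →
      ∀ σ : Vec d × Vec d → ℝ, BoundedBy C (C + M₃) σ → (∀ p, σ (reflect p) = σ p) →
        (∃ M, 0 ≤ M ∧ KernelBound X ν k' M) ∧ ∃ μ : ℝ, 1 < μ ∧
          HasL2Eigenvalue (phaseMeasure X ν) (fun f => KOp ν k' (TPlusInv X σ f)) μ := by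
  have := h.finite
  have := h.isFiniteMeasure_phase
  -- Supplies separability of L², which the extraction of weakly convergent subsequences requires.
  have : Fact ((2 : ℝ≥0∞) ≠ ⊤) := ⟨by norm_num⟩
  obtain ⟨C, hCM, hC0, w, hw, hw1, hC⟩ := h.exists_test_function (M₂ := M₂) hM₁ hM₃
  refine ⟨C, hCM, hC0, fun k k' hk hk' hkk' hks hkn hsig σ hσ hσr => ?_⟩
  obtain ⟨U, hU⟩ := h.exists_clm_TMinusInv hσ.neg
  obtain ⟨T, hT⟩ := h.exists_clm_TPlusInv hσ
  have hcomp := h.isCompactingKernel_of_continuous hσ.neg hU hk hk' hkk'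
  obtain ⟨M, hM, hkM⟩ := hcomp.1
  refine ⟨⟨M, hM, hkM⟩, ?_⟩
  obtain ⟨K, -, hK⟩ := h.exists_clm_KOp hM hkM
  have hK' : ∀ f : Lp ℝ 2 (phaseMeasure X ν), K f =ᵐ[phaseMeasure X ν] KOp ν k' f :=
    fun f => hK f f (ae_eq_refl _)
  have hUK : CompletelyContinuous (U.comp K) := by
    refine hcomp.2 univ .univ K ?_
    rw [univ_prod_univ, indicator_univ]
    exact hK'
  have hadj := h.inner_TPlusInv hσ hU hT
  have hinner : ∀ (f g : Lp ℝ 2 (phaseMeasure X ν)) (f' g' : Vec d × Vec d → ℝ),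
      f =ᵐ[phaseMeasure X ν] f' → g =ᵐ[phaseMeasure X ν] g' →
      inner ℝ f g = ∫ p, f' p * g' p ∂phaseMeasure X ν := fun f g f' g' hf hg => by
    rw [inner_eq_integral]
    refine integral_congr_ae ?_
    filter_upwards [hf, hg] with p h1 h2
    rw [h1, h2]
  have hsym : ∀ f g, inner ℝ (K f) g = inner ℝ f (K g) := fun f g => by
    rw [hinner _ _ _ _ (hK' f) (ae_eq_refl g), hinner _ _ _ _ (ae_eq_refl f) (hK' g)]
    exact h.integral_KOp_mul hkM hks (Lp.memLp f) (Lp.memLp g)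
  have hpos : ∀ f, 0 ≤ inner ℝ (K f) f := fun f => by
    rw [hinner _ _ _ _ (hK' f) (ae_eq_refl f)]
    exact hkn f (Lp.memLp f)
  -- Kf and Kg are even. On even functions T is -U followed by reflection, and reflection preserves
  -- the measure, so it can be moved onto Kf, where it disappears.
  have hTK : ∀ f g, inner ℝ (T (K f)) (K g) = inner ℝ (K f) (T (K g)) := fun f g => by
    have hr := h.measurePreserving_reflect_phase
    have hUg := hU _ _ (hK' g)
    rw [hadj, hinner _ _ _ _ (hK' f) hUg,
      hinner _ _ _ _ (hK' f) ((hT _ _ (hK' g)).trans (h.TPlusInv_of_even hσr (h.KOp_reflect hks g))),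
      ← integral_neg]
    have hm : AEStronglyMeasurable (fun p => -(KOp ν k' f p *
        TMinusInv X (fun q => -σ q) (KOp ν k' g) p)) (phaseMeasure X ν) :=
      (((Lp.aestronglyMeasurable (K f)).congr (hK' f)).mul
        ((Lp.aestronglyMeasurable (U (K g))).congr hUg)).neg
    rw [← integral_comp_measurePreserving hr hm]
    refine integral_congr_ae ?_
    filter_upwards [h.KOp_reflect hks f] with p hp
    rw [hp]
    ring
  -- K is symmetric and T = -U*, so KT = -(UK)*. Velocity averaging gives complete continuity of UK,
  -- and this passes to the adjoint.
  have hcc : CompletelyContinuous (K.comp T) := by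
    have e : K.comp T = -ContinuousLinearMap.adjoint (U.comp K) := by
      refine ContinuousLinearMap.ext fun f => ext_inner_right ℝ fun g => ?_
      rw [neg_apply, inner_neg_left, ContinuousLinearMap.adjoint_inner_left]
      rw [ContinuousLinearMap.comp_apply, ContinuousLinearMap.comp_apply, hsym, hadj]
    rw [e]
    intro u hu
    simpa using (hUK.adjoint u hu).neg
  have hwm : MemLp (fun p : Vec d × Vec d => w p.1) 2 (phaseMeasure X ν) :=
    MemLp.of_bound (hw.comp measurable_fst).aestronglyMeasurable 1 (ae_of_all _ fun p => hw1 p.1)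
  have hK₀ : K (hwm.toLp _) =ᵐ[phaseMeasure X ν] fun p => w p.1 * sigmaS ν k' p :=
    (hK _ _ hwm.coeFn_toLp).trans (h.KOp_position hks w)
  -- Since w² ≤ 1 and σ_s ≤ M₂, the left side is at most M₂ times the measure of phase space, the
  -- very bound exceeded by the test function.
  have hlt : inner ℝ (K (hwm.toLp _)) (hwm.toLp _) <
      inner ℝ (T (K (hwm.toLp _))) (K (hwm.toLp _)) := by
    rw [hadj, hinner _ _ _ _ hK₀ (hU _ _ hK₀), hinner _ _ _ _ hK₀ hwm.coeFn_toLp]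
    refine lt_of_le_of_lt ?_ (hC σ (sigmaS ν k') hσ (h.aestronglyMeasurable_sigmaS hk' hks) hsig)
    have hi : Integrable (fun p => w p.1 * sigmaS ν k' p * w p.1) (phaseMeasure X ν) :=
      ((memLp_congr_ae hK₀).1 (Lp.memLp _)).integrable_mul hwm
    refine (integral_mono_ae hi (integrable_const M₂) ?_).trans_eq ?_
    · filter_upwards [hsig] with p hp
      have h1 : w p.1 * w p.1 ≤ 1 := by
        have := abs_le.1 (hw1 p.1)
        nlinarith
      nlinarith [mul_self_nonneg (w p.1), hM₁.le.trans hp.1]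
    · rw [integral_const, smul_eq_mul, mul_comm]
  obtain ⟨μ, hμ, f, hf, hfμ⟩ := exists_eigenvalue_gt_one K T hsym hpos hTK hcc _ hlt
  refine ⟨μ, hμ, f, Lp.memLp f, fun h0 => hf ((Lp.eq_zero_iff_ae_eq_zero).2 h0), ?_⟩
  have h1 : K (T f) =ᵐ[phaseMeasure X ν] KOp ν k' (TPlusInv X σ f) :=
    hK _ _ (hT f f (ae_eq_refl _))
  rw [hfμ] at h1
  filter_upwards [h1, Lp.coeFn_smul μ f] with p h2 h3
  rw [← h2, h3]
  rfl

end Admissible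

end

section

variable {d : ℕ} {X V : Set (Vec d)} {ν : Measure (Vec d)}

/-! ### The transport operators on a line -/

theorem EMinus_eq_EPlus (σ : Vec d × Vec d → ℝ) (p : Vec d × Vec d) (t : ℝ) :
    EMinus σ p t = EPlus σ p (-t) := by
  unfold EMinus EPlus
  have := intervalIntegral.integral_comp_neg (fun s => σ (p.1 + s • p.2, p.2)) (a := 0) (b := t)
  simp only [neg_smul, ← sub_eq_add_neg, neg_zero] at this
  rw [this, intervalIntegral.integral_symm, neg_neg]

theorem EPlus_neg (σ : Vec d × Vec d → ℝ) (p : Vec d × Vec d) (t : ℝ) :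
    EPlus (fun q => -σ q) p t = (EPlus σ p t)⁻¹ := by
  unfold EPlus
  rw [intervalIntegral.integral_neg, Real.exp_neg]

theorem EPlus_pos (σ : Vec d × Vec d → ℝ) (p : Vec d × Vec d) (t : ℝ) : 0 < EPlus σ p t :=
  Real.exp_pos _

theorem BoundedBy.EPlus_add {a b : ℝ} {σ : Vec d × Vec d → ℝ} (hσ : BoundedBy a b σ)
    (p : Vec d × Vec d) (s t : ℝ) :
    EPlus σ (p.1 + s • p.2, p.2) t = (EPlus σ p s)⁻¹ * EPlus σ p (s + t) := by
  unfold EPlus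
  rw [← Real.exp_neg, ← Real.exp_add]
  congr 1
  have h1 := intervalIntegral.integral_comp_add_left (fun r => σ (p.1 + r • p.2, p.2))
    (a := 0) (b := t) s
  simp only [add_smul, ← add_assoc, add_zero] at h1
  rw [h1, ← intervalIntegral.integral_interval_sub_left (hσ.forth p 0 (s + t)) (hσ.forth p 0 s)]
  ring

theorem BoundedBy.continuous_EPlus {a b : ℝ} {σ : Vec d × Vec d → ℝ} (hσ : BoundedBy a b σ)
    (p : Vec d × Vec d) : Continuous (EPlus σ p) :=
  Real.continuous_exp.comp (intervalIntegral.continuous_primitive (hσ.forth p) 0)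

/-- With the integrating factor based at one point p of the line, the values at all points of the
line share a single integrand, and identities between them become additivity of integrals. -/
theorem BoundedBy.TMinusInv_add_smul {a b : ℝ} {σ : Vec d × Vec d → ℝ} (hσ : BoundedBy a b σ)
    (f : Vec d × Vec d → ℝ) (p : Vec d × Vec d) (s : ℝ) :
    TMinusInv X σ f (p.1 + s • p.2, p.2) = (EPlus σ p s)⁻¹ *
      ∫ r in (s - tauMinus X (p.1 + s • p.2, p.2))..s,
        EPlus σ p r * f (p.1 + r • p.2, p.2) := by
  unfold TMinusInv
  have h1 := intervalIntegral.integral_comp_sub_left (fun r => EPlus σ p r * f (p.1 + r • p.2, p.2))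
    (a := 0) (b := tauMinus X (p.1 + s • p.2, p.2)) s
  rw [sub_zero] at h1
  rw [← h1, ← intervalIntegral.integral_const_mul]
  refine intervalIntegral.integral_congr fun t _ => ?_
  simp only [EMinus_eq_EPlus, hσ.EPlus_add, sub_smul, ← sub_eq_add_neg, add_sub_assoc, mul_assoc]

theorem BoundedBy.TPlusInv_add_smul {a b : ℝ} {σ : Vec d × Vec d → ℝ} (hσ : BoundedBy a b σ)
    (f : Vec d × Vec d → ℝ) (p : Vec d × Vec d) (s : ℝ) :
    TPlusInv X σ f (p.1 + s • p.2, p.2) = -((EPlus σ p s)⁻¹ *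
      ∫ r in s..(s + tauPlus X (p.1 + s • p.2, p.2)),
        EPlus σ p r * f (p.1 + r • p.2, p.2)) := by
  unfold TPlusInv
  have h1 := intervalIntegral.integral_comp_add_left (fun r => EPlus σ p r * f (p.1 + r • p.2, p.2))
    (a := 0) (b := tauPlus X (p.1 + s • p.2, p.2)) s
  rw [add_zero] at h1
  rw [← h1, ← intervalIntegral.integral_const_mul]
  congr 1
  refine intervalIntegral.integral_congr fun t _ => ?_
  simp only [hσ.EPlus_add, add_smul, ← add_assoc, mul_assoc]

/-- The product rule for primitives of integrable functions. -/
theorem mul_primitive_eq {f g : ℝ → ℝ} {a b : ℝ} (hf : IntervalIntegrable f volume a b)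
    (hg : IntervalIntegrable g volume a b) (c : ℝ) :
    (c + ∫ r in a..b, f r) * ∫ r in a..b, g r =
      ∫ r in a..b, (f r * (∫ s in a..r, g s) + (c + ∫ s in a..r, f s) * g r) := by
  have h1 : AbsolutelyContinuousOnInterval (fun r => c + ∫ s in a..r, f s) a b :=
    ((LipschitzWith.const c).lipschitzOnWith.absolutelyContinuousOnInterval).add
      (hf.absolutelyContinuousOnInterval_intervalIntegral (by simp))
  have h2 := hg.absolutelyContinuousOnInterval_intervalIntegral (c := a) (by simp)
  have h3 := h1.integral_deriv_mul_eq_sub h2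
  simp only [intervalIntegral.integral_same, mul_zero, sub_zero] at h3
  rw [← h3]
  refine intervalIntegral.integral_congr_ae ?_
  filter_upwards [hf.ae_hasDerivAt_integral, hg.ae_hasDerivAt_integral] with x hx1 hx2 hx
  have hx' := uIoc_subset_uIcc hx
  rw [((hx1 hx' a (by simp)).const_add c).deriv, (hx2 hx' a (by simp)).deriv]

theorem tau_reflect (p : Vec d × Vec d) : tau X (reflect p) = tau X p := by
  unfold tau reflect
  rw [tauMinus_eq_tauPlus, tauMinus_eq_tauPlus, neg_neg, add_comm]

/-! ### Phase space and boundary spaces -/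

/-- Plain Cauchy–Schwarz in time. It keeps a factor τ₋, with which the weight τ^(-2r) of the phase
space is later paid. -/
theorem enorm_sq_TMinusInv_le {a b D : ℝ} {σ w : Vec d × Vec d → ℝ} (hσ : BoundedBy a b σ)
    {p : Vec d × Vec d} (hτ : tauMinus X p ≤ D) (hm : AEMeasurable
      (fun t => ‖w (p.1 - t • p.2, p.2)‖ₑ) (volume.restrict (Ioo 0 (tauMinus X p)))) :
    ‖TMinusInv X σ w p‖ₑ ^ 2 ≤ ENNReal.ofReal (Real.exp (|a| * D) ^ 2 * tauMinus X p) *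
      ∫⁻ t in Ioo 0 (tauMinus X p), ‖w (p.1 - t • p.2, p.2)‖ₑ ^ 2 := by
  set A := Real.exp (|a| * D)
  have h1 : ‖TMinusInv X σ w p‖ₑ ≤
      ∫⁻ t in Ioo 0 (tauMinus X p), ENNReal.ofReal A * ‖w (p.1 - t • p.2, p.2)‖ₑ := by
    refine (Admissible.enorm_TMinusInv_le hσ p).trans (setLIntegral_mono_ae' measurableSet_Ioo
      (ae_of_all _ fun t ht => mul_le_mul' (ENNReal.ofReal_le_ofReal (Real.exp_le_exp.2 ?_)) le_rfl))
    exact (mul_le_mul_of_nonneg_right (neg_le_abs a) ht.1.le).trans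
      (mul_le_mul_of_nonneg_left (ht.2.le.trans hτ) (abs_nonneg a))
  refine (pow_le_pow_left' h1 2).trans ((sq_lintegral_mul_le aemeasurable_const hm).trans_eq ?_)
  rw [setLIntegral_const, Real.volume_Ioo, sub_zero, ENNReal.ofReal_mul (by positivity),
    ENNReal.ofReal_pow (Real.exp_pos _).le]

namespace Admissible

theorem ae_tau (h : Admissible X V ν) : ∃ D : ℝ, 0 < D ∧
    (∀ p : Vec d × Vec d, p.2 ∈ V → tauMinus X p ≤ D ∧ tauPlus X p ≤ D ∧ tau X p ≤ D) ∧
    ∀ᵐ p ∂phaseMeasure X ν, 0 < tauMinus X p ∧ 0 < tauPlus X p := by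
  obtain ⟨D, hD, hDt⟩ := h.exists_tau_le
  refine ⟨2 * D, by positivity, fun p hp => ?_, ?_⟩
  · have := hDt p hp
    refine ⟨by linarith, by linarith, ?_⟩
    unfold tau
    linarith
  · filter_upwards [h.ae_phase] with p hp
    have hv := h.velocity_ne_zero hp.2
    exact ⟨tauMinus_pos h.isOpen h.isBounded hv hp.1, tauPlus_pos h.isOpen h.isBounded hv hp.1⟩

theorem memLp_of_memPhase (h : Admissible X V ν) {r : ℝ} (hr : 0 ≤ r) {u : Vec d × Vec d → ℝ}
    (hu : MemPhase X ν r u) : MemLp u 2 (phaseMeasure X ν) := by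
  obtain ⟨D, hD, hDt, hpos⟩ := h.ae_tau
  have hτm : Measurable fun p => tau X p ^ r := (measurable_tau h.isOpen).pow_const r
  have e : ∀ᵐ p ∂phaseMeasure X ν, tau X p ^ r * (tau X p ^ (-r) * u p) = u p := by
    filter_upwards [hpos] with p hp
    have hτ : 0 < tau X p := add_pos hp.1 hp.2
    rw [Real.rpow_neg hτ.le, mul_inv_cancel_left₀ (Real.rpow_pos_of_pos hτ r).ne']
  refine MemLp.of_le_mul (c := D ^ r) hu ((hτm.aestronglyMeasurable.mul hu.1).congr e) ?_
  filter_upwards [e, h.ae_phase] with p hp hpV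
  rw [← hp, norm_mul, Real.norm_of_nonneg (Real.rpow_nonneg (tau_nonneg X p) r), hp]
  exact mul_le_mul_of_nonneg_right (Real.rpow_le_rpow (tau_nonneg X p) (hDt p hpV.2).2.2 hr)
    (norm_nonneg _)

theorem memPhase_reflect (h : Admissible X V ν) {r : ℝ} {u : Vec d × Vec d → ℝ}
    (hu : MemPhase X ν r u) : MemPhase X ν r fun p => u (reflect p) := by
  have h1 := MemLp.comp_measurePreserving hu h.measurePreserving_reflect_phase
  unfold MemPhase
  convert h1 using 2 with p
  simp [tau_reflect]

/-- The factor τ₋ ≤ τ gained from Cauchy–Schwarz meets τ^(-2r), and τ^(1-2r) is bounded exactly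
because r ≤ 1/2. Thus solutions with L² sources lie in both phase spaces. -/
theorem memPhase_TMinusInv (h : Admissible X V ν) {r a b : ℝ} (hr' : r ≤ 1 / 2)
    {σ w : Vec d × Vec d → ℝ} (hσ : BoundedBy a b σ) (hw : MemLp w 2 (phaseMeasure X ν)) :
    MemPhase X ν r (TMinusInv X σ w) := by
  obtain ⟨D, hD, hDt, hpos⟩ := h.ae_tau
  set A := Real.exp (|a| * D)
  have hτm : Measurable fun p => tau X p ^ (-r) := (measurable_tau h.isOpen).pow_const _
  refine memLp_two_of_lintegral
    (hτm.aestronglyMeasurable.mul (h.aestronglyMeasurable_TMinusInv hσ hw.1)) ?_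
  have h1 : ∀ᵐ p ∂phaseMeasure X ν, ‖tau X p ^ (-r) * TMinusInv X σ w p‖ₑ ^ 2 ≤
      ENNReal.ofReal (A ^ 2 * D ^ (1 - 2 * r)) *
        ∫⁻ t in Ioo 0 (tauMinus X p), 1 * ‖w (p.1 - t • p.2, p.2)‖ₑ ^ 2 := by
    filter_upwards [h.ae_phase, hpos, h.ae_aemeasurable_back hw.1.enorm] with p hp hp0 hm
    have hτ : 0 < tau X p := add_pos hp0.1 hp0.2
    have h2 := enorm_sq_TMinusInv_le hσ (hDt p hp.2).1 hm
    simp only [one_mul]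
    rw [enorm_mul, mul_pow]
    refine (mul_le_mul' le_rfl h2).trans ?_
    rw [← mul_assoc]
    refine mul_le_mul' ?_ le_rfl
    rw [Real.enorm_eq_ofReal (Real.rpow_nonneg hτ.le _), ← ENNReal.ofReal_pow
      (Real.rpow_nonneg hτ.le _), ← ENNReal.ofReal_mul (by positivity)]
    refine ENNReal.ofReal_le_ofReal ?_
    have h3 : (tau X p ^ (-r)) ^ 2 * tau X p = tau X p ^ (1 - 2 * r) := by
      rw [← Real.rpow_natCast, ← Real.rpow_mul hτ.le, ← Real.rpow_add_one hτ.ne']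
      congr 1
      push_cast
      ring
    calc (tau X p ^ (-r)) ^ 2 * (A ^ 2 * tauMinus X p)
        ≤ (tau X p ^ (-r)) ^ 2 * (A ^ 2 * tau X p) := by
          have : tauMinus X p ≤ tau X p := le_add_of_nonneg_right hp0.2.le
          gcongr
      _ = A ^ 2 * tau X p ^ (1 - 2 * r) := by rw [← h3]; ring
      _ ≤ _ := by
          refine mul_le_mul_of_nonneg_left (Real.rpow_le_rpow hτ.le (hDt p hp.2).2.2 (by linarith))
            (by positivity)
  refine (lintegral_mono_ae h1).trans_lt ?_
  rw [lintegral_const_mul' _ _ (by finiteness), h.lintegral_back (a := fun _ => 1) measurable_const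
    (F := fun p => ‖w p‖ₑ ^ 2) (hw.1.enorm.pow_const 2)]
  refine ENNReal.mul_lt_top (by finiteness) ?_
  have h4 : ∫⁻ p, ‖w p‖ₑ ^ 2 * (∫⁻ _ in Ioo 0 (tauPlus X p), 1) ∂phaseMeasure X ν ≤
      ∫⁻ p, ‖w p‖ₑ ^ 2 * ENNReal.ofReal D ∂phaseMeasure X ν := by
    refine lintegral_mono_ae ?_
    filter_upwards [h.ae_phase] with p hp
    refine mul_le_mul' le_rfl ?_
    simpa using ENNReal.ofReal_le_ofReal (hDt p hp.2).2.1
  refine h4.trans_lt ?_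
  rw [lintegral_mul_const' _ _ (by finiteness)]
  exact ENNReal.mul_lt_top (lintegral_enorm_sq_lt_top hw) (by finiteness)

theorem memBoundary_of_memLp (h : Admissible X V ν) {r : ℝ} (hr' : r ≤ 1 / 2)
    {G : Set (Vec d × Vec d)} (hG : ∀ᵐ p ∂(xi X ν).restrict G, p.2 ∈ V)
    {g : Vec d × Vec d → ℝ} (hg : MemLp g 2 ((xi X ν).restrict G)) : MemBoundary X ν r G g := by
  obtain ⟨D, hD, hDt, -⟩ := h.ae_tau
  refine hg.of_measure_le_smul (c := ENNReal.ofReal (D ^ (1 - 2 * r))) (by finiteness) ?_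
  rw [← withDensity_const]
  refine withDensity_mono ?_
  filter_upwards [hG] with p hp
  exact ENNReal.ofReal_le_ofReal
    (Real.rpow_le_rpow (tau_nonneg X p) (hDt p hp).2.2 (by linarith))

theorem aemeasurable_gammaPlus (h : Admissible X V ν) {F : Vec d × Vec d → ℝ≥0∞}
    (hF : AEMeasurable F (phaseMeasure X ν)) : ∀ᵐ p ∂(xi X ν).restrict (gammaPlus X V),
      AEMeasurable (fun t => F (p.1 - t • p.2, p.2)) (volume.restrict (Ioo 0 (tauMinus X p))) := by
  filter_upwards [h.ae_gammaPlus hF.ae_eq_mk] with p hp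
  exact ⟨fun t => hF.mk F (p.1 - t • p.2, p.2), hF.measurable_mk.comp (by fun_prop), hp⟩

/-- At an exit point the chord integral of w² is the inner integral of the outgoing disintegration,
so the sum over Γ₊ returns the L² norm of w. -/
theorem memLp_TMinusInv_gammaPlus (h : Admissible X V ν) {a b : ℝ} {σ w : Vec d × Vec d → ℝ}
    (hσ : BoundedBy a b σ) (hw : MemLp w 2 (phaseMeasure X ν)) :
    MemLp (TMinusInv X σ w) 2 ((xi X ν).restrict (gammaPlus X V)) := by
  have := h.sFinite_xi_restrict (gammaPlus X V)
  obtain ⟨D, hD, hDt, -⟩ := h.ae_tau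
  set A := Real.exp (|a| * D)
  have hmp := h.measurePreserving_gammaPlus
  refine memLp_two_of_lintegral ?_ ?_
  · refine aestronglyMeasurable_chord_integral (measurable_tauMinus h.isOpen) (tauMinus_nonneg X)
      (G := fun p t => EMinus σ p t * w (p.1 - t • p.2, p.2)) ?_
    exact hσ.measurable_EMinus.aestronglyMeasurable.mul (hw.1.comp_measurePreserving hmp)
  have h1 : ∀ᵐ p ∂(xi X ν).restrict (gammaPlus X V), ‖TMinusInv X σ w p‖ₑ ^ 2 ≤
      ENNReal.ofReal (A ^ 2 * D) *
        ∫⁻ t in Ioo 0 (tauMinus X p), ‖w (p.1 - t • p.2, p.2)‖ₑ ^ 2 := by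
    filter_upwards [h.ae_gammaPlus_mem, h.aemeasurable_gammaPlus hw.1.enorm] with p hp hm
    refine (enorm_sq_TMinusInv_le hσ (hDt p hp.2.1).1 hm).trans
      (mul_le_mul' (ENNReal.ofReal_le_ofReal ?_) le_rfl)
    exact mul_le_mul_of_nonneg_left (hDt p hp.2.1).1 (by positivity)
  refine (lintegral_mono_ae h1).trans_lt ?_
  rw [lintegral_const_mul' _ _ (by finiteness)]
  refine ENNReal.mul_lt_top (by finiteness) ?_
  have hwm : AEMeasurable (fun p => ‖w p‖ₑ ^ 2) (phaseMeasure X ν) := hw.1.enorm.pow_const 2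
  have h2 := lintegral_enorm_sq_lt_top hw
  rw [← hmp.map_eq, lintegral_map' (hmp.map_eq.symm ▸ hwm) hmp.measurable.aemeasurable,
    lintegral_chordMeasure (F := fun z => ‖w (z.1.1 - z.2 • z.1.2, z.1.2)‖ₑ ^ 2)
      (measurable_tauMinus h.isOpen) (hwm.comp_quasiMeasurePreserving hmp.quasiMeasurePreserving)] at h2
  exact h2

end Admissible

end

section

variable {d : ℕ} {X V : Set (Vec d)} {ν : Measure (Vec d)}

/-! ### Well-posedness in the subcritical case -/

namespace Admissible

/-- Schur's estimate for the scattering operator with a nonnegative symmetric kernel. -/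
theorem lintegral_sq_KOp_le_of_sigmaS_le (h : Admissible X V ν) {k : Vec d × Vec d × Vec d → ℝ}
    {M N : ℝ} (hk : KernelBound X ν k M) (hks : IsSymmetricEvenKernel X ν k)
    (hk0 : ∀ᵐ q ∂kernelMeasure X ν, 0 ≤ k q)
    (hsig : ∀ᵐ p ∂phaseMeasure X ν, sigmaS ν k p ≤ N) {u : Vec d × Vec d → ℝ}
    (hu : MemLp u 2 (phaseMeasure X ν)) :
    ∫⁻ p, ‖KOp ν k u p‖ₑ ^ 2 ∂phaseMeasure X ν ≤
      ENNReal.ofReal N ^ 2 * ∫⁻ p, ‖u p‖ₑ ^ 2 ∂phaseMeasure X ν := by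
  have := h.finite
  wlog hum : Measurable u generalizing u
  · have hu' : u =ᵐ[phaseMeasure X ν] hu.1.mk u := hu.1.ae_eq_mk
    have h1 := this ((memLp_congr_ae hu').1 hu) hu.1.stronglyMeasurable_mk.measurable
    have h2 : ∀ᵐ p ∂phaseMeasure X ν, KOp ν k u p = KOp ν k (hu.1.mk u) p :=
      h.KOp_congr (ae_eq_refl k) hu'
    have e : ∀ {f g : Vec d × Vec d → ℝ}, f =ᵐ[phaseMeasure X ν] g →
        ∫⁻ p, ‖f p‖ₑ ^ 2 ∂phaseMeasure X ν = ∫⁻ p, ‖g p‖ₑ ^ 2 ∂phaseMeasure X ν := fun hfg =>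
      lintegral_congr_ae (by filter_upwards [hfg] with p hp; rw [hp])
    rwa [e h2, e hu']
  have hsym := h.ae_kernel hks
  have hcol : ∀ᵐ p ∂phaseMeasure X ν, ∫⁻ v, ‖k (p.1, p.2, v)‖ₑ ∂ν ≤ ENNReal.ofReal N := by
    filter_upwards [hsig, hsym, h.ae_kernel hk0, h.ae_memLp_kernel hk] with p hp hs h0 hm
    have hi := (hm.integrable (by norm_num)).congr (hs.mono fun v hv => hv.1)
    rw [← ofReal_integral_norm_eq_lintegral_enorm hi]
    refine ENNReal.ofReal_le_ofReal (le_trans (le_of_eq ?_) hp)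
    refine integral_congr_ae ?_
    filter_upwards [hs, h0] with v hv hv0
    exact Real.norm_of_nonneg (hv.1 ▸ hv0)
  have hrow : ∀ᵐ p ∂phaseMeasure X ν, ∫⁻ v', ‖k (p.1, v', p.2)‖ₑ ∂ν ≤ ENNReal.ofReal N := by
    filter_upwards [hcol, hsym] with p hp hs
    rwa [lintegral_congr_ae (hs.mono fun v' hv' => by rw [hv'.1])]
  have hkm : Measurable fun z : (Vec d × Vec d) × Vec d =>
      ‖k (z.1.1, z.2, z.1.2)‖ₑ * ‖u (z.1.1, z.2)‖ₑ ^ 2 :=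
    ((hk.1.comp (by fun_prop)).enorm).mul ((hum.comp (by fun_prop)).enorm.pow_const 2)
  have hkm' : Measurable fun z : (Vec d × Vec d) × Vec d =>
      ‖k (z.1.1, z.1.2, z.2)‖ₑ * ‖u z.1‖ₑ ^ 2 :=
    ((hk.1.comp (by fun_prop)).enorm).mul ((hum.comp (by fun_prop)).enorm.pow_const 2)
  have h1 : ∀ᵐ p ∂phaseMeasure X ν, ‖KOp ν k u p‖ₑ ^ 2 ≤ ENNReal.ofReal N *
      ∫⁻ v', ‖k (p.1, v', p.2)‖ₑ * ‖u (p.1, v')‖ₑ ^ 2 ∂ν := by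
    filter_upwards [hrow] with p hp
    refine (pow_le_pow_left' (enorm_integral_le_lintegral_enorm _) 2).trans ?_
    simp only [enorm_mul]
    exact (sq_lintegral_mul_le_weighted (hk.1.comp (by fun_prop)).enorm.aemeasurable
      (hum.comp (by fun_prop)).enorm.aemeasurable).trans (mul_le_mul' hp le_rfl)
  have h2 : ∫⁻ p, (∫⁻ v', ‖k (p.1, v', p.2)‖ₑ * ‖u (p.1, v')‖ₑ ^ 2 ∂ν) ∂phaseMeasure X ν =
      ∫⁻ p, (∫⁻ v, ‖k (p.1, p.2, v)‖ₑ * ‖u p‖ₑ ^ 2 ∂ν) ∂phaseMeasure X ν := by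
    rw [phaseMeasure, lintegral_prod _ hkm.lintegral_prod_right'.aemeasurable,
      lintegral_prod _ hkm'.lintegral_prod_right'.aemeasurable]
    refine lintegral_congr fun x => lintegral_lintegral_swap ?_
    exact (hkm.comp (by fun_prop : Measurable fun w : Vec d × Vec d => ((x, w.1), w.2))).aemeasurable
  refine (lintegral_mono_ae h1).trans ?_
  rw [lintegral_const_mul' _ _ (by finiteness), h2, pow_two, mul_assoc]
  refine mul_le_mul' le_rfl ?_
  rw [← lintegral_const_mul' _ _ (by finiteness)]
  refine lintegral_mono_ae ?_
  filter_upwards [hcol] with p hp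
  rw [lintegral_mul_const' _ _ (by finiteness)]
  exact mul_le_mul' hp le_rfl

/-- Neumann series in L²: the composition has norm at most N/a < 1. The solution returns to the
weighted phase space through u = f + T_{Γ₋}⁻¹Ku, because T_{Γ₋}⁻¹ maps L² into it. -/
theorem wellPosed_of_lt (h : Admissible X V ν) {r a b M N : ℝ} (hr : 0 ≤ r) (hr' : r ≤ 1 / 2)
    {σ : Vec d × Vec d → ℝ} {k : Vec d × Vec d × Vec d → ℝ} (hσ : BoundedBy a b σ)
    (hk : KernelBound X ν k M) (hN : 0 ≤ N) (hNa : N < a)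
    (hkN : ∀ u, MemLp u 2 (phaseMeasure X ν) → ∫⁻ p, ‖KOp ν k u p‖ₑ ^ 2 ∂phaseMeasure X ν ≤
      ENNReal.ofReal N ^ 2 * ∫⁻ p, ‖u p‖ₑ ^ 2 ∂phaseMeasure X ν) :
    WellPosed X ν r σ k := by
  have ha : 0 < a := hN.trans_lt hNa
  obtain ⟨S, hSn, hS⟩ := h.exists_clm_TMinusInv_of_pos hσ ha
  obtain ⟨K, hKn, hK⟩ := exists_clm (KOp ν k) N hN (fun _ _ hfg => h.KOp_congr (ae_eq_refl k) hfg)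
    (fun _ _ hf hg => h.KOp_add hk hf hg) (fun c f => by rw [KOp_smul])
    (fun _ hf => h.aestronglyMeasurable_KOp hk.1 hf.1) hkN
  have hA : ‖S.comp K‖ < 1 := by
    refine (S.opNorm_comp_le K).trans_lt ((mul_le_mul hSn hKn (norm_nonneg _)
      (by positivity)).trans_lt ?_)
    rw [one_div, inv_mul_lt_iff₀ ha]
    linarith
  set B := Units.oneSub (S.comp K) hA with hB
  have heq : ∀ (w f : Lp ℝ 2 (phaseMeasure X ν)) (w' f' : Vec d × Vec d → ℝ),
      w =ᵐ[phaseMeasure X ν] w' → f =ᵐ[phaseMeasure X ν] f' →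
      ((fun p => w' p - TMinusInv X σ (KOp ν k w') p) =ᵐ[phaseMeasure X ν] f' ↔
        (B : Lp ℝ 2 (phaseMeasure X ν) →L[ℝ] Lp ℝ 2 (phaseMeasure X ν)) w = f) := by
    intro w f w' f' hw hf
    have h1 : (B : Lp ℝ 2 (phaseMeasure X ν) →L[ℝ] Lp ℝ 2 (phaseMeasure X ν)) w =
        w - S (K w) := by
      rw [hB, Units.val_oneSub]
      rfl
    have h2 := (Lp.coeFn_sub w (S (K w))).trans (hw.sub (hS _ _ (hK _ _ hw)))
    rw [h1, Lp.ext_iff]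
    exact ⟨fun h3 => h2.trans (h3.trans hf.symm), fun h3 => (h2.symm.trans h3).trans hf⟩
  have hinv : ∀ f : Lp ℝ 2 (phaseMeasure X ν),
      (B : Lp ℝ 2 (phaseMeasure X ν) →L[ℝ] Lp ℝ 2 (phaseMeasure X ν))
        ((↑B⁻¹ : Lp ℝ 2 (phaseMeasure X ν) →L[ℝ] Lp ℝ 2 (phaseMeasure X ν)) f) = f := fun f => by
    rw [← mul_apply_eq_comp, Units.mul_inv]
    rfl
  have hinv' : ∀ f : Lp ℝ 2 (phaseMeasure X ν),
      (↑B⁻¹ : Lp ℝ 2 (phaseMeasure X ν) →L[ℝ] Lp ℝ 2 (phaseMeasure X ν))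
      ((B : Lp ℝ 2 (phaseMeasure X ν) →L[ℝ] Lp ℝ 2 (phaseMeasure X ν)) f) = f := fun f => by
    rw [← mul_apply_eq_comp, Units.inv_mul]
    rfl
  intro f hf
  have hf2 := h.memLp_of_memPhase hr hf
  set u := (↑B⁻¹ : Lp ℝ 2 (phaseMeasure X ν) →L[ℝ] Lp ℝ 2 (phaseMeasure X ν)) (hf2.toLp f) with hu
  have hue := (heq u _ u f (ae_eq_refl _) hf2.coeFn_toLp).2 (hinv _)
  refine ⟨u, ?_, hue, fun w hw hwe => ?_⟩
  · have h1 : MemLp (KOp ν k u) 2 (phaseMeasure X ν) :=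
      (memLp_congr_ae (hK u u (ae_eq_refl _))).1 (Lp.memLp _)
    refine (memLp_congr_ae ?_).1 (MemLp.add hf (h.memPhase_TMinusInv hr' hσ h1))
    filter_upwards [hue] with p hp
    rw [Pi.add_apply, ← mul_add, ← hp, sub_add_cancel]
  · have hw2 := h.memLp_of_memPhase hr hw
    have h1 := (heq _ _ w f hw2.coeFn_toLp hf2.coeFn_toLp).1 hwe
    have h2 : hw2.toLp w = u := by rw [hu, ← h1, hinv']
    exact hw2.coeFn_toLp.symm.trans (h2 ▸ ae_eq_refl _)

end Admissible

end

section

variable {d : ℕ} {X V : Set (Vec d)} {ν : Measure (Vec d)}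

/-! ### Solutions along characteristics and their traces -/

/-- A conull set of times meets every right neighbourhood of 0, so limits along this filter, and
hence traces, are unique. -/
theorem neBot_nhdsGT_inf_ae : (𝓝[>] (0 : ℝ) ⊓ ae volume).NeBot := by
  rw [inf_neBot_iff]
  intro s hs t ht
  obtain ⟨r, hr, hrs⟩ := mem_nhdsGT_iff_exists_Ioo_subset.1 hs
  by_contra hne
  have h1 : Ioo 0 r ⊆ tᶜ := fun x hx hxt => hne ⟨x, hrs hx, hxt⟩
  have h2 := measure_mono_null h1 (mem_ae_iff.1 ht)
  rw [Real.volume_Ioo, ENNReal.ofReal_eq_zero] at h2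
  exact absurd (show (0 : ℝ) < r from hr) (by linarith)

theorem eventually_nhdsGT_inf_ae {q : ℝ → Prop} {r : ℝ} (hr : 0 < r)
    (hq : ∀ᵐ t ∂volume.restrict (Ioo 0 r), q t) : ∀ᶠ t in 𝓝[>] (0 : ℝ) ⊓ ae volume, q t := by
  rw [ae_restrict_iff' measurableSet_Ioo] at hq
  exact mem_inf_of_inter (Ioo_mem_nhdsGT hr) hq fun t ht => ht.2 ht.1

theorem tendsto_neg_of_continuousOn {F : ℝ → ℝ} {r : ℝ} (hr : 0 < r)
    (hF : ContinuousOn F (Icc (-r) 0)) :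
    Tendsto (fun t => F (-t)) (𝓝[>] (0 : ℝ) ⊓ ae volume) (𝓝 (F 0)) := by
  have h1 : Tendsto (fun t : ℝ => -t) (𝓝[>] 0) (𝓝[Icc (-r) 0] 0) := by
    refine tendsto_nhdsWithin_iff.2 ⟨?_, ?_⟩
    · have : Tendsto (fun t : ℝ => -t) (𝓝 0) (𝓝 (-0)) := continuous_neg.tendsto 0
      rw [neg_zero] at this
      exact this.mono_left nhdsWithin_le_nhds
    · filter_upwards [Ioo_mem_nhdsGT hr] with t ht
      exact ⟨by linarith [ht.2], by linarith [ht.1]⟩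
  exact ((hF 0 ⟨by linarith, le_rfl⟩).tendsto.comp h1).mono_left inf_le_left

theorem intervalIntegrable_neg_iff {f : ℝ → ℝ} {r : ℝ} :
    IntervalIntegrable (fun t => f (-t)) volume 0 r ↔ IntervalIntegrable f volume (-r) 0 := by
  have := IntervalIntegrable.iff_comp_neg (f := f) (a := -r) (b := 0)
  rw [neg_neg, neg_zero] at this
  rw [this]
  exact ⟨fun h => h.symm, fun h => h.symm⟩

namespace Admissible

theorem ae_intervalIntegrable_line (h : Admissible X V ν) {f : Vec d × Vec d → ℝ}
    (hf : Integrable f (phaseMeasure X ν)) : ∀ᵐ p ∂phaseMeasure X ν,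
      IntervalIntegrable (fun r => f (p.1 + r • p.2, p.2)) volume (-tauMinus X p) 0 ∧
      IntervalIntegrable (fun r => f (p.1 + r • p.2, p.2)) volume 0 (tauPlus X p) := by
  have hr := h.measurePreserving_reflect_phase
  have h1 := h.ae_intervalIntegrable_back (hr.integrable_comp_of_integrable hf)
  filter_upwards [h.ae_intervalIntegrable_back hf, hr.quasiMeasurePreserving.ae h1] with p hp hp'
  refine ⟨?_, ?_⟩
  · rw [← intervalIntegrable_neg_iff]
    simpa [sub_eq_add_neg] using hp
  · simpa [reflect, tauMinus_eq_tauPlus] using hp'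

theorem ae_intervalIntegrable_gammaPlus (h : Admissible X V ν) {f : Vec d × Vec d → ℝ}
    (hf : Integrable f (phaseMeasure X ν)) : ∀ᵐ p ∂(xi X ν).restrict (gammaPlus X V),
      IntervalIntegrable (fun r => f (p.1 + r • p.2, p.2)) volume (-tauMinus X p) 0 := by
  have := h.sFinite_xi_restrict (gammaPlus X V)
  have h1 := ae_intervalIntegrable_chord (measurable_tauMinus h.isOpen) (tauMinus_nonneg X)
    (h.measurePreserving_gammaPlus.integrable_comp_of_integrable hf)
  filter_upwards [h1] with p hp
  rw [← intervalIntegrable_neg_iff]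
  simpa [sub_eq_add_neg] using hp

theorem tauMinus_sub_smul (h : Admissible X V ν) {p : Vec d × Vec d} (hp : p.2 ∈ V) {t : ℝ}
    (h0 : 0 ≤ t) (ht : t < tauMinus X p) :
    tauMinus X (p.1 - t • p.2, p.2) = tauMinus X p - t := by
  refine tauMinus_eq_of (by linarith) (fun s hs hst => ?_) ?_
  · have := sub_smul_mem_of_lt_tauMinus (X := X) (p := p) (s := t + s) (by linarith) (by linarith)
    simpa [add_smul, sub_sub] using this
  · have := sub_tauMinus_smul_notMem h.isOpen h.isBounded (p := p) (h.velocity_ne_zero hp)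
    simpa [sub_smul] using this

/-- `T_{Γ₊}⁻¹ f` solves the transport equation with source `f` and with its own incoming data. -/
theorem TPlusInv_sub_TMinusInv (h : Admissible X V ν) {a b : ℝ} {σ f : Vec d × Vec d → ℝ}
    (hσ : BoundedBy a b σ) (hf : Integrable f (phaseMeasure X ν)) :
    (fun p => TPlusInv X σ f p - TMinusInv X σ f p) =ᵐ[phaseMeasure X ν]
      LMinus X V σ (TPlusInv X σ f) := by
  filter_upwards [h.ae_entry (q := fun _ => True) (ae_of_all _ fun _ => trivial), h.ae_phase,
    h.ae_intervalIntegrable_line hf] with p hpe hp hpi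
  have hv := h.velocity_ne_zero hp.2
  have hE := (hσ.continuous_EPlus p).continuousOn (s := univ)
  set ℓ := tauMinus X p with hℓ
  have hτ : tauPlus X (p.1 - ℓ • p.2, p.2) = tauPlus X p + ℓ := by
    have := tauPlus_add_smul h.isOpen h.isBounded (x := p.1) (v := p.2) (t := -ℓ) hv
      (by linarith [tauPlus_nonneg X p, tauMinus_pos h.isOpen h.isBounded hv hp.1]) le_rfl hp.1
    simpa [sub_eq_add_neg] using this
  have e1 := hσ.TPlusInv_add_smul (X := X) f p 0
  have e2 := hσ.TMinusInv_add_smul (X := X) f p 0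
  have e3 := hσ.TPlusInv_add_smul (X := X) f p (-ℓ)
  have hE0 : EPlus σ p 0 = 1 := by simp [EPlus]
  simp only [zero_smul, add_zero, zero_add, zero_sub, hE0, inv_one, one_mul] at e1 e2
  rw [neg_smul, ← sub_eq_add_neg, hτ, neg_add_cancel_comm_assoc] at e3
  rw [LMinus, indicator_of_mem hpe.1]
  change TPlusInv X σ f (p.1, p.2) - TMinusInv X σ f (p.1, p.2) = _
  rw [e1, e2, e3, EMinus_eq_EPlus, ← intervalIntegral.integral_add_adjacent_intervals
    (hpi.1.continuousOn_mul (hσ.continuous_EPlus p).continuousOn)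
    (hpi.2.continuousOn_mul (hσ.continuous_EPlus p).continuousOn)]
  have := (EPlus_pos σ p (-ℓ)).ne'
  change _ - ∫ r in (-ℓ)..0, _ = _
  field_simp
  ring

theorem continuousOn_primitive {f : ℝ → ℝ} {a b : ℝ} (hab : a ≤ b)
    (hf : IntervalIntegrable f volume a b) {s : ℝ} (hs : s ∈ Icc a b) :
    ContinuousOn (fun r => ∫ t in s..r, f t) (Icc a b) := by
  rw [← uIcc_of_le hab] at hs ⊢
  exact intervalIntegral.continuousOn_primitive_interval' hf hs

theorem hasTracePlus_TPlusInv (h : Admissible X V ν) {a b : ℝ} {σ f : Vec d × Vec d → ℝ}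
    (hσ : BoundedBy a b σ) (hf : Integrable f (phaseMeasure X ν)) :
    HasTracePlus X V ν (TPlusInv X σ f) 0 := by
  filter_upwards [h.ae_gammaPlus_mem, h.ae_intervalIntegrable_gammaPlus hf] with p hp hpi
  have hℓ := h.tauMinus_pos_of_mem_gammaPlus hp
  have hnm := h.notMem_of_mem_frontier hp.1
  have hi := hpi.continuousOn_mul (hσ.continuous_EPlus p).continuousOn
  have h1 : ContinuousOn (fun r => (EPlus σ p r)⁻¹ *
      ∫ t in (0 : ℝ)..r, EPlus σ p t * f (p.1 + t • p.2, p.2)) (Icc (-tauMinus X p) 0) :=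
    ((hσ.continuous_EPlus p).inv₀ fun r => (EPlus_pos σ p r).ne').continuousOn.mul
      (continuousOn_primitive (by linarith) hi ⟨by linarith, le_rfl⟩)
  have h2 := tendsto_neg_of_continuousOn hℓ h1
  simp only [intervalIntegral.integral_same, mul_zero] at h2
  refine h2.congr' ?_
  filter_upwards [eventually_nhdsGT_inf_ae (q := fun t => t ∈ Ioo 0 (tauMinus X p)) hℓ
    (ae_restrict_mem measurableSet_Ioo)] with t ht
  have e := hσ.TPlusInv_add_smul (X := X) f p (-t)
  rw [neg_smul, ← sub_eq_add_neg, tauPlus_sub_smul_of_notMem hnm ht.1 ht.2, neg_add_cancel] at e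
  rw [e, intervalIntegral.integral_symm]
  ring

/-- Green's formula, along characteristics, for a solution and a solution of the adjoint equation
with the same outgoing data. -/
theorem integral_sq_gammaPlus (h : Admissible X V ν) {a b : ℝ} {σ u q g ψ : Vec d × Vec d → ℝ}
    (hσ : BoundedBy a b σ) (hu : MemLp u 2 (phaseMeasure X ν)) (hq : MemLp q 2 (phaseMeasure X ν))
    (hψ : MemLp ψ 2 (phaseMeasure X ν))
    (heq : (fun p => u p - TMinusInv X σ q p) =ᵐ[phaseMeasure X ν] LMinus X V σ g)
    (htr : HasTracePlus X V ν u (TMinusInv X (fun p => -σ p) ψ)) :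
    ∫ p, TMinusInv X (fun p => -σ p) ψ p ^ 2 ∂(xi X ν).restrict (gammaPlus X V) =
      ∫ p, (q p * TMinusInv X (fun p => -σ p) ψ p + u p * ψ p) ∂phaseMeasure X ν := by
  have := h.sFinite_xi_restrict (gammaPlus X V)
  have := h.isFiniteMeasure_phase
  have hneb := neBot_nhdsGT_inf_ae
  set G := TMinusInv X (fun p => -σ p) ψ with hG
  obtain ⟨S, hS⟩ := h.exists_clm_TMinusInv hσ.neg
  have hG2 : MemLp G 2 (phaseMeasure X ν) :=
    (memLp_congr_ae (hS _ _ hψ.coeFn_toLp)).1 (Lp.memLp _)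
  have hH : Integrable (fun p => q p * G p + u p * ψ p) (phaseMeasure X ν) :=
    (hq.integrable_mul hG2).add (hu.integrable_mul hψ)
  have hmp := h.measurePreserving_gammaPlus
  rw [← integral_comp_measurePreserving hmp hH.1]
  refine Eq.trans ?_ (integral_chordMeasure (measurable_tauMinus h.isOpen) (tauMinus_nonneg X)
    (hmp.integrable_comp_of_integrable hH)).symm
  refine integral_congr_ae ?_
  filter_upwards [h.ae_gammaPlus_mem, h.ae_gammaPlus heq, htr,
    h.ae_intervalIntegrable_gammaPlus (hq.integrable (by norm_num)),
    h.ae_intervalIntegrable_gammaPlus (hψ.integrable (by norm_num))] with p hp hpe hpt hpq hpψ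
  have hℓ := h.tauMinus_pos_of_mem_gammaPlus hp
  set ℓ := tauMinus X p with hℓd
  have hEc := hσ.continuous_EPlus p
  have hEi : Continuous fun r => (EPlus σ p r)⁻¹ := hEc.inv₀ fun r => (EPlus_pos σ p r).ne'
  have hiq := hpq.continuousOn_mul hEc.continuousOn
  have hiψ := hpψ.continuousOn_mul hEi.continuousOn
  set c := (gammaMinus X V).indicator g (p.1 - ℓ • p.2, p.2) * EPlus σ p (-ℓ) with hc
  have hτ : ∀ t, 0 ≤ t → t < ℓ → tauMinus X (p.1 + (-t) • p.2, p.2) = ℓ - t := fun t h0 h1 => by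
    have := h.tauMinus_sub_smul hp.2.1 h0 h1
    rwa [sub_eq_add_neg, ← neg_smul] at this
  have hGl : ∀ t, 0 ≤ t → t < ℓ → G (p.1 + (-t) • p.2, p.2) = EPlus σ p (-t) *
      ∫ r in (-ℓ)..(-t), (EPlus σ p r)⁻¹ * ψ (p.1 + r • p.2, p.2) := fun t h0 h1 => by
    rw [hG, hσ.neg.TMinusInv_add_smul, hτ t h0 h1]
    simp only [EPlus_neg, inv_inv]
    congr 2
    ring
  have hul : ∀ᵐ t ∂volume.restrict (Ioo 0 ℓ), u (p.1 + (-t) • p.2, p.2) = (EPlus σ p (-t))⁻¹ *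
      (c + ∫ r in (-ℓ)..(-t), EPlus σ p r * q (p.1 + r • p.2, p.2)) := by
    filter_upwards [hpe, ae_restrict_mem measurableSet_Ioo] with t ht ht0
    rw [sub_eq_iff_eq_add, sub_eq_add_neg p.1, ← neg_smul] at ht
    rw [ht, hσ.TMinusInv_add_smul, LMinus, hτ t ht0.1.le ht0.2, EMinus_eq_EPlus, hσ.EPlus_add,
      show -t - (ℓ - t) = -ℓ by ring, show -t + -(ℓ - t) = -ℓ by ring,
      show p.1 + (-t) • p.2 - (ℓ - t) • p.2 = p.1 - ℓ • p.2 by module, hc]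
    ring
  have hE0 : EPlus σ p 0 = 1 := by simp [EPlus]
  have hG0 := hGl 0 le_rfl hℓ
  rw [neg_zero, zero_smul, add_zero, hE0, one_mul] at hG0
  -- The solution formula extends continuously to the exit point, so the assumed trace identifies
  -- its value there with G.
  have hlim : G p = c + ∫ r in (-ℓ)..0, EPlus σ p r * q (p.1 + r • p.2, p.2) := by
    refine tendsto_nhds_unique hpt ?_
    have h1 : ContinuousOn (fun s => (EPlus σ p s)⁻¹ *
        (c + ∫ r in (-ℓ)..s, EPlus σ p r * q (p.1 + r • p.2, p.2))) (Icc (-ℓ) 0) :=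
      hEi.continuousOn.mul (continuousOn_const.add
        (continuousOn_primitive (by linarith) hiq ⟨le_rfl, by linarith⟩))
    have h2 := tendsto_neg_of_continuousOn hℓ h1
    simp only [hE0, inv_one, one_mul] at h2
    refine h2.congr' ?_
    filter_upwards [eventually_nhdsGT_inf_ae hℓ hul] with t ht
    rw [← ht, neg_smul, ← sub_eq_add_neg]
  -- On the line u is E⁻¹ times a primitive and G is E times a primitive, so absorption cancels in
  -- uG and the product rule applies. G vanishes at the entry point, hence no term from Γ₋ appears.
  have hprod := mul_primitive_eq hiq hiψ c
  rw [← hlim, ← hG0] at hprod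
  change G p ^ 2 = ∫ t in (0 : ℝ)..ℓ, (q (p.1 - t • p.2, p.2) * G (p.1 - t • p.2, p.2) +
    u (p.1 - t • p.2, p.2) * ψ (p.1 - t • p.2, p.2))
  rw [pow_two]
  refine hprod.trans ?_
  have hneg := intervalIntegral.integral_comp_neg (a := 0) (b := ℓ) (fun r =>
    EPlus σ p r * q (p.1 + r • p.2, p.2) *
      (∫ s in (-ℓ)..r, (EPlus σ p s)⁻¹ * ψ (p.1 + s • p.2, p.2)) +
    (c + ∫ s in (-ℓ)..r, EPlus σ p s * q (p.1 + s • p.2, p.2)) *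
      ((EPlus σ p r)⁻¹ * ψ (p.1 + r • p.2, p.2)))
  rw [neg_zero] at hneg
  rw [← hneg, intervalIntegral_eq_Ioo hℓ.le, intervalIntegral_eq_Ioo hℓ.le]
  refine integral_congr_ae ?_
  filter_upwards [hul, ae_restrict_mem measurableSet_Ioo] with t ht ht0
  rw [sub_eq_add_neg p.1, ← neg_smul, ht, hGl t ht0.1.le ht0.2]
  ring

end Admissible

end

/-! ### From an eigenfunction to the failure of injectivity and surjectivity -/

section

variable {X V : Set (Vec d)} {ν : Measure (Vec d)}

namespace Admissible

theorem memPhase_TPlusInv (h : Admissible X V ν) {r a b : ℝ} (hr' : r ≤ 1 / 2)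
    {σ w : Vec d × Vec d → ℝ} (hσ : BoundedBy a b σ) (hw : MemLp w 2 (phaseMeasure X ν)) :
    MemPhase X ν r (TPlusInv X σ w) := by
  have h1 := (h.memPhase_reflect (h.memPhase_TMinusInv hr' hσ.reflect.neg
    (hw.comp_measurePreserving h.measurePreserving_reflect_phase))).neg
  refine (memLp_congr_ae (Eventually.of_forall fun p => ?_)).1 h1
  simp only [Pi.neg_apply, TPlusInv_eq_reflect X σ w p, mul_neg]
  rfl

theorem TPlusInv_gammaMinus_of_even (h : Admissible X V ν) {σ ψ : Vec d × Vec d → ℝ}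
    (hσe : ∀ p, σ (reflect p) = σ p) (hψe : ∀ᵐ p ∂phaseMeasure X ν, ψ (reflect p) = ψ p) :
    ∀ᵐ p ∂(xi X ν).restrict (gammaMinus X V),
      TPlusInv X σ ψ p = -TMinusInv X (fun q => -σ q) ψ (reflect p) := by
  filter_upwards [h.measurePreserving_reflect_gamma.quasiMeasurePreserving.ae
    (h.ae_gammaPlus hψe)] with p hp
  rw [TPlusInv_eq_reflect]
  congr 1
  refine TMinusInv_congr_of_ae (Eventually.of_forall fun t => ?_) hp
  simp only [hσe]

theorem memBoundary_TPlusInv (h : Admissible X V ν) {r a b : ℝ} (hr' : r ≤ 1 / 2)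
    {σ w : Vec d × Vec d → ℝ} (hσ : BoundedBy a b σ) (hw : MemLp w 2 (phaseMeasure X ν)) :
    MemBoundary X ν r (gammaMinus X V) (TPlusInv X σ w) := by
  refine h.memBoundary_of_memLp hr' (h.ae_gammaMinus_mem.mono fun p hp => hp.2.1) ?_
  have h1 := ((h.memLp_TMinusInv_gammaPlus hσ.reflect.neg
    (hw.comp_measurePreserving h.measurePreserving_reflect_phase)).comp_measurePreserving
      h.measurePreserving_reflect_gamma).neg
  refine (memLp_congr_ae (Eventually.of_forall fun p => ?_)).1 h1
  rw [TPlusInv_eq_reflect X σ w p]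
  rfl

/-- An eigenfunction `K T_{Γ₊}⁻¹ ψ = ψ` obstructs both injectivity and surjectivity of the albedo
operator. -/
theorem albedoObstruction_of_fixed (h : Admissible X V ν) {r a b M : ℝ}
    (hr : 0 ≤ r) (hr' : r ≤ 1 / 2) {σ ψ : Vec d × Vec d → ℝ} {k : Vec d × Vec d × Vec d → ℝ}
    (hσ : BoundedBy a b σ) (hσe : ∀ p, σ (reflect p) = σ p) (hk : KernelBound X ν k M)
    (hks : IsSymmetricEvenKernel X ν k) (hW : WellPosed X ν r σ k)
    (hψ : MemLp ψ 2 (phaseMeasure X ν)) (hψ0 : ¬ ψ =ᵐ[phaseMeasure X ν] 0)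
    (hfix : KOp ν k (TPlusInv X σ ψ) =ᵐ[phaseMeasure X ν] ψ) :
    AlbedoObstruction X V ν r σ k := by
  have := h.isFiniteMeasure_phase
  set u₀ := TPlusInv X σ ψ with hu₀
  have hu₀m : MemPhase X ν r u₀ := h.memPhase_TPlusInv hr' hσ hψ
  have hu₀2 : MemLp u₀ 2 (phaseMeasure X ν) := h.memLp_of_memPhase hr hu₀m
  have hR := h.measurePreserving_reflect_phase
  have hψe : ∀ᵐ p ∂phaseMeasure X ν, ψ (reflect p) = ψ p := by
    filter_upwards [hfix, hR.quasiMeasurePreserving.ae hfix, h.KOp_reflect hks u₀]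
      with p h1 h2 h3
    rw [← h1, ← h2, h3]
  have hL : (fun p => u₀ p - TMinusInv X σ (KOp ν k u₀) p) =ᵐ[phaseMeasure X ν]
      LMinus X V σ u₀ := by
    filter_upwards [h.TPlusInv_sub_TMinusInv hσ (hψ.integrable one_le_two),
      h.TMinusInv_congr (σ := σ) ae_eq_rfl hfix] with p h1 h2
    rw [h2, h1]
  -- With zero incoming data, uniqueness for the forward problem would give u₀ = 0, and then ψ = K
  -- u₀ = 0.
  have hne : ¬ u₀ =ᵐ[(xi X ν).restrict (gammaMinus X V)] 0 := by
    intro h0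
    have hL0 : LMinus X V σ u₀ =ᵐ[phaseMeasure X ν] 0 := by
      filter_upwards [h.ae_entry h0] with p hp
      rw [LMinus, indicator_of_mem hp.1, hp.2]
      simp
    have hz : MemPhase X ν r (0 : Vec d × Vec d → ℝ) := by
      simp [MemPhase]
    obtain ⟨w, -, -, hw⟩ := hW 0 hz
    have e1 := hw u₀ hu₀m (hL.trans hL0)
    have e2 := hw 0 hz (Eventually.of_forall fun p => by simp [TMinusInv, KOp])
    have e3 := h.KOp_congr (k := k) ae_eq_rfl (e1.trans e2.symm)
    refine hψ0 (hfix.symm.trans (e3.trans (Eventually.of_forall fun p => by simp [KOp])))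
  refine ⟨hW, ⟨u₀, h.memBoundary_TPlusInv hr' hσ hψ, hne, u₀, hu₀m, hL,
    h.hasTracePlus_TPlusInv hσ (hψ.integrable one_le_two)⟩,
    TMinusInv X (fun p => -σ p) ψ, h.memBoundary_of_memLp hr'
      (h.ae_gammaPlus_mem.mono fun p hp => hp.2.1) (h.memLp_TMinusInv_gammaPlus hσ.neg hψ), ?_⟩
  -- The unattained outgoing data are the trace of G, the reflection of -u₀, which solves the
  -- adjoint equation with source ψ.
  rintro g - ⟨u, hum, hu, htr⟩
  have hu2 := h.memLp_of_memPhase hr hum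
  have hq : MemLp (KOp ν k u) 2 (phaseMeasure X ν) :=
    memLp_two_of_lintegral (h.aestronglyMeasurable_KOp hk.1 hu2.1)
      ((h.lintegral_sq_KOp_le hk hu2).trans_lt
        (ENNReal.mul_lt_top (by finiteness) (lintegral_enorm_sq_lt_top hu2)))
  set G := TMinusInv X (fun p => -σ p) ψ with hG
  have hG2 : MemLp G 2 (phaseMeasure X ν) :=
    h.memLp_of_memPhase le_rfl (h.memPhase_TMinusInv (by norm_num) hσ.neg hψ)
  have hI := h.integral_sq_gammaPlus hσ hu2 hq hψ hu htr
  -- Reflection turns G into -u₀ and fixes Ku; symmetry moves K onto u₀, and K u₀ = ψ. The two terms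
  -- of Green's formula therefore cancel.
  have hqG : ∫ p, KOp ν k u p * G p ∂phaseMeasure X ν =
      -∫ p, u p * ψ p ∂phaseMeasure X ν := by
    rw [← integral_comp_measurePreserving hR (F := fun p => KOp ν k u p * G p)
      (hq.1.mul hG2.1)]
    have e1 : ∫ p, KOp ν k u (reflect p) * G (reflect p) ∂phaseMeasure X ν =
        -∫ p, KOp ν k u p * u₀ p ∂phaseMeasure X ν := by
      rw [← integral_neg]
      refine integral_congr_ae ?_
      filter_upwards [h.KOp_reflect hks u, h.TPlusInv_of_even hσe hψe] with p h1 h2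
      rw [hu₀, h2, h1]
      ring
    rw [e1, h.integral_KOp_mul hk hks hu2 hu₀2]
    congr 1
    refine integral_congr_ae ?_
    filter_upwards [hfix] with p hp
    rw [hp]
  have hI0 : ∫ p, G p ^ 2 ∂(xi X ν).restrict (gammaPlus X V) = 0 := by
    refine hI.trans ((integral_add (f := fun p => KOp ν k u p * G p) (g := fun p => u p * ψ p)
      (hq.integrable_mul hG2) (hu2.integrable_mul hψ)).trans ?_)
    rw [hqG, neg_add_cancel]
  have hG0 : ∀ᵐ p ∂(xi X ν).restrict (gammaPlus X V), G p = 0 := by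
    filter_upwards [(integral_eq_zero_iff_of_nonneg (fun p => sq_nonneg (G p))
      (h.memLp_TMinusInv_gammaPlus hσ.neg hψ).integrable_sq).1 hI0] with p hp
    exact pow_eq_zero_iff two_ne_zero |>.1 hp
  refine hne ?_
  filter_upwards [h.TPlusInv_gammaMinus_of_even hσe hψe,
    h.measurePreserving_reflect_gamma.quasiMeasurePreserving.ae hG0] with p h1 h2
  rw [hu₀, h1]
  exact neg_eq_zero.2 h2

/-- Division by μ does two things at once: ψ becomes a fixed point, and the scattering bound N/μ
drops strictly below the absorption a, even when N = a. -/
theorem albedoObstruction_of_eigenvalue (h : Admissible X V ν) {r a b M N μ : ℝ}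
    (hr : 0 ≤ r) (hr' : r ≤ 1 / 2) {σ : Vec d × Vec d → ℝ} {k : Vec d × Vec d × Vec d → ℝ}
    (hσ : BoundedBy a b σ) (hσe : ∀ p, σ (reflect p) = σ p) (hk : KernelBound X ν k M)
    (hks : IsSymmetricEvenKernel X ν k) (hk0 : ∀ᵐ q ∂kernelMeasure X ν, 0 ≤ k q)
    (hsig : ∀ᵐ p ∂phaseMeasure X ν, sigmaS ν k p ≤ N) (hN : 0 < N) (hNa : N ≤ a) (hμ : 1 < μ)
    (hev : HasL2Eigenvalue (phaseMeasure X ν) (fun f => KOp ν k (TPlusInv X σ f)) μ) :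
    AlbedoObstruction X V ν r σ fun q => μ⁻¹ * k q := by
  have hμ0 : 0 < μ := one_pos.trans hμ
  have hi : μ⁻¹ < 1 := inv_lt_one_of_one_lt₀ hμ
  obtain ⟨ψ, hψ, hψ0, hE⟩ := hev
  refine h.albedoObstruction_of_fixed hr hr' hσ hσe (hk.const_mul μ⁻¹) ?_ ?_ hψ hψ0 ?_
  · filter_upwards [hks] with q hq
    exact ⟨congrArg _ hq.1, congrArg _ hq.2⟩
  · refine h.wellPosed_of_lt hr hr' hσ (hk.const_mul μ⁻¹) (N := μ⁻¹ * N) (by positivity)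
      (by nlinarith) fun u hu => ?_
    refine h.lintegral_sq_KOp_le_of_sigmaS_le (hk.const_mul μ⁻¹) ?_ ?_ ?_ hu
    · filter_upwards [hks] with q hq
      exact ⟨congrArg _ hq.1, congrArg _ hq.2⟩
    · filter_upwards [hk0] with q hq
      positivity
    · filter_upwards [hsig] with p hp
      rw [sigmaS, integral_const_mul]
      exact mul_le_mul_of_nonneg_left hp (by positivity)
  · filter_upwards [hE] with p hp
    rw [KOp_const_mul, Pi.smul_apply, hp, smul_eq_mul, inv_mul_cancel_left₀ hμ0.ne']

end Admissible

end

section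

variable {X V : Set (Vec d)} {ν : Measure (Vec d)}

/-! ### Gauge transformations -/

/-- The solution of `v·∇ₓφ = qφ` in `X × V` with `φ = 1` on `Γ₋`. -/
def gauge (X : Set (Vec d)) (q : Vec d × Vec d → ℝ) (p : Vec d × Vec d) : ℝ :=
  EMinus (fun z => -q z) p (tauMinus X p)

theorem gauge_pos (X : Set (Vec d)) (q : Vec d × Vec d → ℝ) (p : Vec d × Vec d) :
    0 < gauge X q p := Real.exp_pos _

theorem gauge_neg (X : Set (Vec d)) (q : Vec d × Vec d → ℝ) (p : Vec d × Vec d) :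
    gauge X (fun z => -q z) p = (gauge X q p)⁻¹ := by
  simp only [gauge, EMinus, ← Real.exp_neg, neg_neg, intervalIntegral.integral_neg]

theorem BoundedBy.measurable_gauge {a b : ℝ} {q : Vec d × Vec d → ℝ} (hX : IsOpen X)
    (hq : BoundedBy a b q) : Measurable (gauge X q) :=
  hq.neg.measurable_EMinus.comp (measurable_id.prodMk (measurable_tauMinus hX))

theorem BoundedBy.EMinus_sub {a b a' b' : ℝ} {s q : Vec d × Vec d → ℝ} (hs : BoundedBy a b s)
    (hq : BoundedBy a' b' q) (p : Vec d × Vec d) (t : ℝ) :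
    EMinus (fun z => s z - q z) p t = EMinus s p t * EMinus (fun z => -q z) p t := by
  rw [EMinus, EMinus, EMinus, ← Real.exp_add, intervalIntegral.integral_sub (hs.back p 0 t)
    (hq.back p 0 t), intervalIntegral.integral_neg]
  congr 1
  ring

namespace Admissible

theorem gauge_back (h : Admissible X V ν) {a b : ℝ} {q : Vec d × Vec d → ℝ}
    (hq : BoundedBy a b q) {p : Vec d × Vec d} (hp : p.2 ∈ V) {t : ℝ}
    (h0 : 0 ≤ t) (ht : t < tauMinus X p) :
    gauge X q p = EMinus (fun z => -q z) p t * gauge X q (p.1 - t • p.2, p.2) := by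
  have e := hq.neg.EPlus_add p (-t) (-(tauMinus X p - t))
  rw [neg_smul, ← sub_eq_add_neg, show -t + -(tauMinus X p - t) = -tauMinus X p by ring] at e
  simp only [gauge, h.tauMinus_sub_smul hp h0 ht, EMinus_eq_EPlus]
  rw [e, mul_inv_cancel_left₀ (EPlus_pos _ _ _).ne']

/-- The backward weight of s - q is that of s times the ratio of the gauge at the end point to the
gauge at the earlier point, so the gauge factors out of the integral. -/
theorem TMinusInv_gauge (h : Admissible X V ν) {a b a' b' : ℝ} {s q : Vec d × Vec d → ℝ}
    (hs : BoundedBy a b s) (hq : BoundedBy a' b' q) (f : Vec d × Vec d → ℝ)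
    {p : Vec d × Vec d} (hp : p.2 ∈ V) :
    TMinusInv X (fun z => s z - q z) (fun z => gauge X q z * f z) p =
      gauge X q p * TMinusInv X s f p := by
  simp only [TMinusInv]
  rw [intervalIntegral_eq_Ioo (tauMinus_nonneg X p), intervalIntegral_eq_Ioo (tauMinus_nonneg X p),
    ← integral_const_mul]
  refine setIntegral_congr_fun measurableSet_Ioo fun t ht => ?_
  simp only [hs.EMinus_sub hq, h.gauge_back hq hp ht.1.le ht.2]
  ring

theorem LMinus_gauge {a b a' b' : ℝ} {s q : Vec d × Vec d → ℝ}
    (hs : BoundedBy a b s) (hq : BoundedBy a' b' q) (g : Vec d × Vec d → ℝ) (p : Vec d × Vec d) :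
    LMinus X V (fun z => s z - q z) g p = gauge X q p * LMinus X V s g p := by
  simp only [LMinus, hs.EMinus_sub hq, gauge]
  ring

theorem LMinus_congr (h : Admissible X V ν) {σ σ' : Vec d × Vec d → ℝ}
    (hσ : σ =ᵐ[phaseMeasure X ν] σ') (g : Vec d × Vec d → ℝ) :
    LMinus X V σ g =ᵐ[phaseMeasure X ν] LMinus X V σ' g := by
  filter_upwards [h.ae_back hσ] with p hp
  rw [LMinus, LMinus, EMinus_congr hp (tauMinus_nonneg X p) le_rfl]

theorem exists_gauge_le (h : Admissible X V ν) {a b : ℝ} {q : Vec d × Vec d → ℝ}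
    (hq : BoundedBy a b q) : ∃ B : ℝ, ∀ p : Vec d × Vec d, p.2 ∈ V → gauge X q p ≤ B := by
  obtain ⟨D, hD, hτ, -⟩ := h.ae_tau
  refine ⟨Real.exp (|b| * D), fun p hp => (hq.neg.EMinus_le p (tauMinus_nonneg X p)).trans ?_⟩
  rw [Real.exp_le_exp, neg_neg]
  exact mul_le_mul (le_abs_self b) (hτ p hp).1 (tauMinus_nonneg X p) (abs_nonneg b)

theorem memPhase_gauge (h : Admissible X V ν) {a b r : ℝ} {q u : Vec d × Vec d → ℝ}
    (hq : BoundedBy a b q) (hu : MemPhase X ν r u) :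
    MemPhase X ν r fun p => gauge X q p * u p := by
  obtain ⟨B, hB⟩ := h.exists_gauge_le hq
  have hm := (hq.measurable_gauge h.isOpen).aestronglyMeasurable (μ := phaseMeasure X ν)
  have h1 := hu.1.mul hm
  refine MemLp.of_le_mul (c := B) hu ?_ ?_
  · refine h1.congr (Eventually.of_forall fun p => ?_)
    simp only [Pi.mul_apply]
    ring
  · filter_upwards [h.ae_phase] with p hp
    rw [show tau X p ^ (-r) * (gauge X q p * u p) = gauge X q p * (tau X p ^ (-r) * u p) by ring,
      norm_mul, Real.norm_of_nonneg (gauge_pos X q p).le]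
    exact mul_le_mul_of_nonneg_right (hB p hp.2) (norm_nonneg _)

theorem tendsto_gauge (h : Admissible X V ν) {a b : ℝ} {q : Vec d × Vec d → ℝ}
    (hq : BoundedBy a b q) {p : Vec d × Vec d} (hp : p ∈ gammaPlus X V) :
    Tendsto (fun t : ℝ => gauge X q (p.1 - t • p.2, p.2)) (𝓝[>] 0 ⊓ ae volume)
      (𝓝 (gauge X q p)) := by
  have h0 := h.tauMinus_pos_of_mem_gammaPlus hp
  have hc : Tendsto (fun t => (EMinus (fun z => -q z) p t)⁻¹ * gauge X q p) (𝓝 0)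
      (𝓝 ((EMinus (fun z => -q z) p 0)⁻¹ * gauge X q p)) := by
    refine Tendsto.mul_const _ (Tendsto.inv₀ ?_ (Real.exp_pos _).ne')
    exact (hq.neg.continuous_EMinus p).tendsto 0
  have e0 : EMinus (fun z => -q z) p 0 = 1 := by simp [EMinus]
  rw [e0, inv_one, one_mul] at hc
  refine (hc.mono_left (inf_le_left.trans nhdsWithin_le_nhds)).congr' ?_
  refine Eventually.filter_mono inf_le_left ?_
  filter_upwards [Ioo_mem_nhdsGT h0] with t ht
  rw [h.gauge_back hq hp.2.1 ht.1.le ht.2, inv_mul_cancel_left₀]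
  exact (Real.exp_pos _).ne'

end Admissible

/-- The pair `(σ',k')` is obtained from `(σ,k)` by the gauge transformation generated by `q`. -/
structure IsGauge (X V : Set (Vec d)) (ν : Measure (Vec d)) (q σ : Vec d × Vec d → ℝ)
    (k : Vec d × Vec d × Vec d → ℝ) (σ' : Vec d × Vec d → ℝ) (k' : Vec d × Vec d × Vec d → ℝ) :
    Prop where
  bounded : ∃ a b, BoundedBy a b q
  absorption : ∃ a b s, BoundedBy a b s ∧ σ =ᵐ[phaseMeasure X ν] s ∧
    σ' =ᵐ[phaseMeasure X ν] fun p => s p - q p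
  kernel : ∀ᵐ z ∂kernelMeasure X ν,
    k' z = gauge X q (z.1, z.2.2) / gauge X q (z.1, z.2.1) * k z
  trace : ∀ᵐ p ∂(xi X ν).restrict (gammaPlus X V), gauge X q p = 1

namespace IsGauge

variable {q σ σ' : Vec d × Vec d → ℝ} {k k' : Vec d × Vec d × Vec d → ℝ} {r : ℝ}

theorem symm (hg : IsGauge X V ν q σ k σ' k') :
    IsGauge X V ν (fun p => -q p) σ' k' σ k := by
  obtain ⟨⟨a, b, hq⟩, ⟨a', b', s, hs, h1, h2⟩, h3, h4⟩ := hg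
  refine ⟨⟨_, _, hq.neg⟩, ⟨a' - b, b' - a, fun p => s p - q p, ⟨hs.1.sub hq.1, fun p => ?_⟩, h2, ?_⟩,
    ?_, ?_⟩
  · have := hs.2 p
    have := hq.2 p
    constructor <;> linarith
  · filter_upwards [h1] with p hp
    rw [hp]
    ring
  · filter_upwards [h3] with z hz
    have e1 := (gauge_pos X q (z.1, z.2.1)).ne'
    have e2 := (gauge_pos X q (z.1, z.2.2)).ne'
    rw [hz, gauge_neg, gauge_neg]
    field_simp
  · filter_upwards [h4] with p hp
    rw [gauge_neg, hp, inv_one]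

theorem KOp_eq (hg : IsGauge X V ν q σ k σ' k') (h : Admissible X V ν) (u : Vec d × Vec d → ℝ) :
    KOp ν k' (fun p => gauge X q p * u p) =ᵐ[phaseMeasure X ν]
      fun p => gauge X q p * KOp ν k u p := by
  filter_upwards [h.ae_kernel hg.kernel] with p hp
  simp only [KOp]
  rw [← integral_const_mul]
  refine integral_congr_ae ?_
  filter_upwards [hp] with v' hv
  have := (gauge_pos X q (p.1, v')).ne'
  rw [hv]
  field_simp

theorem sub_TMinusInv_eq (hg : IsGauge X V ν q σ k σ' k') (h : Admissible X V ν)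
    (u : Vec d × Vec d → ℝ) :
    (fun p => gauge X q p * u p - TMinusInv X σ' (KOp ν k' fun z => gauge X q z * u z) p)
      =ᵐ[phaseMeasure X ν] fun p => gauge X q p * (u p - TMinusInv X σ (KOp ν k u) p) := by
  obtain ⟨a, b, hq⟩ := hg.bounded
  obtain ⟨a', b', s, hs, h1, h2⟩ := hg.absorption
  filter_upwards [h.TMinusInv_congr h2 (hg.KOp_eq h u),
    h.TMinusInv_congr (f := KOp ν k u) h1 ae_eq_rfl, h.ae_phase] with p e1 e2 hp
  rw [e1, e2, h.TMinusInv_gauge hs hq _ hp.2]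
  ring

/-- Multiplying the solution by the gauge solves the transformed problem. Incoming data are kept
because the gauge equals 1 at entry by construction, and outgoing data because its trace on Γ₊ is 1.
-/
theorem isAlbedo (hg : IsGauge X V ν q σ k σ' k') (h : Admissible X V ν)
    {g f : Vec d × Vec d → ℝ} (hA : IsAlbedo X V ν r σ k g f) : IsAlbedo X V ν r σ' k' g f := by
  obtain ⟨a, b, hq⟩ := hg.bounded
  obtain ⟨a', b', s, hs, h1, h2⟩ := hg.absorption
  obtain ⟨u, hu, he, ht⟩ := hA
  refine ⟨_, h.memPhase_gauge hq hu, ?_, ?_⟩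
  · filter_upwards [hg.sub_TMinusInv_eq h u, he, h.LMinus_congr h1 g, h.LMinus_congr h2 g]
      with p e1 e2 e3 e4
    rw [e1, e2, e3, e4, Admissible.LMinus_gauge hs hq]
  · filter_upwards [ht, hg.trace, h.ae_gammaPlus_mem] with p e1 e2 e3
    have := (h.tendsto_gauge hq e3).mul e1
    rwa [e2, one_mul] at this

theorem wellPosed (hg : IsGauge X V ν q σ k σ' k') (h : Admissible X V ν)
    (hW : WellPosed X ν r σ k) : WellPosed X ν r σ' k' := by
  obtain ⟨a, b, hq⟩ := hg.bounded
  intro f hf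
  obtain ⟨u, hu, he, hun⟩ := hW _ (h.memPhase_gauge hq.neg hf)
  refine ⟨_, h.memPhase_gauge hq hu, ?_, fun w hw hwe => ?_⟩
  · filter_upwards [hg.sub_TMinusInv_eq h u, he] with p e1 e2
    rw [e1, e2, gauge_neg, mul_inv_cancel_left₀ (gauge_pos X q p).ne']
  · have := hun _ (h.memPhase_gauge hq.neg hw) ?_
    · filter_upwards [this] with p hp
      rw [← hp, gauge_neg, mul_inv_cancel_left₀ (gauge_pos X q p).ne']
    · filter_upwards [hg.symm.sub_TMinusInv_eq h w, hwe] with p e1 e2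
      rw [e1, e2]

/-- The albedo operator is invariant under gauge transformations. -/
theorem albedoObstruction (hg : IsGauge X V ν q σ k σ' k') (h : Admissible X V ν)
    (hA : AlbedoObstruction X V ν r σ k) : AlbedoObstruction X V ν r σ' k' := by
  obtain ⟨hW, ⟨g, h1, h2, h3⟩, f, hf, h4⟩ := hA
  exact ⟨hg.wellPosed h hW, ⟨g, h1, h2, hg.isAlbedo h h3⟩, f, hf, fun g' hg' hA' =>
    h4 g' hg' (hg.symm.isAlbedo h hA')⟩

end IsGauge

end

section

variable {X V : Set (Vec d)} {ν : Measure (Vec d)}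

/-! ### Linear equations along characteristics -/

theorem intervalIntegrable_of_abs_le {f : ℝ → ℝ} (hf : Measurable f) {B : ℝ} (hB : ∀ t, |f t| ≤ B)
    (a b : ℝ) : IntervalIntegrable f volume a b :=
  (intervalIntegrable_const (c := B)).mono_fun hf.aestronglyMeasurable
    (ae_of_all _ fun t => (hB t).trans (le_abs_self B))

/-- Y exp(-∫Q) is absolutely continuous with derivative zero almost everywhere, hence constant. -/
theorem eq_exp_of_eq_integral {Y Q : ℝ → ℝ} {B T : ℝ} (hQ : Measurable Q)
    (hQB : ∀ t, |Q t| ≤ B) (hT : 0 ≤ T) {H : ℝ → ℝ} (hH : IntervalIntegrable H volume 0 T)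
    (hY : ∀ t, Y t = 1 + ∫ s in (0 : ℝ)..t, H s)
    (hHY : ∀ᵐ t ∂volume.restrict (Ioo 0 T), H t = Q t * Y t) :
    ∀ t ∈ Icc 0 T, Y t = Real.exp (∫ s in (0 : ℝ)..t, Q s) := by
  have hQi := intervalIntegrable_of_abs_le hQ hQB
  have hu : uIcc 0 T = Icc 0 T := uIcc_of_le hT
  set R := fun t => ∫ s in (0 : ℝ)..t, Q s with hR
  have hB0 : 0 ≤ B := (abs_nonneg _).trans (hQB 0)
  have hRB : ∀ r t : ℝ, |R t - R r| ≤ B * |t - r| := fun r t => by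
    rw [hR]
    simp only
    rw [intervalIntegral.integral_interval_sub_left (hQi _ _) (hQi _ _)]
    exact intervalIntegral.norm_integral_le_of_norm_le_const (f := Q) fun u _ => hQB u
  have hRM : ∀ t ∈ Icc 0 T, -R t ≤ B * T := fun t ht => by
    have := hRB 0 t
    simp only [hR, intervalIntegral.integral_same, sub_zero, abs_of_nonneg ht.1] at this
    exact (neg_le_abs _).trans (this.trans (mul_le_mul_of_nonneg_left ht.2 hB0))
  have hE : AbsolutelyContinuousOnInterval (fun t => Real.exp (-R t)) 0 T := by
    refine LipschitzOnWith.absolutelyContinuousOnInterval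
      (K := (Real.exp (B * T) * B).toNNReal) (LipschitzOnWith.of_dist_le_mul fun r hr t ht => ?_)
    rw [hu] at hr ht
    rw [Real.dist_eq, Real.dist_eq, Real.coe_toNNReal _ (by positivity)]
    refine (abs_exp_sub_exp_le (hRM r hr) (hRM t ht)).trans ?_
    rw [mul_assoc, neg_sub_neg, abs_sub_comm r t]
    exact mul_le_mul_of_nonneg_left (hRB r t) (Real.exp_pos _).le
  have hYa : AbsolutelyContinuousOnInterval Y 0 T := by
    have h1 := hH.absolutelyContinuousOnInterval_intervalIntegral (c := 0) left_mem_uIcc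
    have h2 : AbsolutelyContinuousOnInterval (fun _ : ℝ => (1 : ℝ)) 0 T :=
      (LipschitzWith.const (1 : ℝ)).lipschitzOnWith.absolutelyContinuousOnInterval
    have h3 := h2.add h1
    rwa [show (fun _ : ℝ => (1 : ℝ)) + (fun t => ∫ s in (0 : ℝ)..t, H s) = Y from
      funext fun t => (hY t).symm] at h3
  obtain ⟨C, hC⟩ := (hYa.mul hE).const_of_ae_hasDerivAt_zero (by
    have h1 := hH.ae_hasDerivAt_integral
    have h2 := (hQi 0 T).ae_hasDerivAt_integral
    have h3 := (ae_restrict_iff' measurableSet_Ioo).1 hHY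
    filter_upwards [h1, h2, h3, Measure.ae_ne volume 0, Measure.ae_ne volume T]
      with t e1 e2 e3 e4 e5 ht
    have d1 : HasDerivAt Y (H t) t := by
      rw [show Y = fun t => 1 + ∫ s in (0 : ℝ)..t, H s from funext hY]
      exact (e1 ht 0 left_mem_uIcc).const_add 1
    have d2 : HasDerivAt R (Q t) t := e2 ht 0 left_mem_uIcc
    rw [hu] at ht
    refine (d1.mul d2.neg.exp).congr_deriv ?_
    rw [e3 ⟨lt_of_le_of_ne ht.1 (Ne.symm e4), lt_of_le_of_ne ht.2 e5⟩]
    simp only [Pi.neg_apply]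
    ring)
  rw [hu] at hC
  have hC0 := hC 0 ⟨le_rfl, hT⟩
  simp only [Pi.mul_apply, hY 0, hR, intervalIntegral.integral_same, add_zero, neg_zero,
    Real.exp_zero, mul_one] at hC0
  intro t ht
  have := hC t ht
  rw [Pi.mul_apply, ← hC0, Real.exp_neg] at this
  exact (mul_inv_eq_one₀ (Real.exp_pos _).ne').1 this

/-- A bounded function satisfying `Φ' = QΦ` in integrated form for almost all pairs of times, and
with initial trace `1`, is the exponential of the primitive of `Q`. -/
theorem ae_eq_exp_of_ae_integral {Φ Q : ℝ → ℝ} {A B T : ℝ} (hΦ : Measurable Φ) (hQ : Measurable Q)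
    (hΦB : ∀ t, |Φ t| ≤ A) (hQB : ∀ t, |Q t| ≤ B) (hT : 0 < T)
    (hI : ∀ᵐ r ∂volume.restrict (Ioo 0 T), ∀ᵐ t ∂volume.restrict (Ioo r T),
      Φ t = Φ r + ∫ s in r..t, Q s * Φ s)
    (hlim : Tendsto Φ (𝓝[>] 0 ⊓ ae volume) (𝓝 1)) :
    ∀ᵐ t ∂volume.restrict (Ioo 0 T), Φ t = Real.exp (∫ s in (0 : ℝ)..t, Q s) := by
  have := neBot_nhdsGT_inf_ae
  have hHi : ∀ a b, IntervalIntegrable (fun s => Q s * Φ s) volume a b :=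
    intervalIntegrable_of_abs_le (hQ.mul hΦ) (B := B * A) fun t => by
      rw [abs_mul]
      exact mul_le_mul (hQB t) (hΦB t) (abs_nonneg _) ((abs_nonneg _).trans (hQB t))
  set P := fun t => ∫ s in (0 : ℝ)..t, Q s * Φ s with hP
  have hPlim : Tendsto P (𝓝[>] 0 ⊓ ae volume) (𝓝 0) := by
    have h1 := (intervalIntegral.continuous_primitive hHi 0).tendsto 0
    rw [intervalIntegral.integral_same] at h1
    exact h1.mono_left (inf_le_left.trans nhdsWithin_le_nhds)
  have hI' : ∀ᵐ r ∂volume.restrict (Ioo 0 T), ∀ᵐ t ∂volume.restrict (Ioo r T),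
      Φ t - P t = Φ r - P r := by
    filter_upwards [hI] with r hr
    filter_upwards [hr] with t ht
    rw [ht, ← intervalIntegral.integral_interval_sub_left (hHi 0 t) (hHi 0 r)]
    simp only [hP]
    ring
  -- The increment identity is known only for almost all pairs of times. Two starting times r and s
  -- are compared at a common later time, and s → 0 brings in the trace.
  have hconst : ∀ᵐ r ∂volume.restrict (Ioo 0 T), Φ r - P r = 1 := by
    filter_upwards [hI', ae_restrict_mem measurableSet_Ioo] with r hr hrT
    have hev : ∀ᶠ s in 𝓝[>] (0 : ℝ) ⊓ ae volume, Φ s - P s = Φ r - P r := by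
      filter_upwards [eventually_nhdsGT_inf_ae hT hI',
        Eventually.filter_mono inf_le_left (Ioo_mem_nhdsGT hrT.1)] with s hs hs'
      have h1 : ∀ᵐ t ∂volume.restrict (Ioo r T), Φ t - P t = Φ s - P s :=
        ae_mono (Measure.restrict_mono (Ioo_subset_Ioo_left hs'.2.le) le_rfl) hs
      have : (ae (volume.restrict (Ioo r T))).NeBot := by
        rw [ae_neBot, Ne, Measure.restrict_eq_zero]
        simp [hrT.2]
      obtain ⟨t, e1, e2⟩ := (hr.and h1).exists
      rw [← e1, e2]
    have h2 := (hlim.sub hPlim).congr' hev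
    rw [sub_zero] at h2
    exact tendsto_nhds_unique tendsto_const_nhds h2
  have hfin := eq_exp_of_eq_integral (Y := fun t => 1 + P t) hQ hQB hT.le (hHi 0 T) (fun t => rfl)
    (by
      filter_upwards [hconst] with t ht
      rw [← ht, sub_add_cancel])
  filter_upwards [hconst, ae_restrict_mem measurableSet_Ioo] with t ht htT
  rw [← hfin t ⟨htT.1.le, htT.2.le⟩, ← ht, sub_add_cancel]

end

section

variable {X V : Set (Vec d)} {ν : Measure (Vec d)}

/-! ### Weak solutions along characteristics -/

/-- Translation of positions by `t` times the velocity. -/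
def drift (t : ℝ) : (Vec d × Vec d) →L[ℝ] (Vec d × Vec d) :=
  (ContinuousLinearMap.fst ℝ (Vec d) (Vec d) + t • ContinuousLinearMap.snd ℝ (Vec d) (Vec d)).prod
    (ContinuousLinearMap.snd ℝ (Vec d) (Vec d))

theorem drift_apply (t : ℝ) (p : Vec d × Vec d) : drift t p = (p.1 + t • p.2, p.2) := by
  simp [drift]

theorem drift_neg_drift (t : ℝ) (p : Vec d × Vec d) : drift (-t) (drift t p) = p := by
  simp [drift_apply]

theorem drift_drift_neg (t : ℝ) (p : Vec d × Vec d) : drift t (drift (-t) p) = p := by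
  simp [drift_apply]

theorem measurePreserving_drift [SFinite ν] (t : ℝ) :
    MeasurePreserving (drift t) ((volume : Measure (Vec d)).prod ν) (volume.prod ν) := by
  have h1 : MeasurePreserving (fun p : Vec d × Vec d => (p.1, p.2 + t • p.1))
      (ν.prod volume) (ν.prod volume) := by
    refine (MeasurePreserving.id ν).skew_product (g := fun v x => x + t • v) (by fun_prop)
      (ae_of_all _ fun v => ?_)
    exact (measurePreserving_add_right volume (t • v)).map_eq
  have h2 := (Measure.measurePreserving_swap (μ := ν) (ν := (volume : Measure (Vec d)))).comp
    (h1.comp (Measure.measurePreserving_swap (μ := (volume : Measure (Vec d))) (ν := ν)))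
  refine (congrArg (MeasurePreserving · _ _) (funext fun p => ?_)).mp h2
  rw [drift_apply]
  rfl

namespace Admissible

theorem integral_mul_drift (h : Admissible X V ν) {g η : Vec d × Vec d → ℝ} {s : ℝ}
    (hg : Measurable g) (hη : Measurable η)
    (hsupp : ∀ p, η p ≠ 0 → (drift s p).1 ∈ X) :
    ∫ p, g p * η (drift (-s) p) ∂phaseMeasure X ν = ∫ p, g (drift s p) * η p ∂volume.prod ν := by
  have := h.finite
  have hP : phaseMeasure X ν = (volume.prod ν).restrict (X ×ˢ univ) := by
    rw [phaseMeasure, ← Measure.prod_restrict, Measure.restrict_univ]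
  have hc : Measurable (drift (-s) : Vec d × Vec d → Vec d × Vec d) := (drift (-s)).measurable
  rw [hP, setIntegral_eq_integral_of_forall_compl_eq_zero fun p hp => ?_,
    ← integral_comp_measurePreserving (measurePreserving_drift s)
      (F := fun p => g p * η (drift (-s) p)) (hg.mul (hη.comp hc)).aestronglyMeasurable]
  · simp only [drift_neg_drift]
  · by_contra hne
    have := hsupp (drift (-s) p) (right_ne_zero_of_mul hne)
    rw [drift_drift_neg] at this
    exact hp ⟨this, mem_univ _⟩

/-- The drift acts on the smooth test function, so the derivative in s is -v·∇ₓ of the drifted test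
function: the form in which a weak equation for φ can be used. -/
theorem hasDerivAt_integral_drift (h : Admissible X V ν) {φ η : Vec d × Vec d → ℝ} {B : ℝ}
    (hφ : Measurable φ) (hφB : ∀ p, |φ p| ≤ B) (hη : ContDiff ℝ ∞ η) (hc : HasCompactSupport η)
    (s : ℝ) : HasDerivAt (fun s => ∫ p, φ p * η (drift (-s) p) ∂phaseMeasure X ν)
      (-∫ p, φ p * fderiv ℝ (fun z => η (drift (-s) z)) p (p.2, 0) ∂phaseMeasure X ν) s := by
  have := h.isFiniteMeasure_phase
  obtain ⟨R, hR, hRV⟩ := h.upper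
  have hB0 : 0 ≤ B := (abs_nonneg _).trans (hφB 0)
  have hη1 : Differentiable ℝ η := hη.differentiable (by simp)
  have hη2 : Continuous (fderiv ℝ η) := hη.continuous_fderiv (by simp)
  obtain ⟨A, hA⟩ := hc.exists_bound_of_continuous hη.continuous
  obtain ⟨A', hA'⟩ := (hc.fderiv (𝕜 := ℝ)).exists_bound_of_continuous hη2
  have hA0 : 0 ≤ A' := (norm_nonneg _).trans (hA' 0)
  have hd : ∀ (s : ℝ) (p : Vec d × Vec d),
      HasDerivAt (fun s => η (drift (-s) p)) (fderiv ℝ η (drift (-s) p) (-p.2, 0)) s := by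
    intro s p
    have h1 : HasDerivAt (fun s : ℝ => drift (-s) p) (-p.2, 0) s := by
      simp only [drift_apply]
      refine HasDerivAt.prodMk ?_ (hasDerivAt_const s p.2)
      have := ((hasDerivAt_id s).neg.smul_const p.2).const_add p.1
      rwa [neg_smul, one_smul] at this
    exact (hη1 _).hasFDerivAt.comp_hasDerivAt s h1
  have hm : ∀ s, Continuous fun p : Vec d × Vec d => η (drift (-s) p) := fun s =>
    hη.continuous.comp (drift (-s)).continuous
  have hm' : Continuous fun p : Vec d × Vec d => fderiv ℝ η (drift (-s) p) (-p.2, 0) :=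
    (hη2.comp (drift (-s)).continuous).clm_apply (by fun_prop)
  have key := (hasDerivAt_integral_of_dominated_loc_of_deriv_le (μ := phaseMeasure X ν)
    (F := fun s p => φ p * η (drift (-s) p))
    (F' := fun s p => φ p * fderiv ℝ η (drift (-s) p) (-p.2, 0)) (x₀ := s) (s := univ)
    (bound := fun _ => B * (A' * R)) univ_mem
    (Eventually.of_forall fun s => (hφ.mul (hm s).measurable).aestronglyMeasurable)
    (Integrable.of_bound (C := B * A) (hφ.mul (hm s).measurable).aestronglyMeasurable
      (ae_of_all _ fun p => ?_))
    (hφ.mul hm'.measurable).aestronglyMeasurable ?_ (integrable_const _)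
    (ae_of_all _ fun p s _ => (hd s p).const_mul (φ p))).2
  · refine key.congr_deriv ?_
    rw [← integral_neg]
    refine integral_congr_ae (ae_of_all _ fun p => ?_)
    have e1 : fderiv ℝ (fun z => η (drift (-s) z)) p (p.2, 0) =
        fderiv ℝ η (drift (-s) p) (p.2, 0) := by
      have e := ((hη1 _).hasFDerivAt.comp p (drift (-s)).hasFDerivAt).fderiv
      rw [Function.comp_def] at e
      rw [e]
      simp [drift_apply]
    have e2 : ((-p.2, 0) : Vec d × Vec d) = -(p.2, 0) := by simp
    simp only [e1, e2]
    rw [ContinuousLinearMap.map_neg, mul_neg]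
  · rw [norm_mul]
    exact mul_le_mul (hφB p) (hA _) (norm_nonneg _) hB0
  · filter_upwards [h.ae_phase] with p hp s _
    rw [norm_mul]
    refine mul_le_mul (hφB p) ?_ (norm_nonneg _) hB0
    refine (ContinuousLinearMap.le_opNorm _ _).trans (mul_le_mul (hA' _) ?_ (norm_nonneg _) hA0)
    simpa [Prod.norm_def, hR.le] using hRV p.2 hp.2

/-- A bounded weak solution of `v·∇ₓφ = h` has increments given by the integral of `h`. -/
theorem ae_drift_eq_add_integral (h : Admissible X V ν) {φ w : Vec d × Vec d → ℝ} {B : ℝ}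
    (hφ : Measurable φ) (hφB : ∀ p, |φ p| ≤ B) (hw : Measurable w) (hwB : ∀ p, |w p| ≤ B)
    (hD : HasTransportDeriv X ν φ w) {t : ℝ} (ht : 0 ≤ t) :
    ∀ᵐ p ∂phaseMeasure X ν, (∀ s ∈ Icc 0 t, p.1 + s • p.2 ∈ X) →
      φ (drift t p) = φ p + ∫ s in (0 : ℝ)..t, w (drift s p) := by
  have := h.finite
  have hdm : Measurable fun z : (Vec d × Vec d) × ℝ => drift z.2 z.1 := by
    simp only [drift_apply]
    fun_prop
  have hJm : StronglyMeasurable fun p : Vec d × Vec d => ∫ s in (0 : ℝ)..t, w (drift s p) := by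
    simp_rw [intervalIntegral.integral_of_le ht]
    exact (hw.comp hdm).stronglyMeasurable.integral_prod_right'
  have hJB : ∀ p : Vec d × Vec d, |∫ s in (0 : ℝ)..t, w (drift s p)| ≤ B * t := fun p => by
    have := intervalIntegral.norm_integral_le_of_norm_le_const (a := 0) (b := t)
      (f := fun s => w (drift s p)) (C := B) fun s _ => hwB _
    rwa [sub_zero, abs_of_nonneg ht] at this
  have hφt : Measurable fun p => φ (drift t p) := hφ.comp (drift t).measurable
  have hfm : Measurable fun p => φ (drift t p) - φ p - ∫ s in (0 : ℝ)..t, w (drift s p) :=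
    (hφt.sub hφ).sub hJm.measurable
  have hU := isOpen_setOf_segment_subset h.isOpen 0 t
  -- Tested against η supported on points whose whole segment stays in X. Drifting η keeps its
  -- support in X × V, so the weak equation applies at each time s, and the fundamental theorem of
  -- calculus in s gives the increment.
  have key := hU.ae_eq_zero_of_integral_contDiff_smul_eq_zero (μ := volume.prod ν)
    (f := fun p => φ (drift t p) - φ p - ∫ s in (0 : ℝ)..t, w (drift s p)) ?_ ?_
  · have hle : phaseMeasure X ν ≤ volume.prod ν := Measure.prod_mono Measure.restrict_le_self le_rfl
    filter_upwards [ae_mono hle key] with p hp hpX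
    linarith [hp hpX]
  · refine LocallyIntegrable.locallyIntegrableOn ?_ _
    refine LocallyIntegrable.mono (locallyIntegrable_const (B + B + B * t))
      hfm.aestronglyMeasurable (ae_of_all _ fun p => ?_)
    rw [Real.norm_eq_abs, Real.norm_eq_abs]
    refine ((abs_sub _ _).trans (add_le_add ((abs_sub _ _).trans (add_le_add (hφB _) (hφB p)))
      (hJB p))).trans (le_abs_self _)
  · intro η hη hc hs
    have hseg : ∀ s ∈ Icc 0 t, ∀ p, p ∈ tsupport η → (drift s p).1 ∈ X := fun s hst p hp => by
      rw [drift_apply]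
      exact hs hp s hst
    have hshift : ∀ g : Vec d × Vec d → ℝ, Measurable g → ∀ s ∈ Icc 0 t,
        ∫ p, g p * η (drift (-s) p) ∂phaseMeasure X ν =
          ∫ p, g (drift s p) * η p ∂volume.prod ν := fun g hg s hst =>
      h.integral_mul_drift hg hη.continuous.measurable fun p hp =>
        hseg s hst p (subset_tsupport η hp)
    have hder : ∀ s ∈ Icc 0 t, HasDerivAt
        (fun s => ∫ p, φ p * η (drift (-s) p) ∂phaseMeasure X ν)
        (∫ p, w (drift s p) * η p ∂volume.prod ν) s := by
      intro s hst
      refine (h.hasDerivAt_integral_drift hφ hφB hη hc s).congr_deriv ?_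
      rw [hD (fun z => η (drift (-s) z)) (hη.comp (drift (-s)).contDiff) ?_ ?_, neg_neg]
      · exact hshift w hw s hst
      · refine HasCompactSupport.intro (hc.isCompact.image (drift s).continuous) fun p hp => ?_
        by_contra hne
        exact hp ⟨drift (-s) p, subset_tsupport η hne, drift_drift_neg s p⟩
      · intro p hp
        have h1 := tsupport_comp_subset_preimage η (drift (-s)).continuous hp
        have h2 := hseg s hst _ h1
        rw [drift_drift_neg] at h2
        exact ⟨h2, mem_univ _⟩
    have hηi : Integrable η (volume.prod ν) := hη.continuous.integrable_of_hasCompactSupport hc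
    have hint : Integrable (Function.uncurry fun s p => w (drift s p) * η p)
        ((volume.restrict (uIoc 0 t)).prod (volume.prod ν)) := by
      have : IsFiniteMeasure ((volume : Measure ℝ).restrict (uIoc 0 t)) := by
        rw [uIoc_of_le ht]
        infer_instance
      refine Integrable.bdd_mul (c := B) (hηi.comp_snd _) ?_ (ae_of_all _ fun z => hwB _)
      exact (hw.comp (hdm.comp measurable_swap)).aestronglyMeasurable
    have hFTC := intervalIntegral.integral_eq_sub_of_hasDerivAt (a := 0) (b := t)
      (fun s hst => hder s (by rwa [uIcc_of_le ht] at hst)) (by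
        rw [intervalIntegrable_iff]
        exact hint.integral_prod_left)
    rw [intervalIntegral_integral_swap hint, hshift φ hφ t ⟨ht, le_rfl⟩,
      hshift φ hφ 0 ⟨le_rfl, ht⟩] at hFTC
    have i1 : Integrable (fun p => φ (drift t p) * η p) (volume.prod ν) :=
      hηi.bdd_mul (c := B) hφt.aestronglyMeasurable (ae_of_all _ fun p => hφB _)
    have i2 : Integrable (fun p => φ (drift 0 p) * η p) (volume.prod ν) :=
      hηi.bdd_mul (c := B) (hφ.comp (drift 0).measurable).aestronglyMeasurable
        (ae_of_all _ fun p => hφB _)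
    have i3 : Integrable (fun p => ∫ s in (0 : ℝ)..t, w (drift s p) * η p) (volume.prod ν) := by
      simp_rw [intervalIntegral.integral_mul_const]
      exact hηi.bdd_mul (c := B * t) hJm.aestronglyMeasurable (ae_of_all _ hJB)
    have e := integral_sub i3 (i1.sub i2)
    simp only [Pi.sub_apply] at e
    rw [← sub_eq_zero, ← integral_sub i1 i2, ← e] at hFTC
    rw [← neg_eq_zero, ← integral_neg]
    refine (integral_congr_ae (ae_of_all _ fun p => ?_)).trans hFTC
    simp only [intervalIntegral.integral_mul_const, drift_apply, zero_smul, add_zero, smul_eq_mul]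
    ring

end Admissible

end

/-! ### Equivalent pairs are gauge transforms -/

section

variable {X V : Set (Vec d)} {ν : Measure (Vec d)}

theorem BoundedBy.measurable_integral_drift {B : ℝ} {w : Vec d × Vec d → ℝ}
    (hw : BoundedBy (-B) B w) :
    Measurable fun z : (Vec d × Vec d) × ℝ => ∫ s in (0 : ℝ)..z.2, w (drift s z.1) := by
  have h1 := (hw.reflect.measurable_EMinus.comp
    ((measurable_reflect.comp measurable_fst).prodMk measurable_snd)).log.neg
  refine (congrArg Measurable (funext fun z => ?_)).mp h1
  simp [EMinus, Transport.reflect, drift_apply]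

namespace Admissible

/-- For each fixed t the identity holds for almost every p; Fubini exchanges the quantifiers, for
which joint measurability in (p,t) is needed. -/
theorem ae_ae_drift_eq (h : Admissible X V ν) {φ w : Vec d × Vec d → ℝ} {B : ℝ}
    (hφ : BoundedBy (-B) B φ) (hw : BoundedBy (-B) B w) (hD : HasTransportDeriv X ν φ w) :
    ∀ᵐ p ∂phaseMeasure X ν, ∀ᵐ t : ℝ, 0 < t → t < tauPlus X p →
      φ (drift t p) = φ p + ∫ s in (0 : ℝ)..t, w (drift s p) := by
  have := h.sFinite_phase
  have hdm : Measurable fun z : (Vec d × Vec d) × ℝ => drift z.2 z.1 := by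
    simp only [drift_apply]
    fun_prop
  have hm : MeasurableSet {z : (Vec d × Vec d) × ℝ | 0 < z.2 → z.2 < tauPlus X z.1 →
      φ (drift z.2 z.1) = φ z.1 + ∫ s in (0 : ℝ)..z.2, w (drift s z.1)} := by
    have m1 : MeasurableSet {z : (Vec d × Vec d) × ℝ | 0 < z.2} :=
      measurableSet_lt measurable_const measurable_snd
    have m2 : MeasurableSet {z : (Vec d × Vec d) × ℝ | z.2 < tauPlus X z.1} :=
      measurableSet_lt measurable_snd ((measurable_tauPlus h.isOpen).comp measurable_fst)
    have m3 : MeasurableSet {z : (Vec d × Vec d) × ℝ |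
        φ (drift z.2 z.1) = φ z.1 + ∫ s in (0 : ℝ)..z.2, w (drift s z.1)} :=
      measurableSet_eq_fun (hφ.1.comp hdm)
        ((hφ.1.comp measurable_fst).add hw.measurable_integral_drift)
    convert m1.compl.union (m2.compl.union m3) using 1
    ext z
    simp only [mem_union, mem_compl_iff, mem_ofPred_eq, imp_iff_not_or]
  rw [Measure.ae_ae_comm hm]
  refine ae_of_all _ fun t => ?_
  by_cases ht : 0 < t
  · filter_upwards [h.ae_drift_eq_add_integral hφ.1 (fun p => abs_le.2 (hφ.2 p)) hw.1
      (fun p => abs_le.2 (hw.2 p)) hD ht.le, h.ae_phase] with p hp hpX _ htτ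
    refine hp fun s hs => ?_
    rcases hs.1.eq_or_lt with rfl | hs0
    · simpa using hpX.1
    · exact add_smul_mem_of_lt_tauPlus hs0 (hs.2.trans_lt htτ)
  · exact ae_of_all _ fun p h0 => absurd h0 ht

/-- A bounded weak solution of `v·∇ₓφ = qφ` with trace `1` on `Γ₋` is the gauge function of `q`. -/
theorem ae_eq_gauge (h : Admissible X V ν) {φ q : Vec d × Vec d → ℝ} {A B : ℝ}
    (hφ : BoundedBy (-A) A φ) (hq : BoundedBy (-B) B q)
    (hD : HasTransportDeriv X ν φ fun p => q p * φ p) (htr : HasTraceMinus X V ν φ 1) :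
    φ =ᵐ[phaseMeasure X ν] gauge X q := by
  have hφA : ∀ p, |φ p| ≤ A := fun p => abs_le.2 (hφ.2 p)
  have hqB : ∀ p, |q p| ≤ B := fun p => abs_le.2 (hq.2 p)
  have hw : BoundedBy (-max A (B * A)) (max A (B * A)) fun p => q p * φ p := by
    refine ⟨hq.1.mul hφ.1, fun p => abs_le.1 (le_trans ?_ (le_max_right _ _))⟩
    rw [abs_mul]
    exact mul_le_mul (hqB p) (hφA p) (abs_nonneg _) ((abs_nonneg _).trans (hqB p))
  have hφ' : BoundedBy (-max A (B * A)) (max A (B * A)) φ :=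
    ⟨hφ.1, fun p => abs_le.1 ((hφA p).trans (le_max_left _ _))⟩
  have hdm : ∀ p : Vec d × Vec d, Measurable fun t : ℝ => drift t p := fun p => by
    simp only [drift_apply]
    fun_prop
  refine h.ae_phase_of_gammaMinus (q := fun p => φ p = gauge X q p)
    (measurableSet_eq_fun hφ.1 (hq.measurable_gauge h.isOpen)) ?_
  filter_upwards [h.ae_gammaMinus (h.ae_ae_drift_eq hφ' hw hD), h.ae_gammaMinus_mem, htr]
    with p hp hpm hlim
  have hT := h.tauPlus_pos_of_mem_gammaMinus hpm
  have hlim' : Tendsto (fun t => φ (drift t p)) (𝓝[>] 0 ⊓ ae volume) (𝓝 1) := by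
    simp only [drift_apply]
    exact hlim
  have key := ae_eq_exp_of_ae_integral (Φ := fun t => φ (drift t p)) (Q := fun t => q (drift t p))
    (hφ.1.comp (hdm p)) (hq.1.comp (hdm p)) (fun t => hφA _) (fun t => hqB _) hT ?_ hlim'
  · filter_upwards [key, ae_restrict_mem measurableSet_Ioo] with t ht htT
    rw [drift_apply] at ht
    rw [ht, gauge, h.entry_eq hpm htT.1 htT.2, EMinus, intervalIntegral.integral_neg, neg_neg]
    congr 1
    have e := intervalIntegral.integral_comp_sub_left (fun s => q (drift s p)) t (a := 0) (b := t)
    rw [sub_self, sub_zero] at e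
    rw [← e]
    simp only [drift_apply, sub_smul, add_sub_assoc]
  · filter_upwards [hp, ae_restrict_mem measurableSet_Ioo] with r hr hrT
    rw [ae_restrict_iff' measurableSet_Ioo]
    -- The increment formula is known from the base point reached at time r; the substitution t ↦ t
    -- - r recentres it at the entry point p.
    filter_upwards [(measurePreserving_sub_right volume r).quasiMeasurePreserving.ae hr] with t ht htr
    have hτ : tauPlus X (p.1 + r • p.2, p.2) = tauPlus X p - r := by
      have := h.tauMinus_sub_smul (p := reflect p) (h.neg_mem _ hpm.2.1) (t := r) hrT.1.le
        (by simpa [reflect, tauMinus_eq_tauPlus] using hrT.2)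
      simpa [reflect, tauMinus_eq_tauPlus] using this
    have e := ht (by linarith [htr.1]) (by rw [hτ]; linarith [htr.2])
    have hd : ∀ s, drift s (p.1 + r • p.2, p.2) = drift (r + s) p := fun s => by
      simp only [drift_apply, add_smul, add_assoc]
    simp only [hd, add_sub_cancel] at e
    rw [intervalIntegral.integral_comp_add_left (fun s => q (drift s p) * φ (drift s p)) r,
      add_zero, add_sub_cancel] at e
    rw [e, drift_apply r]

theorem gauge_eq_one_of_hasTracePlus (h : Admissible X V ν) {φ q : Vec d × Vec d → ℝ} {a b : ℝ}
    (hq : BoundedBy a b q) (hφ : φ =ᵐ[phaseMeasure X ν] gauge X q)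
    (htr : HasTracePlus X V ν φ 1) :
    ∀ᵐ p ∂(xi X ν).restrict (gammaPlus X V), gauge X q p = 1 := by
  have := neBot_nhdsGT_inf_ae
  filter_upwards [h.ae_gammaPlus hφ, h.ae_gammaPlus_mem, htr] with p h1 hp h2
  exact tendsto_nhds_unique ((h.tendsto_gauge hq hp).congr'
    ((eventually_nhdsGT_inf_ae (h.tauMinus_pos_of_mem_gammaPlus hp) h1).mono fun t ht => ht.symm)) h2

theorem ae_kernel_of_ae_phase (h : Admissible X V ν) {q : Vec d × Vec d → Prop}
    (hq : ∀ᵐ p ∂phaseMeasure X ν, q p) :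
    ∀ᵐ z ∂kernelMeasure X ν, q (z.1, z.2.1) ∧ q (z.1, z.2.2) := by
  have := h.finite
  have h1 : ∀ᵐ z ∂kernelMeasure X ν, q (z.1, z.2.1) :=
    (Measure.quasiMeasurePreserving_fst.comp (measurePreserving_prodAssoc (volume.restrict X) ν
      ν).symm.quasiMeasurePreserving).ae hq
  have h2 := ((MeasurePreserving.id (volume.restrict X)).prod
    (Measure.measurePreserving_swap (μ := ν) (ν := ν))).quasiMeasurePreserving.ae h1
  exact h1.and h2

theorem exists_boundedBy_of_memLp_top {f : Vec d × Vec d → ℝ} (hf : MemLp f ⊤ (phaseMeasure X ν)) :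
    ∃ B f', BoundedBy (-B) B f' ∧ f =ᵐ[phaseMeasure X ν] f' := by
  have h1 : eLpNormEssSup f (phaseMeasure X ν) < ⊤ := by
    simpa using hf.2
  obtain ⟨f', h2, h3⟩ := exists_boundedBy hf.1
    (a := -(eLpNormEssSup f (phaseMeasure X ν)).toReal)
    (b := (eLpNormEssSup f (phaseMeasure X ν)).toReal)
    (neg_le_self ENNReal.toReal_nonneg) (by
      filter_upwards [ae_le_eLpNormEssSup (f := f) (μ := phaseMeasure X ν)] with p hp
      rw [← abs_le, ← Real.norm_eq_abs, ← toReal_enorm]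
      exact ENNReal.toReal_mono h1.ne hp)
  exact ⟨_, f', h2, h3⟩

/-- Taking q = σ - σ' makes q bounded without any lower bound on φ, and the relation between the
absorptions says that the transport derivative of φ is qφ. The trace on Γ₋ then determines φ, and
the trace on Γ₊ becomes a property of q. -/
theorem exists_isGauge (h : Admissible X V ν) {a b : ℝ} {s σ σ' : Vec d × Vec d → ℝ}
    {k k' : Vec d × Vec d × Vec d → ℝ} (hs : BoundedBy a b s) (hσ : σ =ᵐ[phaseMeasure X ν] s)
    (hE : EquivalentPairs X V ν σ k σ' k') : ∃ q, IsGauge X V ν q σ k σ' k' := by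
  obtain ⟨h1, h2, -, -, φ, w, h3, h4, -, h5, h6, h7, h8, h9⟩ := hE
  obtain ⟨A, φ', hφ', hφφ'⟩ := exists_boundedBy_of_memLp_top h3
  obtain ⟨B, q, hq, hqq⟩ := exists_boundedBy_of_memLp_top (h1.sub h2)
  have hw : w =ᵐ[phaseMeasure X ν] fun p => q p * φ' p := by
    filter_upwards [h5, h8, hφφ', hqq] with p e1 e2 e3 e4
    rw [← e4, ← e3, Pi.sub_apply, e2, sub_sub_cancel, div_mul_cancel₀ _ e1.ne']
  have hD : HasTransportDeriv X ν φ' fun p => q p * φ' p := by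
    intro η e1 e2 e3
    refine (integral_congr_ae (hφφ'.symm.mul (ae_eq_refl fun p => fderiv ℝ η p (p.2, 0)))).trans
      ((h4 η e1 e2 e3).trans (congrArg Neg.neg (integral_congr_ae (hw.mul (ae_eq_refl η)))))
  have htr : HasTraceMinus X V ν φ' 1 := by
    filter_upwards [h7, h.ae_gammaMinus hφφ', h.ae_gammaMinus_mem] with p e1 e2 e3
    exact e1.congr' (eventually_nhdsGT_inf_ae (h.tauPlus_pos_of_mem_gammaMinus e3) e2)
  have hg : φ =ᵐ[phaseMeasure X ν] gauge X q := hφφ'.trans (h.ae_eq_gauge hφ' hq hD htr)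
  refine ⟨q, ⟨_, _, hq⟩, ⟨a, b, s, hs, hσ, ?_⟩, ?_, h.gauge_eq_one_of_hasTracePlus hq hg h6⟩
  · filter_upwards [hσ, hqq] with p e1 e2
    rw [← e1, ← e2, Pi.sub_apply, sub_sub_cancel]
  · filter_upwards [h9, h.ae_kernel_of_ae_phase hg] with z e1 e2
    rw [← e2.1, ← e2.2]
    exact e1

end Admissible

end

section

variable {X V : Set (Vec d)} {ν : Measure (Vec d)}

/-! ### Change of representatives -/

namespace Admissible

/-- Averaging a bounded representative with its reflection makes evenness hold everywhere and not
only almost everywhere, while keeping the bounds. -/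
theorem exists_even_boundedBy (h : Admissible X V ν) {a b : ℝ} (hab : a ≤ b)
    {σ : Vec d × Vec d → ℝ} (hσ : AEStronglyMeasurable σ (phaseMeasure X ν))
    (he : ∀ᵐ p ∂phaseMeasure X ν, σ (p.1, p.2) = σ (p.1, -p.2))
    (hb : ∀ᵐ p ∂phaseMeasure X ν, a ≤ σ p ∧ σ p ≤ b) :
    ∃ s, BoundedBy a b s ∧ (∀ p, s (reflect p) = s p) ∧ σ =ᵐ[phaseMeasure X ν] s := by
  obtain ⟨s, hs, h1⟩ := exists_boundedBy hσ hab hb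
  refine ⟨fun p => (s p + s (reflect p)) / 2,
    ⟨(hs.1.add (hs.1.comp measurable_reflect)).div_const 2, fun p => ?_⟩, fun p => ?_, ?_⟩
  · have e1 := hs.2 p
    have e2 := hs.2 (reflect p)
    constructor <;> linarith
  · simp only [reflect_reflect, add_comm]
  · filter_upwards [h1, h.measurePreserving_reflect_phase.quasiMeasurePreserving.ae h1, he]
      with p e1 e2 e3
    change σ p = σ (reflect p) at e3
    rw [← e1, ← e2, ← e3]
    ring

theorem ae_kernel_swap (h : Admissible X V ν) {q : Vec d × Vec d × Vec d → Prop}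
    (hq : ∀ᵐ z ∂kernelMeasure X ν, q z) : ∀ᵐ z ∂kernelMeasure X ν, q (z.1, z.2.2, z.2.1) := by
  have := h.finite
  exact ((MeasurePreserving.id (volume.restrict X)).prod
    (Measure.measurePreserving_swap (μ := ν) (ν := ν))).quasiMeasurePreserving.ae hq

theorem ae_kernel_neg (h : Admissible X V ν) {q : Vec d × Vec d × Vec d → Prop}
    (hq : ∀ᵐ z ∂kernelMeasure X ν, q z) : ∀ᵐ z ∂kernelMeasure X ν, q (z.1, z.2.1, -z.2.2) := by
  have := h.finite
  exact ((MeasurePreserving.id (volume.restrict X)).prod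
    ((MeasurePreserving.id ν).prod h.map_neg)).quasiMeasurePreserving.ae hq

theorem isSymmetricEvenKernel_congr (h : Admissible X V ν) {k k' : Vec d × Vec d × Vec d → ℝ}
    (hk : k =ᵐ[kernelMeasure X ν] k') (hs : IsSymmetricEvenKernel X ν k) :
    IsSymmetricEvenKernel X ν k' := by
  filter_upwards [hs, hk, h.ae_kernel_swap hk, h.ae_kernel_neg hk] with z e1 e2 e3 e4
  change k' z = _ ∧ k' z = _
  rw [← e2, ← e3, ← e4]
  exact e1

theorem isNonnegOperator_congr (h : Admissible X V ν) {k k' : Vec d × Vec d × Vec d → ℝ}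
    (hk : k =ᵐ[kernelMeasure X ν] k') (hs : IsNonnegOperator X ν k) :
    IsNonnegOperator X ν k' := by
  intro φ hφ
  refine (hs φ hφ).trans_eq (integral_congr_ae ?_)
  filter_upwards [h.KOp_congr (u := φ) hk ae_eq_rfl] with p hp
  rw [hp]

theorem sigmaS_congr (h : Admissible X V ν) {k k' : Vec d × Vec d × Vec d → ℝ}
    (hk : k =ᵐ[kernelMeasure X ν] k') : sigmaS ν k =ᵐ[phaseMeasure X ν] sigmaS ν k' := by
  filter_upwards [h.ae_kernel (h.ae_kernel_swap hk)] with p hp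
  exact integral_congr_ae hp

/-- A change on null sets is the gauge transformation with q = 0, so invariance of the obstruction
carries it back from measurable representatives to the given coefficients. -/
theorem isGauge_of_ae_eq {a b : ℝ} {s σ : Vec d × Vec d → ℝ} {k k' : Vec d × Vec d × Vec d → ℝ}
    (hs : BoundedBy a b s) (hσ : σ =ᵐ[phaseMeasure X ν] s) (hk : k =ᵐ[kernelMeasure X ν] k') :
    IsGauge X V ν (fun _ => 0) s k' σ k := by
  have hg : ∀ p : Vec d × Vec d, gauge X (fun _ => 0) p = 1 := fun p => by
    simp [gauge, EMinus]
  refine ⟨⟨0, 0, measurable_const, fun _ => ⟨le_rfl, le_rfl⟩⟩, ⟨a, b, s, hs, ae_eq_rfl, ?_⟩, ?_,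
    ae_of_all _ hg⟩
  · simpa using hσ
  · filter_upwards [hk] with z hz
    rw [hz, hg, hg, div_one, one_mul]

theorem hasL2Eigenvalue_congr (h : Admissible X V ν) {s σ : Vec d × Vec d → ℝ}
    {k k' : Vec d × Vec d × Vec d → ℝ} {μ : ℝ} (hσ : σ =ᵐ[phaseMeasure X ν] s)
    (hk : k =ᵐ[kernelMeasure X ν] k')
    (he : HasL2Eigenvalue (phaseMeasure X ν) (fun f => KOp ν k' (TPlusInv X s f)) μ) :
    HasL2Eigenvalue (phaseMeasure X ν) (fun f => KOp ν k (TPlusInv X σ f)) μ := by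
  obtain ⟨ψ, h1, h2, h3⟩ := he
  exact ⟨ψ, h1, h2, (h.KOp_congr hk (h.TPlusInv_congr hσ ae_eq_rfl)).trans h3⟩

end Admissible

end

end Transport

end

theorem theorem5 {d : ℕ} (hd : 1 ≤ d)
    (X V : Set (Transport.Vec d)) (ν : Measure (Transport.Vec d))
    (hX : Transport.IsC1Domain X)
    (hV : Transport.IsVelocitySpace V ν) (hVsymm : ∀ v ∈ V, -v ∈ V)
    (M₁ M₂ M₃ : ℝ) (hM₁ : 0 < M₁) (hM₂ : 0 < M₂) (hM₃ : 0 < M₃) :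
    ∃ C : ℝ, M₂ ≤ C ∧
      ∀ k : Transport.Vec d × Transport.Vec d × Transport.Vec d → ℝ,
        Transport.IsContinuousKernel X ν k →
        Transport.IsSymmetricEvenKernel X ν k →
        Transport.IsNonnegOperator X ν k →
        (∀ᵐ p ∂Transport.phaseMeasure X ν,
          M₁ ≤ Transport.sigmaS ν k p ∧ Transport.sigmaS ν k p ≤ M₂) →
      ∀ σ : Transport.Vec d × Transport.Vec d → ℝ,
        AEStronglyMeasurable σ (Transport.phaseMeasure X ν) →
        (∀ᵐ p ∂Transport.phaseMeasure X ν, σ (p.1, p.2) = σ (p.1, -p.2)) →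
        (∀ᵐ p ∂Transport.phaseMeasure X ν, C ≤ σ p ∧ σ p ≤ C + M₃) →
        (∃ μ : ℝ, 1 ≤ μ ∧
          Transport.HasL2Eigenvalue (Transport.phaseMeasure X ν)
            (fun f => Transport.KOp ν k (Transport.TPlusInv X σ f)) μ) ∧
        ((∀ᵐ q ∂Transport.kernelMeasure X ν, 0 ≤ k q) →
          ∃ lam : ℝ, 0 < lam ∧ lam < 1 ∧ ∀ r : ℝ, (r = 0 ∨ r = 1 / 2) →
            Transport.AlbedoObstruction X V ν r σ (fun q => lam * k q) ∧
            ∀ σ' k', Transport.EquivalentPairs X V ν σ (fun q => lam * k q) σ' k' →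
              Transport.AlbedoObstruction X V ν r σ' k') := by
  have h := Transport.admissible_of_isVelocitySpace hX hV hVsymm
  obtain ⟨C, hC, hC0, hmain⟩ := h.exists_eigenvalue (M₂ := M₂) hM₁ hM₃.le
  refine ⟨C, hC, fun k hk hks hkp hsig σ hσ hσe hσb => ?_⟩
  obtain ⟨s, hs, hse, hσs⟩ := h.exists_even_boundedBy (by linarith) hσ hσe hσb
  obtain ⟨k', hk'm, hkk'⟩ : ∃ k', Measurable k' ∧ k =ᵐ[Transport.kernelMeasure X ν] k' :=
    ⟨hk.1.mk k, hk.1.stronglyMeasurable_mk.measurable, hk.1.ae_eq_mk⟩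
  have hks' := h.isSymmetricEvenKernel_congr hkk' hks
  have hsig' : ∀ᵐ p ∂Transport.phaseMeasure X ν,
      M₁ ≤ Transport.sigmaS ν k' p ∧ Transport.sigmaS ν k' p ≤ M₂ := by
    filter_upwards [hsig, h.sigmaS_congr hkk'] with p e1 e2
    rwa [← e2]
  obtain ⟨⟨M, -, hkM⟩, μ, hμ, hev⟩ :=
    hmain k k' hk hk'm hkk' hks' (h.isNonnegOperator_congr hkk' hkp) hsig' s hs hse
  refine ⟨⟨μ, hμ.le, h.hasL2Eigenvalue_congr hσs hkk' hev⟩, fun hk0 => ?_⟩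
  have hk0' : ∀ᵐ q ∂Transport.kernelMeasure X ν, 0 ≤ k' q := by
    filter_upwards [hk0, hkk'] with q e1 e2
    rwa [← e2]
  -- The scaling λ = 1/μ comes from the spectral problem in L² alone, so it is fixed before the
  -- setting r and before the equivalent pair.
  refine ⟨μ⁻¹, inv_pos.2 (one_pos.trans hμ), inv_lt_one_of_one_lt₀ hμ, fun r hr => ?_⟩
  have hr01 : 0 ≤ r ∧ r ≤ 1 / 2 := by
    rcases hr with rfl | rfl <;> norm_num
  have hbase : Transport.AlbedoObstruction X V ν r σ fun q => μ⁻¹ * k q := by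
    refine (Transport.Admissible.isGauge_of_ae_eq hs hσs ?_).albedoObstruction h
      (h.albedoObstruction_of_eigenvalue hr01.1 hr01.2 hs hse hkM hks' hk0'
        (hsig'.mono fun p hp => hp.2) hM₂ hC hμ hev)
    filter_upwards [hkk'] with q e
    rw [e]
  refine ⟨hbase, fun σ' k'' hE => ?_⟩
  obtain ⟨q, hq⟩ := h.exists_isGauge hs hσs hE
  exact hq.albedoObstruction h hbase
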